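/- Let $d\ge 1$, let $W=\{w\in C([0,1],\mathbb R^d): w(0)=0\}$ with Wiener measure $\mu$, and let $H=\{h\in W:\ \int_0^1|h'(t)|^2dt<\infty\}$, $(h,k)_H=\int_0^1 (h'(t),k'(t))\,dt$, be its Cameron–Martin space; regard $W^*\subset H^*\simeq H\subset W$. For $\lambda>0$ let $\mu_{\lambda,W}$ be the image of $\mu$ under $w\mapsto\lambda^{-1/2}w$. Let $V\subset W^*$ be a finite-dimensional subspace (possibly $0$) with a basis $v_1,\dots,v_m$ orthonormal in $H$, let $P_{W_0}w=w-\sum_{i}(w,v_i)v_i$, $W_0=P_{W_0}W$, $H_0=P_{W_0}H$, and let $\mu_{\lambda,W_0}$ be the image of $\mu_{\lambda,W}$ under $P_{W_0}$. Let $T$ be a self-adjoint Hilbert–Schmidt operator on $H_0$ with a complete orthonormal system of eigenvectors $\{e_i\}_{i\ge1}$, $Te_i=\zeta_ie_i$, and let $N\ge0$ be such that $1+\zeta_i<0$ for $i\le N$ and $1+\zeta_i>0$ for $i\ge N+1$. Write $\eta_i=(\eta,e_i)$ for the Wiener integral on $(W_0,\mu_{\lambda,W_0})$, i.e. the $L^2(\mu_{\lambda,W_0})$-limit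 of $\varphi_n(\eta)$ for $\varphi_n\in W_0^*$ with $\varphi_n\to e_i$ in $H_0$, and put $$:(T\eta,\eta):\;=\sum_{i=1}^\infty\zeta_i\{\eta_i^2-\tfrac1\lambda\},\qquad d\mu_{\lambda,T,W_0}=\exp\!\big(-\tfrac\lambda2:(T\eta,\eta):\big)\,d\mu_{\lambda,W_0},$$ where the series converges in $L^2(\mu_{\lambda,W_0})$ (the measure $\mu_{\lambda,T,W_0}$ is infinite when $N\ge1$). Let $\mathcal{FC}_b^\infty(W_0)$ be the set of functions $F(\eta)=f(\varphi_1(\eta),\dots,\varphi_r(\eta))$ with $\varphi_i\in W_0^*$ and $f$ smooth with all derivatives bounded, and let $D_0F(\eta)\in H_0$ be the derivative in the directions of $H_0$. Consider the form $$\mathcal E_{\lambda,T,W_0}(f,g)=\int_{W_0}(D_0f,D_0g)_{H_0}\,d\mu_{\lambda,T,W_0}$$ on those $f\in\mathcal{FC}_b^\infty(W_0)$ with $f\in L^2(\mu_{\lambda,T,W_0})$ and $D_0f\in L^2(\mu_{\lambda,T,W_0};H_0)$. It is densely defined and closable in $L^2(W_0,\mu_{\lambda,T,W_0})$; let $-L_{\lambda,T,W_0}$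 be the nonnegative generator of its closure. Let $H_n$ be the Hermite polynomials ($-H_n''+xH_n'=nH_n$), normalized to have norm $1$ in $L^2(\mathbb R,(2\pi)^{-1/2}e^{-x^2/2}dx)$ and with positive leading coefficient, and let $\det_2(I+A)=\prod_i(1+a_i)e^{-a_i}$ for a self-adjoint Hilbert–Schmidt operator $A$ with eigenvalues $a_i$. For $\mathbf n=(n_1,n_2,\dots)$, $n_i\in\mathbb Z_{\ge0}$, $\sum_in_i<\infty$, put $$\mathbf e_{\mathbf n,T,\lambda}(\eta)=\big|\det{}_2\big(I+(|I+T|-I)\big)\big|^{1/4}\prod_{i=1}^\infty H_{n_i}\big(\sqrt{\lambda|1+\zeta_i|}\,\eta_i\big)\prod_{i=1}^N\exp\!\Big(-\frac\lambda2|1+\zeta_i|\big(\eta_i^2-\tfrac1\lambda\big)\Big).$$ Then the following hold. (1) For every $\lambda>0$, $\{\mathbf e_{\mathbf n,T,\lambda}\}_{\mathbf n}$ is a complete orthonormal system of $L^2(W_0,\mu_{\lambda,T,W_0})$ consisting of eigenvectors of $-L_{\lambda,T,W_0}$, and the eigenvalue of $\mathbf e_{\mathbf n,T,\lambda}$ is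 $$\lambda\Big(\sum_{i=1}^N|1+\zeta_i|+\sum_{i=1}^\infty n_i|1+\zeta_i|\Big).$$ (2) $|I+T|-I$ has the eigenvalues and eigenvectors $\{(|1+\zeta_i|-1,e_i)\}_{i\ge1}$, and with this choice of pairs, for all $\mathbf n,\mathbf m$ and $\lambda>0$, both densities below are integrable and the following identity of finite signed measures on $W_0$ holds: $$\mathbf e_{\mathbf n,T,\lambda}\,\mathbf e_{\mathbf m,T,\lambda}\,d\mu_{\lambda,T,W_0}=\mathbf e_{\mathbf n,|I+T|-I,\lambda}\,\mathbf e_{\mathbf m,|I+T|-I,\lambda}\,d\mu_{\lambda,|I+T|-I,W_0}.$$ In particular $\lambda|I+T|$ is invertible, $d\gamma_\lambda:=\mathbf e_{\mathbf 0,T,\lambda}^2\,d\mu_{\lambda,T,W_0}$ is the centered Gaussian measure on $W_0$ whose covariance operator on $H_0$ is $(\lambda|I+T|)^{-1}$, and for every $\mathbf n$ $$\mathbf e_{\mathbf n,T,\lambda}^2\,d\mu_{\lambda,T,W_0}=\prod_{i=1}^\infty H_{n_i}\big(\sqrt{\lambda|1+\zeta_i|}\,\eta_i\big)^2\,d\gamma_\lambda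 .$$ (3) For every $\mathbf n$, every integer $k\ge0$ and every real $p\ge2$ there is a constant $C$, depending on $\mathbf n$, $k$, $p$ and $T$ (with its ordered eigenpairs $(\zeta_i,e_i)$) but not on $\lambda$, such that for all $\lambda>0$ the function $\mathbf e_{\mathbf n,T,\lambda}$ is $k$ times Malliavin differentiable on $(W_0,\mu_{\lambda,W_0})$ in the directions of $H_0$, with derivative $D_0^k\mathbf e_{\mathbf n,T,\lambda}\in H_0^{\otimes k}$, and $$\|\mathbf e_{\mathbf n,T,\lambda}\|_{L^p(\mu_{\lambda,T,W_0})}\le C,\qquad \big\||D_0^k\mathbf e_{\mathbf n,T,\lambda}|_{H.S.}\big\|_{L^p(\mu_{\lambda,T,W_0})}\le\lambda^{k/2}C .$$ -/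

import Mathlib

open MeasureTheory ProbabilityTheory Filter Topology
open scoped ENNReal ContDiff

noncomputable section

namespace WienerOU

/-! ### Wiener space and Cameron-Martin space -/

/-- Continuous paths `w : [0,1] → ℝᵈ` with `w 0 = 0`, inside `C([0,1], ℝᵈ)` (sup norm). -/
def pathSubmodule (d : ℕ) : Submodule ℝ C(unitInterval, EuclideanSpace ℝ (Fin d)) where
  carrier := {w | w 0 = 0}
  add_mem' := by
    intro a b ha hb
    simp only [Set.mem_ofPred_eq] at ha hb
    simp [ha, hb]
  zero_mem' := by simp
  smul_mem' := by
    intro c a ha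
    simp only [Set.mem_ofPred_eq] at ha
    simp [ha]

/-- The Banach space `W` of continuous paths `w : [0,1] → ℝᵈ` starting at `0`. -/
def PathSpace (d : ℕ) : Type := ↥(pathSubmodule d)

instance instNormedAddCommGroupPath (d : ℕ) : NormedAddCommGroup (PathSpace d) :=
  inferInstanceAs (NormedAddCommGroup ↥(pathSubmodule d))

instance instNormedSpacePath (d : ℕ) : NormedSpace ℝ (PathSpace d) :=
  inferInstanceAs (NormedSpace ℝ ↥(pathSubmodule d))

instance instMeasurableSpacePath (d : ℕ) : MeasurableSpace (PathSpace d) := borel _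

instance instBorelSpacePath (d : ℕ) : BorelSpace (PathSpace d) := ⟨rfl⟩

/-- `μ` is the standard Wiener measure on `W`: the centered Gaussian measure under which the
coordinate process satisfies `E[wⁱ(s) wʲ(t)] = δᵢⱼ min(s,t)`. -/
structure IsWienerMeasure {d : ℕ} (μ : Measure (PathSpace d)) : Prop where
  gaussian : IsGaussian μ
  mean_zero : ∀ (i : Fin d) (t : unitInterval), ∫ w, w.1 t i ∂μ = 0
  covariance : ∀ (i j : Fin d) (s t : unitInterval),
    ∫ w, w.1 s i * w.1 t j ∂μ = if i = j then min (s : ℝ) (t : ℝ) else 0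

/-- The Cameron-Martin space `H = H¹([0,1], ℝᵈ | h(0) = 0)`. A path `h` with `h(0) = 0` and
`∫₀¹ |h'|² < ∞` is represented by its derivative `h' ∈ L²([0,1], ℝᵈ)`, so that the inner product
is `(h, k)_H = ∫₀¹ (h', k')`. -/
abbrev CameronMartin (d : ℕ) : Type :=
  Lp (EuclideanSpace ℝ (Fin d)) 2 (volume.restrict (Set.Icc (0 : ℝ) 1))

lemma cm_integrableOn {d : ℕ} (h : CameronMartin d) :
    IntegrableOn (fun s => h s) (Set.Icc (0 : ℝ) 1) :=
  (Lp.memLp h).integrable (by norm_num)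

lemma cm_intervalIntegrable {d : ℕ} (h : CameronMartin d) (t : unitInterval) :
    IntervalIntegrable (fun s => h s) volume 0 t := by
  rw [intervalIntegrable_iff_integrableOn_Ioc_of_le t.2.1]
  exact (cm_integrableOn h).mono_set fun s hs => ⟨hs.1.le, hs.2.trans t.2.2⟩

/-- The path `t ↦ ∫₀ᵗ h'(s) ds`. -/
def cmPath {d : ℕ} (h : CameronMartin d) : PathSpace d :=
  ⟨⟨fun t => ∫ s in (0 : ℝ)..t, h s, by
      have hc : ContinuousOn (fun x : ℝ => ∫ s in (0 : ℝ)..x, h s) (Set.uIcc 0 1) := by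
        apply intervalIntegral.continuousOn_primitive_interval
        rw [Set.uIcc_of_le zero_le_one]
        exact cm_integrableOn h
      rw [Set.uIcc_of_le zero_le_one] at hc
      exact continuousOn_iff_continuous_domRestrict.1 hc⟩, by
    change (∫ s in (0 : ℝ)..((0 : unitInterval) : ℝ), h s) = 0
    simp⟩

lemma cmPath_apply {d : ℕ} (h : CameronMartin d) (t : unitInterval) :
    (cmPath h).1 t = ∫ s in (0 : ℝ)..t, h s := rfl

lemma ae_of_cm {p : ℝ → Prop} (t : unitInterval)
    (hp : ∀ᵐ s ∂(volume.restrict (Set.Icc (0 : ℝ) 1)), p s) :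
    ∀ᵐ s, s ∈ Set.uIoc (0 : ℝ) t → p s := by
  have h2 := (ae_restrict_iff' measurableSet_Icc).1 hp
  filter_upwards [h2] with s hs hmem
  rw [Set.uIoc_of_le t.2.1] at hmem
  exact hs ⟨hmem.1.le, hmem.2.trans t.2.2⟩

/-- The inclusion `H → W`, `h ↦ (t ↦ ∫₀ᵗ h'(s) ds)`. -/
def cmIncl (d : ℕ) : CameronMartin d →L[ℝ] PathSpace d :=
  LinearMap.mkContinuous
    { toFun := cmPath
      map_add' := by
        intro h k
        refine Subtype.ext (ContinuousMap.ext fun t => ?_)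
        change (cmPath (h + k)).1 t = (cmPath h).1 t + (cmPath k).1 t
        rw [cmPath_apply, cmPath_apply, cmPath_apply, ← intervalIntegral.integral_add
          (cm_intervalIntegrable h t) (cm_intervalIntegrable k t)]
        exact intervalIntegral.integral_congr_ae (ae_of_cm t (Lp.coeFn_add h k))
      map_smul' := by
        intro c h
        refine Subtype.ext (ContinuousMap.ext fun t => ?_)
        change (cmPath (c • h)).1 t = c • (cmPath h).1 t
        rw [cmPath_apply, cmPath_apply, ← intervalIntegral.integral_smul]
        exact intervalIntegral.integral_congr_ae (ae_of_cm t (Lp.coeFn_smul c h)) }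
    1 (by
      intro h
      rw [one_mul]
      change ‖(cmPath h).1‖ ≤ ‖h‖
      rw [ContinuousMap.norm_le _ (norm_nonneg _)]
      intro t
      rw [cmPath_apply, intervalIntegral.integral_of_le t.2.1]
      have hI := cm_integrableOn h
      calc ‖∫ s in Set.Ioc (0 : ℝ) t, h s‖ ≤ ∫ s in Set.Ioc (0 : ℝ) t, ‖h s‖ :=
            norm_integral_le_integral_norm _
        _ ≤ ∫ s in Set.Icc (0 : ℝ) 1, ‖h s‖ :=
            setIntegral_mono_set hI.norm (Eventually.of_forall fun _ => norm_nonneg _)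
              (LE.le.eventuallyLE fun s hs => ⟨hs.1.le, hs.2.trans t.2.2⟩)
        _ = (eLpNorm h 1 (volume.restrict (Set.Icc (0 : ℝ) 1))).toReal := by
            rw [integral_norm_eq_lintegral_enorm hI.aestronglyMeasurable,
              eLpNorm_one_eq_lintegral_enorm]
        _ ≤ (eLpNorm h 2 (volume.restrict (Set.Icc (0 : ℝ) 1))).toReal := by
            have : IsProbabilityMeasure (volume.restrict (Set.Icc (0 : ℝ) 1)) := ⟨by simp⟩
            exact ENNReal.toReal_mono (Lp.eLpNorm_ne_top h)
              (eLpNorm_le_eLpNorm_of_exponent_le (by norm_num) hI.aestronglyMeasurable)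
        _ = ‖h‖ := (Lp.norm_def h).symm)

/-- The identification `W* ⊂ H* ≃ H`. -/
def dualRep {d : ℕ} (φ : StrongDual ℝ (PathSpace d)) : CameronMartin d :=
  (InnerProductSpace.toDual ℝ (CameronMartin d)).symm (φ ∘L cmIncl d)

lemma inner_dualRep {d : ℕ} (φ : StrongDual ℝ (PathSpace d)) (h : CameronMartin d) :
    inner ℝ (dualRep φ) h = φ (cmIncl d h) := by
  simp [dualRep, InnerProductSpace.toDual_symm_apply]

/-! ### Finite codimensional subspaces

Throughout, `v : Fin m → W*` is a finite family, orthonormal in `H` in the theorem, spanning the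
finite dimensional space `V ⊂ W*`. -/

/-- `P_{W₀} w = w - P_V w`, with `P_V w = ∑ᵢ (w, vᵢ) vᵢ`. -/
def projFull {d m : ℕ} (v : Fin m → StrongDual ℝ (PathSpace d)) : PathSpace d →L[ℝ] PathSpace d :=
  ContinuousLinearMap.id ℝ (PathSpace d) - ∑ i, (v i).smulRight (cmIncl d (dualRep (v i)))

/-- The finite codimensional subspace `W₀ = {w - P_V w | w ∈ W}`. -/
def W0 {d m : ℕ} (v : Fin m → StrongDual ℝ (PathSpace d)) : Submodule ℝ (PathSpace d) :=
  LinearMap.range (projFull v : PathSpace d →ₗ[ℝ] PathSpace d)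

/-- `P_{W₀}` as a map onto `W₀`. -/
def projW0 {d m : ℕ} (v : Fin m → StrongDual ℝ (PathSpace d)) : PathSpace d →L[ℝ] W0 v :=
  (projFull v).codRestrict (W0 v) fun w => ⟨w, rfl⟩

/-- `H₀ = P_{W₀} H`, the orthogonal complement of `V` in `H`. -/
abbrev H0 {d m : ℕ} (v : Fin m → StrongDual ℝ (PathSpace d)) : Submodule ℝ (CameronMartin d) :=
  (Submodule.span ℝ (Set.range fun i => dualRep (v i)))ᗮ

lemma projFull_cmIncl {d m : ℕ} (v : Fin m → StrongDual ℝ (PathSpace d)) (h : H0 v) :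
    projFull v (cmIncl d h) = cmIncl d h := by
  have hz : ∀ i, v i (cmIncl d h) = 0 := fun i => by
    rw [← inner_dualRep]
    exact (Submodule.mem_orthogonal _ _).1 h.2 _ (Submodule.subset_span ⟨i, rfl⟩)
  simp [projFull, hz]

/-- The inclusion `H₀ → W₀`. -/
def incl0 {d m : ℕ} (v : Fin m → StrongDual ℝ (PathSpace d)) : H0 v →L[ℝ] W0 v :=
  (cmIncl d ∘L (H0 v).subtypeL).codRestrict (W0 v) fun h => ⟨cmIncl d h, projFull_cmIncl v h⟩

/-- The identification `W₀* ⊂ H₀* ≃ H₀`. -/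
def dualRep0 {d m : ℕ} {v : Fin m → StrongDual ℝ (PathSpace d)} (φ : StrongDual ℝ (W0 v)) : H0 v :=
  (InnerProductSpace.toDual ℝ (H0 v)).symm (φ ∘L incl0 v)

/-- `μ_λ = μ_{λ,W}`: the image of `μ` under `w ↦ λ^{-1/2} w`. -/
def scaledMeasure {d : ℕ} (μ : Measure (PathSpace d)) (lam : ℝ) : Measure (PathSpace d) :=
  μ.map fun w => (Real.sqrt lam)⁻¹ • w

/-- `μ_{λ,W₀} = (P_{W₀})_* μ_{λ,W}`. -/
def baseMeasure {d m : ℕ} (μ : Measure (PathSpace d)) (v : Fin m → StrongDual ℝ (PathSpace d))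
    (lam : ℝ) : Measure (W0 v) :=
  (scaledMeasure μ lam).map (projW0 v)

/-! ### Wiener integrals and the weighted measure -/

/-- A (measurable version of the) Wiener integral `η ↦ (η, h)` for `h ∈ H₀`: the `L²(ν)`-limit of
`φₙ`, for `φₙ ∈ W₀*` converging to `h` in `H₀`. -/
def wienerIntegral {d m : ℕ} {v : Fin m → StrongDual ℝ (PathSpace d)} (ν : Measure (W0 v))
    (h : H0 v) : W0 v → ℝ :=
  open Classical in
  if hX : ∃ X : W0 v → ℝ, Measurable X ∧ ∃ φ : ℕ → StrongDual ℝ (W0 v),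
      Tendsto (fun k => dualRep0 (φ k)) atTop (𝓝 h) ∧
      Tendsto (fun k => eLpNorm (fun η => φ k η - X η) 2 ν) atTop (𝓝 0)
  then hX.choose else 0

/-- Partial sums of `∑ᵢ ζᵢ {(η, eᵢ)² - 1/λ}`. -/
def wickPartial {d m : ℕ} {v : Fin m → StrongDual ℝ (PathSpace d)} (ν : Measure (W0 v)) (lam : ℝ)
    (e : HilbertBasis ℕ ℝ (H0 v)) (ζ : ℕ → ℝ) (k : ℕ) : W0 v → ℝ := fun η =>
  ∑ i ∈ Finset.range k, ζ i * (wienerIntegral ν (e i) η ^ 2 - 1 / lam)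

/-- `:(Tη, η): = ∑ᵢ ζᵢ {(η, eᵢ)² - 1/λ}`, the series being summed in `L²(ν)`. Here `(ζᵢ, eᵢ)` are
the eigenvalues and eigenvectors of `T`. -/
def wickSquare {d m : ℕ} {v : Fin m → StrongDual ℝ (PathSpace d)} (ν : Measure (W0 v)) (lam : ℝ)
    (e : HilbertBasis ℕ ℝ (H0 v)) (ζ : ℕ → ℝ) : W0 v → ℝ :=
  open Classical in
  if hQ : ∃ Q : W0 v → ℝ, Measurable Q ∧
      Tendsto (fun k => eLpNorm (fun η => wickPartial ν lam e ζ k η - Q η) 2 ν) atTop (𝓝 0)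
  then hQ.choose else 0

/-- `dμ_{λ,T,W₀} = exp(-(λ/2) :(Tη, η):) dμ_{λ,W₀}`, where `(ζᵢ, eᵢ)` are the eigenvalues and
eigenvectors of `T`. -/
def weightedMeasure {d m : ℕ} (μ : Measure (PathSpace d))
    (v : Fin m → StrongDual ℝ (PathSpace d)) (lam : ℝ)
    (e : HilbertBasis ℕ ℝ (H0 v)) (ζ : ℕ → ℝ) : Measure (W0 v) :=
  (baseMeasure μ v lam).withDensity fun η =>
    ENNReal.ofReal (Real.exp (-(lam / 2) * wickSquare (baseMeasure μ v lam) lam e ζ η))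

/-! ### Smooth cylindrical functions, the Dirichlet form, and its generator -/

/-- The class `FC_b^∞(W₀)`: functions `F(η) = f((η, φ₁), …, (η, φ_r))` with `φᵢ ∈ W₀*` and
`f` smooth with all derivatives bounded. -/
def IsSmoothCylinder {d m : ℕ} {v : Fin m → StrongDual ℝ (PathSpace d)} (F : W0 v → ℝ) : Prop :=
  ∃ (r : ℕ) (φ : Fin r → StrongDual ℝ (W0 v)) (f : (Fin r → ℝ) → ℝ),
    ContDiff ℝ ∞ f ∧ (∀ k : ℕ, ∃ C : ℝ, ∀ x, ‖iteratedFDeriv ℝ k f x‖ ≤ C) ∧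
    ∀ η, F η = f fun i => φ i η

/-- The `H`-derivative `D₀F(η) ∈ H₀`: the gradient at `0` of `h ↦ F(η + h)`, `h ∈ H₀`. -/
def hGrad {d m : ℕ} {v : Fin m → StrongDual ℝ (PathSpace d)} (F : W0 v → ℝ) (η : W0 v) : H0 v :=
  gradient (fun h : H0 v => F (η + incl0 v h)) 0

/-- The graph in `L²(ν) × L²(ν; H₀)` of `D₀` on the smooth cylindrical functions `F` such that
`F ∈ L²(ν)` and `D₀F ∈ L²(ν; H₀)`. -/
def gradGraph {d m : ℕ} {v : Fin m → StrongDual ℝ (PathSpace d)} (ν : Measure (W0 v)) :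
    Set (Lp ℝ 2 ν × Lp (H0 v) 2 ν) :=
  {q | ∃ F : W0 v → ℝ, IsSmoothCylinder F ∧ q.1 =ᵐ[ν] F ∧ q.2 =ᵐ[ν] hGrad F}

/-- The graph of the closed extension of `D₀`; its first projection is the domain of the closed
form `E(f, g) = ∫ (D₀f, D₀g) dν`. -/
def closedGradGraph {d m : ℕ} {v : Fin m → StrongDual ℝ (PathSpace d)} (ν : Measure (W0 v)) :
    Set (Lp ℝ 2 ν × Lp (H0 v) 2 ν) :=
  closure (gradGraph ν)

/-- The graph of the nonnegative generator `-L` of the closed form `E(f, g) = ∫ (D₀f, D₀g) dν`: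
`u ∈ D(-L)` and `-L u = w` iff `u ∈ D(E)` and `E(u, f) = (w, f)` for all `f ∈ D(E)`. -/
def generatorGraph {d m : ℕ} {v : Fin m → StrongDual ℝ (PathSpace d)} (ν : Measure (W0 v)) :
    Set (Lp ℝ 2 ν × Lp ℝ 2 ν) :=
  {q | ∃ G : Lp (H0 v) 2 ν, (q.1, G) ∈ closedGradGraph ν ∧
    ∀ f ∈ closedGradGraph ν, inner ℝ G f.2 = inner ℝ q.2 f.1}

/-! ### Higher Malliavin derivatives -/

/-- The coordinate `D₀ᵏF(η)(b_{α 1}, …, b_{α k})` of the `k`-th `H`-derivative of `F` at `η`. -/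
def hDerivCoord {d m : ℕ} {v : Fin m → StrongDual ℝ (PathSpace d)} (b : HilbertBasis ℕ ℝ (H0 v))
    (F : W0 v → ℝ) (k : ℕ) (α : Fin k → ℕ) (η : W0 v) : ℝ :=
  iteratedFDeriv ℝ k (fun h : H0 v => F (η + incl0 v h)) 0 fun j => b (α j)

/-- `F ∈ 𝔻^{k,2}(ν)` with Malliavin derivatives `D₀ˡF = G l`, `l ≤ k`, where an element of
`H₀^{⊗l}` is given by its square-summable coordinates with respect to the basis `b`:
`F` is the `L²(ν)`-limit of smooth cylindrical functions `Fⱼ` such that `D₀ˡFⱼ → G l` in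
`L²(ν; H₀^{⊗l})` for all `l ≤ k`. -/
def HasMalliavinDerivs {d m : ℕ} {v : Fin m → StrongDual ℝ (PathSpace d)} (ν : Measure (W0 v))
    (b : HilbertBasis ℕ ℝ (H0 v)) (k : ℕ) (F : W0 v → ℝ)
    (G : (l : ℕ) → (Fin l → ℕ) → W0 v → ℝ) : Prop :=
  (∀ l α, Measurable (G l α)) ∧
  ∃ Fs : ℕ → W0 v → ℝ, (∀ j, IsSmoothCylinder (Fs j)) ∧
    Tendsto (fun j => eLpNorm (fun η => Fs j η - F η) 2 ν) atTop (𝓝 0) ∧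
    ∀ l ≤ k, Tendsto
      (fun j => ∫⁻ η, ∑' α : Fin l → ℕ, ‖hDerivCoord b (Fs j) l α η - G l α η‖ₑ ^ 2 ∂ν)
      atTop (𝓝 0)

/-- The Hilbert-Schmidt norm of an element of `H₀^{⊗k}` given by its coordinates. -/
def hsNorm {k : ℕ} (a : (Fin k → ℕ) → ℝ) : ℝ≥0∞ :=
  (∑' α, ‖a α‖ₑ ^ 2) ^ (1 / 2 : ℝ)

/-! ### Operators on `H₀` -/

/-- Hilbert-Schmidt operators on a separable infinite dimensional Hilbert space. -/
def IsHilbertSchmidt {E : Type*} [NormedAddCommGroup E] [InnerProductSpace ℝ E]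
    (T : E →L[ℝ] E) : Prop :=
  ∃ b : HilbertBasis ℕ ℝ E, Summable fun i => ‖T (b i)‖ ^ 2

/-- The absolute value `|A|`: the positive operator with `|A|² = A* A`. -/
def opAbs {E : Type*} [NormedAddCommGroup E] [InnerProductSpace ℝ E] [CompleteSpace E]
    (A : E →L[ℝ] E) : E →L[ℝ] E :=
  open Classical in
  if h : ∃ B : E →L[ℝ] E, B.IsPositive ∧ B * B = ContinuousLinearMap.adjoint A * A
  then h.choose else 0

/-- The regularized determinant `det₂(I + A) = ∏ᵢ (1 + aᵢ) exp(-aᵢ)` of the self-adjoint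
Hilbert-Schmidt operator `A` with eigenvalues `aᵢ`. -/
def det2 (a : ℕ → ℝ) : ℝ := ∏' i, (1 + a i) * Real.exp (-(a i))

/-- `γ` is the centered Gaussian measure on `W₀` with covariance operator `C` on `H₀`: every
`φ ∈ W₀* ⊂ H₀` has law `N(0, (Cφ, φ)_{H₀})`. -/
def IsCenteredGaussianWithCov {d m : ℕ} {v : Fin m → StrongDual ℝ (PathSpace d)}
    (γ : Measure (W0 v)) (C : H0 v →L[ℝ] H0 v) : Prop :=
  ∀ φ : StrongDual ℝ (W0 v),
    γ.map φ = gaussianReal 0 (Real.toNNReal (inner ℝ (C (dualRep0 φ)) (dualRep0 φ)))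

/-! ### The eigenfunctions -/

/-- The Hermite polynomial `Hₙ`, normalized in `L²` of the standard Gaussian measure on `ℝ`. -/
def normHermite (n : ℕ) (x : ℝ) : ℝ :=
  Polynomial.aeval x (Polynomial.hermite n) / Real.sqrt (n.factorial : ℝ)

/-- `∏ᵢ H_{nᵢ}(√(λ|1+ζᵢ|) ηᵢ)`, with `ηᵢ = (η, eᵢ)`; only finitely many factors differ
from `1`. -/
def hermiteProd {d m : ℕ} {v : Fin m → StrongDual ℝ (PathSpace d)} (ν : Measure (W0 v)) (lam : ℝ)
    (e : HilbertBasis ℕ ℝ (H0 v)) (ζ : ℕ → ℝ) (n : ℕ →₀ ℕ) (η : W0 v) : ℝ :=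
  n.prod fun i k => normHermite k (Real.sqrt (lam * |1 + ζ i|) * wienerIntegral ν (e i) η)

/-- The function `e_{n,T,λ}` on `W₀`, where `(ζᵢ, eᵢ)` are the eigenvalues and eigenvectors of `T`,
the indices `i < N` being those with `1 + ζᵢ < 0`, and `ν = μ_{λ,W₀}`. -/
def eigenfunction {d m : ℕ} {v : Fin m → StrongDual ℝ (PathSpace d)} (ν : Measure (W0 v)) (lam : ℝ)
    (e : HilbertBasis ℕ ℝ (H0 v)) (ζ : ℕ → ℝ) (N : ℕ) (n : ℕ →₀ ℕ) (η : W0 v) : ℝ :=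
  |det2 fun i => |1 + ζ i| - 1| ^ (1 / 4 : ℝ) * hermiteProd ν lam e ζ n η *
    ∏ i ∈ Finset.range N,
      Real.exp (-(lam / 2) * |1 + ζ i| * (wienerIntegral ν (e i) η ^ 2 - 1 / lam))

/-- `λ (∑_{i<N} |1+ζᵢ| + ∑ᵢ nᵢ |1+ζᵢ|)`. -/
def eigenvalueOf (lam : ℝ) (ζ : ℕ → ℝ) (N : ℕ) (n : ℕ →₀ ℕ) : ℝ :=
  lam * (∑ i ∈ Finset.range N, |1 + ζ i| + n.sum fun i k => (k : ℝ) * |1 + ζ i|)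

end WienerOU

end

/-!
Gaussian analysis of quadratic Wiener functionals, carried out in coordinates.

The covariance of Wiener measure says that every `φ ∈ W₀*` is, under `μ_{λ,W₀}`, a centered Gaussian
variable of variance `‖φ‖² / λ` in the norm of `H₀` (`IsWienerMeasure.baseMeasure_map_dual`). Hence
the Wiener integrals `ηᵢ` of the eigenvectors are independent with law `N(0, 1/λ)`
(`IsIsonormal.iIndepFun`), and every functional is a limit of their linear combinations. All that
follows concerns this sequence of variables; the operator `T` only enters through the summability of
`ζᵢ²` (`SpectralData`).

*The ground state measure.* Completing the series `:(Tη, η):` by the exponential factors of the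
ground state `𝐞₀` replaces `1 + ζᵢ` by `|1 + ζᵢ|`: the measure `γ = 𝐞₀² dμ_{λ,T}` depends on `T` only
through `|I + T|` (`SpectralData.groundMeasure_eq`). Its density with respect to `μ_{λ,W₀}` is the
limit of the densities changing the variance of finitely many `ηᵢ` from `1 / λ` to
`1 / (λ |1 + ζᵢ|)`. The Hellinger affinity of two such laws is `1 - O(ζᵢ²)` in the tail, so the square
roots of these densities converge in `L²`, no mass is lost, and `γ` is a probability measure making
the `ηᵢ` independent Gaussian with the new variances (`IsIndepGaussian.withDensity`,
`SpectralData.indep_coord_ground`). This yields the Gaussian measure with covariance `(λ|I + T|)⁻¹`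
and the identity of signed measures.

*The eigenfunctions.* Multiplication by `𝐞₀` carries `L²(γ)` onto `L²(μ_{λ,T})` and Hermite products
to the functions `𝐞ₙ`, so completeness is that of the Hermite products in `L²(γ)`: a function
orthogonal to all of them is orthogonal to `exp(i φ)` for every `φ ∈ W₀*`
(`SpectralData.ae_eq_zero_of_integral_hermiteProd`). Along `eᵢ` the derivative maps `𝐞ₙ` to a
multiple of a neighbouring eigenfunction (`fderiv_profile_single`); integration by parts
under `γ`, where one coordinate is independent of the others, shows that the adjoint does the same
(`SpectralData.integral_hGrad_mul_eigenfunction`). The raising and lowering coefficients give the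
eigenvalue `λ (∑_{i<N} |1 + ζᵢ| + ∑ᵢ nᵢ |1 + ζᵢ|)`, and testing against the `𝐞ₙ` gives closability.

*Differentiability and bounds.* In the variables `√λ ηᵢ` the function `𝐞ₙ` is a fixed function of
finitely many variables, a product of polynomials and of factors `exp(-|1 + ζᵢ| zᵢ² / 2)` for
`i < N`, which do not involve `λ`; each derivative therefore costs a factor `√λ`
(`exists_eLpNorm_eigenfunction_le`). Relative to `γ`, the measure `μ_{λ,T}` carries the growing weight
`exp(∑_{i<N} |1 + ζᵢ| zᵢ²)`, which the decay of `𝐞ₙ` only just compensates: to approximate `𝐞ₙ` by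
cylindrical functions in the presence of this weight, `𝐞ₙ` is first cut off by `exp(-ε ∑ zᵢ²)`, and
then the `ηᵢ` are replaced by nearby functionals in `W₀*`. `IsGaussBounded.exists_approx` does this;
it places the `𝐞ₙ` in the domain of the closed form
(`SpectralData.eigenLp_mem_closedGradGraph`), which is thereby dense, and in the domains of the
Malliavin derivatives (`SpectralData.hasMalliavinDerivs`).
-/

open scoped NNReal

noncomputable section

namespace WienerOU

section

/-! ### Wiener measure on the dual of the path space -/

instance instCompleteSpacePath (d : ℕ) : CompleteSpace (PathSpace d) := by
  have hc : IsClosed ((pathSubmodule d : Set C(unitInterval, EuclideanSpace ℝ (Fin d)))) := by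
    change IsClosed {w : C(unitInterval, EuclideanSpace ℝ (Fin d)) | w 0 = 0}
    exact isClosed_eq (by fun_prop) continuous_const
  exact hc.completeSpace_coe

instance instSecondCountablePath (d : ℕ) : SecondCountableTopology (PathSpace d) :=
  inferInstanceAs (SecondCountableTopology ↥(pathSubmodule d))

/-- The coordinate evaluation `w ↦ wⁱ(t)` as an element of `W*`. -/
def evalDual {d : ℕ} (t : unitInterval) (i : Fin d) : StrongDual ℝ (PathSpace d) :=
  LinearMap.mkContinuous
    { toFun := fun w => w.1 t i
      map_add' := fun _ _ => rfl
      map_smul' := fun _ _ => rfl } 1 (by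
      intro w
      rw [one_mul]
      exact (PiLp.norm_apply_le (w.1 t) i).trans (w.1.norm_coe_le_norm t))

lemma evalDual_apply {d : ℕ} (t : unitInterval) (i : Fin d) (w : PathSpace d) :
    evalDual t i w = w.1 t i := rfl

lemma pathSpace_ext {d : ℕ} {w w' : PathSpace d} (h : ∀ t i, evalDual t i w = evalDual t i w') :
    w = w' :=
  Subtype.ext (ContinuousMap.ext fun t => PiLp.ext fun i => h t i)

lemma dualRep_evalDual {d : ℕ} (t : unitInterval) (i : Fin d) :
    dualRep (evalDual t i) = indicatorConstLp 2 (measurableSet_Ioc (a := (0 : ℝ)) (b := t))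
      (measure_ne_top (volume.restrict (Set.Icc (0 : ℝ) 1)) _) (EuclideanSpace.single i (1 : ℝ)) := by
  refine ext_inner_right ℝ fun h => ?_
  rw [inner_dualRep, L2.inner_indicatorConstLp_eq_inner_setIntegral]
  have hsub : Set.Ioc (0 : ℝ) t ⊆ Set.Icc 0 1 := fun s hs => ⟨hs.1.le, hs.2.trans t.2.2⟩
  rw [Measure.restrict_restrict measurableSet_Ioc, Set.inter_eq_left.2 hsub]
  rw [evalDual_apply]
  change (cmPath h).1 t i = _
  rw [cmPath_apply, intervalIntegral.integral_of_le t.2.1]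
  simp [EuclideanSpace.inner_single_left]

lemma inner_dualRep_evalDual {d : ℕ} (s t : unitInterval) (i j : Fin d) :
    inner ℝ (dualRep (evalDual s i)) (dualRep (evalDual t j)) =
      if i = j then min (s : ℝ) (t : ℝ) else 0 := by
  rw [dualRep_evalDual, dualRep_evalDual, L2.inner_indicatorConstLp_indicatorConstLp]
  have h1 : (volume.restrict (Set.Icc (0 : ℝ) 1)).real (Set.Ioc 0 (s : ℝ) ∩ Set.Ioc 0 (t : ℝ))
      = min (s : ℝ) t := by
    rw [measureReal_restrict_apply (by measurability), Set.Ioc_inter_Ioc]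
    have : Set.Ioc (max (0:ℝ) 0) (min (s : ℝ) t) ∩ Set.Icc 0 1 = Set.Ioc 0 (min (s : ℝ) t) := by
      rw [max_self]
      exact Set.inter_eq_left.2 fun x hx => ⟨hx.1.le, hx.2.trans ((min_le_left _ _).trans s.2.2)⟩
    rw [this, Real.volume_real_Ioc_of_le (le_min s.2.1 t.2.1), sub_zero]
  rw [h1]
  by_cases hij : i = j
  · subst hij; simp
  · simp [hij, EuclideanSpace.inner_single_left]

variable {d : ℕ} {μ : Measure (PathSpace d)}

lemma IsWienerMeasure.integral_id (hμ : IsWienerMeasure μ) : ∫ w, w ∂μ = 0 := by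
  have := hμ.gaussian
  refine pathSpace_ext fun t i => ?_
  rw [← (evalDual t i).integral_comp_comm (IsGaussian.integrable_fun_id), map_zero]
  exact hμ.mean_zero i t

lemma IsWienerMeasure.integral_dual (hμ : IsWienerMeasure μ) (φ : StrongDual ℝ (PathSpace d)) :
    ∫ w, φ w ∂μ = 0 := by
  have := hμ.gaussian
  rw [φ.integral_comp_comm (IsGaussian.integrable_fun_id), hμ.integral_id, map_zero]

/-- The covariance of `W*` under Wiener measure is the inner product of `H`. It is enough to test
the Bochner integral `∫ φ(w) w dμ`, which is the path of `dualRep φ`, on coordinate evaluations. -/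
lemma IsWienerMeasure.covariance_dual (hμ : IsWienerMeasure μ) (φ ψ : StrongDual ℝ (PathSpace d)) :
    ∫ w, φ w * ψ w ∂μ = inner ℝ (dualRep φ) (dualRep ψ) := by
  have := hμ.gaussian
  have hint : ∀ φ : StrongDual ℝ (PathSpace d), Integrable (fun w => φ w • w) μ := fun φ =>
    (IsGaussian.memLp_two_fun_id (μ := μ)).smul (p := 2) (q := 2) (r := 1)
      (IsGaussian.memLp_dual μ φ 2 (by simp)) |>.integrable le_rfl
  have hk : ∀ φ ψ : StrongDual ℝ (PathSpace d), ψ (∫ w, φ w • w ∂μ) = ∫ w, φ w * ψ w ∂μ := by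
    intro φ ψ
    rw [← ψ.integral_comp_comm (hint φ)]
    simp
  have hev : ∀ t i, ∫ w, evalDual t i w • w ∂μ = cmIncl d (dualRep (evalDual t i)) := by
    intro t i
    refine pathSpace_ext fun s j => ?_
    rw [hk, ← inner_dualRep, real_inner_comm, inner_dualRep_evalDual]
    exact hμ.covariance i j t s
  have hφ : ∀ φ : StrongDual ℝ (PathSpace d), ∫ w, φ w • w ∂μ = cmIncl d (dualRep φ) := by
    intro φ
    refine pathSpace_ext fun t i => ?_
    rw [hk, ← inner_dualRep, real_inner_comm, inner_dualRep, ← hev, hk]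
    simp_rw [mul_comm]
  rw [← hk, hφ, ← inner_dualRep, real_inner_comm]

lemma IsWienerMeasure.map_dual (hμ : IsWienerMeasure μ) (φ : StrongDual ℝ (PathSpace d)) :
    μ.map φ = gaussianReal 0 (‖dualRep φ‖₊ ^ 2) := by
  have := hμ.gaussian
  rw [IsGaussian.map_eq_gaussianReal φ, hμ.integral_dual φ]
  congr 1
  rw [variance_eq_sub (IsGaussian.memLp_dual μ φ 2 (by simp)), hμ.integral_dual φ]
  have h := hμ.covariance_dual φ φ
  rw [real_inner_self_eq_norm_sq] at h
  have h2 : μ[(⇑φ) ^ 2] = ‖dualRep φ‖ ^ 2 := by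
    rw [← h]; exact integral_congr_ae (Eventually.of_forall fun w => by simp [pow_two])
  rw [h2]
  refine NNReal.eq ?_
  simp

/-! ### The subspace `W₀` and the measure `μ_{λ,W₀}` -/

variable {m : ℕ} {v : Fin m → StrongDual ℝ (PathSpace d)}

lemma inner_dualRep0 (φ : StrongDual ℝ (W0 v)) (h : H0 v) :
    inner ℝ (dualRep0 φ) h = φ (incl0 v h) := by
  simp [dualRep0, InnerProductSpace.toDual_symm_apply]

lemma projFull_cmIncl_dualRep (hv : Orthonormal ℝ fun i => dualRep (v i)) (i : Fin m) :
    projFull v (cmIncl d (dualRep (v i))) = 0 := by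
  have h : ∀ j, v j (cmIncl d (dualRep (v i))) = if j = i then 1 else 0 := fun j => by
    rw [← inner_dualRep]
    exact orthonormal_iff_ite.1 hv j i
  simp [projFull, h]

lemma dualRep_comp_projW0 (hv : Orthonormal ℝ fun i => dualRep (v i)) (ψ : StrongDual ℝ (W0 v)) :
    dualRep (ψ ∘L projW0 v) = (dualRep0 ψ : CameronMartin d) := by
  refine ext_inner_right ℝ fun h => ?_
  have hker : ∀ x ∈ Submodule.span ℝ (Set.range fun i => dualRep (v i)),
      projW0 v (cmIncl d x) = 0 := by
    intro x hx
    induction hx using Submodule.span_induction with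
    | mem x hx =>
      obtain ⟨i, rfl⟩ := hx
      exact Subtype.ext (projFull_cmIncl_dualRep hv i)
    | zero => simp
    | add x y _ _ hx hy => simp [hx, hy]
    | smul c x _ hx => simp [hx]
  set K := Submodule.span ℝ (Set.range fun i => dualRep (v i)) with hK
  have hfin : FiniteDimensional ℝ K := FiniteDimensional.span_of_finite ℝ (Set.finite_range _)
  obtain ⟨x, hx, y, hy, rfl⟩ := K.exists_add_mem_mem_orthogonal h
  rw [inner_dualRep, inner_add_right]
  have h1 : inner ℝ (dualRep0 ψ : CameronMartin d) x = 0 := by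
    rw [real_inner_comm]
    exact (Submodule.mem_orthogonal _ _).1 (dualRep0 ψ).2 x hx
  have h2 : inner ℝ (dualRep0 ψ : CameronMartin d) y = inner ℝ (dualRep0 ψ) (⟨y, hy⟩ : H0 v) := rfl
  rw [h1, h2, inner_dualRep0, zero_add, ContinuousLinearMap.comp_apply, map_add, map_add,
    hker x hx, zero_add]
  congr 1
  exact Subtype.ext (projFull_cmIncl v ⟨y, hy⟩)

/-- Under `μ_{λ,W₀}` every `φ ∈ W₀*` is centered Gaussian with variance `‖φ‖²_{H₀} / λ`. -/
lemma IsWienerMeasure.baseMeasure_map_dual (hμ : IsWienerMeasure μ)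
    (hv : Orthonormal ℝ fun i => dualRep (v i)) {lam : ℝ} (hlam : 0 < lam)
    (φ : StrongDual ℝ (W0 v)) :
    (baseMeasure μ v lam).map φ = gaussianReal 0 (Real.toNNReal (‖dualRep0 φ‖ ^ 2 / lam)) := by
  have hm : Measurable fun w : PathSpace d => (Real.sqrt lam)⁻¹ • w :=
    (continuous_const_smul _).measurable
  rw [baseMeasure, scaledMeasure, Measure.map_map (by fun_prop) (by fun_prop),
    Measure.map_map (by fun_prop) (by fun_prop)]
  have : (⇑φ ∘ (⇑(projW0 v)) ∘ fun w : PathSpace d => (Real.sqrt lam)⁻¹ • w) =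
      (fun x => (Real.sqrt lam)⁻¹ * x) ∘ (φ ∘L projW0 v) := by
    ext w; simp
  rw [Function.comp_assoc] at *
  rw [this, ← Measure.map_map (by fun_prop) (by fun_prop), hμ.map_dual, gaussianReal_map_const_mul,
    dualRep_comp_projW0 hv, mul_zero]
  congr 1
  refine NNReal.eq ?_
  rw [Real.coe_toNNReal _ (by positivity)]
  simp [Real.sq_sqrt hlam.le, div_eq_inv_mul]

lemma cmIncl_injective (d : ℕ) : Function.Injective (cmIncl d) := by
  refine (injective_iff_map_eq_zero _).2 fun h hh => ?_
  have hp : ∀ t : unitInterval, ∫ s in Set.Ioc (0 : ℝ) t, h s = 0 := fun t => by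
    rw [← intervalIntegral.integral_of_le t.2.1, ← cmPath_apply]
    change (cmIncl d h).1 t = 0
    rw [hh]; rfl
  have hI : Integrable (fun s => h s) (volume.restrict (Set.Icc (0 : ℝ) 1)) := cm_integrableOn h
  have key : (fun s => h s) =ᵐ[volume.restrict (Set.Icc (0 : ℝ) 1)] 0 := by
    set g : ℝ → EuclideanSpace ℝ (Fin d) := (Set.Icc (0 : ℝ) 1).indicator (fun s => h s) with hg
    have hgi : Integrable g volume := (integrable_indicator_iff measurableSet_Icc).2 hI
    have hzero : ∀ b : ℝ, ∫ s in Set.Iic b, g s = 0 := by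
      intro b
      rw [hg, setIntegral_indicator measurableSet_Icc]
      rcases le_or_gt b 0 with hb | hb
      · have : Set.Iic b ∩ Set.Icc (0:ℝ) 1 ⊆ {0} := fun s hs =>
          le_antisymm (hs.1.trans hb) hs.2.1
        rw [Measure.restrict_eq_zero.2 (measure_mono_null this (by simp)), integral_zero_measure]
      · have hset : Set.Iic b ∩ Set.Icc (0:ℝ) 1 = Set.Icc 0 (min b 1) := by
          ext s; simp only [Set.mem_inter_iff, Set.mem_Iic, Set.mem_Icc, le_min_iff]; tauto
        rw [hset, integral_Icc_eq_integral_Ioc]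
        exact hp ⟨min b 1, le_min hb.le zero_le_one, min_le_right _ _⟩
    have hg0 : g =ᵐ[volume] 0 := by
      refine hgi.ae_eq_zero_of_forall_setIntegral_eq_zero ?_
      intro s hs _
      refine MeasurableSpace.induction_on_inter (C := fun s _ => ∫ x in s, g x = 0)
        (borel_eq_generateFrom_Iic ℝ ▸ BorelSpace.measurable_eq) isPiSystem_Iic (by simp) ?_ ?_ ?_
        s hs
      · rintro _ ⟨b, rfl⟩; exact hzero b
      · intro t ht h0
        have h1 := integral_add_compl ht hgi
        have h2 : ∫ x, g x = 0 := by
          have := tendsto_setIntegral_of_monotone (f := g) (μ := volume)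
            (s := fun n : ℕ => Set.Iic (n : ℝ)) (fun n => measurableSet_Iic)
            (fun a b hab => Set.Iic_subset_Iic.2 (by exact_mod_cast hab)) hgi.integrableOn
          have hU : (⋃ n : ℕ, Set.Iic (n : ℝ)) = Set.univ :=
            Set.iUnion_eq_univ_iff.2 fun x => (exists_nat_ge x)
          rw [hU, Measure.restrict_univ] at this
          simp only [hzero] at this
          exact (tendsto_nhds_unique this tendsto_const_nhds)
        rw [h0, h2, zero_add] at h1
        exact h1
      · intro f hd hf h0
        rw [integral_iUnion hf hd hgi.integrableOn]
        simp [h0]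
    rw [Filter.EventuallyEq, ae_restrict_iff' measurableSet_Icc]
    filter_upwards [hg0] with s hs hmem
    rw [hg, Set.indicator_of_mem hmem] at hs
    exact hs
  exact (Lp.eq_zero_iff_ae_eq_zero).2 key

lemma incl0_injective : Function.Injective (incl0 v) := fun _ _ hhk =>
  Subtype.ext (cmIncl_injective d (congrArg Subtype.val hhk))

/-- `dualRep0` as a linear map. -/
def dualRep0L (v : Fin m → StrongDual ℝ (PathSpace d)) : StrongDual ℝ (W0 v) →ₗ[ℝ] H0 v where
  toFun := dualRep0
  map_add' φ ψ := ext_inner_right ℝ fun h => by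
    rw [inner_add_left]; simp only [inner_dualRep0]; rfl
  map_smul' c φ := ext_inner_right ℝ fun h => by
    rw [inner_smul_left]; simp only [inner_dualRep0]; rfl

lemma dualRep0_add (φ ψ : StrongDual ℝ (W0 v)) : dualRep0 (φ + ψ) = dualRep0 φ + dualRep0 ψ :=
  (dualRep0L v).map_add φ ψ

lemma dualRep0_smul (c : ℝ) (φ : StrongDual ℝ (W0 v)) : dualRep0 (c • φ) = c • dualRep0 φ :=
  (dualRep0L v).map_smul c φ

lemma dualRep0_sub (φ ψ : StrongDual ℝ (W0 v)) : dualRep0 (φ - ψ) = dualRep0 φ - dualRep0 ψ :=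
  (dualRep0L v).map_sub φ ψ

lemma completeSpace_W0 (hv : Orthonormal ℝ fun i => dualRep (v i)) : CompleteSpace (W0 v) := by
  have hP : ∀ w, projFull v (projFull v w) = projFull v w := fun w => by
    have h : projFull v w = w - ∑ i, v i w • cmIncl d (dualRep (v i)) := by simp [projFull]
    rw [congrArg (projFull v) h, map_sub, map_sum]
    simp [projFull_cmIncl_dualRep hv]
  have hc : IsClosed (W0 v : Set (PathSpace d)) := by
    have : (W0 v : Set (PathSpace d)) = {w | projFull v w = w} := by
      ext w
      exact ⟨fun ⟨u, hu⟩ => by rw [← hu]; exact hP u, fun h => ⟨w, h⟩⟩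
    rw [this]
    exact isClosed_eq (by fun_prop) continuous_id
  exact hc.completeSpace_coe

/-- An `h ∈ H₀` orthogonal to all representatives of functionals is annihilated by `W₀*`, hence
vanishes in `W₀`; and `H₀ → W₀` is injective. -/
lemma dualRep0_denseRange : DenseRange (dualRep0 : StrongDual ℝ (W0 v) → H0 v) := by
  have : Dense ((LinearMap.range (dualRep0L v) : Submodule ℝ (H0 v)) : Set (H0 v)) := by
    rw [Submodule.dense_iff_topologicalClosure_eq_top,
      Submodule.topologicalClosure_eq_top_iff, Submodule.eq_bot_iff]
    intro h hh
    have h0 : incl0 v h = 0 := by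
      by_contra hne
      obtain ⟨φ, -, hφ⟩ := exists_dual_vector ℝ _ (norm_ne_zero_iff.2 hne)
      have := (Submodule.mem_orthogonal _ _).1 hh (dualRep0 φ) ⟨φ, rfl⟩
      rw [inner_dualRep0, hφ] at this
      exact hne (norm_eq_zero.1 (by simpa using this))
    exact incl0_injective (h0.trans (map_zero _).symm)
  exact this

end

section

/-! ### Gaussian random variables -/

section Gaussian

variable {Ω : Type*} [MeasurableSpace Ω] {P : Measure Ω}

lemma aemeasurable_of_map_gaussian {Y : Ω → ℝ} {w : ℝ≥0} (h : P.map Y = gaussianReal 0 w) :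
    AEMeasurable Y P := by
  by_contra hne
  rw [Measure.map_of_not_aemeasurable hne] at h
  exact IsProbabilityMeasure.ne_zero (gaussianReal 0 w) h.symm

lemma memLp_of_map_gaussian {Y : Ω → ℝ} {w : ℝ≥0} (h : P.map Y = gaussianReal 0 w) (p : ℝ≥0) :
    MemLp Y p P := by
  have hid := memLp_id_gaussianReal (μ := 0) (v := w) p
  rw [← h, memLp_map_measure_iff (by fun_prop) (aemeasurable_of_map_gaussian h)] at hid
  exact hid

lemma integral_sq_of_map_gaussian {Y : Ω → ℝ} {w : ℝ≥0} (h : P.map Y = gaussianReal 0 w) :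
    ∫ x, Y x ^ 2 ∂P = w := by
  have h1 : ∫ x, x ^ 2 ∂(P.map Y) = ∫ x, Y x ^ 2 ∂P :=
    integral_map (aemeasurable_of_map_gaussian h) (by fun_prop)
  rw [← h1, h, ← variance_fun_id_gaussianReal (μ := 0) (v := w), variance_of_integral_eq_zero
    (by fun_prop) (by simp)]

lemma eLpNorm_two_of_map_gaussian {Y : Ω → ℝ} {w : ℝ≥0} (h : P.map Y = gaussianReal 0 w) :
    eLpNorm Y 2 P = ENNReal.ofReal (Real.sqrt w) := by
  have hL : MemLp Y 2 P := memLp_of_map_gaussian h 2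
  rw [hL.eLpNorm_eq_integral_rpow_norm (by simp) (by simp)]
  simp only [ENNReal.toReal_ofNat, Real.rpow_ofNat, Real.norm_eq_abs, sq_abs]
  rw [integral_sq_of_map_gaussian h, Real.sqrt_eq_rpow, one_div]

lemma charFun_gaussian_zero (w : ℝ≥0) (t : ℝ) :
    charFun (gaussianReal 0 w) t = Complex.exp (-(w * t ^ 2 / 2 : ℝ)) := by
  rw [charFun_gaussianReal]; congr 1; push_cast; ring

/-- An almost sure limit of centered Gaussian variables is Gaussian. -/
lemma map_gaussian_of_tendsto_ae [IsProbabilityMeasure P] {Y : ℕ → Ω → ℝ} {Y' : Ω → ℝ}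
    {w : ℕ → ℝ≥0} {w' : ℝ≥0} (hY : ∀ k, P.map (Y k) = gaussianReal 0 (w k))
    (hY' : AEMeasurable Y' P) (hlim : ∀ᵐ x ∂P, Tendsto (fun k => Y k x) atTop (𝓝 (Y' x)))
    (hw : Tendsto w atTop (𝓝 w')) : P.map Y' = gaussianReal 0 w' := by
  have := Measure.isProbabilityMeasure_map hY'
  refine Measure.ext_of_charFun (funext fun t => ?_)
  have hm : ∀ k, AEMeasurable (Y k) P := fun k => aemeasurable_of_map_gaussian (hY k)
  have h1 : ∀ Z : Ω → ℝ, AEMeasurable Z P →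
      charFun (P.map Z) t = ∫ x, Complex.exp (t * Z x * Complex.I) ∂P := fun Z hZ => by
    rw [charFun_apply_real, integral_map hZ (by fun_prop)]
  have h2 : Tendsto (fun k => charFun (P.map (Y k)) t) atTop (𝓝 (charFun (P.map Y') t)) := by
    rw [h1 _ hY']
    simp_rw [fun k => h1 _ (hm k)]
    refine tendsto_integral_of_dominated_convergence (fun _ => 1) (fun k => ?_)
      (integrable_const _) (fun k => Eventually.of_forall fun x => ?_) ?_
    · have := hm k; fun_prop
    · rw [← Complex.ofReal_mul, Complex.norm_exp_ofReal_mul_I]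
    · filter_upwards [hlim] with x hx
      have hc : Continuous fun x : ℝ => Complex.exp (t * x * Complex.I) := by fun_prop
      exact (hc.tendsto _).comp hx
  refine tendsto_nhds_unique h2 ?_
  simp_rw [hY, charFun_gaussian_zero]
  have hc : Continuous fun x : ℝ≥0 => Complex.exp (-(x * t ^ 2 / 2 : ℝ)) := by fun_prop
  exact (hc.tendsto _).comp hw

end Gaussian

/-! ### Wiener integrals -/

variable {d m : ℕ} {v : Fin m → StrongDual ℝ (PathSpace d)}

/-- `ν` is a measure on `W₀` under which every `φ ∈ W₀* ⊂ H₀` is centered Gaussian with variance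
`‖φ‖² / λ`. -/
def IsIsonormal (ν : Measure (W0 v)) (lam : ℝ) : Prop :=
  ∀ φ : StrongDual ℝ (W0 v), ν.map φ = gaussianReal 0 (Real.toNNReal (‖dualRep0 φ‖ ^ 2 / lam))

variable {ν : Measure (W0 v)} {lam : ℝ}

lemma IsIsonormal.isProbabilityMeasure (hν : IsIsonormal ν lam) : IsProbabilityMeasure ν := by
  have h := hν 0
  have : IsProbabilityMeasure (ν.map (0 : StrongDual ℝ (W0 v))) := by rw [h]; infer_instance
  exact ν.isProbabilityMeasure_of_map (0 : StrongDual ℝ (W0 v))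

lemma IsIsonormal.memLp (hν : IsIsonormal ν lam) (φ : StrongDual ℝ (W0 v)) : MemLp φ 2 ν :=
  memLp_of_map_gaussian (hν φ) 2

lemma IsIsonormal.eLpNorm_dual (hν : IsIsonormal ν lam) (φ : StrongDual ℝ (W0 v)) :
    eLpNorm φ 2 ν = ENNReal.ofReal (‖dualRep0 φ‖ / Real.sqrt lam) := by
  rw [eLpNorm_two_of_map_gaussian (hν φ)]
  congr 1
  rcases le_or_gt lam 0 with h | h
  · rw [Real.sqrt_eq_zero_of_nonpos h, div_zero, Real.toNNReal_of_nonpos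
      (div_nonpos_of_nonneg_of_nonpos (by positivity) h)]
    simp
  · rw [Real.coe_toNNReal _ (by positivity), Real.sqrt_div (by positivity),
      Real.sqrt_sq (norm_nonneg _)]

lemma IsIsonormal.eLpNorm_dual_sub (hν : IsIsonormal ν lam) (φ ψ : StrongDual ℝ (W0 v)) :
    eLpNorm (fun η => φ η - ψ η) 2 ν =
      ENNReal.ofReal (‖dualRep0 φ - dualRep0 ψ‖ / Real.sqrt lam) := by
  rw [← dualRep0_sub, ← hν.eLpNorm_dual]; rfl

lemma exists_dual_seq (h : H0 v) : ∃ φ : ℕ → StrongDual ℝ (W0 v),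
    Tendsto (fun k => dualRep0 (φ k)) atTop (𝓝 h) := by
  obtain ⟨u, hu, hlim⟩ := mem_closure_iff_seq_limit.1 (dualRep0_denseRange h)
  choose φ hφ using hu
  exact ⟨φ, by simpa [hφ] using hlim⟩

lemma IsIsonormal.exists_wienerIntegral (hν : IsIsonormal ν lam) (h : H0 v) :
    ∃ X : W0 v → ℝ, Measurable X ∧ ∃ φ : ℕ → StrongDual ℝ (W0 v),
      Tendsto (fun k => dualRep0 (φ k)) atTop (𝓝 h) ∧
      Tendsto (fun k => eLpNorm (fun η => φ k η - X η) 2 ν) atTop (𝓝 0) := by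
  obtain ⟨φ, hφ⟩ := exists_dual_seq h
  have hc : CauchySeq fun k => (hν.memLp (φ k)).toLp (φ k) := by
    have hd : ∀ k l, dist ((hν.memLp (φ k)).toLp (φ k)) ((hν.memLp (φ l)).toLp (φ l)) =
        dist (dualRep0 (φ k)) (dualRep0 (φ l)) / Real.sqrt lam := fun k l => by
      rw [dist_eq_norm, ← MemLp.toLp_sub, Lp.norm_toLp, dist_eq_norm]
      change (eLpNorm (fun η => φ k η - φ l η) 2 ν).toReal = _
      rw [hν.eLpNorm_dual_sub, ENNReal.toReal_ofReal (by positivity)]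
    rw [cauchySeq_iff_tendsto_dist_atTop_0]
    simp_rw [hd]
    simpa using (cauchySeq_iff_tendsto_dist_atTop_0.1 hφ.cauchySeq).div_const (Real.sqrt lam)
  obtain ⟨Y, hY⟩ := cauchySeq_tendsto_of_complete hc
  refine ⟨Y, (Lp.stronglyMeasurable Y).measurable, φ, hφ, ?_⟩
  rw [Lp.tendsto_Lp_iff_tendsto_eLpNorm'] at hY
  refine hY.congr fun k => eLpNorm_congr_ae ?_
  filter_upwards [(hν.memLp (φ k)).coeFn_toLp] with η hη
  simp [hη]

lemma IsIsonormal.wienerIntegral_spec (hν : IsIsonormal ν lam) (h : H0 v) :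
    Measurable (wienerIntegral ν h) ∧ ∃ φ : ℕ → StrongDual ℝ (W0 v),
      Tendsto (fun k => dualRep0 (φ k)) atTop (𝓝 h) ∧
      Tendsto (fun k => eLpNorm (fun η => φ k η - wienerIntegral ν h η) 2 ν) atTop (𝓝 0) := by
  have hX := hν.exists_wienerIntegral h
  have : wienerIntegral ν h = hX.choose := by rw [wienerIntegral, dif_pos hX]
  rw [this]
  exact hX.choose_spec

lemma measurable_wienerIntegral (h : H0 v) : Measurable (wienerIntegral ν h) := by
  rw [wienerIntegral]
  split_ifs with hX
  · exact hX.choose_spec.1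
  · exact measurable_zero

/-- Every sequence in `W₀*` converging to `h` in `H₀` converges to the Wiener integral of `h`. -/
lemma IsIsonormal.tendsto_wienerIntegral (hν : IsIsonormal ν lam) {h : H0 v}
    {ψ : ℕ → StrongDual ℝ (W0 v)} (hψ : Tendsto (fun k => dualRep0 (ψ k)) atTop (𝓝 h)) :
    Tendsto (fun k => eLpNorm (fun η => ψ k η - wienerIntegral ν h η) 2 ν) atTop (𝓝 0) := by
  obtain ⟨-, φ, hφ, hX⟩ := hν.wienerIntegral_spec h
  have h1 : Tendsto (fun k => eLpNorm (fun η => ψ k η - φ k η) 2 ν) atTop (𝓝 0) := by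
    simp_rw [hν.eLpNorm_dual_sub]
    have := ((hψ.sub hφ).norm.div_const (Real.sqrt lam))
    simp only [sub_self, norm_zero, zero_div] at this
    simpa using ENNReal.tendsto_ofReal this
  refine tendsto_of_tendsto_of_tendsto_of_le_of_le tendsto_const_nhds
    (by simpa using h1.add hX) (fun _ => zero_le) fun k => ?_
  have h2 : (fun η => ψ k η - wienerIntegral ν h η) =
      (fun η => ψ k η - φ k η) + fun η => φ k η - wienerIntegral ν h η := by
    ext η; simp
  rw [h2]
  have := (measurable_wienerIntegral (ν := ν) h).aestronglyMeasurable (μ := ν)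
  exact eLpNorm_add_le (by fun_prop) (by fun_prop) (by norm_num)

lemma ae_eq_of_tendsto_eLpNorm {Ω : Type*} [MeasurableSpace Ω] {P : Measure Ω}
    {X Y : Ω → ℝ} {U : ℕ → Ω → ℝ} (hU : ∀ k, AEStronglyMeasurable (U k) P)
    (hX : AEStronglyMeasurable X P) (hY : AEStronglyMeasurable Y P)
    (h1 : Tendsto (fun k => eLpNorm (fun η => U k η - X η) 2 P) atTop (𝓝 0))
    (h2 : Tendsto (fun k => eLpNorm (fun η => U k η - Y η) 2 P) atTop (𝓝 0)) : X =ᵐ[P] Y :=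
  tendstoInMeasure_ae_unique (tendstoInMeasure_of_tendsto_eLpNorm (by norm_num) hU hX h1)
    (tendstoInMeasure_of_tendsto_eLpNorm (by norm_num) hU hY h2)

lemma IsIsonormal.wienerIntegral_dual (hν : IsIsonormal ν lam) (φ : StrongDual ℝ (W0 v)) :
    wienerIntegral ν (dualRep0 φ) =ᵐ[ν] φ := by
  have h := hν.tendsto_wienerIntegral (ψ := fun _ => φ) (tendsto_const_nhds (x := dualRep0 φ))
  refine ae_eq_of_tendsto_eLpNorm (fun _ => by fun_prop)
    (measurable_wienerIntegral _).aestronglyMeasurable (by fun_prop) h (by simp)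

lemma IsIsonormal.wienerIntegral_add (hν : IsIsonormal ν lam) (h k : H0 v) :
    wienerIntegral ν (h + k) =ᵐ[ν] fun η => wienerIntegral ν h η + wienerIntegral ν k η := by
  have mh := (measurable_wienerIntegral (ν := ν) h).aestronglyMeasurable (μ := ν)
  have mk := (measurable_wienerIntegral (ν := ν) k).aestronglyMeasurable (μ := ν)
  obtain ⟨φ, hφ⟩ := exists_dual_seq h
  obtain ⟨ψ, hψ⟩ := exists_dual_seq k
  have hs : Tendsto (fun j => dualRep0 (φ j + ψ j)) atTop (𝓝 (h + k)) := by
    simpa only [dualRep0_add] using hφ.add hψ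
  refine ae_eq_of_tendsto_eLpNorm (fun _ => by fun_prop)
    (measurable_wienerIntegral _).aestronglyMeasurable (by fun_prop)
    (hν.tendsto_wienerIntegral hs) ?_
  refine tendsto_of_tendsto_of_tendsto_of_le_of_le tendsto_const_nhds
    (by simpa using (hν.tendsto_wienerIntegral hφ).add (hν.tendsto_wienerIntegral hψ))
    (fun _ => zero_le) fun j => ?_
  have h2 : (fun η => (φ j + ψ j) η - (wienerIntegral ν h η + wienerIntegral ν k η)) =
      (fun η => φ j η - wienerIntegral ν h η) + fun η => ψ j η - wienerIntegral ν k η := by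
    ext η; simp; ring
  rw [h2]
  exact eLpNorm_add_le (by fun_prop) (by fun_prop) (by norm_num)

lemma IsIsonormal.wienerIntegral_smul (hν : IsIsonormal ν lam) (c : ℝ) (h : H0 v) :
    wienerIntegral ν (c • h) =ᵐ[ν] fun η => c * wienerIntegral ν h η := by
  have mh := (measurable_wienerIntegral (ν := ν) h).aestronglyMeasurable (μ := ν)
  obtain ⟨φ, hφ⟩ := exists_dual_seq h
  have hs : Tendsto (fun j => dualRep0 (c • φ j)) atTop (𝓝 (c • h)) := by
    simpa only [dualRep0_smul] using hφ.const_smul c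
  refine ae_eq_of_tendsto_eLpNorm (fun _ => by fun_prop)
    (measurable_wienerIntegral _).aestronglyMeasurable (by fun_prop)
    (hν.tendsto_wienerIntegral hs) ?_
  have h2 : ∀ j, eLpNorm (fun η => (c • φ j) η - c * wienerIntegral ν h η) 2 ν =
      ‖c‖ₑ * eLpNorm (fun η => φ j η - wienerIntegral ν h η) 2 ν := fun j => by
    rw [← eLpNorm_const_smul]
    congr 1; ext η; simp [mul_sub]
  simp_rw [h2]
  simpa using ENNReal.Tendsto.const_mul (hν.tendsto_wienerIntegral hφ) (Or.inr (by simp))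

lemma IsIsonormal.wienerIntegral_sum (hν : IsIsonormal ν lam) {ι : Type*} (s : Finset ι)
    (c : ι → ℝ) (h : ι → H0 v) :
    wienerIntegral ν (∑ i ∈ s, c i • h i) =ᵐ[ν] fun η => ∑ i ∈ s, c i * wienerIntegral ν (h i) η := by
  classical
  induction s using Finset.induction_on with
  | empty =>
    have h0 := hν.wienerIntegral_smul 0 0
    simpa using h0
  | insert a s ha ih =>
    rw [Finset.sum_insert ha]
    filter_upwards [ih, hν.wienerIntegral_add (c a • h a) (∑ i ∈ s, c i • h i),
      hν.wienerIntegral_smul (c a) (h a)] with η h1 h2 h3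
    rw [h2, h3, h1, Finset.sum_insert ha]

lemma IsIsonormal.map_wienerIntegral (hν : IsIsonormal ν lam) (h : H0 v) :
    ν.map (wienerIntegral ν h) = gaussianReal 0 (Real.toNNReal (‖h‖ ^ 2 / lam)) := by
  have := hν.isProbabilityMeasure
  obtain ⟨hm, φ, hφ, hX⟩ := hν.wienerIntegral_spec h
  have hmeas := tendstoInMeasure_of_tendsto_eLpNorm (p := 2) (by norm_num)
    (fun k => ((φ k).continuous.measurable.aestronglyMeasurable (μ := ν)))
    hm.aestronglyMeasurable hX
  obtain ⟨ns, hns, hae⟩ := hmeas.exists_seq_tendsto_ae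
  refine map_gaussian_of_tendsto_ae (fun k => hν (φ (ns k))) hm.aemeasurable hae ?_
  refine (continuous_real_toNNReal.tendsto _).comp ?_
  exact ((hφ.comp hns.tendsto_atTop).norm.pow 2).div_const lam

lemma IsIsonormal.eLpNorm_wienerIntegral (hν : IsIsonormal ν lam) (hlam : 0 < lam) (h : H0 v) :
    eLpNorm (wienerIntegral ν h) 2 ν = ENNReal.ofReal (‖h‖ / Real.sqrt lam) := by
  rw [eLpNorm_two_of_map_gaussian (hν.map_wienerIntegral h), Real.coe_toNNReal _ (by positivity),
    Real.sqrt_div (by positivity), Real.sqrt_sq (norm_nonneg _)]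

/-- The Wiener integrals of an orthonormal system are independent: every linear combination of them
is again a Wiener integral, so the joint characteristic function is known, and factorizes. -/
lemma IsIsonormal.iIndepFun (hν : IsIsonormal ν lam) (hlam : 0 < lam)
    (e : HilbertBasis ℕ ℝ (H0 v)) : iIndepFun (fun i => wienerIntegral ν (e i)) ν := by
  classical
  have := hν.isProbabilityMeasure
  rw [iIndepFun_iff_finset]
  intro s
  refine (iIndepFun_iff_charFunDual_pi (X := fun (i : s) => wienerIntegral ν (e i))
    (fun i => (measurable_wienerIntegral (ν := ν) (e i)).aemeasurable)).2 ?_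
  intro L
  have hL : ∀ x : s → ℝ, L x = ∑ i, L (Pi.single i 1) * x i := fun x => by
    conv_lhs => rw [pi_eq_sum_univ' x, map_sum]
    refine Finset.sum_congr rfl fun i _ => ?_
    rw [map_smul, smul_eq_mul, mul_comm]
  set c : s → ℝ := fun i => L (Pi.single i 1) with hc
  have hsum := hν.wienerIntegral_sum Finset.univ c (fun i : s => e i)
  have hmeas : Measurable fun (η : W0 v) (i : s) => wienerIntegral ν (e i) η :=
    measurable_pi_lambda _ fun i => measurable_wienerIntegral _
  have h1 : (ν.map fun η (i : s) => wienerIntegral ν (e i) η).map L =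
      gaussianReal 0 (Real.toNNReal (∑ i, c i ^ 2 / lam)) := by
    rw [Measure.map_map (by fun_prop) hmeas, ← Finset.sum_div]
    have hn : ‖∑ i, c i • e (i : ℕ)‖ ^ 2 = ∑ i, c i ^ 2 := by
      rw [← real_inner_self_eq_norm_sq]
      have ho : Orthonormal ℝ fun i : s => e (i : ℕ) := e.orthonormal.comp _ Subtype.val_injective
      rw [ho.inner_sum]
      simp [pow_two]
    rw [← hn, ← hν.map_wienerIntegral]
    refine Measure.map_congr ?_
    filter_upwards [hsum] with η hη
    rw [hη, Function.comp_apply, hL]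
  change charFunDual (ν.map fun η (i : s) => wienerIntegral ν (e i) η) L = _
  rw [charFunDual_eq_charFun_map_one, h1, charFun_gaussian_zero]
  have h2 : ∀ i : s, charFunDual (ν.map (wienerIntegral ν (e i)))
      (L.comp (.single ℝ (fun _ => ℝ) i)) = Complex.exp (-(c i ^ 2 / lam / 2 : ℝ)) := fun i => by
    rw [charFunDual_eq_charFun_map_one]
    have h3 : ⇑(L.comp (ContinuousLinearMap.single ℝ (fun _ : s => ℝ) i)) = fun x => c i * x := by
      ext x
      have hx : (Pi.single i x : s → ℝ) = x • Pi.single i 1 := by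
        rw [← Pi.single_smul, smul_eq_mul, mul_one]
      rw [ContinuousLinearMap.comp_apply, ContinuousLinearMap.single_apply, hx, map_smul,
        smul_eq_mul, mul_comm]
    rw [h3]
    rw [hν.map_wienerIntegral, gaussianReal_map_const_mul, mul_zero, charFun_gaussian_zero]
    congr 2
    simp [e.orthonormal.1 i, hlam.le]
    ring
  rw [Finset.prod_congr rfl fun i _ => h2 i, ← Complex.exp_sum]
  congr 1
  rw [Real.coe_toNNReal _ (Finset.sum_nonneg fun i _ => by positivity)]
  push_cast
  rw [Finset.sum_neg_distrib, one_pow, mul_one, Finset.sum_div]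

/-- Along a subsequence, the Wiener integral of `h` is almost surely the sum of `∑ᵢ (h, eᵢ) ηᵢ`. -/
lemma IsIsonormal.exists_seq_tendsto_ae (hν : IsIsonormal ν lam) (hlam : 0 < lam)
    (e : HilbertBasis ℕ ℝ (H0 v)) (h : H0 v) : ∃ ns : ℕ → ℕ, StrictMono ns ∧
      ∀ᵐ η ∂ν, Tendsto (fun k => ∑ i ∈ Finset.range (ns k),
        inner ℝ (e i) h * wienerIntegral ν (e i) η) atTop (𝓝 (wienerIntegral ν h η)) := by
  have hmX : ∀ h : H0 v, AEStronglyMeasurable (wienerIntegral ν h) ν := fun h =>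
    (measurable_wienerIntegral _).aestronglyMeasurable
  have hs : Tendsto (fun k => ∑ i ∈ Finset.range k, (inner ℝ (e i) h : ℝ) • e i) atTop (𝓝 h) := by
    have := (e.hasSum_repr h).tendsto_sum_nat
    simpa [e.repr_apply_apply] using this
  have hL : Tendsto (fun k => eLpNorm ((fun η => ∑ i ∈ Finset.range k,
      inner ℝ (e i) h * wienerIntegral ν (e i) η) - wienerIntegral ν h) 2 ν) atTop (𝓝 0) := by
    have h1 : ∀ k, eLpNorm ((fun η => ∑ i ∈ Finset.range k,
        inner ℝ (e i) h * wienerIntegral ν (e i) η) - wienerIntegral ν h) 2 ν =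
        ENNReal.ofReal (‖(∑ i ∈ Finset.range k, (inner ℝ (e i) h : ℝ) • e i) - h‖ /
          Real.sqrt lam) := fun k => by
      rw [← hν.eLpNorm_wienerIntegral hlam]
      refine eLpNorm_congr_ae ?_
      filter_upwards [hν.wienerIntegral_sum (Finset.range k) (fun i => inner ℝ (e i) h) e,
        hν.wienerIntegral_add (∑ i ∈ Finset.range k, (inner ℝ (e i) h : ℝ) • e i) ((-1 : ℝ) • h),
        hν.wienerIntegral_smul (-1) h] with η a1 a2 a3
      rw [sub_eq_add_neg (∑ i ∈ Finset.range k, _) h, ← neg_one_smul ℝ h, a2, a3, a1]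
      simp [sub_eq_add_neg]
    simp_rw [h1]
    have := ((hs.sub_const h).norm.div_const (Real.sqrt lam))
    simp only [sub_self, norm_zero, zero_div] at this
    simpa using ENNReal.tendsto_ofReal this
  exact (tendstoInMeasure_of_tendsto_eLpNorm (by norm_num)
    (fun k => (Finset.measurable_fun_sum _ fun i _ =>
      (measurable_wienerIntegral _).const_mul _).aestronglyMeasurable) (hmX h)
    hL).exists_seq_tendsto_ae

end

section

/-! ### Diagonal operators on a Hilbert space -/

section Operators

variable {E : Type*} [NormedAddCommGroup E] [InnerProductSpace ℝ E]

lemma hilbertBasis_hasSum_sq (e : HilbertBasis ℕ ℝ E) (x : E) :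
    HasSum (fun i => inner ℝ (e i) x ^ 2) (‖x‖ ^ 2) := by
  rw [← real_inner_self_eq_norm_sq]
  have h := e.hasSum_inner_mul_inner x x
  simpa only [real_inner_comm (e _) x, ← pow_two] using h

lemma hilbertBasis_tsum_ofReal_sq (e : HilbertBasis ℕ ℝ E) (x : E) :
    ∑' i, ENNReal.ofReal (inner ℝ (e i) x ^ 2) = ENNReal.ofReal (‖x‖ ^ 2) := by
  have h := hilbertBasis_hasSum_sq e x
  rw [← h.tsum_eq, ENNReal.ofReal_tsum_of_nonneg (fun _ => sq_nonneg _) h.summable]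

lemma hilbertBasis_ext {F : Type*} [NormedAddCommGroup F] [NormedSpace ℝ F]
    (e : HilbertBasis ℕ ℝ E) {A B : E →L[ℝ] F} (h : ∀ i, A (e i) = B (e i)) : A = B := by
  refine ContinuousLinearMap.ext_on (s := Set.range e) ?_ ?_
  · rw [Submodule.dense_iff_topologicalClosure_eq_top]; exact e.dense_span
  · rintro _ ⟨i, rfl⟩; exact h i

lemma hasSum_inner_apply_self {B : E →L[ℝ] E} (hB : B.IsSymmetric)
    (e : HilbertBasis ℕ ℝ E) {a : ℕ → ℝ} (hBe : ∀ i, B (e i) = a i • e i) (x y : E) :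
    HasSum (fun i => a i * (inner ℝ (e i) x * inner ℝ (e i) y)) (inner ℝ (B x) y) := by
  refine (e.hasSum_inner_mul_inner (B x) y).congr_fun fun i => ?_
  have : inner ℝ (B x) (e i) = inner ℝ x (B (e i)) := hB x (e i)
  rw [this, hBe, inner_smul_right, real_inner_comm x (e i)]
  ring

variable [CompleteSpace E]

/-- The eigenvalues of a self-adjoint Hilbert-Schmidt operator are square summable: the
Hilbert-Schmidt norm does not depend on the basis. -/
lemma summable_eigenvalue_sq {T : E →L[ℝ] E} (hT : IsSelfAdjoint T) (hHS : IsHilbertSchmidt T)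
    (e : HilbertBasis ℕ ℝ E) {ζ : ℕ → ℝ} (hTe : ∀ i, T (e i) = ζ i • e i) :
    Summable fun i => ζ i ^ 2 := by
  obtain ⟨b, hb⟩ := hHS
  have hsym : ∀ x y, inner ℝ (T x) y = inner ℝ x (T y) :=
    ContinuousLinearMap.isSelfAdjoint_iff_isSymmetric.1 hT
  have h1 : ∑' i, ENNReal.ofReal (ζ i ^ 2) = ∑' j, ENNReal.ofReal (‖T (b j)‖ ^ 2) := by
    have hζ : ∀ i, ENNReal.ofReal (ζ i ^ 2) = ∑' j, ENNReal.ofReal (inner ℝ (b j) (T (e i)) ^ 2) :=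
      fun i => by
        rw [hilbertBasis_tsum_ofReal_sq, hTe, norm_smul, e.orthonormal.1 i]; simp
    simp_rw [hζ, ← hilbertBasis_tsum_ofReal_sq e]
    rw [ENNReal.tsum_comm]
    refine tsum_congr fun j => tsum_congr fun i => ?_
    rw [← hsym, real_inner_comm]
  have h2 : ∑' i, ENNReal.ofReal (ζ i ^ 2) ≠ ⊤ := by
    rw [h1, ← ENNReal.ofReal_tsum_of_nonneg (fun _ => sq_nonneg _) hb]
    simp
  have h3 := ENNReal.summable_toReal h2
  simpa [ENNReal.toReal_ofReal (sq_nonneg _)] using h3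

variable {T : E →L[ℝ] E} {e : HilbertBasis ℕ ℝ E} {ζ : ℕ → ℝ} {N : ℕ}

/-- `|I + T|` exists, as `I + T` plus a finite rank operator which flips the sign of the negative
eigenvalues. -/
lemma exists_opAbs (hT : IsSelfAdjoint T) (hTe : ∀ i, T (e i) = ζ i • e i)
    (hneg : ∀ i < N, 1 + ζ i < 0) (hpos : ∀ i, N ≤ i → 0 < 1 + ζ i) :
    ∃ B : E →L[ℝ] E, B.IsPositive ∧ B * B = ContinuousLinearMap.adjoint (1 + T) * (1 + T) := by
  have hA : IsSelfAdjoint (1 + T) := (IsSelfAdjoint.one _).add hT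
  set B : E →L[ℝ] E := (1 + T) +
    ∑ i ∈ Finset.range N, (2 * |1 + ζ i|) • (innerSL ℝ (e i)).smulRight (e i) with hB
  have hBe : ∀ i, B (e i) = |1 + ζ i| • e i := by
    intro j
    have h1 : (1 + T) (e j) = (1 + ζ j) • e j := by
      rw [add_smul, one_smul, ← hTe]; rfl
    have h2 : ∀ i, inner ℝ (e i) (e j) = if i = j then (1 : ℝ) else 0 :=
      fun i => orthonormal_iff_ite.1 e.orthonormal i j
    rw [hB, add_apply, h1]
    simp only [sum_apply, smul_apply,
      ContinuousLinearMap.smulRight_apply, innerSL_apply_apply, h2]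
    simp only [ite_smul, one_smul, zero_smul, smul_ite, smul_zero, Finset.sum_ite_eq',
      Finset.mem_range]
    split_ifs with h
    · rw [← add_smul, abs_of_neg (hneg j h)]; congr 1; ring
    · rw [add_zero, abs_of_pos (hpos j (not_lt.1 h))]
  have hsym : B.IsSymmetric := by
    intro x y
    have hAs := ContinuousLinearMap.isSelfAdjoint_iff_isSymmetric.1 hA x y
    simp only [hB, ContinuousLinearMap.coe_coe] at hAs ⊢
    rw [add_apply (1 + T), add_apply (1 + T), inner_add_left,
      inner_add_right, hAs]
    simp only [sum_apply, smul_apply,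
      ContinuousLinearMap.smulRight_apply, innerSL_apply_apply, sum_inner, inner_sum,
      inner_smul_left, inner_smul_right]
    congr 1
    refine Finset.sum_congr rfl fun i _ => ?_
    rw [real_inner_comm x (e i)]
    simp only [conj_trivial]
    ring
  refine ⟨B, (ContinuousLinearMap.isPositive_iff B).2 ⟨hsym, fun x => ?_⟩, ?_⟩
  · refine (hasSum_inner_apply_self hsym e hBe x x).nonneg fun i => ?_
    exact mul_nonneg (abs_nonneg _) (mul_self_nonneg _)
  · rw [hA.adjoint_eq]
    refine hilbertBasis_ext e fun i => ?_
    have h1 : (1 + T) (e i) = (1 + ζ i) • e i := by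
      rw [add_smul, one_smul, ← hTe]; rfl
    rw [mul_apply_eq_comp, mul_apply_eq_comp, h1, hBe, map_smul, map_smul,
      h1, hBe, smul_smul, smul_smul, abs_mul_abs_self]

lemma opAbs_isPositive (hT : IsSelfAdjoint T) (hTe : ∀ i, T (e i) = ζ i • e i)
    (hneg : ∀ i < N, 1 + ζ i < 0) (hpos : ∀ i, N ≤ i → 0 < 1 + ζ i) :
    (opAbs (1 + T)).IsPositive ∧
      opAbs (1 + T) * opAbs (1 + T) = ContinuousLinearMap.adjoint (1 + T) * (1 + T) := by
  have h := exists_opAbs hT hTe hneg hpos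
  rw [opAbs, dif_pos h]
  exact h.choose_spec

lemma opAbs_apply (hT : IsSelfAdjoint T) (hTe : ∀ i, T (e i) = ζ i • e i)
    (hneg : ∀ i < N, 1 + ζ i < 0) (hpos : ∀ i, N ≤ i → 0 < 1 + ζ i) (i : ℕ) :
    opAbs (1 + T) (e i) = |1 + ζ i| • e i := by
  obtain ⟨hP, hsq⟩ := opAbs_isPositive hT hTe hneg hpos
  set B := opAbs (1 + T)
  have hA : IsSelfAdjoint (1 + T) := (IsSelfAdjoint.one _).add hT
  have h1 : (1 + T) (e i) = (1 + ζ i) • e i := by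
    rw [add_smul, one_smul, ← hTe]; rfl
  have ha : 0 < |1 + ζ i| := by
    rcases lt_or_ge i N with h | h
    · exact abs_pos.2 (hneg i h).ne
    · exact abs_pos.2 (hpos i h).ne'
  have h2 : B (B (e i)) = (|1 + ζ i| * |1 + ζ i|) • e i := by
    change (B * B) (e i) = _
    rw [hsq, hA.adjoint_eq, mul_apply_eq_comp, h1, map_smul, h1, smul_smul,
      abs_mul_abs_self]
  -- `(B + a) y = 0` for `y = B eᵢ - a eᵢ`, and `B + a` is injective
  set y := B (e i) - |1 + ζ i| • e i with hy
  have h3 : B y + |1 + ζ i| • y = 0 := by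
    rw [hy, map_sub, map_smul, h2, smul_sub, smul_smul]; abel
  have h4 : inner ℝ (B y) y + |1 + ζ i| * ‖y‖ ^ 2 = 0 := by
    have := congrArg (fun z => inner ℝ z y) h3
    simpa [inner_add_left, inner_smul_left] using this
  have h5 : 0 ≤ inner ℝ (B y) y := hP.inner_nonneg_left y
  have h6 : ‖y‖ ^ 2 = 0 := by
    by_contra hne
    have : 0 < |1 + ζ i| * ‖y‖ ^ 2 := mul_pos ha (lt_of_le_of_ne (sq_nonneg _) (Ne.symm hne))
    linarith
  exact sub_eq_zero.1 (norm_eq_zero.1 (pow_eq_zero_iff (two_ne_zero) |>.1 h6))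

lemma exists_abs_lower_bound (hs : Summable fun i => ζ i ^ 2)
    (hne : ∀ i, 1 + ζ i ≠ 0) : ∃ c : ℝ, 0 < c ∧ ∀ i, c ≤ |1 + ζ i| := by
  have h0 : Tendsto ζ atTop (𝓝 0) := by
    have := (hs.tendsto_atTop_zero).sqrt
    simp only [Real.sqrt_sq_eq_abs, Real.sqrt_zero] at this
    exact (tendsto_zero_iff_abs_tendsto_zero ζ).2 this
  have h1 : ∀ᶠ i in atTop, (1 / 2 : ℝ) ≤ |1 + ζ i| := by
    have := (h0.const_add 1).abs
    simp only [add_zero, abs_one] at this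
    exact (this.eventually (lt_mem_nhds (by norm_num : (1 / 2 : ℝ) < 1))).mono fun i hi => hi.le
  obtain ⟨M, hM⟩ := eventually_atTop.1 h1
  have h2 : ∃ c : ℝ, 0 < c ∧ ∀ i < M, c ≤ |1 + ζ i| := by
    clear hM
    induction M with
    | zero => exact ⟨1, one_pos, fun i hi => absurd hi (Nat.not_lt_zero i)⟩
    | succ M ih =>
      obtain ⟨c, hc, h⟩ := ih
      refine ⟨min c |1 + ζ M|, lt_min hc (abs_pos.2 (hne M)), fun i hi => ?_⟩
      rcases Nat.lt_succ_iff_lt_or_eq.1 hi with h' | rfl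
      · exact (min_le_left _ _).trans (h i h')
      · exact min_le_right _ _
  obtain ⟨c, hc, h⟩ := h2
  refine ⟨min c (1 / 2), by positivity, fun i => ?_⟩
  rcases lt_or_ge i M with h' | h'
  · exact (min_le_left _ _).trans (h i h')
  · exact (min_le_right _ _).trans (hM i h')

lemma isUnit_smul_opAbs (hT : IsSelfAdjoint T) (hTe : ∀ i, T (e i) = ζ i • e i)
    (hneg : ∀ i < N, 1 + ζ i < 0) (hpos : ∀ i, N ≤ i → 0 < 1 + ζ i)
    (hs : Summable fun i => ζ i ^ 2) {lam : ℝ} (hlam : 0 < lam) :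
    IsUnit (lam • opAbs (1 + T)) := by
  obtain ⟨hP, -⟩ := opAbs_isPositive hT hTe hneg hpos
  obtain ⟨c, hc, hle⟩ := exists_abs_lower_bound hs fun i => by
    rcases lt_or_ge i N with h | h
    · exact (hneg i h).ne
    · exact (hpos i h).ne'
  have hB : ∀ x, c * ‖x‖ ^ 2 ≤ inner ℝ (opAbs (1 + T) x) x := fun x =>
    hasSum_le (fun i => by
        rw [← pow_two]
        exact mul_le_mul_of_nonneg_right (hle i) (sq_nonneg _))
      ((hilbertBasis_hasSum_sq e x).mul_left c)
      (hasSum_inner_apply_self hP.isSymmetric e (opAbs_apply hT hTe hneg hpos) x x)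
  refine ContinuousLinearMap.isUnit_of_forall_le_norm_inner_map _
    (c := Real.toNNReal (lam * c)) (Real.toNNReal_pos.2 (mul_pos hlam hc)) fun x => ?_
  rw [smul_apply, inner_smul_left, Real.norm_eq_abs]
  refine le_trans ?_ (le_abs_self _)
  have := mul_le_mul_of_nonneg_left (hB x) hlam.le
  rw [Real.coe_toNNReal _ (by positivity), conj_trivial]
  linarith

/-- The quadratic form of the covariance operator `(λ|I + T|)⁻¹`. -/
lemma hasSum_inner_inverse (hT : IsSelfAdjoint T) (hTe : ∀ i, T (e i) = ζ i • e i)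
    (hneg : ∀ i < N, 1 + ζ i < 0) (hpos : ∀ i, N ≤ i → 0 < 1 + ζ i)
    (hs : Summable fun i => ζ i ^ 2) {lam : ℝ} (hlam : 0 < lam) (h : E) :
    HasSum (fun i => inner ℝ (e i) h ^ 2 * (lam * |1 + ζ i|)⁻¹)
      (inner ℝ (Ring.inverse (lam • opAbs (1 + T)) h) h) := by
  have hU := isUnit_smul_opAbs hT hTe hneg hpos hs hlam
  obtain ⟨hP, -⟩ := opAbs_isPositive hT hTe hneg hpos
  set A := lam • opAbs (1 + T) with hA
  have hAs : ∀ x y, inner ℝ (A x) y = inner ℝ x (A y) := fun x y => by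
    rw [hA, smul_apply, smul_apply, inner_smul_left,
      inner_smul_right, hP.inner_left_eq_inner_right]; rfl
  set C := Ring.inverse A
  have hAC : ∀ x, A (C x) = x := fun x => by
    rw [← mul_apply_eq_comp, Ring.mul_inverse_cancel _ hU]; rfl
  have hCA : ∀ x, C (A x) = x := fun x => by
    rw [← mul_apply_eq_comp, Ring.inverse_mul_cancel _ hU]; rfl
  have hCs : C.IsSymmetric := fun x y => by
    change inner ℝ (C x) y = inner ℝ x (C y)
    rw [← hAC y, ← hAs, hAC, hCA]
  have hCe : ∀ i, C (e i) = (lam * |1 + ζ i|)⁻¹ • e i := fun i => by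
    have hne : lam * |1 + ζ i| ≠ 0 := by
      refine mul_ne_zero hlam.ne' (abs_ne_zero.2 ?_)
      rcases lt_or_ge i N with h | h
      · exact (hneg i h).ne
      · exact (hpos i h).ne'
    have : A ((lam * |1 + ζ i|)⁻¹ • e i) = e i := by
      rw [map_smul, hA, smul_apply, opAbs_apply hT hTe hneg hpos, smul_smul,
        smul_smul, mul_assoc, inv_mul_cancel₀ hne, one_smul]
    rw [← this, hCA, this]
  refine (hasSum_inner_apply_self hCs e hCe h h).congr_fun fun i => ?_
  ring

end Operators

end

section

/-! ### Hermite polynomials and the standard Gaussian measure on the line -/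

lemma derivative_hermite_succ (n : ℕ) :
    Polynomial.derivative (Polynomial.hermite (n + 1)) =
      ((n + 1 : ℕ) : Polynomial ℤ) * Polynomial.hermite n := by
  induction n with
  | zero => simp
  | succ n ih =>
    rw [Polynomial.hermite_succ (n + 1), Polynomial.derivative_sub, Polynomial.derivative_mul, ih,
      Polynomial.derivative_mul]
    simp only [Polynomial.derivative_X, Polynomial.derivative_natCast, zero_mul, zero_add, one_mul]
    have h := Polynomial.hermite_succ n
    rw [h]
    push_cast
    ring

lemma gaussianPDFReal_zero_one (x : ℝ) :
    gaussianPDFReal 0 1 x = (Real.sqrt (2 * Real.pi))⁻¹ * Real.exp (-(x ^ 2) / 2) := by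
  simp [gaussianPDFReal]

lemma hasDerivAt_gaussianPDFReal (x : ℝ) :
    HasDerivAt (gaussianPDFReal 0 1) (-x * gaussianPDFReal 0 1 x) x := by
  have h : HasDerivAt (fun x : ℝ => (Real.sqrt (2 * Real.pi))⁻¹ * Real.exp (-(x ^ 2) / 2))
      ((Real.sqrt (2 * Real.pi))⁻¹ * (Real.exp (-(x ^ 2) / 2) * (-(2 * x) / 2))) x := by
    have h1 : HasDerivAt (fun x : ℝ => -(x ^ 2) / 2) (-(2 * x) / 2) x := by
      simpa using ((hasDerivAt_pow 2 x).neg.div_const 2)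
    exact (h1.exp).const_mul _
  rw [show gaussianPDFReal 0 1 = fun x : ℝ =>
    (Real.sqrt (2 * Real.pi))⁻¹ * Real.exp (-(x ^ 2) / 2) from funext gaussianPDFReal_zero_one]
  convert h using 1
  ring

lemma integrable_gaussian_iff {f : ℝ → ℝ} :
    Integrable f (gaussianReal 0 1) ↔ Integrable (fun x => gaussianPDFReal 0 1 x * f x) := by
  rw [gaussianReal_of_var_ne_zero 0 one_ne_zero,
    integrable_withDensity_iff_integrable_smul' (measurable_gaussianPDF _ _)
      (Eventually.of_forall fun x => gaussianPDF_lt_top)]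
  simp [toReal_gaussianPDF]

lemma integral_gaussian_eq (f : ℝ → ℝ) :
    ∫ x, f x ∂(gaussianReal 0 1) = ∫ x, gaussianPDFReal 0 1 x * f x := by
  rw [integral_gaussianReal_eq_integral_smul one_ne_zero]; rfl

/-- Gaussian integration by parts on the line. -/
lemma gaussian_integral_by_parts {u u' k k' : ℝ → ℝ} (hu : ∀ x, HasDerivAt u (u' x) x)
    (hk : ∀ x, HasDerivAt k (k' x) x)
    (h1 : Integrable (fun x => u' x * k x) (gaussianReal 0 1))
    (h2 : Integrable (fun x => u x * (x * k x - k' x)) (gaussianReal 0 1))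
    (h3 : Integrable (fun x => u x * k x) (gaussianReal 0 1)) :
    ∫ x, u' x * k x ∂(gaussianReal 0 1) = ∫ x, u x * (x * k x - k' x) ∂(gaussianReal 0 1) := by
  rw [integrable_gaussian_iff] at h1 h2 h3
  rw [integral_gaussian_eq, integral_gaussian_eq]
  have hv : ∀ x, HasDerivAt (fun x => gaussianPDFReal 0 1 x * k x)
      (-(gaussianPDFReal 0 1 x * (x * k x - k' x))) x := fun x => by
    exact ((hasDerivAt_gaussianPDFReal x).mul (hk x)).congr_deriv (by ring)
  have key := integral_mul_deriv_eq_deriv_mul_of_integrable (u := u) (u' := u')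
    (v := fun x => gaussianPDFReal 0 1 x * k x)
    (v' := fun x => -(gaussianPDFReal 0 1 x * (x * k x - k' x)))
    (fun x _ => hu x) (fun x _ => hv x)
    (h2.neg.congr (Eventually.of_forall fun x => by simp only [Pi.mul_apply, Pi.neg_apply]; ring))
    (h1.congr (Eventually.of_forall fun x => by simp only [Pi.mul_apply]; ring))
    (h3.congr (Eventually.of_forall fun x => by simp only [Pi.mul_apply]; ring))
  have e1 : ∫ x, gaussianPDFReal 0 1 x * (u' x * k x) =
      ∫ x, u' x * (gaussianPDFReal 0 1 x * k x) :=
    integral_congr_ae (Eventually.of_forall fun x => by ring)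
  have e2 : ∫ x, gaussianPDFReal 0 1 x * (u x * (x * k x - k' x)) =
      -∫ x, u x * -(gaussianPDFReal 0 1 x * (x * k x - k' x)) := by
    rw [← integral_neg]
    exact integral_congr_ae (Eventually.of_forall fun x => by ring)
  rw [e1, e2, key, neg_neg]

lemma memLp_polynomial_gaussian (p : Polynomial ℝ) (w : ℝ≥0) (q : ℝ≥0) :
    MemLp (fun x => p.eval x) q (gaussianReal 0 w) := by
  induction p using Polynomial.induction_on' with
  | add p r hp hr =>
    simp only [Polynomial.eval_add]
    exact hp.add hr
  | monomial n c =>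
    simp only [Polynomial.eval_monomial]
    refine MemLp.const_mul ?_ c
    rcases Nat.eq_zero_or_pos n with rfl | hn
    · simpa using memLp_const (1 : ℝ)
    · have h := (memLp_id_gaussianReal (μ := 0) (v := w) (q * n)).norm_rpow_div (n : ℝ≥0∞)
      have hn' : (n : ℝ≥0∞) ≠ 0 := by simp; omega
      rw [ENNReal.coe_mul, ENNReal.coe_natCast, mul_div_assoc,
        ENNReal.div_self hn' (by simp), mul_one] at h
      exact h.of_le (by fun_prop) (Eventually.of_forall fun x => by simp)

lemma integrable_polynomial_gaussian (p : Polynomial ℝ) (w : ℝ≥0) :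
    Integrable (fun x => p.eval x) (gaussianReal 0 w) :=
  memLp_one_iff_integrable.1 (by simpa using memLp_polynomial_gaussian p w 1)

lemma integral_X_mul_gaussian (p : Polynomial ℝ) :
    ∫ x, x * p.eval x ∂(gaussianReal 0 1) = ∫ x, p.derivative.eval x ∂(gaussianReal 0 1) := by
  have h := gaussian_integral_by_parts (u := fun x => p.eval x) (u' := fun x => p.derivative.eval x)
    (k := fun _ => 1) (k' := fun _ => 0) (fun x => p.hasDerivAt x) (fun x => hasDerivAt_const x 1)
    (by simpa using integrable_polynomial_gaussian p.derivative 1)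
    ((integrable_polynomial_gaussian (p * Polynomial.X) 1).congr
      (Eventually.of_forall fun x => by simp))
    (by simpa using integrable_polynomial_gaussian p 1)
  simp only [mul_one, sub_zero] at h
  rw [h]
  exact integral_congr_ae (Eventually.of_forall fun x => mul_comm _ _)

/-- Hermite polynomials with real coefficients. -/
def hermiteR (n : ℕ) : Polynomial ℝ := (Polynomial.hermite n).map (Int.castRingHom ℝ)

lemma hermiteR_zero : hermiteR 0 = 1 := by simp [hermiteR]

lemma hermiteR_succ (n : ℕ) :
    hermiteR (n + 1) = Polynomial.X * hermiteR n - (hermiteR n).derivative := by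
  simp [hermiteR, Polynomial.hermite_succ, Polynomial.derivative_map]

lemma derivative_hermiteR (n : ℕ) :
    (hermiteR n).derivative = (n : Polynomial ℝ) * hermiteR (n - 1) := by
  cases n with
  | zero => simp [hermiteR_zero]
  | succ n =>
    rw [hermiteR, Polynomial.derivative_map, derivative_hermite_succ]
    simp [hermiteR]

lemma normHermite_eq (n : ℕ) (x : ℝ) :
    normHermite n x = (hermiteR n).eval x / Real.sqrt (n.factorial : ℝ) := by
  rw [normHermite, hermiteR, Polynomial.aeval_def, Polynomial.eval_map]; rfl

lemma integral_hermiteR_mul (n m : ℕ) :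
    ∫ x, (hermiteR n).eval x * (hermiteR m).eval x ∂(gaussianReal 0 1) =
      if n = m then (n.factorial : ℝ) else 0 := by
  have hi : ∀ p : Polynomial ℝ, Integrable (fun x => p.eval x) (gaussianReal 0 1) := fun p =>
    integrable_polynomial_gaussian p 1
  have step : ∀ n m, ∫ x, (hermiteR (n + 1)).eval x * (hermiteR m).eval x ∂(gaussianReal 0 1) =
      m * ∫ x, (hermiteR n).eval x * (hermiteR (m - 1)).eval x ∂(gaussianReal 0 1) := by
    intro n m
    have h := integral_X_mul_gaussian (hermiteR n * hermiteR m)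
    rw [Polynomial.derivative_mul] at h
    have e1 : ∫ x, (hermiteR (n + 1)).eval x * (hermiteR m).eval x ∂(gaussianReal 0 1) =
        ∫ x, (x * (hermiteR n * hermiteR m).eval x
          - ((hermiteR n).derivative * hermiteR m).eval x) ∂(gaussianReal 0 1) :=
      integral_congr_ae (Eventually.of_forall fun x => by
        simp only [hermiteR_succ, Polynomial.eval_sub, Polynomial.eval_mul, Polynomial.eval_X]; ring)
    have hX : Integrable (fun x => x * (hermiteR n * hermiteR m).eval x) (gaussianReal 0 1) := by
      exact (hi (Polynomial.X * (hermiteR n * hermiteR m))).congr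
        (Eventually.of_forall fun x => by simp)
    rw [e1, integral_sub hX (hi _), h]
    simp only [Polynomial.eval_add]
    rw [integral_add (hi _) (hi _), add_sub_cancel_left, derivative_hermiteR m, ← integral_const_mul]
    refine integral_congr_ae (Eventually.of_forall fun x => ?_)
    simp only [Polynomial.eval_mul, Polynomial.eval_natCast]
    ring
  induction n generalizing m with
  | zero =>
    cases m with
    | zero => simp [hermiteR_zero]
    | succ m =>
      have h := step m 0
      simp only [Nat.cast_zero, zero_mul] at h
      simp only [mul_comm ((hermiteR 0).eval _)]
      rw [h]; simp
  | succ n ih =>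
    rw [step]
    cases m with
    | zero => simp
    | succ m =>
      rw [Nat.add_sub_cancel, ih]
      by_cases hnm : n = m
      · subst hnm; simp [Nat.factorial_succ]
      · simp [hnm]

lemma integral_normHermite_mul (n m : ℕ) :
    ∫ x, normHermite n x * normHermite m x ∂(gaussianReal 0 1) = if n = m then 1 else 0 := by
  have h : ∀ x, normHermite n x * normHermite m x =
      (Real.sqrt (n.factorial : ℝ))⁻¹ * (Real.sqrt (m.factorial : ℝ))⁻¹ *
        ((hermiteR n).eval x * (hermiteR m).eval x) := fun x => by
    rw [normHermite_eq, normHermite_eq]; ring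
  simp_rw [h]
  rw [integral_const_mul, integral_hermiteR_mul]
  split_ifs with hnm
  · subst hnm
    rw [← mul_inv, Real.mul_self_sqrt (by positivity), inv_mul_cancel₀ (by positivity)]
  · simp

lemma normHermite_zero (x : ℝ) : normHermite 0 x = 1 := by simp [normHermite]

lemma hasDerivAt_normHermite (n : ℕ) (x : ℝ) :
    HasDerivAt (normHermite n) (Real.sqrt n * normHermite (n - 1) x) x := by
  have h := ((hermiteR n).hasDerivAt x).div_const (Real.sqrt (n.factorial : ℝ))
  rw [show normHermite n = fun x => (hermiteR n).eval x / Real.sqrt (n.factorial : ℝ) from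
    funext (normHermite_eq n)]
  refine h.congr_deriv ?_
  rw [derivative_hermiteR, normHermite_eq]
  cases n with
  | zero => simp
  | succ n =>
    have h1 : Real.sqrt (n + 1 : ℕ) ≠ 0 := (Real.sqrt_pos.2 (by positivity)).ne'
    have h2 : Real.sqrt (n.factorial : ℝ) ≠ 0 := (Real.sqrt_pos.2 (by positivity)).ne'
    rw [Nat.factorial_succ, Nat.cast_mul, Real.sqrt_mul (by positivity)]
    simp only [Nat.add_sub_cancel, Polynomial.eval_mul, Polynomial.eval_natCast]
    field_simp
    rw [Real.sq_sqrt (by positivity), mul_comm]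

lemma mul_normHermite (n : ℕ) (x : ℝ) :
    x * normHermite n x =
      Real.sqrt (n + 1 : ℕ) * normHermite (n + 1) x + Real.sqrt n * normHermite (n - 1) x := by
  have h3 := (hasDerivAt_normHermite n x).unique
    (by
      have h := ((hermiteR n).hasDerivAt x).div_const (Real.sqrt (n.factorial : ℝ))
      rwa [← show normHermite n = fun x => (hermiteR n).eval x / Real.sqrt (n.factorial : ℝ) from
        funext (normHermite_eq n)] at h)
  rw [h3, normHermite_eq, normHermite_eq, hermiteR_succ]
  have h1 : Real.sqrt (n + 1 : ℕ) ≠ 0 := (Real.sqrt_pos.2 (by positivity)).ne'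
  have h2 : Real.sqrt (n.factorial : ℝ) ≠ 0 := (Real.sqrt_pos.2 (by positivity)).ne'
  rw [Nat.factorial_succ, Nat.cast_mul, Real.sqrt_mul (by positivity)]
  simp only [Polynomial.eval_sub, Polynomial.eval_mul, Polynomial.eval_X]
  field_simp
  ring

lemma continuous_normHermite (n : ℕ) : Continuous (normHermite n) :=
  continuous_iff_continuousAt.2 fun x => (hasDerivAt_normHermite n x).continuousAt

lemma memLp_normHermite (n : ℕ) (w q : ℝ≥0) : MemLp (normHermite n) q (gaussianReal 0 w) := by
  rw [show normHermite n = fun x => (hermiteR n).eval x / Real.sqrt (n.factorial : ℝ) from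
    funext (normHermite_eq n)]
  simp_rw [div_eq_mul_inv]
  exact (memLp_polynomial_gaussian _ _ _).mul_const _

/-! ### Change of variance on the line -/

/-- The density of `N(0, 1/a)` with respect to `N(0, 1)`. -/
def gaussWeight (a x : ℝ) : ℝ := Real.sqrt a * Real.exp (-((a - 1) * x ^ 2 / 2))

lemma gaussWeight_nonneg (a x : ℝ) : 0 ≤ gaussWeight a x := by unfold gaussWeight; positivity

lemma measurable_gaussWeight (a : ℝ) : Measurable (gaussWeight a) := by
  unfold gaussWeight; fun_prop

lemma withDensity_gaussWeight {a : ℝ} (ha : 0 < a) :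
    (gaussianReal 0 1).withDensity (fun x => ENNReal.ofReal (gaussWeight a x)) =
      gaussianReal 0 (Real.toNNReal a⁻¹) := by
  have ha' : Real.toNNReal a⁻¹ ≠ 0 := by simpa using ha
  rw [gaussianReal_of_var_ne_zero 0 one_ne_zero, gaussianReal_of_var_ne_zero 0 ha',
    ← withDensity_mul _ (measurable_gaussianPDF _ _) (measurable_gaussWeight a).ennreal_ofReal]
  congr 1
  ext x
  simp only [Pi.mul_apply, gaussianPDF]
  rw [← ENNReal.ofReal_mul (gaussianPDFReal_nonneg _ _ _)]
  congr 1
  rw [gaussianPDFReal_zero_one, gaussWeight, gaussianPDFReal, Real.coe_toNNReal _ (by positivity),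
    Real.sqrt_mul (by positivity) a⁻¹, mul_inv, Real.sqrt_inv, inv_inv, sub_zero]
  have : Real.exp (-(x ^ 2) / 2) * Real.exp (-((a - 1) * x ^ 2 / 2)) =
      Real.exp (-x ^ 2 / (2 * a⁻¹)) := by
    rw [← Real.exp_add]; congr 1; field_simp; ring
  rw [← this]; ring

lemma lintegral_gaussWeight {a : ℝ} (ha : 0 < a) :
    ∫⁻ x, ENNReal.ofReal (gaussWeight a x) ∂(gaussianReal 0 1) = 1 := by
  have h := congrArg (fun μ : Measure ℝ => μ Set.univ) (withDensity_gaussWeight ha)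
  simpa [withDensity_apply] using h

/-- The Hellinger affinity of `N(0, 1)` and `N(0, 1/a)`. -/
def affinity (a : ℝ) : ℝ := Real.sqrt (Real.sqrt a) / Real.sqrt ((1 + a) / 2)

lemma sqrt_gaussWeight {a : ℝ} (ha : 0 < a) (x : ℝ) :
    Real.sqrt (gaussWeight a x) = affinity a * gaussWeight ((1 + a) / 2) x := by
  have hb : Real.sqrt ((1 + a) / 2) ≠ 0 := (Real.sqrt_pos.2 (by positivity)).ne'
  rw [gaussWeight, gaussWeight, affinity, Real.sqrt_mul (Real.sqrt_nonneg _), ← Real.exp_half]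
  rw [← mul_assoc, div_mul_cancel₀ _ hb]
  congr 2; ring

lemma affinity_nonneg (a : ℝ) : 0 ≤ affinity a := by unfold affinity; positivity

lemma lintegral_sqrt_gaussWeight {a : ℝ} (ha : 0 < a) :
    ∫⁻ x, ENNReal.ofReal (Real.sqrt (gaussWeight a x)) ∂(gaussianReal 0 1) =
      ENNReal.ofReal (affinity a) := by
  simp_rw [sqrt_gaussWeight ha, ENNReal.ofReal_mul (affinity_nonneg a)]
  rw [lintegral_const_mul _ (measurable_gaussWeight _).ennreal_ofReal,
    lintegral_gaussWeight (by positivity), mul_one]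

lemma affinity_bounds {a : ℝ} (ha : 0 < a) : affinity a ≤ 1 ∧ 1 - (a - 1) ^ 2 ≤ affinity a := by
  set s := Real.sqrt a with hs
  have hs0 : 0 < s := Real.sqrt_pos.2 ha
  have hsa : s ^ 2 = a := Real.sq_sqrt ha.le
  have hsq : affinity a ^ 2 = 2 * s / (1 + a) := by
    rw [affinity, div_pow, Real.sq_sqrt hs0.le, Real.sq_sqrt (by positivity)]
    field_simp
  have h1 : affinity a ^ 2 ≤ 1 := by
    rw [hsq, div_le_one (by positivity)]; nlinarith [sq_nonneg (s - 1)]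
  have hle : affinity a ≤ 1 := by
    nlinarith [affinity_nonneg a]
  refine ⟨hle, le_trans ?_ (show affinity a ^ 2 ≤ affinity a by nlinarith [affinity_nonneg a])⟩
  rw [hsq, le_div_iff₀ (by positivity), ← hsa]
  nlinarith [sq_nonneg (s - 1), mul_nonneg (sq_nonneg (s - 1)) hs0.le,
    mul_nonneg (sq_nonneg (s - 1)) (pow_nonneg hs0.le 2),
    mul_nonneg (sq_nonneg (s - 1)) (pow_nonneg hs0.le 3),
    mul_nonneg (sq_nonneg (s - 1)) (pow_nonneg hs0.le 4)]

end

section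

/-! ### Sequences of independent Gaussian variables -/

lemma eLpNorm_two_sq {Ω ε : Type*} [MeasurableSpace Ω] [TopologicalSpace ε] [ContinuousENorm ε]
    (P : Measure Ω) (f : Ω → ε) :
    eLpNorm f 2 P ^ 2 = ∫⁻ x, ‖f x‖ₑ ^ 2 ∂P := by
  have h := eLpNorm_nnreal_pow_eq_lintegral (μ := P) (f := f) (p := 2) two_ne_zero
  simp only [NNReal.coe_ofNat, ENNReal.coe_ofNat, ENNReal.rpow_ofNat] at h
  exact h

/-- The square root of the density of `∏_{i<k} N(0, 1/aᵢ)` with respect to `N(0, 1)^k`. -/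
def sqrtDensity {Ω : Type*} (Z : ℕ → Ω → ℝ) (a : ℕ → ℝ) (k : ℕ) (x : Ω) : ℝ :=
  ∏ i ∈ Finset.range k, Real.sqrt (gaussWeight (a i) (Z i x))

lemma sqrtDensity_nonneg {Ω : Type*} {Z : ℕ → Ω → ℝ} (a : ℕ → ℝ) (k : ℕ) (x : Ω) : 0 ≤ sqrtDensity Z a k x :=
  Finset.prod_nonneg fun _ _ => Real.sqrt_nonneg _

lemma sqrtDensity_sq {Ω : Type*} {Z : ℕ → Ω → ℝ} (a : ℕ → ℝ) (k : ℕ) (x : Ω) :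
    sqrtDensity Z a k x ^ 2 = ∏ i ∈ Finset.range k, gaussWeight (a i) (Z i x) := by
  rw [sqrtDensity, ← Finset.prod_pow]
  exact Finset.prod_congr rfl fun i _ => Real.sq_sqrt (gaussWeight_nonneg _ _)

variable {Ω : Type*} [MeasurableSpace Ω] {P : Measure Ω} {Z : ℕ → Ω → ℝ}

/-- `Z₀, Z₁, …` are measurable, independent under `P`, and `Zᵢ` has law `N(0, wᵢ)`. -/
structure IsIndepGaussian (P : Measure Ω) (Z : ℕ → Ω → ℝ) (w : ℕ → ℝ≥0) : Prop where
  measurable : ∀ i, Measurable (Z i)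
  iIndep : iIndepFun Z P
  law : ∀ i, P.map (Z i) = gaussianReal 0 (w i)

namespace IsIndepGaussian

lemma isProbabilityMeasure {w : ℕ → ℝ≥0} (hZ : IsIndepGaussian P Z w) : IsProbabilityMeasure P :=
  hZ.iIndep.isProbabilityMeasure

lemma lintegral_comp {w : ℕ → ℝ≥0} (hZ : IsIndepGaussian P Z w) (i : ℕ) {f : ℝ → ℝ≥0∞}
    (hf : Measurable f) : ∫⁻ x, f (Z i x) ∂P = ∫⁻ x, f x ∂(gaussianReal 0 (w i)) := by
  rw [← hZ.law i, lintegral_map hf (hZ.measurable i)]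

lemma integral_comp {w : ℕ → ℝ≥0} (hZ : IsIndepGaussian P Z w) (i : ℕ) {f : ℝ → ℝ}
    (hf : Measurable f) : ∫ x, f (Z i x) ∂P = ∫ x, f x ∂(gaussianReal 0 (w i)) := by
  rw [← hZ.law i, integral_map (hZ.measurable i).aemeasurable hf.aestronglyMeasurable]

lemma lintegral_prod_comp {w : ℕ → ℝ≥0} (hZ : IsIndepGaussian P Z w) (s : Finset ℕ)
    {f : ℕ → ℝ → ℝ≥0∞} (hf : ∀ i, Measurable (f i)) :
    ∫⁻ x, ∏ i ∈ s, f i (Z i x) ∂P = ∏ i ∈ s, ∫⁻ x, f i x ∂(gaussianReal 0 (w i)) := by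
  have h := lintegral_prod_eq_prod_lintegral_of_indepFun s (fun i => f i ∘ Z i)
    (hZ.iIndep.comp f hf) (fun i => (hf i).comp (hZ.measurable i))
  simp only [Function.comp_apply] at h
  rw [h]
  exact Finset.prod_congr rfl fun i _ => hZ.lintegral_comp i (hf i)

lemma integral_prod_comp {w : ℕ → ℝ≥0} (hZ : IsIndepGaussian P Z w) (s : Finset ℕ)
    {f : ℕ → ℝ → ℝ} (hf : ∀ i, Measurable (f i)) :
    ∫ x, ∏ i ∈ s, f i (Z i x) ∂P = ∏ i ∈ s, ∫ x, f i x ∂(gaussianReal 0 (w i)) := by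
  have h := (hZ.iIndep.restrict s).integral_fun_prod_comp (f := fun i : s => f i)
    (fun i => (hZ.measurable i).aemeasurable) (fun i => (hf i).aestronglyMeasurable)
  simp only [Finset.restrict] at h
  have e1 : ∀ x, ∏ i ∈ s, f i (Z i x) = ∏ i : s, f i (Z i x) := fun x =>
    (Finset.prod_coe_sort s fun i => f i (Z i x)).symm
  simp_rw [e1]
  rw [h, Finset.prod_coe_sort s fun i => ∫ x, f i (Z i x) ∂P]
  exact Finset.prod_congr rfl fun i _ => hZ.integral_comp i (hf i)

lemma memLp_comp {w : ℕ → ℝ≥0} (hZ : IsIndepGaussian P Z w) (i : ℕ) {f : ℝ → ℝ} {q : ℝ≥0∞}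
    (hf : MemLp f q (gaussianReal 0 (w i))) : MemLp (fun x => f (Z i x)) q P := by
  rw [← hZ.law i] at hf
  exact (memLp_map_measure_iff hf.1 (hZ.measurable i).aemeasurable).1 hf

/-- The series `∑ ζᵢ (Zᵢ² - 1)` converges in `L²` as soon as `∑ ζᵢ² < ∞`, since the variables
`Zᵢ² - 1` are orthogonal with the same norm. -/
lemma exists_tendsto_wick (hZ : IsIndepGaussian P Z fun _ => 1) {ζ : ℕ → ℝ}
    (hζ : Summable fun i => ζ i ^ 2) : ∃ Q : Ω → ℝ, Measurable Q ∧
      Tendsto (fun k => eLpNorm (fun x => ∑ i ∈ Finset.range k, ζ i * (Z i x ^ 2 - 1) - Q x) 2 P)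
        atTop (𝓝 0) := by
  have hH : ∀ x, x ^ 2 - 1 = Real.sqrt 2 * normHermite 2 x := fun x => by
    have h := mul_normHermite 1 x
    have h0 := mul_normHermite 0 x
    simp only [normHermite_zero, Nat.cast_one, Real.sqrt_one, one_mul, Nat.sub_self, zero_add,
      Nat.cast_zero, Real.sqrt_zero, zero_mul, add_zero, mul_one, Nat.reduceAdd,
      Nat.cast_ofNat] at h h0
    rw [← h0] at h
    linarith
  have hm : ∀ i, MemLp (fun x => normHermite 2 (Z i x)) 2 P := fun i =>
    hZ.memLp_comp i (memLp_normHermite 2 1 2)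
  set u : ℕ → Lp ℝ 2 P := fun i => (hm i).toLp _ with hu
  have hin : ∀ i j, inner ℝ (u i) (u j) = ∫ x, normHermite 2 (Z i x) * normHermite 2 (Z j x) ∂P := by
    intro i j
    rw [L2.inner_def]
    refine integral_congr_ae ?_
    filter_upwards [(hm i).coeFn_toLp, (hm j).coeFn_toLp] with x h1 h2
    rw [hu]; simp only [h1, h2]; simp [mul_comm]
  have hmeas : Measurable (normHermite 2) := (continuous_normHermite 2).measurable
  have hzero : ∫ x, normHermite 2 x ∂(gaussianReal 0 1) = 0 := by
    simpa [normHermite_zero] using integral_normHermite_mul 2 0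
  have ho : Orthonormal ℝ u := by
    rw [orthonormal_iff_ite]
    intro i j
    rw [hin]
    split_ifs with hij
    · subst hij
      rw [hZ.integral_comp i (f := fun x => normHermite 2 x * normHermite 2 x) (by fun_prop),
        integral_normHermite_mul, if_pos rfl]
    · have hind := (hZ.iIndep.indepFun hij).comp hmeas hmeas
      have := hind.integral_fun_mul_eq_mul_integral
        (hmeas.comp (hZ.measurable i)).aestronglyMeasurable
        (hmeas.comp (hZ.measurable j)).aestronglyMeasurable
      simp only [Function.comp_apply] at this
      rw [this]
      have h0 : ∫ x, normHermite 2 (Z i x) ∂P = 0 := by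
        rw [← hzero]; exact hZ.integral_comp i hmeas
      rw [h0, zero_mul]
  have hsum : Summable fun i => (Real.sqrt 2 * ζ i) • u i := by
    have := (ho.orthogonalFamily.summable_iff_norm_sq_summable fun i => Real.sqrt 2 * ζ i).2 (by
      simpa [mul_pow] using hζ.mul_left 2)
    simpa using this
  have ht := hsum.hasSum.tendsto_sum_nat
  refine ⟨_, (Lp.stronglyMeasurable (∑' i, (Real.sqrt 2 * ζ i) • u i)).measurable, ?_⟩
  rw [Lp.tendsto_Lp_iff_tendsto_eLpNorm'] at ht
  refine ht.congr fun k => eLpNorm_congr_ae ?_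
  have h1 : ∀ᵐ x ∂P, ∀ i, u i x = normHermite 2 (Z i x) :=
    ae_all_iff.2 fun i => (hm i).coeFn_toLp
  have h2 : ⇑(∑ i ∈ Finset.range k, (Real.sqrt 2 * ζ i) • u i) =ᵐ[P]
      fun x => ∑ i ∈ Finset.range k, (Real.sqrt 2 * ζ i) * u i x := by
    induction k with
    | zero => simp only [Finset.range_zero, Finset.sum_empty]; exact Lp.coeFn_zero ℝ 2 P
    | succ k ih =>
      rw [Finset.sum_range_succ]
      filter_upwards [ih, Lp.coeFn_add (∑ i ∈ Finset.range k, (Real.sqrt 2 * ζ i) • u i)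
        ((Real.sqrt 2 * ζ k) • u k), Lp.coeFn_smul (Real.sqrt 2 * ζ k) (u k)] with x a1 a2 a3
      rw [a2, Pi.add_apply, a1, a3, Finset.sum_range_succ]; rfl
  filter_upwards [h1, h2] with x a1 a2
  rw [Pi.sub_apply, a2]
  congr 1
  refine Finset.sum_congr rfl fun i _ => ?_
  rw [a1, hH]; ring

end IsIndepGaussian

lemma one_sub_sum_le_prod {ι : Type*} (s : Finset ι) {r : ι → ℝ} (h0 : ∀ i, 0 ≤ r i)
    (h1 : ∀ i, r i ≤ 1) : 1 - ∑ i ∈ s, (1 - r i) ≤ ∏ i ∈ s, r i := by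
  classical
  induction s using Finset.induction_on with
  | empty => simp
  | insert a s ha ih =>
    rw [Finset.sum_insert ha, Finset.prod_insert ha]
    have hp : ∏ i ∈ s, r i ≤ 1 := Finset.prod_le_one (fun i _ => h0 i) fun i _ => h1 i
    nlinarith [h0 a, h1 a]

/-! ### Equivalence of Gaussian product measures -/

namespace IsIndepGaussian

variable {a : ℕ → ℝ}

lemma measurable_sqrtDensity {w : ℕ → ℝ≥0} (hZ : IsIndepGaussian P Z w) (k : ℕ) :
    Measurable (sqrtDensity Z a k) :=
  Finset.measurable_fun_prod _ fun i _ => ((measurable_gaussWeight (a i)).comp (hZ.measurable i)).sqrt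

lemma lintegral_density (hZ : IsIndepGaussian P Z fun _ => 1) (ha : ∀ i, 0 < a i) (k : ℕ) :
    ∫⁻ x, ENNReal.ofReal (sqrtDensity Z a k x ^ 2) ∂P = 1 := by
  simp_rw [sqrtDensity_sq, ENNReal.ofReal_prod_of_nonneg fun i _ => gaussWeight_nonneg (a i) _]
  rw [hZ.lintegral_prod_comp (Finset.range k) (f := fun i x => ENNReal.ofReal (gaussWeight (a i) x))
    fun i => (measurable_gaussWeight (a i)).ennreal_ofReal]
  exact Finset.prod_eq_one fun i _ => lintegral_gaussWeight (ha i)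

lemma memLp_sqrtDensity (hZ : IsIndepGaussian P Z fun _ => 1) (ha : ∀ i, 0 < a i) (k : ℕ) :
    MemLp (sqrtDensity Z a k) 2 P := by
  refine ⟨(hZ.measurable_sqrtDensity k).aestronglyMeasurable, ?_⟩
  have h : eLpNorm (sqrtDensity Z a k) 2 P ^ 2 = 1 := by
    rw [eLpNorm_two_sq, ← hZ.lintegral_density ha k]
    refine lintegral_congr fun x => ?_
    rw [Real.enorm_of_nonneg (sqrtDensity_nonneg _ _ _), ENNReal.ofReal_pow (sqrtDensity_nonneg _ _ _)]
  by_contra htop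
  rw [not_lt, top_le_iff] at htop
  simp [htop] at h

/-- The inner product of two square roots of densities is the product of the Hellinger affinities
`1 - O((aᵢ - 1)²)` of the factors by which they differ. -/
lemma inner_sqrtDensity (hZ : IsIndepGaussian P Z fun _ => 1) (ha : ∀ i, 0 < a i) {k l : ℕ}
    (hkl : k ≤ l) : 1 - ∑ i ∈ Finset.Ico k l, (a i - 1) ^ 2 ≤
      inner ℝ ((hZ.memLp_sqrtDensity ha k).toLp _) ((hZ.memLp_sqrtDensity ha l).toLp _) := by
  have h1 : inner ℝ ((hZ.memLp_sqrtDensity ha k).toLp _) ((hZ.memLp_sqrtDensity ha l).toLp _) =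
      ∫ x, sqrtDensity Z a k x * sqrtDensity Z a l x ∂P := by
    rw [L2.inner_def]
    refine integral_congr_ae ?_
    filter_upwards [(hZ.memLp_sqrtDensity ha k).coeFn_toLp,
      (hZ.memLp_sqrtDensity ha l).coeFn_toLp] with x h1 h2
    simp only [h1, h2]; simp [mul_comm]
  set f : ℕ → ℝ → ℝ≥0∞ := fun i x => if i < k then ENNReal.ofReal (gaussWeight (a i) x) else
    ENNReal.ofReal (Real.sqrt (gaussWeight (a i) x)) with hf
  have h2 : ∀ x, ENNReal.ofReal (sqrtDensity Z a k x * sqrtDensity Z a l x) =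
      ∏ i ∈ Finset.range l, f i (Z i x) := by
    intro x
    have e1 : sqrtDensity Z a l x = sqrtDensity Z a k x *
        ∏ i ∈ Finset.Ico k l, Real.sqrt (gaussWeight (a i) (Z i x)) :=
      (Finset.prod_range_mul_prod_Ico _ hkl).symm
    rw [e1, ← mul_assoc, ← pow_two, sqrtDensity_sq, ENNReal.ofReal_mul
      (Finset.prod_nonneg fun i _ => gaussWeight_nonneg _ _),
      ENNReal.ofReal_prod_of_nonneg fun i _ => gaussWeight_nonneg (a i) _,
      ENNReal.ofReal_prod_of_nonneg fun i _ => Real.sqrt_nonneg _,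
      ← Finset.prod_range_mul_prod_Ico _ hkl]
    congr 1
    · refine Finset.prod_congr rfl fun i hi => ?_
      simp [hf, Finset.mem_range.1 hi]
    · refine Finset.prod_congr rfl fun i hi => ?_
      simp [hf, not_lt.2 (Finset.mem_Ico.1 hi).1]
  have h3 : ∫⁻ x, ENNReal.ofReal (sqrtDensity Z a k x * sqrtDensity Z a l x) ∂P =
      ENNReal.ofReal (∏ i ∈ Finset.Ico k l, affinity (a i)) := by
    rw [lintegral_congr h2, hZ.lintegral_prod_comp (Finset.range l) (f := f)]
    · rw [← Finset.prod_range_mul_prod_Ico _ hkl, Finset.prod_eq_one, one_mul,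
        ENNReal.ofReal_prod_of_nonneg fun i _ => affinity_nonneg _]
      · refine Finset.prod_congr rfl fun i hi => ?_
        simp only [hf, not_lt.2 (Finset.mem_Ico.1 hi).1, if_false]
        exact lintegral_sqrt_gaussWeight (ha i)
      · intro i hi
        simp only [hf, Finset.mem_range.1 hi, if_true]
        exact lintegral_gaussWeight (ha i)
    · intro i
      simp only [hf]
      split_ifs
      · exact (measurable_gaussWeight (a i)).ennreal_ofReal
      · exact (measurable_gaussWeight (a i)).sqrt.ennreal_ofReal
  rw [h1, integral_eq_lintegral_of_nonneg_ae
    (Eventually.of_forall fun x => mul_nonneg (sqrtDensity_nonneg _ _ _) (sqrtDensity_nonneg _ _ _))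
    ((hZ.measurable_sqrtDensity k).mul (hZ.measurable_sqrtDensity l)).aestronglyMeasurable, h3,
    ENNReal.toReal_ofReal (Finset.prod_nonneg fun i _ => affinity_nonneg _)]
  refine le_trans ?_ (one_sub_sum_le_prod _ (fun i => affinity_nonneg (a i))
    fun i => (affinity_bounds (ha i)).1)
  have : ∑ i ∈ Finset.Ico k l, (1 - affinity (a i)) ≤ ∑ i ∈ Finset.Ico k l, (a i - 1) ^ 2 :=
    Finset.sum_le_sum fun i _ => by linarith [(affinity_bounds (ha i)).2]
  linarith

lemma norm_sqrtDensity (hZ : IsIndepGaussian P Z fun _ => 1) (ha : ∀ i, 0 < a i) (k : ℕ) :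
    ‖(hZ.memLp_sqrtDensity ha k).toLp _‖ = 1 := by
  have h : eLpNorm (sqrtDensity Z a k) 2 P ^ 2 = 1 := by
    rw [eLpNorm_two_sq, ← hZ.lintegral_density ha k]
    refine lintegral_congr fun x => ?_
    rw [Real.enorm_of_nonneg (sqrtDensity_nonneg _ _ _), ENNReal.ofReal_pow (sqrtDensity_nonneg _ _ _)]
  rw [Lp.norm_toLp]
  have h2 := congrArg ENNReal.toReal h
  rw [ENNReal.toReal_pow, ENNReal.toReal_one] at h2
  exact (pow_eq_one_iff_of_nonneg ENNReal.toReal_nonneg two_ne_zero).1 h2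

/-- The square roots of the densities form a Cauchy sequence in `L²`, because the tails of the
product of the Hellinger affinities tend to `1`. -/
lemma cauchySeq_sqrtDensity (hZ : IsIndepGaussian P Z fun _ => 1) (ha : ∀ i, 0 < a i)
    (hs : Summable fun i => (a i - 1) ^ 2) :
    CauchySeq fun k => (hZ.memLp_sqrtDensity ha k).toLp (sqrtDensity Z a k) := by
  set S : ℕ → Lp ℝ 2 P := fun k => (hZ.memLp_sqrtDensity ha k).toLp _ with hS
  set t : ℕ → ℝ := fun k => ∑' i, (a i - 1) ^ 2 - ∑ i ∈ Finset.range k, (a i - 1) ^ 2 with ht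
  have ht0 : Tendsto t atTop (𝓝 0) := by
    have := hs.hasSum.tendsto_sum_nat.const_sub (∑' i, (a i - 1) ^ 2)
    rwa [sub_self] at this
  refine cauchySeq_of_le_tendsto_0' (fun k => Real.sqrt (2 * t k)) (fun k l hkl => ?_) ?_
  · refine Real.le_sqrt_of_sq_le ?_
    rw [dist_eq_norm, norm_sub_sq_real, hZ.norm_sqrtDensity ha, hZ.norm_sqrtDensity ha]
    have h1 := hZ.inner_sqrtDensity ha hkl
    have h2 : ∑ i ∈ Finset.Ico k l, (a i - 1) ^ 2 ≤ t k := by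
      have h3 := hs.sum_le_tsum (Finset.range l) fun i _ => sq_nonneg _
      have h4 := Finset.sum_range_add_sum_Ico (fun i => (a i - 1) ^ 2) hkl
      simp only [ht]; linarith
    linarith
  · have := (ht0.const_mul 2).sqrt
    simpa using this

/-- The partial densities converge to `D` on every set: almost sure convergence alone could lose
mass, but the square roots converge in `L²`, so the squares converge in `L¹`. -/
lemma tendsto_lintegral_density (hZ : IsIndepGaussian P Z fun _ => 1) (ha : ∀ i, 0 < a i)
    (hs : Summable fun i => (a i - 1) ^ 2) {D : Ω → ℝ}
    {ns : ℕ → ℕ} (hns : StrictMono ns)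
    (hlim : ∀ᵐ x ∂P, Tendsto (fun k => sqrtDensity Z a (ns k) x ^ 2) atTop (𝓝 (D x)))
    (A : Set Ω) :
    Tendsto (fun k => ∫⁻ x in A, ENNReal.ofReal (sqrtDensity Z a k x ^ 2) ∂P) atTop
      (𝓝 (∫⁻ x in A, ENNReal.ofReal (D x) ∂P)) := by
  obtain ⟨g, hg⟩ := cauchySeq_tendsto_of_complete (hZ.cauchySeq_sqrtDensity ha hs)
  have hg' := (tendstoInMeasure_of_tendsto_Lp (hg.comp hns.tendsto_atTop)).exists_seq_tendsto_ae
  obtain ⟨ms, hms, hae⟩ := hg'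
  have hall : ∀ᵐ x ∂P, ∀ k, (hZ.memLp_sqrtDensity ha k).toLp (sqrtDensity Z a k) x =
      sqrtDensity Z a k x := ae_all_iff.2 fun k => (hZ.memLp_sqrtDensity ha k).coeFn_toLp
  have hgD : ∀ᵐ x ∂P, g x ^ 2 = D x := by
    filter_upwards [hlim, hae, hall] with x h1 h2 h3
    simp only [Function.comp_apply, h3] at h2
    exact tendsto_nhds_unique (h2.pow 2) (h1.comp hms.tendsto_atTop)
  have hgA : MemLp g 2 (P.restrict A) := (Lp.memLp g).restrict A
  have hSA : ∀ k, MemLp (sqrtDensity Z a k) 2 (P.restrict A) := fun k =>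
    (hZ.memLp_sqrtDensity ha k).restrict A
  have hconv : Tendsto (fun k => (hSA k).toLp (sqrtDensity Z a k)) atTop (𝓝 (hgA.toLp g)) := by
    rw [Lp.tendsto_Lp_iff_tendsto_eLpNorm'']
    rw [Lp.tendsto_Lp_iff_tendsto_eLpNorm'] at hg
    refine tendsto_of_tendsto_of_tendsto_of_le_of_le tendsto_const_nhds hg (fun _ => zero_le)
      fun k => ?_
    refine (eLpNorm_mono_measure _ Measure.restrict_le_self).trans (le_of_eq (eLpNorm_congr_ae ?_))
    filter_upwards [(hZ.memLp_sqrtDensity ha k).coeFn_toLp] with x hx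
    simp [hx]
  have hnorm := ENNReal.Tendsto.pow (n := 2) (ENNReal.tendsto_ofReal hconv.norm)
  simp only [Lp.norm_toLp, ENNReal.ofReal_toReal (hSA _).2.ne, ENNReal.ofReal_toReal hgA.2.ne,
    eLpNorm_two_sq] at hnorm
  have e1 : ∫⁻ x in A, ‖g x‖ₑ ^ 2 ∂P = ∫⁻ x in A, ENNReal.ofReal (D x) ∂P := by
    refine lintegral_congr_ae (ae_restrict_of_ae ?_)
    filter_upwards [hgD] with x hx
    rw [← hx, Real.enorm_eq_ofReal_abs, ← ENNReal.ofReal_pow (abs_nonneg _), sq_abs]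
  rw [e1] at hnorm
  refine hnorm.congr fun k => lintegral_congr fun x => ?_
  rw [Real.enorm_eq_ofReal_abs, ← ENNReal.ofReal_pow (abs_nonneg _), sq_abs]

/-- If `∑ (aᵢ - 1)² < ∞`, the limit `D` of the densities turns independent standard Gaussian
variables into independent variables with laws `N(0, 1/aᵢ)`. -/
theorem withDensity (hZ : IsIndepGaussian P Z fun _ => 1) (ha : ∀ i, 0 < a i)
    (hs : Summable fun i => (a i - 1) ^ 2) {D : Ω → ℝ} {ns : ℕ → ℕ} (hns : StrictMono ns)
    (hlim : ∀ᵐ x ∂P, Tendsto (fun k => sqrtDensity Z a (ns k) x ^ 2) atTop (𝓝 (D x))) :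
    IsIndepGaussian (P.withDensity fun x => ENNReal.ofReal (D x)) Z
      fun i => Real.toNNReal (a i)⁻¹ := by
  classical
  have key : ∀ (S : Finset ℕ) (A : ℕ → Set ℝ), (∀ i, MeasurableSet (A i)) →
      (P.withDensity fun x => ENNReal.ofReal (D x)) (⋂ i ∈ S, Z i ⁻¹' A i) =
        ∏ i ∈ S, gaussianReal 0 (Real.toNNReal (a i)⁻¹) (A i) := by
    intro S A hA
    have hmeas : MeasurableSet (⋂ i ∈ S, Z i ⁻¹' A i) :=
      Finset.measurableSet_biInter S fun i _ => hZ.measurable i (hA i)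
    rw [withDensity_apply _ hmeas]
    refine tendsto_nhds_unique (hZ.tendsto_lintegral_density ha hs hns hlim _) ?_
    -- Under the partial densities, the probability of a cylinder set is eventually constant.
    refine tendsto_const_nhds.congr' ?_
    obtain ⟨K, hK⟩ := S.exists_nat_subset_range
    filter_upwards [eventually_ge_atTop K] with k hk
    have hSk : S ⊆ Finset.range k := hK.trans (Finset.range_subset_range.2 hk)
    rw [← lintegral_indicator hmeas]
    set f : ℕ → ℝ → ℝ≥0∞ := fun i x => ENNReal.ofReal (gaussWeight (a i) x) *
      (if i ∈ S then (A i).indicator 1 x else 1) with hf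
    have e1 : ∀ x, (⋂ i ∈ S, Z i ⁻¹' A i).indicator
        (fun x => ENNReal.ofReal (sqrtDensity Z a k x ^ 2)) x =
        ∏ i ∈ Finset.range k, f i (Z i x) := by
      intro x
      have e2 : ∏ i ∈ Finset.range k, (if i ∈ S then (A i).indicator (1 : ℝ → ℝ≥0∞) (Z i x) else 1)
          = (⋂ i ∈ S, Z i ⁻¹' A i).indicator 1 x := by
        rw [Finset.prod_ite, Finset.prod_const_one, mul_one]
        have : (Finset.range k).filter (· ∈ S) = S := by
          ext i; simp only [Finset.mem_filter]; exact ⟨fun h => h.2, fun h => ⟨hSk h, h⟩⟩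
        rw [this]
        by_cases hx : x ∈ ⋂ i ∈ S, Z i ⁻¹' A i
        · rw [Set.indicator_of_mem hx]
          refine Finset.prod_eq_one fun i hi => ?_
          have : Z i x ∈ A i := by simpa using Set.mem_iInter₂.1 hx i hi
          simp [this]
        · rw [Set.indicator_of_notMem hx]
          simp only [Set.mem_iInter, not_forall] at hx
          obtain ⟨i, hi, hx⟩ := hx
          refine Finset.prod_eq_zero hi ?_
          exact Set.indicator_of_notMem (s := A i) hx (1 : ℝ → ℝ≥0∞)
      simp only [hf]
      rw [Finset.prod_mul_distrib, e2]
      simp only [sqrtDensity_sq]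
      rw [← ENNReal.ofReal_prod_of_nonneg fun i _ => gaussWeight_nonneg (a i) _]
      by_cases hx : x ∈ ⋂ i ∈ S, Z i ⁻¹' A i
      · simp [Set.indicator_of_mem hx]
      · simp [Set.indicator_of_notMem hx]
    have hfm : ∀ i, Measurable (f i) := fun i => by
      refine (measurable_gaussWeight (a i)).ennreal_ofReal.mul ?_
      split_ifs
      · exact measurable_one.indicator (hA i)
      · exact measurable_const
    simp_rw [e1]
    rw [hZ.lintegral_prod_comp _ hfm, ← Finset.prod_subset hSk]
    · refine Finset.prod_congr rfl fun i hi => ?_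
      rw [← withDensity_gaussWeight (ha i), withDensity_apply _ (hA i), ← lintegral_indicator (hA i)]
      refine lintegral_congr fun x => ?_
      simp only [hf, hi, if_true]
      by_cases hx : x ∈ A i <;> simp [hx]
    · intro i _ hi
      simp only [hf, hi, if_false, mul_one]
      exact lintegral_gaussWeight (ha i)
  have hlaw : ∀ i, (P.withDensity fun x => ENNReal.ofReal (D x)).map (Z i) =
      gaussianReal 0 (Real.toNNReal (a i)⁻¹) := fun i => by
    ext s hs
    rw [Measure.map_apply (hZ.measurable i) hs]
    simpa using key {i} (fun _ => s) fun _ => hs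
  refine ⟨hZ.measurable, ?_, hlaw⟩
  rw [iIndepFun_iff_measure_inter_preimage_eq_mul]
  intro S A hA
  have hA' : ∀ i, MeasurableSet (if i ∈ S then A i else ∅) := fun i => by
    split_ifs with h
    · exact hA i h
    · exact MeasurableSet.empty
  have h := key S (fun i => if i ∈ S then A i else ∅) hA'
  have e1 : (⋂ i ∈ S, Z i ⁻¹' (if i ∈ S then A i else ∅)) = ⋂ i ∈ S, Z i ⁻¹' A i :=
    Set.iInter₂_congr fun i hi => by rw [if_pos hi]
  rw [e1] at h
  rw [h]
  refine Finset.prod_congr rfl fun i hi => ?_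
  rw [if_pos hi, ← hlaw i, Measure.map_apply (hZ.measurable i) (hA i hi)]

end IsIndepGaussian

end

section

/-! ### The weighted measure and the ground state measure -/

variable {d m : ℕ} {v : Fin m → StrongDual ℝ (PathSpace d)} {ν : Measure (W0 v)} {lam : ℝ}
  {e : HilbertBasis ℕ ℝ (H0 v)} {ζ : ℕ → ℝ} {N : ℕ}

/-- The standing assumptions: an isonormal measure `ν`, and square summable eigenvalues `ζᵢ` such
that `1 + ζᵢ` is negative for `i < N` and positive for `i ≥ N`. -/
structure SpectralData (ν : Measure (W0 v)) (lam : ℝ) (ζ : ℕ → ℝ) (N : ℕ) : Prop where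
  isonormal : IsIsonormal ν lam
  lam_pos : 0 < lam
  neg : ∀ i < N, 1 + ζ i < 0
  pos : ∀ i, N ≤ i → 0 < 1 + ζ i
  summable : Summable fun i => ζ i ^ 2

/-- `dμ_{λ,T} = exp(-(λ/2) :(Tη, η):) dν`. -/
def tilt (ν : Measure (W0 v)) (lam : ℝ) (e : HilbertBasis ℕ ℝ (H0 v)) (ζ : ℕ → ℝ) :
    Measure (W0 v) :=
  ν.withDensity fun η => ENNReal.ofReal (Real.exp (-(lam / 2) * wickSquare ν lam e ζ η))

/-- The ground state measure `dγ = 𝐞₀² dμ_{λ,T}`. -/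
def groundMeasure (ν : Measure (W0 v)) (lam : ℝ) (e : HilbertBasis ℕ ℝ (H0 v)) (ζ : ℕ → ℝ)
    (N : ℕ) : Measure (W0 v) :=
  (tilt ν lam e ζ).withDensity fun η => ENNReal.ofReal (eigenfunction ν lam e ζ N 0 η ^ 2)

/-- The coordinates `Zᵢ = √λ ηᵢ`, which are standard Gaussian under `ν`. -/
def coord (ν : Measure (W0 v)) (lam : ℝ) (e : HilbertBasis ℕ ℝ (H0 v)) (i : ℕ) (η : W0 v) : ℝ :=
  Real.sqrt lam * wienerIntegral ν (e i) η

/-- The coordinates `Xᵢ = √(λ|1+ζᵢ|) ηᵢ`, which are standard Gaussian under the ground state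
measure. -/
def groundCoord (ν : Measure (W0 v)) (lam : ℝ) (e : HilbertBasis ℕ ℝ (H0 v)) (ζ : ℕ → ℝ)
    (i : ℕ) (η : W0 v) : ℝ :=
  Real.sqrt (lam * |1 + ζ i|) * wienerIntegral ν (e i) η

lemma measurable_coord (i : ℕ) : Measurable (coord ν lam e i) :=
  (measurable_wienerIntegral _).const_mul _

lemma measurable_groundCoord (i : ℕ) : Measurable (groundCoord ν lam e ζ i) :=
  (measurable_wienerIntegral _).const_mul _

lemma measurable_wickSquare : Measurable (wickSquare ν lam e ζ) := by
  unfold wickSquare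
  split_ifs with h
  · exact h.choose_spec.1
  · exact measurable_zero

lemma measurable_wickPartial (k : ℕ) : Measurable (wickPartial ν lam e ζ k) :=
  Finset.measurable_fun_sum _ fun _ _ =>
    (((measurable_wienerIntegral _).pow_const 2).sub_const _).const_mul _

lemma hermiteProd_eq (n : ℕ →₀ ℕ) (η : W0 v) : hermiteProd ν lam e ζ n η =
    ∏ i ∈ n.support, normHermite (n i) (groundCoord ν lam e ζ i η) := rfl

lemma hermiteProd_eq_of_subset {n : ℕ →₀ ℕ} {s : Finset ℕ} (hs : n.support ⊆ s) (η : W0 v) :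
    hermiteProd ν lam e ζ n η = ∏ i ∈ s, normHermite (n i) (groundCoord ν lam e ζ i η) :=
  Finsupp.prod_of_support_subset _ hs _ fun _ _ => normHermite_zero _

lemma measurable_hermiteProd (n : ℕ →₀ ℕ) : Measurable (hermiteProd ν lam e ζ n) :=
  Finset.measurable_fun_prod _ fun i _ =>
    (continuous_normHermite (n i)).measurable.comp (measurable_groundCoord i)

lemma hermiteProd_zero (η : W0 v) : hermiteProd ν lam e ζ 0 η = 1 := by
  simp [hermiteProd]

lemma eigenfunction_eq (n : ℕ →₀ ℕ) (η : W0 v) : eigenfunction ν lam e ζ N n η =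
    hermiteProd ν lam e ζ n η * eigenfunction ν lam e ζ N 0 η := by
  simp only [eigenfunction, hermiteProd_zero]; ring

lemma measurable_eigenfunction (n : ℕ →₀ ℕ) : Measurable (eigenfunction ν lam e ζ N n) := by
  unfold eigenfunction
  refine ((measurable_hermiteProd n).const_mul _).mul (Finset.measurable_fun_prod _ fun i _ => ?_)
  exact ((((measurable_wienerIntegral _).pow_const 2).sub_const _).const_mul _).exp

/-- `|1 + x| - 1` shifts the spectrum of `T` to that of `|I + T| - I`. -/
lemma abs_one_add_flip (x : ℝ) : |1 + (|1 + x| - 1)| = |1 + x| := by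
  rw [add_sub_cancel, abs_abs]

lemma groundCoord_flip (i : ℕ) :
    groundCoord ν lam e (fun i => |1 + ζ i| - 1) i = groundCoord ν lam e ζ i := by
  funext η; simp only [groundCoord, abs_one_add_flip]

lemma hermiteProd_flip (n : ℕ →₀ ℕ) :
    hermiteProd ν lam e (fun i => |1 + ζ i| - 1) n = hermiteProd ν lam e ζ n := by
  funext η; simp only [hermiteProd_eq, groundCoord_flip]

namespace SpectralData

lemma ne_zero (hS : SpectralData ν lam ζ N) (i : ℕ) : 1 + ζ i ≠ 0 := by
  rcases lt_or_ge i N with h | h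
  · exact (hS.neg i h).ne
  · exact (hS.pos i h).ne'

lemma abs_pos (hS : SpectralData ν lam ζ N) (i : ℕ) : 0 < |1 + ζ i| := _root_.abs_pos.2 (hS.ne_zero i)

lemma flip_summable (hS : SpectralData ν lam ζ N) : Summable fun i => (|1 + ζ i| - 1) ^ 2 := by
  refine hS.summable.of_nonneg_of_le (fun i => sq_nonneg _) fun i => ?_
  have h := abs_abs_sub_abs_le_abs_sub (1 + ζ i) 1
  rw [abs_one, add_sub_cancel_left] at h
  exact sq_le_sq.2 h

/-- The hypotheses are inherited by `|I + T| - I`, which has no negative part. -/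
lemma flip (hS : SpectralData ν lam ζ N) : SpectralData ν lam (fun i => |1 + ζ i| - 1) 0 where
  isonormal := hS.isonormal
  lam_pos := hS.lam_pos
  neg := fun i hi => absurd hi (Nat.not_lt_zero i)
  pos := fun i _ => by simpa using hS.ne_zero i
  summable := hS.flip_summable

lemma indep_coord (hS : SpectralData ν lam ζ N) (e : HilbertBasis ℕ ℝ (H0 v)) :
    IsIndepGaussian ν (coord ν lam e) fun _ => 1 where
  measurable := measurable_coord
  iIndep := (hS.isonormal.iIndepFun hS.lam_pos e).comp (fun _ x => Real.sqrt lam * x)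
    fun _ => measurable_const_mul _
  law := fun i => by
    have h : coord ν lam e i = (fun x => Real.sqrt lam * x) ∘ wienerIntegral ν (e i) := rfl
    rw [h, ← Measure.map_map (measurable_const_mul _) (measurable_wienerIntegral _),
      hS.isonormal.map_wienerIntegral, gaussianReal_map_const_mul, mul_zero]
    congr 1
    ext
    simp only [NNReal.coe_mul, NNReal.coe_mk, NNReal.coe_one]
    rw [Real.coe_toNNReal _ (by have := hS.lam_pos; positivity), Real.sq_sqrt hS.lam_pos.le,
      e.orthonormal.1 i]
    have := hS.lam_pos.ne'
    field_simp

lemma wickPartial_eq (hS : SpectralData ν lam ζ N) (ξ : ℕ → ℝ) (k : ℕ) (η : W0 v) :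
    wickPartial ν lam e ξ k η =
      lam⁻¹ * ∑ i ∈ Finset.range k, ξ i * (coord ν lam e i η ^ 2 - 1) := by
  rw [wickPartial, Finset.mul_sum]
  refine Finset.sum_congr rfl fun i _ => ?_
  rw [coord, mul_pow, Real.sq_sqrt hS.lam_pos.le]
  have := hS.lam_pos.ne'
  field_simp

lemma tendsto_wickPartial (hS : SpectralData ν lam ζ N) (e : HilbertBasis ℕ ℝ (H0 v)) :
    Tendsto (fun k => eLpNorm (fun η => wickPartial ν lam e ζ k η - wickSquare ν lam e ζ η) 2 ν)
      atTop (𝓝 0) := by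
  have hex : ∃ Q : W0 v → ℝ, Measurable Q ∧
      Tendsto (fun k => eLpNorm (fun η => wickPartial ν lam e ζ k η - Q η) 2 ν) atTop (𝓝 0) := by
    obtain ⟨Q, hQ, hlim⟩ := (hS.indep_coord e).exists_tendsto_wick hS.summable
    refine ⟨fun η => lam⁻¹ * Q η, hQ.const_mul _, ?_⟩
    have h := ENNReal.Tendsto.const_mul (a := ‖lam⁻¹‖ₑ) hlim (Or.inr enorm_ne_top)
    rw [mul_zero] at h
    refine h.congr fun k => ?_
    rw [← eLpNorm_const_smul]
    refine congrArg (fun f => eLpNorm f 2 ν) (funext fun η => ?_)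
    rw [hS.wickPartial_eq]
    simp only [Pi.smul_apply, smul_eq_mul]
    ring
  have hW : wickSquare ν lam e ζ = hex.choose := by rw [wickSquare, dif_pos hex]
  rw [hW]
  exact hex.choose_spec.2

lemma exists_seq_wickPartial (hS : SpectralData ν lam ζ N) (e : HilbertBasis ℕ ℝ (H0 v)) :
    ∃ ns : ℕ → ℕ, StrictMono ns ∧ ∀ᵐ η ∂ν,
      Tendsto (fun k => wickPartial ν lam e ζ (ns k) η) atTop (𝓝 (wickSquare ν lam e ζ η)) :=
  (tendstoInMeasure_of_tendsto_eLpNorm two_ne_zero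
    (fun k => (measurable_wickPartial k).aestronglyMeasurable)
    measurable_wickSquare.aestronglyMeasurable (hS.tendsto_wickPartial e)).exists_seq_tendsto_ae

/-- Passing from `T` to `|I + T| - I` changes the quadratic functional only in the finitely many
negative directions. -/
lemma wickSquare_flip (hS : SpectralData ν lam ζ N) (e : HilbertBasis ℕ ℝ (H0 v)) :
    wickSquare ν lam e (fun i => |1 + ζ i| - 1) =ᵐ[ν] fun η => wickSquare ν lam e ζ η +
      ∑ i ∈ Finset.range N, 2 * |1 + ζ i| * (wienerIntegral ν (e i) η ^ 2 - 1 / lam) := by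
  refine ae_eq_of_tendsto_eLpNorm
    (U := fun k => wickPartial ν lam e (fun i => |1 + ζ i| - 1) k)
    (fun k => (measurable_wickPartial k).aestronglyMeasurable)
    measurable_wickSquare.aestronglyMeasurable ?_ (hS.flip.tendsto_wickPartial e) ?_
  · refine (measurable_wickSquare.add (Finset.measurable_fun_sum _ fun i _ => ?_)).aestronglyMeasurable
    exact ((((measurable_wienerIntegral _).pow_const 2).sub_const _).const_mul _)
  · refine (hS.tendsto_wickPartial e).congr' ?_
    filter_upwards [eventually_ge_atTop N] with k hk
    refine congrArg (fun f => eLpNorm f 2 ν) (funext fun η => ?_)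
    simp only [wickPartial]
    rw [← Finset.sum_range_add_sum_Ico (fun i => ζ i * _) hk,
      ← Finset.sum_range_add_sum_Ico (fun i => (|1 + ζ i| - 1) * _) hk]
    have e1 : ∑ i ∈ Finset.Ico N k, (|1 + ζ i| - 1) * (wienerIntegral ν (e i) η ^ 2 - 1 / lam) =
        ∑ i ∈ Finset.Ico N k, ζ i * (wienerIntegral ν (e i) η ^ 2 - 1 / lam) := by
      refine Finset.sum_congr rfl fun i hi => ?_
      rw [abs_of_pos (hS.pos i (Finset.mem_Ico.1 hi).1), add_sub_cancel_left]
    have e2 : ∑ i ∈ Finset.range N, (|1 + ζ i| - 1) * (wienerIntegral ν (e i) η ^ 2 - 1 / lam) =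
        ∑ i ∈ Finset.range N, ζ i * (wienerIntegral ν (e i) η ^ 2 - 1 / lam) +
        ∑ i ∈ Finset.range N, 2 * |1 + ζ i| * (wienerIntegral ν (e i) η ^ 2 - 1 / lam) := by
      rw [← Finset.sum_add_distrib]
      refine Finset.sum_congr rfl fun i hi => ?_
      rw [abs_of_neg (hS.neg i (Finset.mem_range.1 hi))]
      ring
    rw [e1, e2]; ring

/-- The regularized determinant is positive, and the limit of its partial products: the series
`∑ (x - log (1 + x))` converges because `0 ≤ x - log (1 + x) ≤ x² / (1 + x)`. -/
lemma det2_spec (hS : SpectralData ν lam ζ N) :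
    0 < det2 (fun i => |1 + ζ i| - 1) ∧
    Tendsto (fun k => ∏ i ∈ Finset.range k, (|1 + ζ i| * Real.exp (-(|1 + ζ i| - 1)))) atTop
      (𝓝 (det2 fun i => |1 + ζ i| - 1)) := by
  obtain ⟨c, hc, hcl⟩ := exists_abs_lower_bound hS.summable hS.ne_zero
  have hlog : ∀ i, Real.log (|1 + ζ i| * Real.exp (-(|1 + ζ i| - 1))) =
      Real.log |1 + ζ i| - (|1 + ζ i| - 1) := fun i => by
    rw [Real.log_mul (hS.abs_pos i).ne' (Real.exp_pos _).ne', Real.log_exp]; ring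
  have hsum : Summable fun i => Real.log (|1 + ζ i| * Real.exp (-(|1 + ζ i| - 1))) := by
    rw [← summable_neg_iff]
    refine (hS.flip_summable.mul_left c⁻¹).of_nonneg_of_le (fun i => ?_) fun i => ?_
    · rw [hlog]
      have := Real.log_le_sub_one_of_pos (hS.abs_pos i)
      linarith
    · rw [hlog]
      have h1 := Real.one_sub_inv_le_log_of_pos (hS.abs_pos i)
      have h2 : |1 + ζ i| - 1 - (1 - |1 + ζ i|⁻¹) = |1 + ζ i|⁻¹ * (|1 + ζ i| - 1) ^ 2 := by
        have := (hS.abs_pos i).ne'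
        field_simp
      have h3 : |1 + ζ i|⁻¹ * (|1 + ζ i| - 1) ^ 2 ≤ c⁻¹ * (|1 + ζ i| - 1) ^ 2 :=
        mul_le_mul_of_nonneg_right (inv_anti₀ hc (hcl i)) (sq_nonneg _)
      linarith
  have hp := Real.hasProd_of_hasSum_log
    (fun i => mul_pos (hS.abs_pos i) (Real.exp_pos (-(|1 + ζ i| - 1)))) hsum.hasSum
  have hd : det2 (fun i => |1 + ζ i| - 1) =
      Real.exp (∑' i, Real.log (|1 + ζ i| * Real.exp (-(|1 + ζ i| - 1)))) := by
    rw [← hp.tprod_eq, det2]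
    refine tprod_congr fun i => ?_
    rw [add_sub_cancel]
  rw [hd]
  exact ⟨Real.exp_pos _, hp.tendsto_prod_nat⟩

lemma eigenfunction_zero_pos (hS : SpectralData ν lam ζ N) (η : W0 v) :
    0 < eigenfunction ν lam e ζ N 0 η := by
  rw [eigenfunction, hermiteProd_zero, mul_one]
  refine mul_pos (Real.rpow_pos_of_pos (_root_.abs_pos.2 hS.det2_spec.1.ne') _)
    (Finset.prod_pos fun i _ => Real.exp_pos _)

/-- The ground state measure only depends on `|I + T|`. -/
lemma groundMeasure_eq (hS : SpectralData ν lam ζ N) (e : HilbertBasis ℕ ℝ (H0 v)) :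
    groundMeasure ν lam e ζ N = ν.withDensity fun η => ENNReal.ofReal
      (Real.sqrt (det2 fun i => |1 + ζ i| - 1) *
        Real.exp (-(lam / 2) * wickSquare ν lam e (fun i => |1 + ζ i| - 1) η)) := by
  rw [groundMeasure, tilt, ← withDensity_mul _
    ((measurable_wickSquare.const_mul _).exp.ennreal_ofReal)
    ((measurable_eigenfunction 0).pow_const 2).ennreal_ofReal]
  refine withDensity_congr_ae ?_
  filter_upwards [hS.wickSquare_flip e] with η hη
  rw [Pi.mul_apply, ← ENNReal.ofReal_mul (Real.exp_pos _).le, hη, eigenfunction, hermiteProd_zero,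
    mul_one, mul_pow, ← Finset.prod_pow]
  congr 1
  have e1 : (|det2 fun i => |1 + ζ i| - 1| ^ (1 / 4 : ℝ)) ^ 2 =
      Real.sqrt (det2 fun i => |1 + ζ i| - 1) := by
    rw [abs_of_pos hS.det2_spec.1, Real.sqrt_eq_rpow, ← Real.rpow_natCast,
      ← Real.rpow_mul hS.det2_spec.1.le]
    norm_num
  rw [e1]
  simp_rw [← Real.exp_nat_mul]
  rw [← Real.exp_sum]
  rw [mul_comm, mul_assoc, ← Real.exp_add]
  congr 2
  rw [mul_add, Finset.mul_sum, add_comm]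
  congr 1
  refine Finset.sum_congr rfl fun i _ => ?_
  push_cast; ring

lemma groundMeasure_flip (hS : SpectralData ν lam ζ N) (e : HilbertBasis ℕ ℝ (H0 v)) :
    groundMeasure ν lam e (fun i => |1 + ζ i| - 1) 0 = groundMeasure ν lam e ζ N := by
  rw [hS.groundMeasure_eq, hS.flip.groundMeasure_eq]
  simp only [abs_one_add_flip]

/-- Under the ground state measure the rescaled coordinates are independent with laws
`N(0, 1 / |1 + ζᵢ|)`: its density is the limit of the densities of Gaussian changes of variance, the
normalizing constants `∏ |1 + ζᵢ| exp(-(|1 + ζᵢ| - 1))` tending to the regularized determinant. -/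
lemma indep_coord_ground (hS : SpectralData ν lam ζ N) (e : HilbertBasis ℕ ℝ (H0 v)) :
    IsIndepGaussian (groundMeasure ν lam e ζ N) (coord ν lam e)
      fun i => Real.toNNReal |1 + ζ i|⁻¹ := by
  obtain ⟨ns, hns, hae⟩ := hS.flip.exists_seq_wickPartial e
  rw [hS.groundMeasure_eq]
  refine (hS.indep_coord e).withDensity hS.abs_pos hS.flip_summable hns ?_
  filter_upwards [hae] with η hη
  have h1 := (hS.det2_spec.2.comp hns.tendsto_atTop).sqrt.mul ((hη.const_mul (-(lam / 2))).rexp)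
  refine h1.congr fun k => ?_
  rw [sqrtDensity_sq, hS.wickPartial_eq, Function.comp_apply]
  simp only [gaussWeight]
  rw [Real.sqrt_prod _ fun i _ => mul_nonneg (abs_nonneg _) (Real.exp_pos _).le,
    ← mul_assoc, Finset.mul_sum, Real.exp_sum, ← Finset.prod_mul_distrib]
  refine Finset.prod_congr rfl fun i _ => ?_
  rw [Real.sqrt_mul (abs_nonneg _), ← Real.exp_half, mul_assoc, ← Real.exp_add]
  congr 2
  have := hS.lam_pos.ne'
  field_simp; ring

lemma groundCoord_eq (hS : SpectralData ν lam ζ N) (i : ℕ) (η : W0 v) :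
    groundCoord ν lam e ζ i η = Real.sqrt |1 + ζ i| * coord ν lam e i η := by
  rw [groundCoord, coord, Real.sqrt_mul hS.lam_pos.le]; ring

lemma indep_groundCoord (hS : SpectralData ν lam ζ N) (e : HilbertBasis ℕ ℝ (H0 v)) :
    IsIndepGaussian (groundMeasure ν lam e ζ N) (groundCoord ν lam e ζ) fun _ => 1 where
  measurable := measurable_groundCoord
  iIndep := by
    have h := (hS.indep_coord_ground e).iIndep.comp (fun i x => Real.sqrt |1 + ζ i| * x)
      fun _ => measurable_const_mul _
    refine (iIndepFun_congr fun i => Eventually.of_forall fun η => ?_).1 h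
    exact (hS.groundCoord_eq i η).symm
  law := fun i => by
    have h : groundCoord ν lam e ζ i = (fun x => Real.sqrt |1 + ζ i| * x) ∘ coord ν lam e i :=
      funext fun η => hS.groundCoord_eq i η
    rw [h, ← Measure.map_map (measurable_const_mul _) (measurable_coord i),
      (hS.indep_coord_ground e).law, gaussianReal_map_const_mul, mul_zero]
    congr 1
    ext
    simp only [NNReal.coe_mul, NNReal.coe_mk, NNReal.coe_one]
    rw [Real.coe_toNNReal _ (by positivity), Real.sq_sqrt (abs_nonneg _)]
    exact mul_inv_cancel₀ (hS.abs_pos i).ne'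

lemma isProbabilityMeasure_ground (hS : SpectralData ν lam ζ N) (e : HilbertBasis ℕ ℝ (H0 v)) :
    IsProbabilityMeasure (groundMeasure ν lam e ζ N) := (hS.indep_groundCoord e).isProbabilityMeasure

lemma tilt_absolutelyContinuous : tilt ν lam e ζ ≪ ν := withDensity_absolutelyContinuous _ _

lemma ground_absolutelyContinuous_tilt :
    groundMeasure ν lam e ζ N ≪ tilt ν lam e ζ := withDensity_absolutelyContinuous _ _

lemma tilt_absolutelyContinuous_ground (hS : SpectralData ν lam ζ N) :
    tilt ν lam e ζ ≪ groundMeasure ν lam e ζ N :=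
  withDensity_absolutelyContinuous'
    ((measurable_eigenfunction 0).pow_const 2).ennreal_ofReal.aemeasurable
    (Eventually.of_forall fun η => by
      have := hS.eigenfunction_zero_pos (e := e) η
      rw [Ne, ENNReal.ofReal_eq_zero, not_le]; positivity)

lemma ground_absolutelyContinuous : groundMeasure ν lam e ζ N ≪ ν :=
  ground_absolutelyContinuous_tilt.trans tilt_absolutelyContinuous

lemma integral_ground (f : W0 v → ℝ) :
    ∫ η, f η ∂(groundMeasure ν lam e ζ N) =
      ∫ η, eigenfunction ν lam e ζ N 0 η ^ 2 * f η ∂(tilt ν lam e ζ) := by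
  rw [groundMeasure, integral_withDensity_eq_integral_toReal_smul
    ((measurable_eigenfunction 0).pow_const 2).ennreal_ofReal
    (Eventually.of_forall fun _ => ENNReal.ofReal_lt_top)]
  simp only [ENNReal.toReal_ofReal (sq_nonneg _), smul_eq_mul]

lemma integrable_ground {f : W0 v → ℝ} : Integrable f (groundMeasure ν lam e ζ N) ↔
    Integrable (fun η => eigenfunction ν lam e ζ N 0 η ^ 2 * f η) (tilt ν lam e ζ) := by
  rw [groundMeasure, integrable_withDensity_iff_integrable_smul'
    ((measurable_eigenfunction 0).pow_const 2).ennreal_ofReal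
    (Eventually.of_forall fun _ => ENNReal.ofReal_lt_top)]
  simp only [ENNReal.toReal_ofReal (sq_nonneg _), smul_eq_mul]

end SpectralData

end

section

/-! ### Limits of linear combinations and Hermite products -/

namespace IsIndepGaussian

variable {Ω : Type*} [MeasurableSpace Ω] {P : Measure Ω} {Z : ℕ → Ω → ℝ} {w : ℕ → ℝ≥0}

lemma map_sum (hZ : IsIndepGaussian P Z w) (c : ℕ → ℝ) (k : ℕ) :
    P.map (fun x => ∑ i ∈ Finset.range k, c i * Z i x) =
      gaussianReal 0 (∑ i ∈ Finset.range k, Real.toNNReal (c i ^ 2) * w i) := by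
  have := hZ.isProbabilityMeasure
  have hlaw : ∀ i, P.map (fun x => c i * Z i x) =
      gaussianReal 0 (Real.toNNReal (c i ^ 2) * w i) := fun i => by
    have h : (fun x => c i * Z i x) = (fun x => c i * x) ∘ Z i := rfl
    rw [h, ← Measure.map_map (measurable_const_mul _) (hZ.measurable i), hZ.law i,
      gaussianReal_map_const_mul, mul_zero]
    congr 2
    ext
    simp [Real.coe_toNNReal _ (sq_nonneg (c i))]
  have hind : iIndepFun (fun i x => c i * Z i x) P :=
    hZ.iIndep.comp (fun i x => c i * x) fun i => measurable_const_mul _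
  have hm : ∀ i, Measurable fun x => c i * Z i x := fun i => (hZ.measurable i).const_mul _
  induction k with
  | zero =>
    simp only [Finset.range_zero, Finset.sum_empty, gaussianReal_zero_var]
    rw [Measure.map_const, measure_univ, one_smul]
  | succ k ih =>
    have h1 := hind.indepFun_finsetSum_of_notMem hm (s := Finset.range k) (i := k) (by simp)
    have e1 : (∑ j ∈ Finset.range k, fun x => c j * Z j x) =
        fun x => ∑ i ∈ Finset.range k, c i * Z i x := by ext x; simp
    rw [e1] at h1
    have h2 := gaussianReal_add_gaussianReal_of_indepFun h1 ih (hlaw k)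
    rw [add_zero] at h2
    rw [Finset.sum_range_succ, ← h2]
    refine congrArg (fun f => P.map f) (funext fun x => ?_)
    rw [Finset.sum_range_succ]; rfl

/-- An almost sure limit of partial sums of `∑ cᵢ Zᵢ` has law `N(0, ∑ cᵢ² wᵢ)`. -/
lemma map_of_tendsto_ae (hZ : IsIndepGaussian P Z w) {c : ℕ → ℝ} {s : ℝ}
    (hs : HasSum (fun i => c i ^ 2 * w i) s) {Y : Ω → ℝ} (hY : AEMeasurable Y P) {ns : ℕ → ℕ}
    (hns : StrictMono ns)
    (hlim : ∀ᵐ x ∂P, Tendsto (fun k => ∑ i ∈ Finset.range (ns k), c i * Z i x) atTop (𝓝 (Y x))) :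
    P.map Y = gaussianReal 0 (Real.toNNReal s) := by
  have := hZ.isProbabilityMeasure
  refine map_gaussian_of_tendsto_ae (fun k => hZ.map_sum c (ns k)) hY hlim ?_
  have h := (continuous_real_toNNReal.tendsto s).comp (hs.tendsto_sum_nat.comp hns.tendsto_atTop)
  refine h.congr fun k => ?_
  ext
  simp only [Function.comp_apply]
  rw [Real.coe_toNNReal _ (Finset.sum_nonneg fun i _ => by positivity)]
  push_cast
  refine Finset.sum_congr rfl fun i _ => ?_
  rw [Real.coe_toNNReal _ (sq_nonneg _)]

lemma memLp_prod (hZ : IsIndepGaussian P Z w) (s : Finset ℕ) {f : ℕ → ℝ → ℝ} {q : ℝ≥0}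
    (hf : ∀ i, Measurable (f i)) (hfq : ∀ i, MemLp (f i) q (gaussianReal 0 (w i))) :
    MemLp (fun x => ∏ i ∈ s, f i (Z i x)) q P := by
  have := hZ.isProbabilityMeasure
  refine ⟨(Finset.measurable_fun_prod _ fun i _ =>
    (hf i).comp (hZ.measurable i)).aestronglyMeasurable, ?_⟩
  rcases eq_or_ne q 0 with rfl | hq
  · simp
  have hq' : (q : ℝ≥0∞) ≠ 0 := by simpa using hq
  rw [eLpNorm_lt_top_iff_lintegral_rpow_enorm_lt_top hq' ENNReal.coe_ne_top]
  have e1 : ∀ x, ‖∏ i ∈ s, f i (Z i x)‖ₑ ^ (q : ℝ≥0∞).toReal =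
      ∏ i ∈ s, ‖f i (Z i x)‖ₑ ^ (q : ℝ≥0∞).toReal := fun x => by
    rw [ENNReal.prod_rpow_of_nonneg ENNReal.toReal_nonneg]
    congr 1
    simp [enorm_eq_nnnorm, nnnorm_prod]
  simp_rw [e1]
  rw [hZ.lintegral_prod_comp s (f := fun i x => ‖f i x‖ₑ ^ (q : ℝ≥0∞).toReal)
    fun i => (hf i).enorm.pow_const _]
  exact ENNReal.prod_lt_top fun i _ =>
    (eLpNorm_lt_top_iff_lintegral_rpow_enorm_lt_top hq' ENNReal.coe_ne_top).1 (hfq i).2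

lemma memLp_exp_abs_sum (hZ : IsIndepGaussian P Z w) (c : ℕ → ℝ) (k : ℕ) :
    MemLp (fun x => Real.exp |∑ i ∈ Finset.range k, c i * Z i x|) 2 P := by
  have hm : Measurable fun x => ∑ i ∈ Finset.range k, c i * Z i x :=
    Finset.measurable_fun_sum _ fun i _ => (hZ.measurable i).const_mul _
  have h : ∀ t : ℝ, Integrable (fun x => Real.exp (t * ∑ i ∈ Finset.range k, c i * Z i x)) P := by
    intro t
    have := integrable_exp_mul_gaussianReal (μ := 0)
      (v := ∑ i ∈ Finset.range k, Real.toNNReal (c i ^ 2) * w i) t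
    rw [← hZ.map_sum c k] at this
    exact (integrable_map_measure (by fun_prop) hm.aemeasurable).1 this
  have hm' : Measurable fun x => Real.exp |∑ i ∈ Finset.range k, c i * Z i x| :=
    (continuous_abs.measurable.comp hm).exp
  rw [memLp_two_iff_integrable_sq hm'.aestronglyMeasurable]
  refine ((h 2).add (h (-2))).mono' (hm'.pow_const 2).aestronglyMeasurable (Eventually.of_forall fun x => ?_)
  rw [Real.norm_of_nonneg (by positivity), ← Real.exp_nat_mul]
  simp only [Pi.add_apply]
  have h1 := Real.exp_pos (2 * ∑ i ∈ Finset.range k, c i * Z i x)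
  have h2 := Real.exp_pos (-2 * ∑ i ∈ Finset.range k, c i * Z i x)
  push_cast
  rcases abs_cases (∑ i ∈ Finset.range k, c i * Z i x) with ⟨h, _⟩ | ⟨h, _⟩
  · rw [h]; linarith
  · rw [h]
    have : 2 * -(∑ i ∈ Finset.range k, c i * Z i x) = -2 * ∑ i ∈ Finset.range k, c i * Z i x := by
      ring
    rw [this]; linarith

end IsIndepGaussian

/-- The product `∏ᵢ H_{nᵢ}(xᵢ)` of normalized Hermite polynomials. -/
def multiHermite (n : ℕ →₀ ℕ) (x : ℕ → ℝ) : ℝ := n.prod fun i k => normHermite k (x i)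

lemma multiHermite_of_subset {n : ℕ →₀ ℕ} {s : Finset ℕ} (hs : n.support ⊆ s) (x : ℕ → ℝ) :
    multiHermite n x = ∏ i ∈ s, normHermite (n i) (x i) :=
  Finsupp.prod_of_support_subset _ hs _ fun _ _ => normHermite_zero _

lemma multiHermite_zero (x : ℕ → ℝ) : multiHermite 0 x = 1 := by simp [multiHermite]

/-- The factor with index `i` split off. -/
lemma multiHermite_erase (n : ℕ →₀ ℕ) (i : ℕ) (x : ℕ → ℝ) :
    multiHermite n x = multiHermite (n.erase i) x * normHermite (n i) (x i) := by
  classical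
  have h : n.support ⊆ insert i n.support := Finset.subset_insert _ _
  have h' : (n.erase i).support ⊆ (insert i n.support).erase i := by
    rw [Finsupp.support_erase]; exact Finset.erase_subset_erase _ h
  rw [multiHermite_of_subset h, multiHermite_of_subset h',
    ← Finset.prod_erase_mul _ _ (Finset.mem_insert_self i n.support)]
  congr 1
  refine Finset.prod_congr rfl fun j hj => ?_
  rw [Finsupp.erase_ne (Finset.ne_of_mem_erase hj)]

lemma multiHermite_update (n : ℕ →₀ ℕ) (i k : ℕ) (x : ℕ → ℝ) :
    multiHermite (n.update i k) x = multiHermite (n.erase i) x * normHermite k (x i) := by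
  rw [multiHermite_erase _ i]
  simp

lemma mul_multiHermite (n : ℕ →₀ ℕ) (i : ℕ) (x : ℕ → ℝ) :
    x i * multiHermite n x = Real.sqrt (n i + 1 : ℕ) * multiHermite (n.update i (n i + 1)) x +
      Real.sqrt (n i) * multiHermite (n.update i (n i - 1)) x := by
  rw [multiHermite_update, multiHermite_update, multiHermite_erase n i]
  linear_combination multiHermite (n.erase i) x * mul_normHermite (n i) (x i)

namespace IsIndepGaussian

variable {Ω : Type*} [MeasurableSpace Ω] {P : Measure Ω} {X : ℕ → Ω → ℝ}

lemma memLp_multiHermite {w : ℕ → ℝ≥0} (hX : IsIndepGaussian P X w) (n : ℕ →₀ ℕ) (q : ℝ≥0) :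
    MemLp (fun x => multiHermite n fun i => X i x) q P :=
  hX.memLp_prod n.support (f := fun i => normHermite (n i))
    (fun _ => (continuous_normHermite _).measurable) fun _ => memLp_normHermite _ _ _

lemma integral_multiHermite_mul (hX : IsIndepGaussian P X fun _ => 1) (n n' : ℕ →₀ ℕ) :
    ∫ x, (multiHermite n fun i => X i x) * (multiHermite n' fun i => X i x) ∂P =
      if n = n' then 1 else 0 := by
  classical
  have e1 : ∀ x, (multiHermite n fun i => X i x) * (multiHermite n' fun i => X i x) =
      ∏ i ∈ n.support ∪ n'.support, normHermite (n i) (X i x) * normHermite (n' i) (X i x) :=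
    fun x => by
      rw [multiHermite_of_subset Finset.subset_union_left,
        multiHermite_of_subset Finset.subset_union_right, Finset.prod_mul_distrib]
  simp_rw [e1]
  rw [hX.integral_prod_comp _ (f := fun i x => normHermite (n i) x * normHermite (n' i) x)
    (fun i => ((continuous_normHermite _).mul (continuous_normHermite _)).measurable)]
  simp_rw [integral_normHermite_mul]
  split_ifs with h
  · subst h; simp
  · obtain ⟨i, hi⟩ := Finsupp.ne_iff.1 h
    refine Finset.prod_eq_zero (i := i) ?_ (if_neg hi)
    rw [Finset.mem_union, Finsupp.mem_support_iff, Finsupp.mem_support_iff]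
    by_contra hc
    push Not at hc
    exact hi (hc.1.trans hc.2.symm)

/-- A function in `L²` which is orthogonal to all Hermite products is orthogonal to all powers of
linear combinations of the variables. -/
lemma integral_mul_pow_eq_zero (hX : IsIndepGaussian P X fun _ => 1) {g : Ω → ℝ} (hg : MemLp g 2 P)
    (h : ∀ n, ∫ x, g x * (multiHermite n fun i => X i x) ∂P = 0) (c : ℕ → ℝ) (k p : ℕ) :
    Integrable (fun x => g x * (∑ i ∈ Finset.range k, c i * X i x) ^ p) P ∧
    ∫ x, g x * (∑ i ∈ Finset.range k, c i * X i x) ^ p ∂P = 0 := by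
  obtain ⟨L, hL⟩ : ∃ L : Ω → ℝ, ∀ x, L x = ∑ i ∈ Finset.range k, c i * X i x := ⟨_, fun _ => rfl⟩
  simp_rw [← hL]
  -- The three-term recurrence absorbs one factor of the power into the Hermite products, so the
  -- induction has to carry a Hermite product along.
  suffices H : ∀ n, Integrable (fun x => g x * (L x ^ p * multiHermite n fun i => X i x)) P ∧
      ∫ x, g x * (L x ^ p * multiHermite n fun i => X i x) ∂P = 0 by
    simpa [multiHermite_zero] using H 0
  induction p with
  | zero =>
    intro n
    simp only [pow_zero, one_mul]
    have h2 : MemLp (fun x => multiHermite n fun i => X i x) 2 P := hX.memLp_multiHermite n 2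
    exact ⟨hg.integrable_mul h2, h n⟩
  | succ p ih =>
    intro n
    have e1 : ∀ x, g x * (L x ^ (p + 1) * multiHermite n fun i => X i x) =
        ∑ i ∈ Finset.range k,
          (c i * Real.sqrt (n i + 1 : ℕ) *
            (g x * (L x ^ p * multiHermite (n.update i (n i + 1)) fun i => X i x)) +
          c i * Real.sqrt (n i) *
            (g x * (L x ^ p * multiHermite (n.update i (n i - 1)) fun i => X i x))) := by
      intro x
      have h1 : L x * (multiHermite n fun i => X i x) = ∑ i ∈ Finset.range k,
          c i * (X i x * multiHermite n fun i => X i x) := by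
        rw [hL, Finset.sum_mul]
        exact Finset.sum_congr rfl fun i _ => by ring
      rw [pow_succ, mul_assoc, h1, Finset.mul_sum, Finset.mul_sum]
      refine Finset.sum_congr rfl fun i _ => ?_
      rw [mul_multiHermite n i fun i => X i x]
      ring
    simp_rw [e1]
    have hi : ∀ i, Integrable (fun x => c i * Real.sqrt (n i + 1 : ℕ) *
            (g x * (L x ^ p * multiHermite (n.update i (n i + 1)) fun i => X i x)) +
          c i * Real.sqrt (n i) *
            (g x * (L x ^ p * multiHermite (n.update i (n i - 1)) fun i => X i x))) P := fun i =>
      ((ih _).1.const_mul _).add ((ih _).1.const_mul _)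
    refine ⟨integrable_finsetSum _ fun i _ => hi i, ?_⟩
    rw [integral_finsetSum _ fun i _ => hi i]
    refine Finset.sum_eq_zero fun i _ => ?_
    rw [integral_add ((ih _).1.const_mul _) ((ih _).1.const_mul _), integral_const_mul,
      integral_const_mul, (ih _).2, (ih _).2]
    simp

/-- A function in `L²` which is orthogonal to all Hermite products is orthogonal to the characters
of linear combinations of the variables: the exponential series may be integrated termwise. -/
lemma integral_mul_cexp_eq_zero (hX : IsIndepGaussian P X fun _ => 1) {g : Ω → ℝ}
    (hg : MemLp g 2 P) (h : ∀ n, ∫ x, g x * (multiHermite n fun i => X i x) ∂P = 0) (c : ℕ → ℝ)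
    (k : ℕ) :
    ∫ x, (g x : ℂ) * Complex.exp ((∑ i ∈ Finset.range k, c i * X i x : ℝ) * Complex.I) ∂P = 0 := by
  set L : Ω → ℝ := fun x => ∑ i ∈ Finset.range k, c i * X i x with hL
  have hLm : Measurable L := Finset.measurable_fun_sum _ fun i _ => (hX.measurable i).const_mul _
  have hser : ∀ x : ℝ, HasSum (fun p : ℕ => |x| ^ p / p.factorial) (Real.exp |x|) := fun x => by
    rw [Real.exp_eq_exp_ℝ]; exact NormedSpace.expSeries_div_hasSum_exp |x|
  have hterm : ∀ (p : ℕ) (x : Ω), (g x : ℂ) * ((L x * Complex.I) ^ p / p.factorial) =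
      Complex.I ^ p / p.factorial * ((g x * L x ^ p : ℝ) : ℂ) := fun p x => by
    push_cast; rw [mul_pow]; ring
  have hsum := hasSum_integral_of_dominated_convergence (μ := P)
    (F := fun (p : ℕ) x => (g x : ℂ) * ((L x * Complex.I) ^ p / p.factorial))
    (f := fun x => (g x : ℂ) * Complex.exp (L x * Complex.I))
    (fun p x => |g x| * (|L x| ^ p / p.factorial)) ?_ ?_ ?_ ?_ ?_
  · refine hsum.unique ?_
    have : (fun p : ℕ => ∫ x, (g x : ℂ) * ((L x * Complex.I) ^ p / p.factorial) ∂P) = 0 := by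
      funext p
      simp_rw [hterm]
      rw [integral_const_mul, integral_complex_ofReal, (hX.integral_mul_pow_eq_zero hg h c k p).2]
      simp
    rw [this]
    exact hasSum_zero
  · intro p
    have : AEStronglyMeasurable (fun x => (g x : ℂ)) P :=
      Complex.continuous_ofReal.comp_aestronglyMeasurable hg.1
    exact this.mul (by fun_prop)
  · intro p
    refine Eventually.of_forall fun x => le_of_eq ?_
    simp
  · exact Eventually.of_forall fun x => (hser (L x)).summable.mul_left _
  · have : (fun x => ∑' p : ℕ, |g x| * (|L x| ^ p / p.factorial)) =
        fun x => |g x| * Real.exp |L x| := funext fun x => ((hser (L x)).mul_left _).tsum_eq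
    rw [this]
    exact hg.abs.integrable_mul (hX.memLp_exp_abs_sum c k)
  · refine Eventually.of_forall fun x => HasSum.mul_left _ ?_
    rw [Complex.exp_eq_exp_ℂ]; exact NormedSpace.expSeries_div_hasSum_exp _

end IsIndepGaussian

end

section

/-! ### The ground state transform -/

variable {d m : ℕ} {v : Fin m → StrongDual ℝ (PathSpace d)} {ν : Measure (W0 v)} {lam : ℝ}
  {e : HilbertBasis ℕ ℝ (H0 v)} {ζ : ℕ → ℝ} {N : ℕ}

namespace SpectralData

lemma sqrt_pos (hS : SpectralData ν lam ζ N) (i : ℕ) : 0 < Real.sqrt (lam * |1 + ζ i|) :=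
  Real.sqrt_pos.2 (mul_pos hS.lam_pos (hS.abs_pos i))

/-- The Wiener integral of `h` is an almost sure limit of linear combinations of the `Xᵢ`. -/
lemma exists_seq_groundCoord (hS : SpectralData ν lam ζ N) (e : HilbertBasis ℕ ℝ (H0 v))
    (h : H0 v) : ∃ ns : ℕ → ℕ, StrictMono ns ∧
      ∀ᵐ η ∂ν, Tendsto (fun k => ∑ i ∈ Finset.range (ns k),
        (inner ℝ (e i) h / Real.sqrt (lam * |1 + ζ i|)) * groundCoord ν lam e ζ i η) atTop
        (𝓝 (wienerIntegral ν h η)) := by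
  obtain ⟨ns, hns, hae⟩ := hS.isonormal.exists_seq_tendsto_ae hS.lam_pos e h
  refine ⟨ns, hns, ?_⟩
  filter_upwards [hae] with η hη
  refine hη.congr fun k => Finset.sum_congr rfl fun i _ => ?_
  have := (hS.sqrt_pos i).ne'
  rw [groundCoord]
  field_simp

lemma map_wienerIntegral_ground (hS : SpectralData ν lam ζ N) (e : HilbertBasis ℕ ℝ (H0 v))
    {h : H0 v} {s : ℝ} (hs : HasSum (fun i => inner ℝ (e i) h ^ 2 * (lam * |1 + ζ i|)⁻¹) s) :
    (groundMeasure ν lam e ζ N).map (wienerIntegral ν h) = gaussianReal 0 (Real.toNNReal s) := by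
  obtain ⟨ns, hns, hae⟩ := hS.exists_seq_groundCoord e h
  refine (hS.indep_groundCoord e).map_of_tendsto_ae (hs.congr_fun fun i => ?_)
    (measurable_wienerIntegral _).aemeasurable hns (ground_absolutelyContinuous.ae_le hae)
  rw [div_pow, Real.sq_sqrt (mul_pos hS.lam_pos (hS.abs_pos i)).le, NNReal.coe_one, mul_one,
    div_eq_mul_inv]

lemma map_dual_ground (hS : SpectralData ν lam ζ N) (e : HilbertBasis ℕ ℝ (H0 v))
    (φ : StrongDual ℝ (W0 v)) {s : ℝ}
    (hs : HasSum (fun i => inner ℝ (e i) (dualRep0 φ) ^ 2 * (lam * |1 + ζ i|)⁻¹) s) :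
    (groundMeasure ν lam e ζ N).map φ = gaussianReal 0 (Real.toNNReal s) := by
  rw [← hS.map_wienerIntegral_ground e hs]
  have h : φ =ᵐ[groundMeasure ν lam e ζ N] wienerIntegral ν (dualRep0 φ) :=
    ground_absolutelyContinuous.ae_le (hS.isonormal.wienerIntegral_dual φ).symm
  exact Measure.map_congr h

lemma memLp_hermiteProd (hS : SpectralData ν lam ζ N) (n : ℕ →₀ ℕ) (q : ℝ≥0) :
    MemLp (hermiteProd ν lam e ζ n) q (groundMeasure ν lam e ζ N) :=
  (hS.indep_groundCoord e).memLp_multiHermite n q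

lemma integral_hermiteProd_mul (hS : SpectralData ν lam ζ N) (n n' : ℕ →₀ ℕ) :
    ∫ η, hermiteProd ν lam e ζ n η * hermiteProd ν lam e ζ n' η ∂(groundMeasure ν lam e ζ N) =
      if n = n' then 1 else 0 :=
  (hS.indep_groundCoord e).integral_multiHermite_mul n n'

lemma eigenfunction_mul (n n' : ℕ →₀ ℕ) (η : W0 v) :
    eigenfunction ν lam e ζ N n η * eigenfunction ν lam e ζ N n' η =
      eigenfunction ν lam e ζ N 0 η ^ 2 *
        (hermiteProd ν lam e ζ n η * hermiteProd ν lam e ζ n' η) := by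
  rw [eigenfunction_eq n, eigenfunction_eq n']; ring

lemma integrable_hermiteProd_mul (hS : SpectralData ν lam ζ N) (n n' : ℕ →₀ ℕ) :
    Integrable (fun η => hermiteProd ν lam e ζ n η * hermiteProd ν lam e ζ n' η)
      (groundMeasure ν lam e ζ N) := by
  have h1 : MemLp (hermiteProd ν lam e ζ n) 2 (groundMeasure ν lam e ζ N) :=
    hS.memLp_hermiteProd n 2
  have h2 : MemLp (hermiteProd ν lam e ζ n') 2 (groundMeasure ν lam e ζ N) :=
    hS.memLp_hermiteProd n' 2
  exact h1.integrable_mul h2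

lemma integrable_eigenfunction_mul (hS : SpectralData ν lam ζ N) (n n' : ℕ →₀ ℕ) :
    Integrable (fun η => eigenfunction ν lam e ζ N n η * eigenfunction ν lam e ζ N n' η)
      (tilt ν lam e ζ) := by
  simp_rw [eigenfunction_mul]
  exact integrable_ground.1 (hS.integrable_hermiteProd_mul n n')

lemma setIntegral_ground {A : Set (W0 v)} (hA : MeasurableSet A) (f : W0 v → ℝ) :
    ∫ η in A, f η ∂(groundMeasure ν lam e ζ N) =
      ∫ η in A, eigenfunction ν lam e ζ N 0 η ^ 2 * f η ∂(tilt ν lam e ζ) := by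
  rw [← integral_indicator hA, integral_ground, ← integral_indicator hA]
  refine integral_congr_ae (Eventually.of_forall fun η => ?_)
  by_cases h : η ∈ A <;> simp [h]

/-- Both signed measures have density `∏ H_{nᵢ}(Xᵢ) ∏ H_{n'ᵢ}(Xᵢ)` with respect to the common
ground state measure. -/
lemma withDensityᵥ_eq (hS : SpectralData ν lam ζ N) (n n' : ℕ →₀ ℕ) :
    (tilt ν lam e ζ).withDensityᵥ (fun η =>
        eigenfunction ν lam e ζ N n η * eigenfunction ν lam e ζ N n' η) =
      (tilt ν lam e (fun i => |1 + ζ i| - 1)).withDensityᵥ (fun η =>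
        eigenfunction ν lam e (fun i => |1 + ζ i| - 1) 0 n η *
        eigenfunction ν lam e (fun i => |1 + ζ i| - 1) 0 n' η) := by
  refine VectorMeasure.ext fun A hA => ?_
  rw [withDensityᵥ_apply (hS.integrable_eigenfunction_mul n n') hA,
    withDensityᵥ_apply (hS.flip.integrable_eigenfunction_mul n n') hA]
  simp_rw [eigenfunction_mul]
  rw [← setIntegral_ground hA, ← setIntegral_ground hA, hS.groundMeasure_flip, hermiteProd_flip,
    hermiteProd_flip]

lemma withDensity_eigenfunction_sq (n : ℕ →₀ ℕ) :
    (tilt ν lam e ζ).withDensity (fun η =>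
        ENNReal.ofReal (eigenfunction ν lam e ζ N n η ^ 2)) =
      (groundMeasure ν lam e ζ N).withDensity
        (fun η => ENNReal.ofReal (hermiteProd ν lam e ζ n η ^ 2)) := by
  rw [groundMeasure, ← withDensity_mul _ ((measurable_eigenfunction 0).pow_const 2).ennreal_ofReal
    ((measurable_hermiteProd n).pow_const 2).ennreal_ofReal]
  congr 1
  funext η
  rw [Pi.mul_apply, ← ENNReal.ofReal_mul (sq_nonneg _), eigenfunction_eq n, mul_pow, mul_comm]

/-- `g ∈ L²` of the ground state measure if and only if `g e₀ ∈ L²(μ_{λ,T})`. -/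
lemma memLp_ground_iff (hS : SpectralData ν lam ζ N) {g : W0 v → ℝ} :
    MemLp g 2 (groundMeasure ν lam e ζ N) ↔
      MemLp (fun η => g η * eigenfunction ν lam e ζ N 0 η) 2 (tilt ν lam e ζ) := by
  have hpos : ∀ η, eigenfunction ν lam e ζ N 0 η ≠ 0 := fun η => (hS.eigenfunction_zero_pos η).ne'
  have hm : AEStronglyMeasurable g (groundMeasure ν lam e ζ N) ↔
      AEStronglyMeasurable (fun η => g η * eigenfunction ν lam e ζ N 0 η) (tilt ν lam e ζ) := by
    constructor
    · intro h
      exact (h.mono_ac hS.tilt_absolutelyContinuous_ground).mul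
        (measurable_eigenfunction 0).aestronglyMeasurable
    · intro h
      have h1 : AEStronglyMeasurable (fun η => g η * eigenfunction ν lam e ζ N 0 η)
        (groundMeasure ν lam e ζ N) := h.mono_ac ground_absolutelyContinuous_tilt
      have h2 : Measurable fun η => (eigenfunction ν lam e ζ N 0 η)⁻¹ :=
        (measurable_eigenfunction 0).inv
      refine (h1.mul h2.aestronglyMeasurable).congr (Eventually.of_forall fun η => ?_)
      exact mul_inv_cancel_right₀ (hpos η) _
  by_cases h : AEStronglyMeasurable g (groundMeasure ν lam e ζ N)
  · rw [memLp_two_iff_integrable_sq h, memLp_two_iff_integrable_sq (hm.1 h), integrable_ground]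
    simp_rw [mul_pow, mul_comm]
  · exact ⟨fun h' => absurd h'.1 h, fun h' => absurd (hm.2 h'.1) h⟩

lemma memLp_eigenfunction (hS : SpectralData ν lam ζ N) (n : ℕ →₀ ℕ) :
    MemLp (eigenfunction ν lam e ζ N n) 2 (tilt ν lam e ζ) := by
  have h1 : MemLp (hermiteProd ν lam e ζ n) 2 (groundMeasure ν lam e ζ N) :=
    hS.memLp_hermiteProd n 2
  have := hS.memLp_ground_iff.1 h1
  simp_rw [← eigenfunction_eq] at this
  exact this

/-- The eigenfunction `𝐞ₙ` as an element of `L²(μ_{λ,T})`. -/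
def eigenLp (hS : SpectralData ν lam ζ N) (e : HilbertBasis ℕ ℝ (H0 v)) (n : ℕ →₀ ℕ) :
    Lp ℝ 2 (tilt ν lam e ζ) := (hS.memLp_eigenfunction n).toLp _

lemma coeFn_eigenLp (hS : SpectralData ν lam ζ N) (n : ℕ →₀ ℕ) :
    hS.eigenLp e n =ᵐ[tilt ν lam e ζ] eigenfunction ν lam e ζ N n :=
  (hS.memLp_eigenfunction n).coeFn_toLp

lemma inner_eigenLp (hS : SpectralData ν lam ζ N) (n : ℕ →₀ ℕ) (u : Lp ℝ 2 (tilt ν lam e ζ)) :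
    inner ℝ (hS.eigenLp e n) u =
      ∫ η, eigenfunction ν lam e ζ N n η * u η ∂(tilt ν lam e ζ) := by
  rw [L2.inner_def]
  refine integral_congr_ae ?_
  filter_upwards [hS.coeFn_eigenLp n] with η hη
  rw [hη]; simp [mul_comm]

lemma orthonormal_eigenLp (hS : SpectralData ν lam ζ N) (e : HilbertBasis ℕ ℝ (H0 v)) :
    Orthonormal ℝ (hS.eigenLp e) := by
  classical
  rw [orthonormal_iff_ite]
  intro n n'
  rw [inner_eigenLp, ← hS.integral_hermiteProd_mul (e := e) n n', integral_ground]
  refine integral_congr_ae ?_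
  filter_upwards [hS.coeFn_eigenLp (e := e) n'] with η hη
  rw [hη, eigenfunction_mul]

/-- The Hermite products are total in `L²` of the ground state measure: a function orthogonal to
all of them has vanishing Fourier transform. -/
lemma ae_eq_zero_of_integral_hermiteProd (hS : SpectralData ν lam ζ N) [CompleteSpace (W0 v)]
    {g : W0 v → ℝ} (hg : MemLp g 2 (groundMeasure ν lam e ζ N))
    (h : ∀ n, ∫ η, g η * hermiteProd ν lam e ζ n η ∂(groundMeasure ν lam e ζ N) = 0) :
    g =ᵐ[groundMeasure ν lam e ζ N] 0 := by
  set γ := groundMeasure ν lam e ζ N with hγ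
  have hprob : IsProbabilityMeasure γ := hS.isProbabilityMeasure_ground e
  have hgi : Integrable g γ := hg.integrable (by norm_num)
  have hchar : ∀ φ : StrongDual ℝ (W0 v),
      ∫ η, (g η : ℂ) * Complex.exp ((φ η : ℝ) * Complex.I) ∂γ = 0 := by
    intro φ
    obtain ⟨ns, hns, hae⟩ := hS.exists_seq_groundCoord e (dualRep0 φ)
    have hlim := tendsto_integral_of_dominated_convergence (μ := γ)
      (F := fun k η => (g η : ℂ) * Complex.exp ((∑ i ∈ Finset.range (ns k),
        (inner ℝ (e i) (dualRep0 φ) / Real.sqrt (lam * |1 + ζ i|)) *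
          groundCoord ν lam e ζ i η : ℝ) * Complex.I))
      (f := fun η => (g η : ℂ) * Complex.exp ((φ η : ℝ) * Complex.I)) (fun η => |g η|)
      (fun k => ?_) hgi.abs (fun k => ?_) ?_
    · refine tendsto_nhds_unique hlim (tendsto_const_nhds.congr fun k => Eq.symm ?_)
      exact (hS.indep_groundCoord e).integral_mul_cexp_eq_zero hg h _ (ns k)
    · have h1 : AEStronglyMeasurable (fun x => (g x : ℂ)) γ :=
        Complex.continuous_ofReal.comp_aestronglyMeasurable hg.1
      refine h1.mul (Measurable.aestronglyMeasurable ?_)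
      have : Measurable fun η => ∑ i ∈ Finset.range (ns k),
        (inner ℝ (e i) (dualRep0 φ) / Real.sqrt (lam * |1 + ζ i|)) *
          groundCoord ν lam e ζ i η :=
        Finset.measurable_fun_sum _ fun i _ => (measurable_groundCoord i).const_mul _
      fun_prop
    · refine Eventually.of_forall fun η => ?_
      rw [norm_mul, Complex.norm_exp_ofReal_mul_I, mul_one, Complex.norm_real, Real.norm_eq_abs]
    · filter_upwards [ground_absolutelyContinuous.ae_le hae,
        ground_absolutelyContinuous.ae_le (hS.isonormal.wienerIntegral_dual φ)] with η h1 h2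
      rw [h2] at h1
      refine Tendsto.const_mul _ ((Complex.continuous_exp.tendsto _).comp ?_)
      exact ((Complex.continuous_ofReal.tendsto _).comp h1).mul_const _
  -- The finite measures `g⁺ γ` and `g⁻ γ` have the same Fourier transform.
  have hfin : ∀ f : W0 v → ℝ, Integrable f γ →
      IsFiniteMeasure (γ.withDensity fun η => ENNReal.ofReal (f η)) := fun f hf =>
    isFiniteMeasure_withDensity_ofReal hf.2
  have hcf : ∀ f : W0 v → ℝ, Integrable f γ → ∀ φ : StrongDual ℝ (W0 v),
      charFunDual (γ.withDensity fun η => ENNReal.ofReal (f η)) φ =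
        ∫ η, ((max (f η) 0 : ℝ) : ℂ) * Complex.exp ((φ η : ℝ) * Complex.I) ∂γ := by
    intro f hf φ
    rw [charFunDual_apply, integral_withDensity_eq_integral_toReal_smul₀
      hf.aemeasurable.ennreal_ofReal (Eventually.of_forall fun _ => ENNReal.ofReal_lt_top)]
    refine integral_congr_ae (Eventually.of_forall fun η => ?_)
    simp only [ENNReal.toReal_ofReal', Complex.real_smul]
  have hgn : Integrable (fun η => -g η) γ := hgi.neg
  have := hfin g hgi
  have := hfin _ hgn
  have hexp : ∀ (φ : StrongDual ℝ (W0 v)) (f : W0 v → ℝ), Integrable f γ →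
      Integrable (fun η => ((f η : ℝ) : ℂ) * Complex.exp ((φ η : ℝ) * Complex.I)) γ := by
    intro φ f hf
    have h1 : AEStronglyMeasurable (fun x => (f x : ℂ)) γ :=
      Complex.continuous_ofReal.comp_aestronglyMeasurable hf.1
    refine hf.norm.mono' (h1.mul (Continuous.aestronglyMeasurable (by fun_prop)))
      (Eventually.of_forall fun η => ?_)
    rw [norm_mul, Complex.norm_exp_ofReal_mul_I, mul_one, Complex.norm_real]
  have hEq : (γ.withDensity fun η => ENNReal.ofReal (g η)) =
      γ.withDensity fun η => ENNReal.ofReal (-g η) := by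
    refine Measure.ext_of_charFunDual (funext fun φ => ?_)
    rw [hcf g hgi, hcf _ hgn, ← sub_eq_zero,
      ← integral_sub (hexp φ _ hgi.pos_part) (hexp φ _ hgn.pos_part), ← hchar φ]
    refine integral_congr_ae (Eventually.of_forall fun η => ?_)
    dsimp only
    rw [← sub_mul, ← Complex.ofReal_sub]
    congr 2
    rcases le_total 0 (g η) with h0 | h0
    · rw [max_eq_left h0, max_eq_right (by linarith)]; ring
    · rw [max_eq_right h0, max_eq_left (by linarith)]; ring
  have hae := (withDensity_eq_iff hgi.aemeasurable.ennreal_ofReal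
    hgn.aemeasurable.ennreal_ofReal hgi.lintegral_lt_top.ne).1 hEq
  filter_upwards [hae] with η hη
  rcases le_total 0 (g η) with h0 | h0
  · rw [ENNReal.ofReal_of_nonpos (p := -g η) (by linarith), ENNReal.ofReal_eq_zero] at hη
    exact le_antisymm hη h0
  · rw [ENNReal.ofReal_of_nonpos h0, eq_comm, ENNReal.ofReal_eq_zero] at hη
    simp only [Pi.zero_apply]; linarith

lemma eq_zero_of_inner_eigenLp (hS : SpectralData ν lam ζ N) [CompleteSpace (W0 v)]
    {u : Lp ℝ 2 (tilt ν lam e ζ)} (h : ∀ n, inner ℝ (hS.eigenLp e n) u = 0) : u = 0 := by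
  have hpos : ∀ η, eigenfunction ν lam e ζ N 0 η ≠ 0 := fun η => (hS.eigenfunction_zero_pos η).ne'
  set g : W0 v → ℝ := fun η => u η / eigenfunction ν lam e ζ N 0 η with hg
  have hgL : MemLp g 2 (groundMeasure ν lam e ζ N) := by
    rw [hS.memLp_ground_iff]
    refine (Lp.memLp u).congr_norm ?_ (Eventually.of_forall fun η => ?_)
    · have : Measurable fun η => g η * eigenfunction ν lam e ζ N 0 η :=
        ((Lp.stronglyMeasurable u).measurable.div (measurable_eigenfunction 0)).mul
          (measurable_eigenfunction 0)
      exact this.aestronglyMeasurable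
    · simp only [hg]; rw [div_mul_cancel₀ _ (hpos η)]
  have h0 := hS.ae_eq_zero_of_integral_hermiteProd hgL fun n => by
    rw [integral_ground, ← h n, inner_eigenLp]
    refine integral_congr_ae (Eventually.of_forall fun η => ?_)
    simp only [hg]
    rw [eigenfunction_eq n]
    have := hpos η
    field_simp
  refine Lp.ext ?_
  filter_upwards [hS.tilt_absolutelyContinuous_ground.ae_le h0, Lp.coeFn_zero ℝ 2 (tilt ν lam e ζ)]
    with η h1 h2
  rw [h2]
  simp only [hg, Pi.zero_apply, div_eq_zero_iff, hpos η, or_false] at h1 ⊢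
  exact h1

/-- The Hilbert basis of `L²(μ_{λ,T})` formed by the eigenfunctions. -/
def eigenBasis (hS : SpectralData ν lam ζ N) [CompleteSpace (W0 v)]
    (e : HilbertBasis ℕ ℝ (H0 v)) : HilbertBasis (ℕ →₀ ℕ) ℝ (Lp ℝ 2 (tilt ν lam e ζ)) :=
  HilbertBasis.mkOfOrthogonalEqBot (hS.orthonormal_eigenLp e) (by
    rw [Submodule.eq_bot_iff]
    intro u hu
    exact hS.eq_zero_of_inner_eigenLp fun n =>
      (Submodule.mem_orthogonal _ _).1 hu _ (Submodule.subset_span ⟨n, rfl⟩))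

lemma eigenBasis_apply (hS : SpectralData ν lam ζ N) [CompleteSpace (W0 v)] (n : ℕ →₀ ℕ) :
    hS.eigenBasis e n = hS.eigenLp e n :=
  congrFun (HilbertBasis.coe_mkOfOrthogonalEqBot _ _) n

end SpectralData

end

section

/-! ### Smooth functions with Gaussian bounds -/

/-- Smooth functions `q` on `ℝ^ι` all of whose derivatives are bounded by
`C_δ exp(∑ (δ - bᵢ) zᵢ²)`, for every `δ > 0`. -/
def IsGaussBounded {ι : Type*} [Fintype ι] (b : ι → ℝ) (q : (ι → ℝ) → ℝ) : Prop :=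
  ContDiff ℝ ∞ q ∧ ∀ (l : ℕ) (δ : ℝ), 0 < δ → ∃ C : ℝ, 0 ≤ C ∧ ∀ z,
    ‖iteratedFDeriv ℝ l q z‖ ≤ C * Real.exp (∑ i, (δ - b i) * z i ^ 2)

lemma abs_pow_le_exp (n : ℕ) {δ : ℝ} (hδ : 0 < δ) :
    ∃ C : ℝ, 0 ≤ C ∧ ∀ x : ℝ, |x| ^ n ≤ C * Real.exp (δ * x ^ 2) := by
  refine ⟨1 + n.factorial / δ ^ n, by positivity, fun x => ?_⟩
  have h1 : |x| ^ n ≤ 1 + (x ^ 2) ^ n := by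
    rw [← pow_mul, mul_comm 2 n, pow_mul, ← sq_abs (x ^ n), abs_pow]
    nlinarith [sq_nonneg (|x| ^ n - 1)]
  have h2 : (x ^ 2) ^ n ≤ n.factorial / δ ^ n * Real.exp (δ * x ^ 2) := by
    have h := Real.pow_div_factorial_le_exp (δ * x ^ 2) (by positivity) n
    rw [div_le_iff₀ (by positivity)] at h
    rw [div_mul_eq_mul_div, le_div_iff₀ (by positivity)]
    calc (x ^ 2) ^ n * δ ^ n = (δ * x ^ 2) ^ n := by rw [mul_pow]; ring
      _ ≤ _ := by linarith
  have h3 : 1 ≤ Real.exp (δ * x ^ 2) := Real.one_le_exp (by positivity)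
  linarith

lemma polynomial_le_exp (p : Polynomial ℝ) {δ : ℝ} (hδ : 0 < δ) :
    ∃ C : ℝ, 0 ≤ C ∧ ∀ x : ℝ, |p.eval x| ≤ C * Real.exp (δ * x ^ 2) := by
  choose C hC0 hC using fun n : ℕ => abs_pow_le_exp n hδ
  refine ⟨∑ i ∈ Finset.range (p.natDegree + 1), |p.coeff i| * C i,
    Finset.sum_nonneg fun i _ => mul_nonneg (abs_nonneg _) (hC0 i), fun x => ?_⟩
  rw [Polynomial.eval_eq_sum_range, Finset.sum_mul]
  refine (Finset.abs_sum_le_sum_abs _ _).trans (Finset.sum_le_sum fun i _ => ?_)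
  rw [abs_mul, abs_pow, mul_assoc]
  exact mul_le_mul_of_nonneg_left (hC i x) (abs_nonneg _)

/-- The derivatives of a polynomial times a Gaussian are of the same form. -/
lemma iteratedDeriv_polynomial_mul_exp (p : Polynomial ℝ) (β : ℝ) (l : ℕ) :
    ∃ p' : Polynomial ℝ, iteratedDeriv l (fun x => p.eval x * Real.exp (-(β * x ^ 2))) =
      fun x => p'.eval x * Real.exp (-(β * x ^ 2)) := by
  induction l with
  | zero => exact ⟨p, by simp⟩
  | succ l ih =>
    obtain ⟨p', hp'⟩ := ih
    refine ⟨p'.derivative - Polynomial.C (2 * β) * Polynomial.X * p', ?_⟩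
    rw [iteratedDeriv_succ, hp']
    funext x
    have h1 : HasDerivAt (fun x : ℝ => -(β * x ^ 2)) (-(β * (2 * x))) x := by
      refine (((hasDerivAt_pow 2 x).const_mul β).fun_neg).congr_deriv ?_
      simp
    rw [((p'.hasDerivAt x).fun_mul h1.exp).deriv]
    simp only [Polynomial.eval_sub, Polynomial.eval_mul, Polynomial.eval_C, Polynomial.eval_X]
    ring

lemma contDiff_polynomial_mul_exp (p : Polynomial ℝ) (β : ℝ) :
    ContDiff ℝ ∞ fun x => p.eval x * Real.exp (-(β * x ^ 2)) := by
  have h : ContDiff ℝ ∞ fun x => p.eval x := by simpa using p.contDiff_aeval (𝕜 := ℝ) ∞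
  exact h.mul (by fun_prop)

section

variable {ι : Type*} [Fintype ι]

namespace IsGaussBounded

variable {b b' : ι → ℝ} {q q' : (ι → ℝ) → ℝ}

lemma mul (hq : IsGaussBounded b q) (hq' : IsGaussBounded b' q') :
    IsGaussBounded (b + b') fun z => q z * q' z := by
  refine ⟨hq.1.mul hq'.1, fun l δ hδ => ?_⟩
  choose C hC0 hC using fun l => hq.2 l (δ / 2) (by positivity)
  choose C' hC0' hC' using fun l => hq'.2 l (δ / 2) (by positivity)
  refine ⟨∑ i ∈ Finset.range (l + 1), (l.choose i : ℝ) * C i * C' (l - i),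
    Finset.sum_nonneg fun i _ => mul_nonneg (mul_nonneg (Nat.cast_nonneg _) (hC0 i)) (hC0' _),
    fun z => ?_⟩
  refine (norm_iteratedFDeriv_mul_le (hq.1.of_le (by exact_mod_cast le_top) : ContDiff ℝ l q)
    (hq'.1.of_le (by exact_mod_cast le_top)) z le_rfl).trans ?_
  rw [Finset.sum_mul]
  refine Finset.sum_le_sum fun i _ => ?_
  have he : Real.exp (∑ i, (δ - (b + b') i) * z i ^ 2) =
      Real.exp (∑ i, (δ / 2 - b i) * z i ^ 2) * Real.exp (∑ i, (δ / 2 - b' i) * z i ^ 2) := by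
    rw [← Real.exp_add, ← Finset.sum_add_distrib]
    congr 1
    refine Finset.sum_congr rfl fun i _ => ?_
    rw [Pi.add_apply]; ring
  rw [he]
  calc (l.choose i : ℝ) * ‖iteratedFDeriv ℝ i q z‖ * ‖iteratedFDeriv ℝ (l - i) q' z‖
      ≤ (l.choose i : ℝ) * (C i * Real.exp (∑ i, (δ / 2 - b i) * z i ^ 2)) *
        (C' (l - i) * Real.exp (∑ i, (δ / 2 - b' i) * z i ^ 2)) := by
        gcongr
        · have := hC0 i; positivity
        · exact hC i z
        · exact hC' (l - i) z
    _ = _ := by ring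

lemma const (c : ℝ) : IsGaussBounded (0 : ι → ℝ) fun _ => c := by
  refine ⟨contDiff_const, fun l δ hδ => ⟨‖c‖, norm_nonneg _, fun z => ?_⟩⟩
  have h1 : 1 ≤ Real.exp (∑ i, (δ - (0 : ι → ℝ) i) * z i ^ 2) :=
    Real.one_le_exp (Finset.sum_nonneg fun i _ => by
      rw [Pi.zero_apply, sub_zero]; positivity)
  have h2 : ‖iteratedFDeriv ℝ l (fun _ : ι → ℝ => c) z‖ ≤ ‖c‖ := by
    rcases Nat.eq_zero_or_pos l with rfl | hl
    · rw [norm_iteratedFDeriv_zero]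
    · rw [iteratedFDeriv_const_of_ne hl.ne']; simp
  exact h2.trans (le_mul_of_one_le_right (norm_nonneg _) h1)

lemma coord [DecidableEq ι] (p : Polynomial ℝ) (β : ℝ) (i : ι) :
    IsGaussBounded (Pi.single i β) fun z : ι → ℝ => p.eval (z i) * Real.exp (-(β * z i ^ 2)) := by
  set u : ℝ → ℝ := fun x => p.eval x * Real.exp (-(β * x ^ 2)) with hu
  have hus : ContDiff ℝ ∞ u := contDiff_polynomial_mul_exp p β
  have hcomp : (fun z : ι → ℝ => p.eval (z i) * Real.exp (-(β * z i ^ 2))) =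
      u ∘ (ContinuousLinearMap.proj i : (ι → ℝ) →L[ℝ] ℝ) := rfl
  rw [hcomp]
  refine ⟨hus.comp (ContinuousLinearMap.contDiff _), fun l δ hδ => ?_⟩
  obtain ⟨p', hp'⟩ := iteratedDeriv_polynomial_mul_exp p β l
  obtain ⟨C, hC0, hC⟩ := polynomial_le_exp p' hδ
  refine ⟨C, hC0, fun z => ?_⟩
  rw [ContinuousLinearMap.iteratedFDeriv_comp_right _ hus z (i := l) (by exact_mod_cast le_top)]
  refine (ContinuousMultilinearMap.norm_compContinuousLinearMap_le _ _).trans ?_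
  have hpr : ‖(ContinuousLinearMap.proj i : (ι → ℝ) →L[ℝ] ℝ)‖ ≤ 1 :=
    ContinuousLinearMap.opNorm_le_bound _ zero_le_one fun z => by
      rw [one_mul]; exact norm_le_pi_norm z i
  have h1 : ∏ _j : Fin l, ‖(ContinuousLinearMap.proj i : (ι → ℝ) →L[ℝ] ℝ)‖ ≤ 1 :=
    Finset.prod_le_one (fun _ _ => norm_nonneg _) fun _ _ => hpr
  refine (mul_le_of_le_one_right (norm_nonneg _) h1).trans ?_
  rw [norm_iteratedFDeriv_eq_norm_iteratedDeriv, hp', Real.norm_eq_abs, abs_mul,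
    abs_of_pos (Real.exp_pos _)]
  have h2 : δ * z i ^ 2 + -(β * z i ^ 2) ≤ ∑ j, (δ - (Pi.single i β : ι → ℝ) j) * z j ^ 2 := by
    rw [← Finset.add_sum_erase _ _ (Finset.mem_univ i), Pi.single_eq_same]
    have : 0 ≤ ∑ j ∈ Finset.univ.erase i, (δ - (Pi.single i β : ι → ℝ) j) * z j ^ 2 :=
      Finset.sum_nonneg fun j hj => by
        rw [Pi.single_eq_of_ne (Finset.ne_of_mem_erase hj), sub_zero]; positivity
    linarith
  calc |p'.eval (z i)| * Real.exp (-(β * z i ^ 2))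
      ≤ C * Real.exp (δ * z i ^ 2) * Real.exp (-(β * z i ^ 2)) := by
        gcongr; exact hC (z i)
    _ = C * Real.exp (δ * z i ^ 2 + -(β * z i ^ 2)) := by rw [mul_assoc, ← Real.exp_add]
    _ ≤ _ := by gcongr

lemma prod (p : ι → Polynomial ℝ) (b : ι → ℝ) :
    IsGaussBounded b fun z : ι → ℝ => ∏ i, (p i).eval (z i) * Real.exp (-(b i * z i ^ 2)) := by
  classical
  have h : ∀ s : Finset ι, IsGaussBounded (∑ i ∈ s, Pi.single i (b i)) fun z : ι → ℝ =>
      ∏ i ∈ s, (p i).eval (z i) * Real.exp (-(b i * z i ^ 2)) := by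
    intro s
    induction s using Finset.induction_on with
    | empty => simpa using const (ι := ι) 1
    | insert i s hi ih =>
      simp_rw [Finset.prod_insert hi, Finset.sum_insert hi]
      exact (coord (p i) (b i) i).mul ih
  have h1 := h Finset.univ
  rwa [Finset.univ_sum_single] at h1

/-- A Gaussian bounded function with positive rates has bounded derivatives. -/
lemma bounded {ε : ℝ} (hε : 0 < ε) (hb : ∀ i, ε ≤ b i) (hq : IsGaussBounded b q) (l : ℕ) :
    ∃ C : ℝ, ∀ z, ‖iteratedFDeriv ℝ l q z‖ ≤ C := by
  obtain ⟨C, hC0, hC⟩ := hq.2 l ε hε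
  refine ⟨C, fun z => (hC z).trans (mul_le_of_le_one_right hC0 (Real.exp_le_one_iff.2 ?_))⟩
  refine Finset.sum_nonpos fun i _ => mul_nonpos_of_nonpos_of_nonneg ?_ (sq_nonneg _)
  linarith [hb i]

end IsGaussBounded

/-- The cutoff `exp(-ε ∑ zᵢ²)`. -/
def gaussCutoff (ι : Type*) [Fintype ι] (ε : ℝ) (z : ι → ℝ) : ℝ := ∏ i, Real.exp (-(ε * z i ^ 2))

lemma isGaussBounded_gaussCutoff (ε : ℝ) : IsGaussBounded (fun _ : ι => ε) (gaussCutoff ι ε) := by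
  have := IsGaussBounded.prod (fun _ : ι => (1 : Polynomial ℝ)) fun _ => ε
  simp only [Polynomial.eval_one, one_mul] at this
  exact this

/-- The derivatives of `1 - exp(-ε|z|²)` are `O(√ε (1 + |z|²))`. -/
lemma norm_iteratedFDeriv_one_sub_gaussCutoff (l : ℕ) : ∃ B : ℝ, 0 ≤ B ∧ ∀ ε : ℝ, 0 < ε → ε ≤ 1 →
    ∀ z : ι → ℝ, ‖iteratedFDeriv ℝ l (fun z => 1 - gaussCutoff ι ε z) z‖ ≤
      Real.sqrt ε * B * (1 + ∑ i, z i ^ 2) := by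
  have hsm := (isGaussBounded_gaussCutoff (ι := ι) 1).1
  rcases Nat.eq_zero_or_pos l with rfl | hl
  · refine ⟨1, zero_le_one, fun ε h0 h1 z => ?_⟩
    rw [norm_iteratedFDeriv_zero, gaussCutoff, ← Real.exp_sum, Real.norm_eq_abs, mul_one]
    have ht : 0 ≤ ∑ i, z i ^ 2 := Finset.sum_nonneg fun i _ => sq_nonneg _
    have e1 : ∑ i, -(ε * z i ^ 2) = -(ε * ∑ i, z i ^ 2) := by
      rw [Finset.sum_neg_distrib, Finset.mul_sum]
    rw [e1, abs_of_nonneg (by rw [sub_nonneg, Real.exp_le_one_iff]; nlinarith)]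
    have h2 := Real.add_one_le_exp (-(ε * ∑ i, z i ^ 2))
    have h3 : ε ≤ Real.sqrt ε := Real.le_sqrt_of_sq_le (by nlinarith)
    have h4 := Real.sqrt_nonneg ε
    nlinarith
  · obtain ⟨B, hB⟩ := (isGaussBounded_gaussCutoff (ι := ι) 1).bounded one_pos (fun _ => le_rfl) l
    refine ⟨B, (norm_nonneg _).trans (hB 0), fun ε h0 h1 z => ?_⟩
    -- Each derivative of `z ↦ gaussCutoff ι 1 (√ε z)` gains a factor `√ε`, and `l ≥ 1`.
    have hscale : gaussCutoff ι ε = gaussCutoff ι 1 ∘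
        (Real.sqrt ε • ContinuousLinearMap.id ℝ (ι → ℝ)) := by
      funext z
      simp only [gaussCutoff, Function.comp_apply]
      refine Finset.prod_congr rfl fun i _ => ?_
      simp [mul_pow, Real.sq_sqrt h0.le]
    have hB0 : 0 ≤ B := (norm_nonneg _).trans (hB 0)
    have e1 : iteratedFDeriv ℝ l (fun z => 1 - gaussCutoff ι ε z) z =
        -iteratedFDeriv ℝ l (gaussCutoff ι ε) z := by
      have hs' : ContDiff ℝ l (gaussCutoff ι ε) :=
        (isGaussBounded_gaussCutoff (ι := ι) ε).1.of_le (by exact_mod_cast le_top)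
      have := iteratedFDeriv_sub_apply (𝕜 := ℝ) (i := l) (f := fun _ : ι → ℝ => (1 : ℝ))
        (g := gaussCutoff ι ε) (x := z) contDiff_const.contDiffAt hs'.contDiffAt
      rw [iteratedFDeriv_const_of_ne hl.ne', Pi.zero_apply, zero_sub] at this
      exact this
    rw [e1, norm_neg, hscale, ContinuousLinearMap.iteratedFDeriv_comp_right _ hsm z (i := l)
      (by exact_mod_cast le_top)]
    refine (ContinuousMultilinearMap.norm_compContinuousLinearMap_le _ _).trans ?_
    have hn : ‖Real.sqrt ε • ContinuousLinearMap.id ℝ (ι → ℝ)‖ ≤ Real.sqrt ε := by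
      rw [norm_smul, Real.norm_of_nonneg (Real.sqrt_nonneg _)]
      exact mul_le_of_le_one_right (Real.sqrt_nonneg _) ContinuousLinearMap.norm_id_le
    have hs1 : Real.sqrt ε ≤ 1 := Real.sqrt_le_one.2 h1
    have hprod : ∏ _j : Fin l, ‖Real.sqrt ε • ContinuousLinearMap.id ℝ (ι → ℝ)‖ ≤ Real.sqrt ε := by
      rw [Finset.prod_const, Finset.card_univ, Fintype.card_fin]
      calc _ ≤ Real.sqrt ε ^ l := pow_le_pow_left₀ (norm_nonneg _) hn l
        _ ≤ Real.sqrt ε ^ 1 := pow_le_pow_of_le_one (Real.sqrt_nonneg _) hs1 hl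
        _ = _ := pow_one _
    have ht : 0 ≤ ∑ i, z i ^ 2 := Finset.sum_nonneg fun i _ => sq_nonneg _
    calc _ ≤ B * Real.sqrt ε := mul_le_mul (hB _) hprod (Finset.prod_nonneg fun _ _ => norm_nonneg _) hB0
      _ = Real.sqrt ε * B * 1 := by ring
      _ ≤ _ := by gcongr; linarith

/-- Cutting off a Gaussian bounded function by `exp(-ε|z|²)` changes its derivatives by
`O(√ε)`, up to an arbitrarily small loss in the rates. -/
lemma IsGaussBounded.sub_cutoff {b : ι → ℝ} {q : (ι → ℝ) → ℝ} (hq : IsGaussBounded b q) (l : ℕ)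
    {δ : ℝ} (hδ : 0 < δ) : ∃ C : ℝ, 0 ≤ C ∧ ∀ ε : ℝ, 0 < ε → ε ≤ 1 → ∀ z : ι → ℝ,
      ‖iteratedFDeriv ℝ l (fun z => q z * gaussCutoff ι ε z) z - iteratedFDeriv ℝ l q z‖ ≤
        Real.sqrt ε * C * Real.exp (∑ i, (δ - b i) * z i ^ 2) := by
  choose B hB0 hB using fun l => norm_iteratedFDeriv_one_sub_gaussCutoff (ι := ι) l
  choose C hC0 hC using fun l => hq.2 l (δ / 2) (by positivity)
  set A : ℝ := ∑ i ∈ Finset.range (l + 1), (l.choose i : ℝ) * C i * B (l - i) with hA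
  have hA0 : 0 ≤ A := Finset.sum_nonneg fun i _ =>
    mul_nonneg (mul_nonneg (Nat.cast_nonneg _) (hC0 i)) (hB0 _)
  refine ⟨A * (1 + 2 / δ), by positivity, fun ε h0 h1 z => ?_⟩
  have hs : ContDiff ℝ l (fun z => 1 - gaussCutoff ι ε z) :=
    contDiff_const.sub ((isGaussBounded_gaussCutoff (ι := ι) ε).1.of_le (by exact_mod_cast le_top))
  have hqs : ContDiff ℝ l q := hq.1.of_le (by exact_mod_cast le_top)
  have hps : ContDiff ℝ l (fun z => q z * gaussCutoff ι ε z) :=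
    hqs.mul ((isGaussBounded_gaussCutoff (ι := ι) ε).1.of_le (by exact_mod_cast le_top))
  have e1 := iteratedFDeriv_sub_apply (𝕜 := ℝ) (i := l) (x := z) hqs.contDiffAt hps.contDiffAt
  have e2 : (q - fun z => q z * gaussCutoff ι ε z) = fun z => q z * (1 - gaussCutoff ι ε z) := by
    funext z; simp only [Pi.sub_apply]; ring
  rw [norm_sub_rev, ← e1, e2]
  refine (norm_iteratedFDeriv_mul_le hqs hs z le_rfl).trans ?_
  set t : ℝ := ∑ i, z i ^ 2 with ht
  have ht0 : 0 ≤ t := Finset.sum_nonneg fun i _ => sq_nonneg _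
  set E : ℝ := Real.exp (∑ i, (δ / 2 - b i) * z i ^ 2) with hE
  have hEp : 0 < E := Real.exp_pos _
  have he : Real.exp (∑ i, (δ - b i) * z i ^ 2) = E * Real.exp (δ / 2 * t) := by
    rw [hE, ← Real.exp_add, ht, Finset.mul_sum, ← Finset.sum_add_distrib]
    congr 1
    exact Finset.sum_congr rfl fun i _ => by ring
  have h3 : 1 + t ≤ (1 + 2 / δ) * Real.exp (δ / 2 * t) := by
    have h4 := Real.add_one_le_exp (δ / 2 * t)
    have h5 : 1 ≤ Real.exp (δ / 2 * t) := Real.one_le_exp (by positivity)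
    have h6 : t = 2 / δ * (δ / 2 * t) := by field_simp
    have h7 : 2 / δ * (δ / 2 * t) ≤ 2 / δ * Real.exp (δ / 2 * t) := by gcongr; linarith
    linarith
  calc ∑ i ∈ Finset.range (l + 1), (l.choose i : ℝ) * ‖iteratedFDeriv ℝ i q z‖ *
        ‖iteratedFDeriv ℝ (l - i) (fun z => 1 - gaussCutoff ι ε z) z‖
      ≤ ∑ i ∈ Finset.range (l + 1), (l.choose i : ℝ) * (C i * E) *
        (Real.sqrt ε * B (l - i) * (1 + t)) := by
        refine Finset.sum_le_sum fun i _ => ?_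
        gcongr
        · have := hC0 i; positivity
        · exact hC i z
        · exact hB (l - i) ε h0 h1 z
    _ = Real.sqrt ε * A * E * (1 + t) := by
        rw [hA, Finset.mul_sum, Finset.sum_mul, Finset.sum_mul]
        exact Finset.sum_congr rfl fun i _ => by ring
    _ ≤ Real.sqrt ε * A * E * ((1 + 2 / δ) * Real.exp (δ / 2 * t)) := by gcongr
    _ = _ := by rw [he]; ring

/-- Completing the square: the loss incurred by moving from `z` to `z + s d` in the exponent is
controlled by `|d|²`, thanks to the extra rate `ε`. -/
lemma exp_quad_le {β ε z t s : ℝ} (hε : 0 < ε) (hβ : 0 ≤ β) (hs : |s| ≤ 1) :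
    β * z ^ 2 + (ε / 2 - (β + ε)) * (z + s * t) ^ 2 ≤ (2 * β ^ 2 / ε + β) * t ^ 2 := by
  have hs2 : s ^ 2 ≤ 1 := by rw [← sq_abs]; nlinarith [abs_nonneg s]
  have key : β * z ^ 2 + (ε / 2 - (β + ε)) * (z + s * t) ^ 2 = (2 * β ^ 2 / ε + β) * (s * t) ^ 2 -
      ε / 2 * (z + s * t + 2 * β / ε * (s * t)) ^ 2 := by
    field_simp; ring
  have h1 : (s * t) ^ 2 ≤ t ^ 2 := by
    rw [mul_pow]; exact mul_le_of_le_one_left (sq_nonneg _) hs2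
  have h2 : (2 * β ^ 2 / ε + β) * (s * t) ^ 2 ≤ (2 * β ^ 2 / ε + β) * t ^ 2 :=
    mul_le_mul_of_nonneg_left h1 (by positivity)
  have h3 : 0 ≤ ε / 2 * (z + s * t + 2 * β / ε * (s * t)) ^ 2 := by positivity
  linarith

end

end

section

/-! ### Approximation in Gaussian spaces with exponential weights -/

lemma lintegral_exp_sq_gaussian {w : ℝ≥0} {s : ℝ} (hsw : s * w ≤ 1 / 4) :
    ∫⁻ x, ENNReal.ofReal (Real.exp (s * x ^ 2)) ∂(gaussianReal 0 w) ≤ 2 := by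
  set a : ℝ := 1 - 2 * (s * w) with ha
  have ha1 : 1 / 2 ≤ a := by rw [ha]; linarith
  have ha0 : 0 < a := by linarith
  have hmap : gaussianReal 0 w = (gaussianReal 0 1).map fun x => Real.sqrt w * x := by
    rw [gaussianReal_map_const_mul, mul_zero]
    congr 1
    ext
    simp
  rw [hmap, lintegral_map (by fun_prop) (by fun_prop)]
  have h1 : ∀ x : ℝ, ENNReal.ofReal (Real.exp (s * (Real.sqrt w * x) ^ 2)) =
      ENNReal.ofReal (Real.sqrt a)⁻¹ * ENNReal.ofReal (gaussWeight a x) := fun x => by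
    rw [← ENNReal.ofReal_mul (by positivity), gaussWeight, inv_mul_cancel_left₀
      (Real.sqrt_pos.2 ha0).ne', mul_pow, Real.sq_sqrt (NNReal.coe_nonneg w)]
    congr 2
    rw [ha]; ring
  simp_rw [h1]
  rw [lintegral_const_mul _ (measurable_gaussWeight a).ennreal_ofReal, lintegral_gaussWeight ha0,
    mul_one, ← ENNReal.ofReal_ofNat]
  refine ENNReal.ofReal_le_ofReal (inv_le_of_inv_le₀ two_pos (Real.le_sqrt_of_sq_le ?_))
  norm_num; linarith

section

variable {Ω : Type*} [MeasurableSpace Ω] {P : Measure Ω} {ι : Type*} [Fintype ι]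

lemma aemeasurable_exp_sum_sq {X : ι → Ω → ℝ} {w : ι → ℝ≥0}
    (hX : ∀ i, P.map (X i) = gaussianReal 0 (w i)) (s : ℝ) :
    AEMeasurable (fun x => ENNReal.ofReal (Real.exp (s * ∑ i, X i x ^ 2))) P := by
  have h : ∀ i, AEMeasurable (X i) P := fun i => aemeasurable_of_map_gaussian (hX i)
  have h2 : AEMeasurable (fun x => ∑ i, X i x ^ 2) P :=
    Finset.aemeasurable_fun_sum _ fun i _ => (h i).pow_const 2
  exact (Real.measurable_exp.comp_aemeasurable (h2.const_mul s)).ennreal_ofReal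

/-- Exponential moments of sums of squares of Gaussian variables, without any independence: the
exponential of an average is at most the average of the exponentials. -/
lemma lintegral_exp_sum_sq_le [Nonempty ι] {X : ι → Ω → ℝ} {w : ι → ℝ≥0}
    (hX : ∀ i, P.map (X i) = gaussianReal 0 (w i)) {s : ℝ}
    (hsw : ∀ i, s * Fintype.card ι * w i ≤ 1 / 4) :
    ∫⁻ x, ENNReal.ofReal (Real.exp (s * ∑ i, X i x ^ 2)) ∂P ≤ 2 := by
  set M : ℝ := ((Fintype.card ι : ℕ) : ℝ) with hM
  have hM0 : 0 < M := by rw [hM]; exact_mod_cast Fintype.card_pos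
  have hconv : ∀ x, Real.exp (s * ∑ i, X i x ^ 2) ≤ ∑ i, M⁻¹ * Real.exp (s * M * X i x ^ 2) := by
    intro x
    have h := convexOn_exp.map_sum_le (t := Finset.univ) (w := fun _ : ι => M⁻¹)
      (p := fun i => s * M * X i x ^ 2) (fun _ _ => by positivity)
      (by rw [Finset.sum_const, Finset.card_univ, nsmul_eq_mul, ← hM, mul_inv_cancel₀ hM0.ne'])
      (fun _ _ => Set.mem_univ _)
    simp only [smul_eq_mul] at h
    refine (le_of_eq ?_).trans h
    congr 1
    rw [Finset.mul_sum]
    refine Finset.sum_congr rfl fun i _ => ?_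
    field_simp
  have hm : ∀ i, AEMeasurable (fun x => ENNReal.ofReal (M⁻¹ * Real.exp (s * M * X i x ^ 2))) P :=
    fun i => (((Real.measurable_exp.comp_aemeasurable
      (((aemeasurable_of_map_gaussian (hX i)).pow_const 2).const_mul (s * M))).const_mul
        M⁻¹)).ennreal_ofReal
  calc ∫⁻ x, ENNReal.ofReal (Real.exp (s * ∑ i, X i x ^ 2)) ∂P
      ≤ ∫⁻ x, ∑ i, ENNReal.ofReal (M⁻¹ * Real.exp (s * M * X i x ^ 2)) ∂P := by
        refine lintegral_mono fun x => ?_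
        rw [← ENNReal.ofReal_sum_of_nonneg fun i _ => by positivity]
        exact ENNReal.ofReal_le_ofReal (hconv x)
    _ = ∑ i, ∫⁻ x, ENNReal.ofReal (M⁻¹ * Real.exp (s * M * X i x ^ 2)) ∂P :=
        lintegral_finsetSum' _ fun i _ => hm i
    _ ≤ ∑ _i : ι, ENNReal.ofReal M⁻¹ * 2 := by
        refine Finset.sum_le_sum fun i _ => ?_
        have h1 := lintegral_exp_sq_gaussian (w := w i) (s := s * M) (hsw i)
        rw [← hX i, lintegral_map' (by fun_prop) (aemeasurable_of_map_gaussian (hX i))] at h1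
        simp_rw [ENNReal.ofReal_mul (inv_nonneg.2 hM0.le)]
        rw [lintegral_const_mul' _ _ ENNReal.ofReal_ne_top]
        gcongr
    _ = 2 := by
        rw [Finset.sum_const, Finset.card_univ, nsmul_eq_mul, ← mul_assoc,
          ← ENNReal.ofReal_natCast, ← ENNReal.ofReal_mul (Nat.cast_nonneg _), ← hM,
          mul_inv_cancel₀ hM0.ne', ENNReal.ofReal_one, one_mul]

/-- Mean value estimate for a Gaussian bounded function with rates `b + ε`, weighted by
`exp(∑ bᵢ zᵢ²)`. -/
lemma IsGaussBounded.weighted_sub_le {b : ι → ℝ} (hb : ∀ i, 0 ≤ b i) {ε : ℝ} (hε : 0 < ε)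
    {f : (ι → ℝ) → ℝ} (hf : IsGaussBounded (fun i => b i + ε) f) (l : ℕ) :
    ∃ C K : ℝ, 0 ≤ C ∧ 0 ≤ K ∧ ∀ z y : ι → ℝ,
      Real.exp (2 * ∑ i, b i * z i ^ 2) * ‖iteratedFDeriv ℝ l f y - iteratedFDeriv ℝ l f z‖ ^ 2 ≤
        C * (∑ i, (y i - z i) ^ 2) * Real.exp (K * ∑ i, (y i - z i) ^ 2) := by
  obtain ⟨C, hC0, hC⟩ := hf.2 (l + 1) (ε / 2) (by positivity)
  set K : ℝ := ∑ i, (2 * b i ^ 2 / ε + b i) with hK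
  have hKi : ∀ i, 0 ≤ 2 * b i ^ 2 / ε + b i := fun i => by have := hb i; positivity
  have hK0 : 0 ≤ K := Finset.sum_nonneg fun i _ => hKi i
  refine ⟨C ^ 2, 2 * K, by positivity, by positivity, fun z y => ?_⟩
  set R : ℝ := ∑ i, (y i - z i) ^ 2 with hR
  set Q : ℝ := ∑ i, b i * z i ^ 2 with hQ
  have hR0 : 0 ≤ R := Finset.sum_nonneg fun i _ => sq_nonneg _
  have hbound : ∀ x ∈ segment ℝ z y, ‖fderiv ℝ (iteratedFDeriv ℝ l f) x‖ ≤
      C * Real.exp (K * R - Q) := by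
    intro x hx
    rw [segment_eq_image'] at hx
    obtain ⟨s, hs, rfl⟩ := hx
    rw [norm_fderiv_iteratedFDeriv]
    refine (hC _).trans (mul_le_mul_of_nonneg_left (Real.exp_le_exp.2 ?_) hC0)
    have h1 : ∀ i, b i * z i ^ 2 + (ε / 2 - (b i + ε)) * (z + s • (y - z)) i ^ 2 ≤
        (2 * b i ^ 2 / ε + b i) * (y i - z i) ^ 2 := fun i => by
      have := exp_quad_le (β := b i) (z := z i) (t := y i - z i) (s := s) hε (hb i)
        (by rw [abs_of_nonneg hs.1]; exact hs.2)
      simpa using this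
    have h2 : ∑ i, (2 * b i ^ 2 / ε + b i) * (y i - z i) ^ 2 ≤ K * R := by
      rw [hR, Finset.mul_sum]
      refine Finset.sum_le_sum fun i _ => mul_le_mul_of_nonneg_right ?_ (sq_nonneg _)
      exact Finset.single_le_sum (f := fun i => 2 * b i ^ 2 / ε + b i)
        (fun i _ => hKi i) (Finset.mem_univ i)
    have h3 := Finset.sum_le_sum fun i (_ : i ∈ Finset.univ) => h1 i
    rw [Finset.sum_add_distrib] at h3
    linarith
  have hdiff : ∀ x ∈ segment ℝ z y, DifferentiableAt ℝ (iteratedFDeriv ℝ l f) x := fun x _ =>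
    (hf.1.differentiable_iteratedFDeriv (by exact_mod_cast ENat.natCast_lt_top l)) x
  have hmv := (convex_segment z y).norm_image_sub_le_of_norm_fderiv_le hdiff hbound
    (left_mem_segment ℝ z y) (right_mem_segment ℝ z y)
  have hsup : ‖y - z‖ ^ 2 ≤ R := by
    have h1 : ‖y - z‖ ≤ Real.sqrt R := by
      rw [pi_norm_le_iff_of_nonneg (Real.sqrt_nonneg _)]
      intro i
      rw [Real.norm_eq_abs, Pi.sub_apply]
      refine Real.abs_le_sqrt ?_
      exact Finset.single_le_sum (f := fun i => (y i - z i) ^ 2)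
        (fun i _ => sq_nonneg _) (Finset.mem_univ i)
    calc ‖y - z‖ ^ 2 ≤ Real.sqrt R ^ 2 := by gcongr
      _ = R := Real.sq_sqrt hR0
  calc Real.exp (2 * Q) * ‖iteratedFDeriv ℝ l f y - iteratedFDeriv ℝ l f z‖ ^ 2
      ≤ Real.exp (2 * Q) * (C * Real.exp (K * R - Q) * ‖y - z‖) ^ 2 := by gcongr
    _ = C ^ 2 * ‖y - z‖ ^ 2 * Real.exp (2 * K * R) := by
        have : Real.exp (2 * K * R) = Real.exp (2 * Q) * Real.exp (K * R - Q) ^ 2 := by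
          rw [← Real.exp_nat_mul, ← Real.exp_add]; congr 1; push_cast; ring
        rw [this]; ring
    _ ≤ _ := by gcongr

/-- A Gaussian bounded function `q` of Gaussian variables `Zᵢ` can be approximated, together with
its derivatives, by functions `f` with bounded derivatives evaluated at nearby Gaussian variables
`Yᵢ`, even in the presence of the weight `exp(2 ∑ bᵢ Zᵢ²)`. -/
theorem IsGaussBounded.exists_approx [Nonempty ι] {b : ι → ℝ} (hb : ∀ i, 0 ≤ b i)
    {q : (ι → ℝ) → ℝ} (hq : IsGaussBounded b q) {Z : ι → Ω → ℝ} {w : ι → ℝ≥0}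
    (hZ : ∀ i, P.map (Z i) = gaussianReal 0 (w i)) (k : ℕ) {σ : ℝ} (hσ : 0 < σ) :
    ∃ f : (ι → ℝ) → ℝ, ContDiff ℝ ∞ f ∧ (∀ l : ℕ, ∃ C : ℝ, ∀ x, ‖iteratedFDeriv ℝ l f x‖ ≤ C) ∧
      ∃ τ : ℝ, 0 < τ ∧ ∀ Y : ι → Ω → ℝ,
        (∀ i, ∃ w' : ℝ≥0, (w' : ℝ) ≤ τ ∧ P.map (fun x => Y i x - Z i x) = gaussianReal 0 w') →
        ∀ l ≤ k, ∫⁻ x, ENNReal.ofReal (Real.exp (2 * ∑ i, b i * Z i x ^ 2) *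
          ‖iteratedFDeriv ℝ l f (fun i => Y i x) - iteratedFDeriv ℝ l q (fun i => Z i x)‖ ^ 2) ∂P
          ≤ ENNReal.ofReal σ := by
  set M : ℝ := ((Fintype.card ι : ℕ) : ℝ) with hM
  have hM0 : 0 < M := by rw [hM]; exact_mod_cast Fintype.card_pos
  set S : ℝ := 1 + ∑ i, (w i : ℝ) with hS
  have hS0 : 0 < S := by have : 0 ≤ ∑ i, (w i : ℝ) := Finset.sum_nonneg fun i _ => (w i).2
                         rw [hS]; linarith
  have hwS : ∀ i, (w i : ℝ) ≤ S := fun i => by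
    have := Finset.single_le_sum (f := fun i => (w i : ℝ)) (fun i _ => (w i).2) (Finset.mem_univ i)
    rw [hS]; linarith
  -- The loss `δ` in the rates is so small that `exp(2δ ∑ Zᵢ²)` is integrable.
  set δ : ℝ := 1 / (8 * M * S) with hδ
  have hδ0 : 0 < δ := by positivity
  choose C hC0 hC using fun l => hq.sub_cutoff l hδ0
  set A : ℝ := ∑ l ∈ Finset.range (k + 1), C l with hA
  have hA0 : 0 ≤ A := Finset.sum_nonneg fun l _ => hC0 l
  have hCA : ∀ l ≤ k, C l ≤ A := fun l hl =>
    Finset.single_le_sum (f := C) (fun l _ => hC0 l) (Finset.mem_range.2 (by omega))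
  -- The cutoff parameter `ε` makes the error of the cutoff at `Z` small.
  set ε : ℝ := min 1 (σ / (8 * (A ^ 2 + 1))) with hε
  have hε0 : 0 < ε := lt_min one_pos (by positivity)
  have hε1 : ε ≤ 1 := min_le_left _ _
  have hεA : 4 * (ε * A ^ 2) ≤ σ / 2 := by
    have h1 : ε ≤ σ / (8 * (A ^ 2 + 1)) := min_le_right _ _
    rw [le_div_iff₀ (by positivity)] at h1
    nlinarith
  have hf : IsGaussBounded (fun i => b i + ε) fun z => q z * gaussCutoff ι ε z :=
    hq.mul (isGaussBounded_gaussCutoff ε)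
  set f : (ι → ℝ) → ℝ := fun z => q z * gaussCutoff ι ε z with hfdef
  choose B K hB0 hK0 hBK using fun l => hf.weighted_sub_le hb hε0 l
  set B' : ℝ := ∑ l ∈ Finset.range (k + 1), B l with hB'
  set K' : ℝ := ∑ l ∈ Finset.range (k + 1), K l with hK'
  have hB0' : 0 ≤ B' := Finset.sum_nonneg fun l _ => hB0 l
  have hK0' : 0 ≤ K' := Finset.sum_nonneg fun l _ => hK0 l
  -- The constants `B`, `K` of the mean value estimate depend on `ε`; as `R ≤ ρ exp(R / ρ)`, a small
  -- factor `ρ` is gained for a larger exponent, which a small variance `τ` compensates.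
  set ρ : ℝ := σ / (8 * (B' + 1)) with hρ
  have hρ0 : 0 < ρ := by positivity
  have hρB : 4 * (B' * ρ) ≤ σ / 2 := by
    have h1 : ρ * (8 * (B' + 1)) = σ := by rw [hρ]; field_simp
    nlinarith
  set τ : ℝ := 1 / (4 * ((K' + 1 / ρ) * M)) with hτ
  have hτ0 : 0 < τ := by positivity
  refine ⟨f, hf.1, fun l => hf.bounded hε0 (fun i => by have := hb i; linarith) l, τ, hτ0,
    fun Y hY l hl => ?_⟩
  choose w' hw' hYlaw using hY
  have hpt : ∀ x, Real.exp (2 * ∑ i, b i * Z i x ^ 2) *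
        ‖iteratedFDeriv ℝ l f (fun i => Y i x) - iteratedFDeriv ℝ l q (fun i => Z i x)‖ ^ 2 ≤
      2 * (B' * ρ) * Real.exp ((K' + 1 / ρ) * ∑ i, (Y i x - Z i x) ^ 2) +
      2 * (ε * A ^ 2) * Real.exp (2 * δ * ∑ i, Z i x ^ 2) := by
    intro x
    set z : ι → ℝ := fun i => Z i x with hz
    set y : ι → ℝ := fun i => Y i x with hy
    have h1 := hBK l z y
    have h2 := hC l ε hε0 hε1 z
    set R : ℝ := ∑ i, (y i - z i) ^ 2 with hR
    have hR0 : 0 ≤ R := Finset.sum_nonneg fun i _ => sq_nonneg _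
    set E : ℝ := Real.exp (2 * ∑ i, b i * z i ^ 2) with hE
    have hE0 : 0 < E := Real.exp_pos _
    have h3 : ‖iteratedFDeriv ℝ l f y - iteratedFDeriv ℝ l q z‖ ^ 2 ≤
        2 * ‖iteratedFDeriv ℝ l f y - iteratedFDeriv ℝ l f z‖ ^ 2 +
        2 * ‖iteratedFDeriv ℝ l f z - iteratedFDeriv ℝ l q z‖ ^ 2 := by
      have h := norm_sub_le_norm_sub_add_norm_sub (iteratedFDeriv ℝ l f y)
        (iteratedFDeriv ℝ l f z) (iteratedFDeriv ℝ l q z)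
      have h0 := norm_nonneg (iteratedFDeriv ℝ l f y - iteratedFDeriv ℝ l q z)
      nlinarith [sq_nonneg (‖iteratedFDeriv ℝ l f y - iteratedFDeriv ℝ l f z‖ -
        ‖iteratedFDeriv ℝ l f z - iteratedFDeriv ℝ l q z‖)]
    have h4 : B l * R * Real.exp (K l * R) ≤ B' * ρ * Real.exp ((K' + 1 / ρ) * R) := by
      have hBl : B l ≤ B' := Finset.single_le_sum (f := B) (fun l _ => hB0 l)
        (Finset.mem_range.2 (by omega))
      have hKl : K l ≤ K' := Finset.single_le_sum (f := K) (fun l _ => hK0 l)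
        (Finset.mem_range.2 (by omega))
      have hRe : R ≤ ρ * Real.exp (1 / ρ * R) := by
        have := Real.add_one_le_exp (1 / ρ * R)
        have h5 : R = ρ * (1 / ρ * R) := by field_simp
        nlinarith
      calc B l * R * Real.exp (K l * R)
          ≤ B' * (ρ * Real.exp (1 / ρ * R)) * Real.exp (K' * R) := by gcongr
        _ = _ := by rw [add_mul, Real.exp_add]; ring
    have h5 : E * ‖iteratedFDeriv ℝ l f z - iteratedFDeriv ℝ l q z‖ ^ 2 ≤
        ε * A ^ 2 * Real.exp (2 * δ * ∑ i, z i ^ 2) := by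
      have hE2 : E * Real.exp (∑ i, (δ - b i) * z i ^ 2) ^ 2 =
          Real.exp (2 * δ * ∑ i, z i ^ 2) := by
        rw [hE, ← Real.exp_nat_mul, ← Real.exp_add, Finset.mul_sum, Finset.mul_sum, Finset.mul_sum,
          ← Finset.sum_add_distrib]
        congr 1
        refine Finset.sum_congr rfl fun i _ => ?_
        push_cast; ring
      calc _ ≤ E * (Real.sqrt ε * C l * Real.exp (∑ i, (δ - b i) * z i ^ 2)) ^ 2 := by gcongr
        _ = ε * C l ^ 2 * (E * Real.exp (∑ i, (δ - b i) * z i ^ 2) ^ 2) := by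
            rw [mul_pow, mul_pow, Real.sq_sqrt hε0.le]; ring
        _ ≤ ε * A ^ 2 * (E * Real.exp (∑ i, (δ - b i) * z i ^ 2) ^ 2) := by
            have := hCA l hl
            have := hC0 l
            gcongr
        _ = _ := by rw [hE2]
    calc _ ≤ E * (2 * ‖iteratedFDeriv ℝ l f y - iteratedFDeriv ℝ l f z‖ ^ 2 +
        2 * ‖iteratedFDeriv ℝ l f z - iteratedFDeriv ℝ l q z‖ ^ 2) := by gcongr
      _ = 2 * (E * ‖iteratedFDeriv ℝ l f y - iteratedFDeriv ℝ l f z‖ ^ 2) +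
          2 * (E * ‖iteratedFDeriv ℝ l f z - iteratedFDeriv ℝ l q z‖ ^ 2) := by ring
      _ ≤ 2 * (B' * ρ * Real.exp ((K' + 1 / ρ) * R)) +
          2 * (ε * A ^ 2 * Real.exp (2 * δ * ∑ i, z i ^ 2)) := by
            have := h1.trans h4
            linarith
      _ = _ := by ring
  have hm := aemeasurable_exp_sum_sq hZ (2 * δ)
  have hI1 := lintegral_exp_sum_sq_le hYlaw (s := K' + 1 / ρ) fun i => by
    calc (K' + 1 / ρ) * Fintype.card ι * (w' i : ℝ) ≤ (K' + 1 / ρ) * M * τ := by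
          gcongr; exact hw' i
      _ = 1 / 4 := by rw [hτ]; field_simp
  have hI2 := lintegral_exp_sum_sq_le hZ (s := 2 * δ) fun i => by
    calc 2 * δ * Fintype.card ι * (w i : ℝ) ≤ 2 * δ * M * S := by
          gcongr; exact hwS i
      _ = 1 / 4 := by rw [hδ]; field_simp; norm_num
  calc _ ≤ ∫⁻ x, (ENNReal.ofReal (2 * (B' * ρ)) *
        ENNReal.ofReal (Real.exp ((K' + 1 / ρ) * ∑ i, (Y i x - Z i x) ^ 2)) +
        ENNReal.ofReal (2 * (ε * A ^ 2)) *
        ENNReal.ofReal (Real.exp (2 * δ * ∑ i, Z i x ^ 2))) ∂P := by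
        refine lintegral_mono fun x => ?_
        rw [← ENNReal.ofReal_mul (by positivity), ← ENNReal.ofReal_mul (by positivity),
          ← ENNReal.ofReal_add (by positivity) (by positivity)]
        exact ENNReal.ofReal_le_ofReal (hpt x)
    _ = ENNReal.ofReal (2 * (B' * ρ)) *
        ∫⁻ x, ENNReal.ofReal (Real.exp ((K' + 1 / ρ) * ∑ i, (Y i x - Z i x) ^ 2)) ∂P +
        ENNReal.ofReal (2 * (ε * A ^ 2)) *
        ∫⁻ x, ENNReal.ofReal (Real.exp (2 * δ * ∑ i, Z i x ^ 2)) ∂P := by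
        rw [lintegral_add_right' _ (hm.const_mul _),
          lintegral_const_mul' _ _ ENNReal.ofReal_ne_top,
          lintegral_const_mul' _ _ ENNReal.ofReal_ne_top]
    _ ≤ ENNReal.ofReal (2 * (B' * ρ)) * 2 + ENNReal.ofReal (2 * (ε * A ^ 2)) * 2 := by gcongr
    _ = ENNReal.ofReal (4 * (B' * ρ) + 4 * (ε * A ^ 2)) := by
        rw [← ENNReal.ofReal_ofNat, ← ENNReal.ofReal_mul (by positivity),
          ← ENNReal.ofReal_mul (by positivity),
          ← ENNReal.ofReal_add (by positivity) (by positivity)]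
        congr 1; ring
    _ ≤ ENNReal.ofReal σ := ENNReal.ofReal_le_ofReal (by linarith)

end

end

section

/-! ### Hilbert-Schmidt norms of multilinear maps -/

lemma tsum_prod_eq_prod_tsum {l : ℕ} (f : Fin l → ℕ → ℝ≥0∞) :
    ∑' α : Fin l → ℕ, ∏ j, f j (α j) = ∏ j, ∑' a, f j a := by
  induction l with
  | zero => simp
  | succ l ih =>
    rw [← (Fin.consEquiv fun _ : Fin (l + 1) => ℕ).tsum_eq, ENNReal.tsum_prod']
    simp only [Fin.consEquiv_apply, Fin.prod_univ_succ, Fin.cons_zero, Fin.cons_succ]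
    simp_rw [ENNReal.tsum_mul_left]
    rw [ENNReal.tsum_mul_right, ih fun j => f j.succ]

section

variable {E : Type*} [NormedAddCommGroup E] [NormedSpace ℝ E] {l : ℕ}

lemma tsum_multilinear_sq_le (A : ContinuousMultilinearMap ℝ (fun _ : Fin l => E) ℝ) (u : ℕ → E) :
    ∑' α : Fin l → ℕ, ‖A fun j => u (α j)‖ₑ ^ 2 ≤ ‖A‖ₑ ^ 2 * (∑' a, ‖u a‖ₑ ^ 2) ^ l := by
  calc ∑' α : Fin l → ℕ, ‖A fun j => u (α j)‖ₑ ^ 2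
      ≤ ∑' α : Fin l → ℕ, ‖A‖ₑ ^ 2 * ∏ j, ‖u (α j)‖ₑ ^ 2 := by
        refine ENNReal.tsum_le_tsum fun α => ?_
        rw [Finset.prod_pow, ← mul_pow]
        gcongr
        have := A.le_opNorm fun j => u (α j)
        rw [← ofReal_norm, ← ofReal_norm]
        simp_rw [← ofReal_norm]
        rw [← ENNReal.ofReal_prod_of_nonneg fun _ _ => norm_nonneg _,
          ← ENNReal.ofReal_mul (norm_nonneg _)]
        exact ENNReal.ofReal_le_ofReal this
    _ = ‖A‖ₑ ^ 2 * (∑' a, ‖u a‖ₑ ^ 2) ^ l := by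
        rw [ENNReal.tsum_mul_left, tsum_prod_eq_prod_tsum fun _ a => ‖u a‖ₑ ^ 2]
        simp

lemma tsum_multilinear_sub_sq_le (A : ContinuousMultilinearMap ℝ (fun _ : Fin l => E) ℝ)
    (u u' : ℕ → E) :
    ∑' α : Fin l → ℕ, ‖(A fun j => u (α j)) - A fun j => u' (α j)‖ₑ ^ 2 ≤
      ‖A‖ₑ ^ 2 * ((l : ℝ≥0∞) ^ 2 * (∑' a, ‖u a - u' a‖ₑ ^ 2) *
        (∑' a, (‖u a‖ₑ ^ 2 + ‖u' a‖ₑ ^ 2)) ^ (l - 1)) := by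
  classical
  set g : Fin l → Fin l → ℕ → ℝ := fun i j a =>
    if j = i then ‖u a - u' a‖ ^ 2 else ‖u a‖ ^ 2 + ‖u' a‖ ^ 2 with hg
  have hg0 : ∀ i j a, 0 ≤ g i j a := fun i j a => by
    simp only [hg]; split_ifs <;> positivity
  have hpt : ∀ α : Fin l → ℕ, ‖(A fun j => u (α j)) - A fun j => u' (α j)‖ ^ 2 ≤
      ‖A‖ ^ 2 * (l * ∑ i, ∏ j, g i j (α j)) := by
    intro α
    have h1 := A.norm_image_sub_le' (fun j => u (α j)) fun j => u' (α j)
    set p : Fin l → ℝ := fun i => ∏ j, if j = i then ‖u (α i) - u' (α i)‖ else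
      max ‖u (α j)‖ ‖u' (α j)‖ with hp
    have h2 : (∑ i, p i) ^ 2 ≤ l * ∑ i, p i ^ 2 := by
      have := sq_sum_le_card_mul_sum_sq (s := Finset.univ) (f := p)
      rwa [Finset.card_univ, Fintype.card_fin] at this
    have h3 : ∀ i, p i ^ 2 ≤ ∏ j, g i j (α j) := fun i => by
      rw [hp, ← Finset.prod_pow]
      refine Finset.prod_le_prod (fun _ _ => sq_nonneg _) fun j _ => ?_
      simp only [hg]
      split_ifs with h
      · rw [h]
      · rcases max_cases ‖u (α j)‖ ‖u' (α j)‖ with ⟨h, _⟩ | ⟨h, _⟩ <;> rw [h] <;>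
          nlinarith [sq_nonneg ‖u (α j)‖, sq_nonneg ‖u' (α j)‖]
    calc _ ≤ (‖A‖ * ∑ i, p i) ^ 2 := by gcongr
      _ = ‖A‖ ^ 2 * (∑ i, p i) ^ 2 := by ring
      _ ≤ ‖A‖ ^ 2 * (l * ∑ i, p i ^ 2) := by gcongr
      _ ≤ _ := by gcongr with i; exact h3 i
  have hprod : ∀ i : Fin l, ∑' α : Fin l → ℕ, ENNReal.ofReal (∏ j, g i j (α j)) =
      (∑' a, ‖u a - u' a‖ₑ ^ 2) * (∑' a, (‖u a‖ₑ ^ 2 + ‖u' a‖ₑ ^ 2)) ^ (l - 1) := by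
    intro i
    simp_rw [ENNReal.ofReal_prod_of_nonneg fun j _ => hg0 i j _]
    rw [tsum_prod_eq_prod_tsum fun j a => ENNReal.ofReal (g i j a),
      ← Finset.mul_prod_erase _ _ (Finset.mem_univ i)]
    congr 1
    · refine tsum_congr fun a => ?_
      simp only [hg, if_true]
      rw [ENNReal.ofReal_pow (norm_nonneg _), ofReal_norm]
    · rw [Finset.prod_congr rfl (g := fun _ => ∑' a, (‖u a‖ₑ ^ 2 + ‖u' a‖ₑ ^ 2)), Finset.prod_const,
        Finset.card_erase_of_mem (Finset.mem_univ i), Finset.card_univ, Fintype.card_fin]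
      intro j hj
      refine tsum_congr fun a => ?_
      simp only [hg, if_neg (Finset.ne_of_mem_erase hj)]
      rw [ENNReal.ofReal_add (by positivity) (by positivity), ENNReal.ofReal_pow (norm_nonneg _),
        ENNReal.ofReal_pow (norm_nonneg _), ofReal_norm, ofReal_norm]
  calc ∑' α : Fin l → ℕ, ‖(A fun j => u (α j)) - A fun j => u' (α j)‖ₑ ^ 2
      ≤ ∑' α : Fin l → ℕ, ‖A‖ₑ ^ 2 * (l * ∑ i, ENNReal.ofReal (∏ j, g i j (α j))) := by
        refine ENNReal.tsum_le_tsum fun α => ?_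
        rw [← ofReal_norm, ← ofReal_norm, ← ENNReal.ofReal_pow (norm_nonneg _),
          ← ENNReal.ofReal_pow (norm_nonneg _), ← ENNReal.ofReal_natCast,
          ← ENNReal.ofReal_sum_of_nonneg fun i _ => Finset.prod_nonneg fun j _ => hg0 i j _,
          ← ENNReal.ofReal_mul (Nat.cast_nonneg _), ← ENNReal.ofReal_mul (sq_nonneg _)]
        exact ENNReal.ofReal_le_ofReal (hpt α)
    _ = ‖A‖ₑ ^ 2 * (l * ∑ _i : Fin l, ((∑' a, ‖u a - u' a‖ₑ ^ 2) *
          (∑' a, (‖u a‖ₑ ^ 2 + ‖u' a‖ₑ ^ 2)) ^ (l - 1))) := by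
        rw [ENNReal.tsum_mul_left, ENNReal.tsum_mul_left]
        congr 2
        rw [Summable.tsum_finsetSum fun i _ => ENNReal.summable]
        exact Finset.sum_congr rfl fun i _ => hprod i
    _ = _ := by
        rw [Finset.sum_const, Finset.card_univ, Fintype.card_fin, nsmul_eq_mul]
        ring

end

/-! ### The eigenfunctions as functions of finitely many coordinates -/

/-- The Gaussian rates `|1+ζᵢ|/2` of the ground state in its negative directions. -/
def rate (ζ : ℕ → ℝ) (N i : ℕ) : ℝ := if i < N then |1 + ζ i| / 2 else 0

lemma rate_nonneg (ζ : ℕ → ℝ) (N i : ℕ) : 0 ≤ rate ζ N i := by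
  unfold rate; split_ifs <;> positivity

/-- The polynomial part of the `i`-th factor of an eigenfunction. -/
def profilePoly (ζ : ℕ → ℝ) (N : ℕ) (n : ℕ →₀ ℕ) (i : ℕ) : Polynomial ℝ :=
  Polynomial.C (Real.exp (rate ζ N i) / Real.sqrt ((n i).factorial : ℝ)) *
    (hermiteR (n i)).comp (Polynomial.C (Real.sqrt |1 + ζ i|) * Polynomial.X)

/-- The function `q` on `ℝ^M` such that `𝐞ₙ = q(Z₀, …, Z_{M-1})`, with `Zᵢ = √λ ηᵢ`. It does not
depend on `λ`. -/
def profile (ζ : ℕ → ℝ) (N : ℕ) (n : ℕ →₀ ℕ) (M : ℕ) (z : Fin M → ℝ) : ℝ :=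
  |det2 fun i => |1 + ζ i| - 1| ^ (1 / 4 : ℝ) *
    ∏ i : Fin M, (profilePoly ζ N n i).eval (z i) * Real.exp (-(rate ζ N i * z i ^ 2))

lemma isGaussBounded_profile (ζ : ℕ → ℝ) (N : ℕ) (n : ℕ →₀ ℕ) (M : ℕ) :
    IsGaussBounded (fun i : Fin M => rate ζ N i) (profile ζ N n M) := by
  have h := (IsGaussBounded.const (ι := Fin M) (|det2 fun i => |1 + ζ i| - 1| ^ (1 / 4 : ℝ))).mul
    (IsGaussBounded.prod (fun i : Fin M => profilePoly ζ N n i) fun i => rate ζ N i)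
  rw [zero_add] at h
  exact h

section

variable {d m : ℕ} {v : Fin m → StrongDual ℝ (PathSpace d)} {ν : Measure (W0 v)} {lam : ℝ}
  {e : HilbertBasis ℕ ℝ (H0 v)} {ζ : ℕ → ℝ} {N M : ℕ}

/-- The vector of the first `M` coordinates `Zᵢ = √λ ηᵢ`. -/
def coordVec (ν : Measure (W0 v)) (lam : ℝ) (e : HilbertBasis ℕ ℝ (H0 v)) (M : ℕ) (η : W0 v) :
    Fin M → ℝ := fun i => coord ν lam e i η

lemma measurable_coordVec : Measurable (coordVec ν lam e M) :=
  measurable_pi_lambda _ fun i => measurable_coord i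

namespace SpectralData

lemma eigenfunction_eq_profile (hS : SpectralData ν lam ζ N) {n : ℕ →₀ ℕ} (hN : N ≤ M)
    (hn : n.support ⊆ Finset.range M) (η : W0 v) :
    eigenfunction ν lam e ζ N n η = profile ζ N n M (coordVec ν lam e M η) := by
  have hfac : ∀ i, (profilePoly ζ N n i).eval (coord ν lam e i η) *
      Real.exp (-(rate ζ N i * coord ν lam e i η ^ 2)) =
      normHermite (n i) (groundCoord ν lam e ζ i η) *
        if i < N then Real.exp (-(lam / 2) * |1 + ζ i| * (wienerIntegral ν (e i) η ^ 2 - 1 / lam))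
          else 1 := by
    intro i
    have h1 : (profilePoly ζ N n i).eval (coord ν lam e i η) = Real.exp (rate ζ N i) *
        normHermite (n i) (groundCoord ν lam e ζ i η) := by
      rw [profilePoly, hS.groundCoord_eq, normHermite_eq]
      simp only [Polynomial.eval_mul, Polynomial.eval_C, Polynomial.eval_comp, Polynomial.eval_X]
      ring
    have h2 : Real.exp (rate ζ N i) * Real.exp (-(rate ζ N i * coord ν lam e i η ^ 2)) =
        if i < N then Real.exp (-(lam / 2) * |1 + ζ i| * (wienerIntegral ν (e i) η ^ 2 - 1 / lam))
          else 1 := by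
      rw [← Real.exp_add, coord, mul_pow, Real.sq_sqrt hS.lam_pos.le, rate]
      have := hS.lam_pos.ne'
      split_ifs
      · congr 1; field_simp; ring
      · simp
    rw [h1, ← h2]; ring
  rw [eigenfunction, profile, mul_assoc]
  congr 1
  have h1 : ∏ i : Fin M, (profilePoly ζ N n i).eval (coordVec ν lam e M η i) *
      Real.exp (-(rate ζ N i * coordVec ν lam e M η i ^ 2)) =
      ∏ i ∈ Finset.range M, ((profilePoly ζ N n i).eval (coord ν lam e i η) *
        Real.exp (-(rate ζ N i * coord ν lam e i η ^ 2))) :=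
    Fin.prod_univ_eq_prod_range (fun i => (profilePoly ζ N n i).eval (coord ν lam e i η) *
        Real.exp (-(rate ζ N i * coord ν lam e i η ^ 2))) M
  rw [h1, Finset.prod_congr rfl fun i _ => hfac i, Finset.prod_mul_distrib,
    hermiteProd_eq_of_subset hn]
  congr 1
  rw [Finset.prod_ite, Finset.prod_const_one, mul_one]
  refine Finset.prod_congr ?_ fun i _ => rfl
  ext i
  simp only [Finset.mem_filter, Finset.mem_range]
  omega

end SpectralData

/-- The constant relating the weighted measure to the ground state measure. -/
def tiltConst (ζ : ℕ → ℝ) (N : ℕ) : ℝ :=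
  (|det2 fun i => |1 + ζ i| - 1| ^ (1 / 2 : ℝ) * Real.exp (∑ i ∈ Finset.range N, |1 + ζ i|))⁻¹

lemma tiltConst_nonneg (ζ : ℕ → ℝ) (N : ℕ) : 0 ≤ tiltConst ζ N := by
  unfold tiltConst; positivity

namespace SpectralData

/-- In terms of the ground state measure, the weighted measure has a density which is a positive
exponential of the squares of the negative coordinates. -/
lemma lintegral_tilt (hS : SpectralData ν lam ζ N) (hN : N ≤ M) (f : W0 v → ℝ≥0∞) :
    ∫⁻ η, f η ∂(tilt ν lam e ζ) = ENNReal.ofReal (tiltConst ζ N) *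
      ∫⁻ η, ENNReal.ofReal (Real.exp (2 * ∑ i : Fin M, rate ζ N i * coordVec ν lam e M η i ^ 2)) *
        f η ∂(groundMeasure ν lam e ζ N) := by
  have hpos : ∀ η, 0 < eigenfunction ν lam e ζ N 0 η ^ 2 := fun η =>
    pow_pos (hS.eigenfunction_zero_pos η) 2
  have hg : ∀ η, (ENNReal.ofReal (eigenfunction ν lam e ζ N 0 η ^ 2))⁻¹ =
      ENNReal.ofReal (tiltConst ζ N) * ENNReal.ofReal
        (Real.exp (2 * ∑ i : Fin M, rate ζ N i * coordVec ν lam e M η i ^ 2)) := by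
    intro η
    rw [← ENNReal.ofReal_inv_of_pos (hpos η), ← ENNReal.ofReal_mul (tiltConst_nonneg _ _)]
    congr 1
    have h1 : ∑ i : Fin M, rate ζ N i * coordVec ν lam e M η i ^ 2 =
        ∑ i ∈ Finset.range N, |1 + ζ i| / 2 * coord ν lam e i η ^ 2 := by
      have := Fin.sum_univ_eq_sum_range (fun i => rate ζ N i * coord ν lam e i η ^ 2) M
      rw [show ∑ i : Fin M, rate ζ N i * coordVec ν lam e M η i ^ 2 =
        ∑ i : Fin M, rate ζ N i * coord ν lam e i η ^ 2 from rfl, this,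
        ← Finset.sum_subset (Finset.range_subset_range.2 hN)]
      · refine Finset.sum_congr rfl fun i hi => ?_
        rw [rate, if_pos (Finset.mem_range.1 hi)]
      · intro i _ hi
        rw [rate, if_neg (by simpa using hi), zero_mul]
    have h2 : eigenfunction ν lam e ζ N 0 η ^ 2 =
        |det2 fun i => |1 + ζ i| - 1| ^ (1 / 2 : ℝ) *
        Real.exp (∑ i ∈ Finset.range N, |1 + ζ i| -
          2 * ∑ i ∈ Finset.range N, |1 + ζ i| / 2 * coord ν lam e i η ^ 2) := by
      rw [eigenfunction, hermiteProd_zero, mul_one, mul_pow, ← Real.exp_sum, ← Real.exp_nat_mul]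
      congr 1
      · rw [← Real.rpow_natCast, ← Real.rpow_mul (abs_nonneg _)]; norm_num
      · congr 1
        rw [Finset.mul_sum, Finset.mul_sum, ← Finset.sum_sub_distrib]
        refine Finset.sum_congr rfl fun i _ => ?_
        rw [coord, mul_pow, Real.sq_sqrt hS.lam_pos.le]
        have := hS.lam_pos.ne'
        field_simp
        push_cast; ring
    rw [h1, h2, tiltConst, Real.exp_sub, mul_inv, mul_inv]
    have := Real.exp_pos (∑ i ∈ Finset.range N, |1 + ζ i|)
    have := Real.exp_pos (2 * ∑ i ∈ Finset.range N, |1 + ζ i| / 2 * coord ν lam e i η ^ 2)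
    field_simp
  have hm : Measurable fun η => ENNReal.ofReal (eigenfunction ν lam e ζ N 0 η ^ 2) :=
    ((measurable_eigenfunction 0).pow_const 2).ennreal_ofReal
  have hinv : tilt ν lam e ζ = (groundMeasure ν lam e ζ N).withDensity
      fun η => (ENNReal.ofReal (eigenfunction ν lam e ζ N 0 η ^ 2))⁻¹ :=
    (withDensity_inv_same hm (Eventually.of_forall fun η => by
      rw [Ne, ENNReal.ofReal_eq_zero, not_le]; exact hpos η)
      (Eventually.of_forall fun _ => ENNReal.ofReal_ne_top)).symm
  have hm' : Measurable fun η => (ENNReal.ofReal (eigenfunction ν lam e ζ N 0 η ^ 2))⁻¹ := hm.inv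
  rw [hinv, lintegral_withDensity_eq_lintegral_mul_non_measurable _ hm'
    (Eventually.of_forall fun η => by
      rw [hg]; exact ENNReal.mul_lt_top ENNReal.ofReal_lt_top ENNReal.ofReal_lt_top),
    ← lintegral_const_mul' _ _ ENNReal.ofReal_ne_top]
  refine lintegral_congr fun η => ?_
  rw [Pi.mul_apply, hg, mul_assoc]

end SpectralData

/-- The `Lᵖ` norms of the derivatives of an eigenfunction, as a function of the coordinates `Zᵢ`,
are bounded uniformly in `λ`: for `p ≥ 2` the decay of the eigenfunction beats the growth of the
density. -/
lemma exists_eLpNorm_profile_le (ζ : ℕ → ℝ) (N : ℕ) (n : ℕ →₀ ℕ) (hN : N ≤ M) [Nonempty (Fin M)]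
    (k : ℕ) {p : ℝ} (hp : 2 ≤ p) : ∃ C : ℝ, 0 ≤ C ∧
      ∀ (d m : ℕ) (v : Fin m → StrongDual ℝ (PathSpace d)) (ν : Measure (W0 v)) (lam : ℝ)
        (e : HilbertBasis ℕ ℝ (H0 v)), SpectralData ν lam ζ N →
        eLpNorm (fun η => iteratedFDeriv ℝ k (profile ζ N n M) (coordVec ν lam e M η))
          (ENNReal.ofReal p) (tilt ν lam e ζ) ≤ ENNReal.ofReal C := by
  have hp0 : 0 < p := by linarith
  set S : ℝ := 1 + ∑ i : Fin M, |1 + ζ i|⁻¹ with hSdef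
  have hS0 : 0 < S := by
    have : 0 ≤ ∑ i : Fin M, |1 + ζ i|⁻¹ := Finset.sum_nonneg fun i _ => by positivity
    rw [hSdef]; linarith
  have hwS : ∀ i : Fin M, |1 + ζ i|⁻¹ ≤ S := fun i => by
    have := Finset.single_le_sum (f := fun i : Fin M => |1 + ζ i|⁻¹)
      (fun i _ => by positivity) (Finset.mem_univ i)
    rw [hSdef]; linarith
  have hM0 : (0 : ℝ) < Fintype.card (Fin M) := by exact_mod_cast Fintype.card_pos
  set δ : ℝ := 1 / (4 * p * (Fintype.card (Fin M) : ℝ) * S) with hδ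
  have hδ0 : 0 < δ := by positivity
  obtain ⟨C, hC0, hC⟩ := (isGaussBounded_profile ζ N n M).2 k δ hδ0
  refine ⟨(tiltConst ζ N * (C ^ p * 2)) ^ (1 / p), by have := tiltConst_nonneg ζ N; positivity, ?_⟩
  intro d m v ν lam e hS
  rw [eLpNorm_eq_lintegral_rpow_enorm_toReal (by simpa using hp0) ENNReal.ofReal_ne_top,
    ENNReal.toReal_ofReal hp0.le, ← ENNReal.ofReal_rpow_of_nonneg
      (by have := tiltConst_nonneg ζ N; positivity) (by positivity)]
  refine ENNReal.rpow_le_rpow ?_ (by positivity)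
  rw [hS.lintegral_tilt hN, ENNReal.ofReal_mul (tiltConst_nonneg _ _),
    ENNReal.ofReal_mul (by positivity), ENNReal.ofReal_ofNat]
  have hlaw : ∀ i : Fin M, (groundMeasure ν lam e ζ N).map (fun η => coordVec ν lam e M η i) =
      gaussianReal 0 (Real.toNNReal |1 + ζ i|⁻¹) := fun i => (hS.indep_coord_ground e).law i
  have hint := lintegral_exp_sum_sq_le hlaw (s := p * δ) fun i => by
    rw [Real.coe_toNNReal _ (by positivity)]
    calc p * δ * Fintype.card (Fin M) * |1 + ζ i|⁻¹ ≤ p * δ * Fintype.card (Fin M) * S := by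
          gcongr; exact hwS i
      _ = 1 / 4 := by rw [hδ]; field_simp
  have hpt : ∀ η, ENNReal.ofReal (Real.exp (2 * ∑ i : Fin M, rate ζ N i *
        coordVec ν lam e M η i ^ 2)) *
      ‖iteratedFDeriv ℝ k (profile ζ N n M) (coordVec ν lam e M η)‖ₑ ^ p ≤
      ENNReal.ofReal (C ^ p) *
        ENNReal.ofReal (Real.exp (p * δ * ∑ i, coordVec ν lam e M η i ^ 2)) := by
    intro η
    set z := coordVec ν lam e M η with hz
    rw [← ofReal_norm, ENNReal.ofReal_rpow_of_nonneg (norm_nonneg _) hp0.le,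
      ← ENNReal.ofReal_mul (Real.exp_pos _).le, ← ENNReal.ofReal_mul (by positivity)]
    refine ENNReal.ofReal_le_ofReal ?_
    have hQ : 0 ≤ ∑ i : Fin M, rate ζ N i * z i ^ 2 :=
      Finset.sum_nonneg fun i _ => mul_nonneg (rate_nonneg _ _ _) (sq_nonneg _)
    calc _ ≤ Real.exp (2 * ∑ i : Fin M, rate ζ N i * z i ^ 2) *
          (C * Real.exp (∑ i : Fin M, (δ - rate ζ N i) * z i ^ 2)) ^ p := by
          gcongr; exact hC z
      _ = C ^ p * Real.exp (2 * ∑ i : Fin M, rate ζ N i * z i ^ 2 +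
          p * ∑ i : Fin M, (δ - rate ζ N i) * z i ^ 2) := by
          rw [Real.mul_rpow hC0 (Real.exp_pos _).le, ← Real.exp_mul, Real.exp_add,
            mul_comm p (∑ i : Fin M, (δ - rate ζ N i) * z i ^ 2)]
          ring
      _ ≤ _ := by
          gcongr
          have h1 : ∑ i : Fin M, (δ - rate ζ N i) * z i ^ 2 =
              δ * ∑ i, z i ^ 2 - ∑ i : Fin M, rate ζ N i * z i ^ 2 := by
            rw [Finset.mul_sum, ← Finset.sum_sub_distrib]
            exact Finset.sum_congr rfl fun i _ => by ring
          rw [h1]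
          nlinarith
  gcongr
  calc _ ≤ ∫⁻ η, ENNReal.ofReal (C ^ p) *
        ENNReal.ofReal (Real.exp (p * δ * ∑ i, coordVec ν lam e M η i ^ 2))
          ∂(groundMeasure ν lam e ζ N) := lintegral_mono hpt
    _ ≤ _ := by
        rw [lintegral_const_mul' _ _ ENNReal.ofReal_ne_top]
        gcongr

end

end

section

/-! ### Cylindrical functions -/

variable {d m : ℕ} {v : Fin m → StrongDual ℝ (PathSpace d)} {ν : Measure (W0 v)} {lam : ℝ}
  {e : HilbertBasis ℕ ℝ (H0 v)} {ζ : ℕ → ℝ} {N M : ℕ}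

/-- The map `η ↦ (ψ₁(η), …, ψ_M(η))`. -/
def cylMap (ψ : Fin M → StrongDual ℝ (W0 v)) : W0 v →L[ℝ] (Fin M → ℝ) := ContinuousLinearMap.pi ψ

lemma cylMap_apply (ψ : Fin M → StrongDual ℝ (W0 v)) (η : W0 v) (i : Fin M) :
    cylMap ψ η i = ψ i η := rfl

section Cylinder

variable {f : (Fin M → ℝ) → ℝ} (ψ : Fin M → StrongDual ℝ (W0 v))

lemma hDerivCoord_cylinder (hf : ContDiff ℝ ∞ f) (l : ℕ) (α : Fin l → ℕ) (η : W0 v) :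
    hDerivCoord e (fun η => f (cylMap ψ η)) l α η =
      iteratedFDeriv ℝ l f (cylMap ψ η) fun j => cylMap ψ (incl0 v (e (α j))) := by
  have h1 : (fun h : H0 v => f (cylMap ψ (η + incl0 v h))) =
      (fun y => f (cylMap ψ η + y)) ∘ (cylMap ψ ∘L incl0 v) := by
    funext h; simp
  have h2 : ContDiff ℝ ∞ fun y => f (cylMap ψ η + y) := hf.comp (contDiff_const.add contDiff_id)
  rw [hDerivCoord, h1, ContinuousLinearMap.iteratedFDeriv_comp_right _ h2 0 (i := l)
    (by exact_mod_cast le_top), iteratedFDeriv_comp_add_left]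
  simp

/-- The `H`-derivative of a cylindrical function. -/
lemma hGrad_cylinder (hf : ContDiff ℝ ∞ f) (η : W0 v) :
    hGrad (fun η => f (cylMap ψ η)) η =
      ∑ i, (fderiv ℝ f (cylMap ψ η) (Pi.single i 1)) • dualRep0 (ψ i) := by
  rw [hGrad]
  refine HasGradientAt.gradient ?_
  rw [hasGradientAt_iff_hasFDerivAt]
  have h1 : HasFDerivAt (fun h : H0 v => cylMap ψ (η + incl0 v h)) (cylMap ψ ∘L incl0 v) 0 := by
    have h2 : (fun h : H0 v => cylMap ψ (η + incl0 v h)) =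
        fun h => cylMap ψ η + (cylMap ψ ∘L incl0 v) h := by
      funext h; simp
    rw [h2]
    exact (ContinuousLinearMap.hasFDerivAt _).const_add _
  have h3 : HasFDerivAt f (fderiv ℝ f (cylMap ψ η)) (cylMap ψ (η + incl0 v 0)) := by
    rw [map_zero, add_zero]
    exact (hf.differentiable (by simp)).differentiableAt.hasFDerivAt
  have h4 := h3.comp (0 : H0 v) h1
  refine h4.congr_fderiv (ContinuousLinearMap.ext fun h => ?_)
  rw [InnerProductSpace.toDual_apply_apply, sum_inner]
  simp only [inner_smul_left, inner_dualRep0]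
  have h5 : (cylMap ψ (incl0 v h)) = ∑ i, ψ i (incl0 v h) • (Pi.single i 1 : Fin M → ℝ) :=
    (pi_eq_sum_univ' (cylMap ψ (incl0 v h)))
  simp only [ContinuousLinearMap.comp_apply]
  rw [h5, map_sum]
  refine Finset.sum_congr rfl fun i _ => ?_
  rw [map_smul, smul_eq_mul, mul_comm]
  rfl

lemma continuous_hGrad_cylinder (hf : ContDiff ℝ ∞ f) :
    Continuous (hGrad fun η => f (cylMap ψ η)) := by
  have : hGrad (fun η => f (cylMap ψ η)) = fun η =>
      ∑ i, (fderiv ℝ f (cylMap ψ η) (Pi.single i 1)) • dualRep0 (ψ i) :=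
    funext fun η => hGrad_cylinder ψ hf η
  rw [this]
  have hc : Continuous (fderiv ℝ f) := hf.continuous_fderiv (by simp)
  fun_prop

lemma isSmoothCylinder_cylinder (hf : ContDiff ℝ ∞ f)
    (hb : ∀ k : ℕ, ∃ C : ℝ, ∀ x, ‖iteratedFDeriv ℝ k f x‖ ≤ C) :
    IsSmoothCylinder fun η => f (cylMap ψ η) := ⟨M, ψ, f, hf, hb, fun _ => rfl⟩

end Cylinder

lemma IsSmoothCylinder.exists_eq {F : W0 v → ℝ} (hF : IsSmoothCylinder F) :
    ∃ (r : ℕ) (ψ : Fin r → StrongDual ℝ (W0 v)) (f : (Fin r → ℝ) → ℝ), ContDiff ℝ ∞ f ∧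
      F = fun η => f (cylMap ψ η) := by
  obtain ⟨r, ψ, f, hf, -, h⟩ := hF
  exact ⟨r, ψ, f, hf, funext h⟩

lemma mem_closedGradGraph_of_approx {P : Measure (W0 v)} {u : W0 v → ℝ} {U : W0 v → H0 v}
    (hu : MemLp u 2 P) (hU : MemLp U 2 P)
    (h : ∀ ε : ℝ, 0 < ε → ∃ F : W0 v → ℝ, IsSmoothCylinder F ∧
      eLpNorm (fun η => F η - u η) 2 P ≤ ENNReal.ofReal ε ∧
      eLpNorm (fun η => hGrad F η - U η) 2 P ≤ ENNReal.ofReal ε) :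
    (hu.toLp u, hU.toLp U) ∈ closedGradGraph P := by
  rw [closedGradGraph, Metric.mem_closure_iff]
  intro ε hε
  obtain ⟨F, hF, h1, h2⟩ := h (ε / 2) (by positivity)
  obtain ⟨r, ψ, f, hf, hFf⟩ := hF.exists_eq
  have hFm : AEStronglyMeasurable F P := by
    rw [hFf]; exact (hf.continuous.comp (cylMap ψ).continuous).aestronglyMeasurable
  have hGm : AEStronglyMeasurable (hGrad F) P := by
    rw [hFf]; exact (continuous_hGrad_cylinder ψ hf).aestronglyMeasurable
  have hFL : MemLp F 2 P := by
    have : MemLp (fun η => F η - u η) 2 P := ⟨hFm.sub hu.1, h1.trans_lt ENNReal.ofReal_lt_top⟩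
    have h3 := this.add hu
    refine h3.congr_norm hFm (Eventually.of_forall fun η => ?_)
    simp
  have hGL : MemLp (hGrad F) 2 P := by
    have : MemLp (fun η => hGrad F η - U η) 2 P := ⟨hGm.sub hU.1, h2.trans_lt ENNReal.ofReal_lt_top⟩
    have h3 := this.add hU
    refine h3.congr_norm hGm (Eventually.of_forall fun η => ?_)
    simp
  refine ⟨(hFL.toLp F, hGL.toLp _), ⟨F, hF, hFL.coeFn_toLp, hGL.coeFn_toLp⟩, ?_⟩
  rw [dist_comm, Prod.dist_eq]
  refine max_lt ?_ ?_
  · rw [dist_eq_norm, ← MemLp.toLp_sub, Lp.norm_toLp]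
    refine lt_of_le_of_lt (ENNReal.toReal_le_of_le_ofReal (by positivity) h1) (by linarith)
  · rw [dist_eq_norm, ← MemLp.toLp_sub, Lp.norm_toLp]
    refine lt_of_le_of_lt (ENNReal.toReal_le_of_le_ofReal (by positivity) h2) (by linarith)

/-! ### Approximation of the eigenfunctions -/

namespace SpectralData

lemma map_dual_sub_coord (hS : SpectralData ν lam ζ N) (e : HilbertBasis ℕ ℝ (H0 v))
    {P : Measure (W0 v)} (hP : P ≪ ν) (φ : StrongDual ℝ (W0 v)) (i : ℕ) {w : ℝ≥0}
    (hw : P.map (wienerIntegral ν (dualRep0 φ - e i)) = gaussianReal 0 w) :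
    P.map (fun η => Real.sqrt lam * φ η - coord ν lam e i η) =
      gaussianReal 0 (Real.toNNReal lam * w) := by
  have hae : (fun η => Real.sqrt lam * φ η - coord ν lam e i η) =ᵐ[P]
      (fun x => Real.sqrt lam * x) ∘ wienerIntegral ν (dualRep0 φ - e i) := by
    have h1 := hS.isonormal.wienerIntegral_add (dualRep0 φ - e i) (e i)
    rw [sub_add_cancel] at h1
    filter_upwards [hP.ae_le h1, hP.ae_le (hS.isonormal.wienerIntegral_dual φ)] with η h2 h3
    rw [h3] at h2
    rw [h2, coord, Function.comp_apply]; ring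
  rw [Measure.map_congr hae, ← Measure.map_map (measurable_const_mul _)
    (measurable_wienerIntegral _), hw, gaussianReal_map_const_mul, mul_zero]
  congr 2
  ext
  simp [Real.sq_sqrt hS.lam_pos.le, Real.coe_toNNReal _ hS.lam_pos.le]

/-- The variance under `P` of `√λ φ - Zᵢ` is controlled by the distance from `φ` to `eᵢ`. -/
def VarianceBound (P ν : Measure (W0 v)) (lam : ℝ) (e : HilbertBasis ℕ ℝ (H0 v)) (K : ℝ) : Prop :=
  ∀ (φ : StrongDual ℝ (W0 v)) (i : ℕ), ∃ w : ℝ≥0, (w : ℝ) ≤ K * ‖dualRep0 φ - e i‖ ^ 2 ∧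
    P.map (fun η => Real.sqrt lam * φ η - coord ν lam e i η) = gaussianReal 0 w

lemma varianceBound (hS : SpectralData ν lam ζ N) (e : HilbertBasis ℕ ℝ (H0 v)) :
    VarianceBound ν ν lam e 1 := fun φ i => by
  refine ⟨_, le_of_eq ?_, hS.map_dual_sub_coord e Measure.AbsolutelyContinuous.rfl φ i
    (hS.isonormal.map_wienerIntegral _)⟩
  have := hS.lam_pos
  rw [NNReal.coe_mul, Real.coe_toNNReal _ this.le, Real.coe_toNNReal _ (by positivity)]
  field_simp

lemma varianceBound_ground (hS : SpectralData ν lam ζ N) (e : HilbertBasis ℕ ℝ (H0 v)) :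
    ∃ K : ℝ, 0 < K ∧ VarianceBound (groundMeasure ν lam e ζ N) ν lam e K := by
  obtain ⟨c, hc, hcl⟩ := exists_abs_lower_bound hS.summable hS.ne_zero
  have hlam := hS.lam_pos
  refine ⟨c⁻¹, by positivity, fun φ i => ?_⟩
  set h := dualRep0 φ - e i with hh
  have hle : ∀ j, inner ℝ (e j) h ^ 2 * (lam * |1 + ζ j|)⁻¹ ≤ inner ℝ (e j) h ^ 2 * (lam * c)⁻¹ :=
    fun j => by have := hcl j; gcongr
  have hsum2 := (hilbertBasis_hasSum_sq e h).mul_right (lam * c)⁻¹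
  have hsum : Summable fun j => inner ℝ (e j) h ^ 2 * (lam * |1 + ζ j|)⁻¹ :=
    hsum2.summable.of_nonneg_of_le (fun j => by positivity) hle
  refine ⟨_, ?_, hS.map_dual_sub_coord e ground_absolutelyContinuous φ i
    (hS.map_wienerIntegral_ground e hsum.hasSum)⟩
  rw [NNReal.coe_mul, Real.coe_toNNReal _ hlam.le,
    Real.coe_toNNReal _ (tsum_nonneg fun j => by positivity)]
  calc lam * ∑' j, inner ℝ (e j) h ^ 2 * (lam * |1 + ζ j|)⁻¹
      ≤ lam * (‖h‖ ^ 2 * (lam * c)⁻¹) := by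
        gcongr
        exact hasSum_le hle hsum.hasSum hsum2
    _ = c⁻¹ * ‖h‖ ^ 2 := by field_simp

/-- Approximation of an eigenfunction and its derivatives by cylindrical functions based on
functionals `√λ φᵢ` with `φᵢ` close to `eᵢ`. -/
lemma exists_cylinder_approx [Nonempty (Fin M)] {P : Measure (W0 v)} {K : ℝ} (hK0 : 0 < K)
    (hK : VarianceBound P ν lam e K) {w : Fin M → ℝ≥0}
    (hZ : ∀ i : Fin M, P.map (fun η => coordVec ν lam e M η i) = gaussianReal 0 (w i))
    (ζ : ℕ → ℝ) (N : ℕ) (n : ℕ →₀ ℕ) (k : ℕ) {σ : ℝ} (hσ : 0 < σ) :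
    ∃ (f : (Fin M → ℝ) → ℝ) (φ : Fin M → StrongDual ℝ (W0 v)), ContDiff ℝ ∞ f ∧
      (∀ l : ℕ, ∃ C : ℝ, ∀ x, ‖iteratedFDeriv ℝ l f x‖ ≤ C) ∧
      (∀ i : Fin M, ‖dualRep0 (φ i) - e i‖ ≤ σ) ∧
      ∀ l ≤ k, ∫⁻ η, ENNReal.ofReal
          (Real.exp (2 * ∑ i : Fin M, rate ζ N i * coordVec ν lam e M η i ^ 2)) *
        ‖iteratedFDeriv ℝ l f (cylMap (fun i => Real.sqrt lam • φ i) η) -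
          iteratedFDeriv ℝ l (profile ζ N n M) (coordVec ν lam e M η)‖ₑ ^ 2 ∂P
          ≤ ENNReal.ofReal σ := by
  obtain ⟨f, hf, hfb, τ, hτ, happ⟩ := IsGaussBounded.exists_approx (b := fun i : Fin M => rate ζ N i)
    (fun i => rate_nonneg ζ N i) (isGaussBounded_profile ζ N n M) hZ k hσ
  have hφ : ∀ i : Fin M, ∃ φ : StrongDual ℝ (W0 v),
      ‖dualRep0 φ - e i‖ ≤ min σ (Real.sqrt (τ / K)) := fun i => by
    have hpos : 0 < min σ (Real.sqrt (τ / K)) := lt_min hσ (Real.sqrt_pos.2 (by positivity))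
    obtain ⟨φ, hφ⟩ := (dualRep0_denseRange (v := v)).exists_dist_lt (e i) hpos
    exact ⟨φ, by rw [← dist_eq_norm, dist_comm]; exact hφ.le⟩
  choose φ hφ using hφ
  refine ⟨f, φ, hf, hfb, fun i => (hφ i).trans (min_le_left _ _), fun l hl => ?_⟩
  have h := happ (fun i η => Real.sqrt lam * φ i η) (fun i => by
    obtain ⟨w', hw', hlaw⟩ := hK (φ i) i
    refine ⟨w', hw'.trans ?_, hlaw⟩
    have h1 : ‖dualRep0 (φ i) - e i‖ ^ 2 ≤ τ / K := by
      rw [← Real.sq_sqrt (show 0 ≤ τ / K by positivity)]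
      gcongr
      exact (hφ i).trans (min_le_right _ _)
    calc K * ‖dualRep0 (φ i) - e i‖ ^ 2 ≤ K * (τ / K) := by gcongr
      _ = τ := by field_simp) l hl
  refine (le_of_eq (lintegral_congr fun η => ?_)).trans h
  rw [ENNReal.ofReal_mul (Real.exp_pos _).le, ENNReal.ofReal_pow (norm_nonneg _), ofReal_norm]
  rfl

end SpectralData

/-- The image `√λ (δ_{ia})_{i<M}` of the basis vector `e_a` in `ℝ^M`. -/
def basisVec (lam : ℝ) (M a : ℕ) : Fin M → ℝ := fun i => Real.sqrt lam * if (i : ℕ) = a then 1 else 0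

lemma basisVec_eq (e : HilbertBasis ℕ ℝ (H0 v)) (a : ℕ) :
    basisVec lam M a = fun i : Fin M => Real.sqrt lam * inner ℝ (e i) (e a) := by
  funext i
  rw [basisVec, orthonormal_iff_ite.1 e.orthonormal]

lemma cylMap_incl0 (φ : Fin M → StrongDual ℝ (W0 v)) (h : H0 v) :
    cylMap (fun i => Real.sqrt lam • φ i) (incl0 v h) =
      fun i => Real.sqrt lam * inner ℝ (dualRep0 (φ i)) h := by
  funext i
  rw [inner_dualRep0]
  rfl

lemma tsum_enorm_sq_le (hlam : 0 ≤ lam) (e : HilbertBasis ℕ ℝ (H0 v)) (g : Fin M → H0 v) :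
    ∑' a, ‖fun i : Fin M => Real.sqrt lam * inner ℝ (g i) (e a)‖ₑ ^ 2 ≤
      ENNReal.ofReal (lam * ∑ i, ‖g i‖ ^ 2) := by
  have hs : HasSum (fun a => lam * ∑ i, inner ℝ (e a) (g i) ^ 2) (lam * ∑ i, ‖g i‖ ^ 2) :=
    (hasSum_sum fun i _ => hilbertBasis_hasSum_sq e (g i)).mul_left lam
  rw [← hs.tsum_eq, ENNReal.ofReal_tsum_of_nonneg (fun a => mul_nonneg hlam
    (Finset.sum_nonneg fun i _ => sq_nonneg _)) hs.summable]
  refine ENNReal.tsum_le_tsum fun a => ?_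
  rw [← ofReal_norm, ← ENNReal.ofReal_pow (norm_nonneg _)]
  refine ENNReal.ofReal_le_ofReal ?_
  have hS0 : 0 ≤ lam * ∑ i, inner ℝ (e a) (g i) ^ 2 :=
    mul_nonneg hlam (Finset.sum_nonneg fun i _ => sq_nonneg _)
  have h1 : ‖fun i : Fin M => Real.sqrt lam * inner ℝ (g i) (e a)‖ ≤
      Real.sqrt (lam * ∑ i, inner ℝ (e a) (g i) ^ 2) := by
    rw [pi_norm_le_iff_of_nonneg (Real.sqrt_nonneg _)]
    intro i
    rw [Real.norm_eq_abs]
    refine Real.abs_le_sqrt ?_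
    rw [mul_pow, Real.sq_sqrt hlam, real_inner_comm]
    gcongr
    exact Finset.single_le_sum (f := fun i => inner ℝ (e a) (g i) ^ 2)
      (fun i _ => sq_nonneg _) (Finset.mem_univ i)
  calc _ ≤ Real.sqrt (lam * ∑ i, inner ℝ (e a) (g i) ^ 2) ^ 2 := by gcongr
    _ = _ := Real.sq_sqrt hS0

end

section

/-! ### Malliavin derivatives of the eigenfunctions -/

variable {d m : ℕ} {v : Fin m → StrongDual ℝ (PathSpace d)} {ν : Measure (W0 v)} {lam : ℝ}
  {e : HilbertBasis ℕ ℝ (H0 v)} {ζ : ℕ → ℝ} {N M : ℕ}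

/-- The coordinates `λ^{l/2} ∂^l q(Z)(δ_{α 1}, …, δ_{α l})` of the `l`-th Malliavin derivative of
the eigenfunction `q(Z)`. -/
def eigenDeriv (ν : Measure (W0 v)) (lam : ℝ) (e : HilbertBasis ℕ ℝ (H0 v)) (ζ : ℕ → ℝ) (N : ℕ)
    (n : ℕ →₀ ℕ) (M l : ℕ) (α : Fin l → ℕ) (η : W0 v) : ℝ :=
  iteratedFDeriv ℝ l (profile ζ N n M) (coordVec ν lam e M η) fun j => basisVec lam M (α j)

lemma continuous_iteratedFDeriv_profile (ζ : ℕ → ℝ) (N : ℕ) (n : ℕ →₀ ℕ) (M l : ℕ) :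
    Continuous (iteratedFDeriv ℝ l (profile ζ N n M)) :=
  (isGaussBounded_profile ζ N n M).1.continuous_iteratedFDeriv (by exact_mod_cast le_top)

lemma measurable_eigenDeriv (n : ℕ →₀ ℕ) (l : ℕ) (α : Fin l → ℕ) :
    Measurable (eigenDeriv ν lam e ζ N n M l α) := by
  have h : Continuous fun z : Fin M → ℝ =>
      iteratedFDeriv ℝ l (profile ζ N n M) z fun j => basisVec lam M (α j) := by
    have := continuous_iteratedFDeriv_profile ζ N n M l
    fun_prop
  exact h.measurable.comp measurable_coordVec

lemma tsum_basisVec_le (hlam : 0 ≤ lam) (e : HilbertBasis ℕ ℝ (H0 v)) :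
    ∑' a, ‖basisVec lam M a‖ₑ ^ 2 ≤ ENNReal.ofReal (lam * M) := by
  have h := tsum_enorm_sq_le hlam e fun i : Fin M => e i
  simp_rw [← basisVec_eq e] at h
  refine h.trans (le_of_eq ?_)
  congr 2
  simp [e.orthonormal.1]

/-- The Hilbert-Schmidt norm of the `k`-th derivative is at most `(λM)^{k/2} ‖∂ᵏq(Z)‖`. -/
lemma hsNorm_eigenDeriv_le (hlam : 0 ≤ lam) (n : ℕ →₀ ℕ) (k : ℕ) (η : W0 v) :
    hsNorm (fun α => eigenDeriv ν lam e ζ N n M k α η) ≤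
      ENNReal.ofReal (lam ^ ((k : ℝ) / 2) * (M : ℝ) ^ ((k : ℝ) / 2)) *
        ‖iteratedFDeriv ℝ k (profile ζ N n M) (coordVec ν lam e M η)‖ₑ := by
  have h1 := tsum_multilinear_sq_le
    (iteratedFDeriv ℝ k (profile ζ N n M) (coordVec ν lam e M η)) (basisVec lam M)
  have h2 := tsum_basisVec_le (M := M) hlam e
  have hM : (0 : ℝ) ≤ M := Nat.cast_nonneg M
  calc hsNorm (fun α => eigenDeriv ν lam e ζ N n M k α η)
      ≤ (‖iteratedFDeriv ℝ k (profile ζ N n M) (coordVec ν lam e M η)‖ₑ ^ 2 *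
          ENNReal.ofReal (lam * M) ^ k) ^ (1 / 2 : ℝ) := by
        refine ENNReal.rpow_le_rpow (h1.trans ?_) (by norm_num)
        gcongr
    _ = _ := by
        rw [ENNReal.mul_rpow_of_nonneg _ _ (by norm_num), ← ENNReal.rpow_natCast,
          ← ENNReal.rpow_natCast, ← ENNReal.rpow_mul, ← ENNReal.rpow_mul]
        rw [show ((2 : ℕ) : ℝ) * (1 / 2) = 1 by norm_num, ENNReal.rpow_one, mul_comm,
          ENNReal.ofReal_rpow_of_nonneg (by positivity) (by positivity),
          ← Real.mul_rpow hlam hM, mul_one_div]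

lemma enorm_sub_sq_le {E : Type*} [SeminormedAddCommGroup E] (a b c : E) :
    ‖a - c‖ₑ ^ 2 ≤ 2 * ‖a - b‖ₑ ^ 2 + 2 * ‖b - c‖ₑ ^ 2 := by
  have h : ‖a - c‖ ^ 2 ≤ 2 * ‖a - b‖ ^ 2 + 2 * ‖b - c‖ ^ 2 := by
    have h1 := norm_sub_le_norm_sub_add_norm_sub a b c
    have h0 := norm_nonneg (a - c)
    nlinarith [sq_nonneg (‖a - b‖ - ‖b - c‖)]
  have h2 := ENNReal.ofReal_le_ofReal h
  rw [ENNReal.ofReal_add (by positivity) (by positivity), ENNReal.ofReal_mul two_pos.le,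
    ENNReal.ofReal_mul two_pos.le, ENNReal.ofReal_pow (norm_nonneg _),
    ENNReal.ofReal_pow (norm_nonneg _), ENNReal.ofReal_pow (norm_nonneg _), ofReal_norm,
    ofReal_norm, ofReal_norm, ENNReal.ofReal_ofNat] at h2
  exact h2

/-- Comparison in Hilbert-Schmidt norm of the derivatives of a cylindrical function and of an
eigenfunction. -/
lemma tsum_hDerivCoord_sub_le (hlam : 0 ≤ lam) (e : HilbertBasis ℕ ℝ (H0 v))
    {f : (Fin M → ℝ) → ℝ} (hf : ContDiff ℝ ∞ f) {φ : Fin M → StrongDual ℝ (W0 v)} {σ : ℝ}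
    (hσ : 0 ≤ σ) (hσ1 : σ ≤ 1) (hφ : ∀ i : Fin M, ‖dualRep0 (φ i) - e i‖ ≤ σ) (n : ℕ →₀ ℕ) (l : ℕ)
    (η : W0 v) :
    ∑' α : Fin l → ℕ, ‖hDerivCoord e (fun η => f (cylMap (fun i => Real.sqrt lam • φ i) η)) l α η -
        eigenDeriv ν lam e ζ N n M l α η‖ₑ ^ 2 ≤
      2 * ENNReal.ofReal (lam * (4 * M)) ^ l *
        ‖iteratedFDeriv ℝ l f (cylMap (fun i => Real.sqrt lam • φ i) η) -
          iteratedFDeriv ℝ l (profile ζ N n M) (coordVec ν lam e M η)‖ₑ ^ 2 +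
      2 * ((l : ℝ≥0∞) ^ 2 * ENNReal.ofReal (lam * M) *
        ENNReal.ofReal (lam * (5 * M)) ^ (l - 1)) * ENNReal.ofReal σ *
        ‖iteratedFDeriv ℝ l (profile ζ N n M) (coordVec ν lam e M η)‖ₑ ^ 2 := by
  set A := iteratedFDeriv ℝ l f (cylMap (fun i => Real.sqrt lam • φ i) η) with hA
  set B := iteratedFDeriv ℝ l (profile ζ N n M) (coordVec ν lam e M η) with hB
  set u : ℕ → Fin M → ℝ := fun a => cylMap (fun i => Real.sqrt lam • φ i) (incl0 v (e a)) with hu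
  have hu' : ∀ a, u a = fun i => Real.sqrt lam * inner ℝ (dualRep0 (φ i)) (e a) := fun a =>
    cylMap_incl0 φ (e a)
  have hM : (0 : ℝ) ≤ M := Nat.cast_nonneg M
  have hd : ∀ i : Fin M, ‖dualRep0 (φ i)‖ ≤ 2 := fun i => by
    have h1 := norm_le_norm_sub_add (dualRep0 (φ i)) (e i)
    rw [e.orthonormal.1 i] at h1
    linarith [hφ i]
  have hsu : ∑' a, ‖u a‖ₑ ^ 2 ≤ ENNReal.ofReal (lam * (4 * M)) := by
    have h := tsum_enorm_sq_le hlam e fun i => dualRep0 (φ i)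
    simp_rw [← hu'] at h
    refine h.trans (ENNReal.ofReal_le_ofReal ?_)
    gcongr
    calc ∑ i, ‖dualRep0 (φ i)‖ ^ 2 ≤ ∑ _i : Fin M, (2 : ℝ) ^ 2 := by
          gcongr with i; exact hd i
      _ = 4 * M := by simp; ring
  have hsd : ∑' a, ‖u a - basisVec lam M a‖ₑ ^ 2 ≤ ENNReal.ofReal (lam * M) * ENNReal.ofReal σ := by
    have h := tsum_enorm_sq_le hlam e fun i : Fin M => dualRep0 (φ i) - e i
    have e1 : ∀ a, u a - basisVec lam M a =
        fun i : Fin M => Real.sqrt lam * inner ℝ (dualRep0 (φ i) - e i) (e a) := fun a => by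
      rw [hu', basisVec_eq e]
      funext i
      rw [Pi.sub_apply, inner_sub_left]; ring
    simp_rw [← e1] at h
    refine h.trans ?_
    rw [← ENNReal.ofReal_mul (by positivity)]
    refine ENNReal.ofReal_le_ofReal ?_
    rw [mul_assoc]
    gcongr
    calc ∑ i : Fin M, ‖dualRep0 (φ i) - e i‖ ^ 2 ≤ ∑ _i : Fin M, σ := by
          refine Finset.sum_le_sum fun i _ => ?_
          have h1 := hφ i
          have h2 := norm_nonneg (dualRep0 (φ i) - e i)
          nlinarith
      _ = M * σ := by simp
  have hss : ∑' a, (‖u a‖ₑ ^ 2 + ‖basisVec lam M a‖ₑ ^ 2) ≤ ENNReal.ofReal (lam * (5 * M)) := by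
    rw [ENNReal.tsum_add]
    refine (add_le_add hsu (tsum_basisVec_le hlam e)).trans (le_of_eq ?_)
    rw [← ENNReal.ofReal_add (by positivity) (by positivity)]
    congr 1; ring
  have h1 := tsum_multilinear_sq_le (A - B) u
  have h2 := tsum_multilinear_sub_sq_le B u (basisVec lam M)
  calc _ = ∑' α : Fin l → ℕ, ‖(A fun j => u (α j)) - B fun j => basisVec lam M (α j)‖ₑ ^ 2 := by
        refine tsum_congr fun α => ?_
        rw [hDerivCoord_cylinder _ hf]
        rfl
    _ ≤ ∑' α : Fin l → ℕ, (2 * ‖(A - B) fun j => u (α j)‖ₑ ^ 2 +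
          2 * ‖(B fun j => u (α j)) - B fun j => basisVec lam M (α j)‖ₑ ^ 2) :=
        ENNReal.tsum_le_tsum fun α => enorm_sub_sq_le _ _ _
    _ = 2 * ∑' α : Fin l → ℕ, ‖(A - B) fun j => u (α j)‖ₑ ^ 2 +
          2 * ∑' α : Fin l → ℕ, ‖(B fun j => u (α j)) - B fun j => basisVec lam M (α j)‖ₑ ^ 2 := by
        rw [ENNReal.tsum_add, ENNReal.tsum_mul_left, ENNReal.tsum_mul_left]
    _ ≤ 2 * (‖A - B‖ₑ ^ 2 * ENNReal.ofReal (lam * (4 * M)) ^ l) +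
          2 * (‖B‖ₑ ^ 2 * ((l : ℝ≥0∞) ^ 2 * (ENNReal.ofReal (lam * M) * ENNReal.ofReal σ) *
            ENNReal.ofReal (lam * (5 * M)) ^ (l - 1))) := by
        refine add_le_add ?_ ?_
        · gcongr; exact h1.trans (by gcongr)
        · gcongr; exact h2.trans (by gcongr)
    _ = _ := by ring

namespace SpectralData

lemma map_coordVec (hS : SpectralData ν lam ζ N) (e : HilbertBasis ℕ ℝ (H0 v)) (i : Fin M) :
    ν.map (fun η => coordVec ν lam e M η i) = gaussianReal 0 1 := (hS.indep_coord e).law i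

lemma map_coordVec_ground (hS : SpectralData ν lam ζ N) (e : HilbertBasis ℕ ℝ (H0 v)) (i : Fin M) :
    (groundMeasure ν lam e ζ N).map (fun η => coordVec ν lam e M η i) =
      gaussianReal 0 (Real.toNNReal |1 + ζ i|⁻¹) := (hS.indep_coord_ground e).law i

lemma lintegral_profile_sq_lt_top [Nonempty (Fin M)] (hS : SpectralData ν lam ζ N)
    (e : HilbertBasis ℕ ℝ (H0 v)) (n : ℕ →₀ ℕ) (l : ℕ) :
    ∫⁻ η, ‖iteratedFDeriv ℝ l (profile ζ N n M) (coordVec ν lam e M η)‖ₑ ^ 2 ∂ν < ⊤ := by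
  have hM0 : (0 : ℝ) < Fintype.card (Fin M) := by exact_mod_cast Fintype.card_pos
  set δ : ℝ := 1 / (8 * (Fintype.card (Fin M) : ℝ)) with hδ
  obtain ⟨C, hC0, hC⟩ := (isGaussBounded_profile ζ N n M).2 l δ (by positivity)
  have hint := lintegral_exp_sum_sq_le (hS.map_coordVec (M := M) e) (s := 2 * δ) fun i => by
    rw [hδ, NNReal.coe_one]; field_simp; norm_num
  have hpt : ∀ η, ‖iteratedFDeriv ℝ l (profile ζ N n M) (coordVec ν lam e M η)‖ₑ ^ 2 ≤
      ENNReal.ofReal (C ^ 2) *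
        ENNReal.ofReal (Real.exp (2 * δ * ∑ i, coordVec ν lam e M η i ^ 2)) := by
    intro η
    rw [← ofReal_norm, ← ENNReal.ofReal_pow (norm_nonneg _), ← ENNReal.ofReal_mul (by positivity)]
    refine ENNReal.ofReal_le_ofReal ?_
    calc _ ≤ (C * Real.exp (∑ i : Fin M, (δ - rate ζ N i) * coordVec ν lam e M η i ^ 2)) ^ 2 := by
          gcongr; exact hC _
      _ ≤ (C * Real.exp (δ * ∑ i : Fin M, coordVec ν lam e M η i ^ 2)) ^ 2 := by
          gcongr
          rw [Finset.mul_sum]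
          refine Finset.sum_le_sum fun i _ => mul_le_mul_of_nonneg_right ?_ (sq_nonneg _)
          linarith [rate_nonneg ζ N i]
      _ = _ := by
          rw [mul_pow, ← Real.exp_nat_mul]; congr 2; push_cast; ring
  calc _ ≤ ∫⁻ η, ENNReal.ofReal (C ^ 2) *
        ENNReal.ofReal (Real.exp (2 * δ * ∑ i, coordVec ν lam e M η i ^ 2)) ∂ν :=
        lintegral_mono hpt
    _ = ENNReal.ofReal (C ^ 2) *
        ∫⁻ η, ENNReal.ofReal (Real.exp (2 * δ * ∑ i, coordVec ν lam e M η i ^ 2)) ∂ν :=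
        lintegral_const_mul' _ _ ENNReal.ofReal_ne_top
    _ ≤ ENNReal.ofReal (C ^ 2) * 2 := by gcongr
    _ < ⊤ := ENNReal.mul_lt_top ENNReal.ofReal_lt_top (by norm_num)

lemma enorm_iteratedFDeriv_zero_sub {E : Type*} [NormedAddCommGroup E] [NormedSpace ℝ E]
    (f g : E → ℝ) (x y : E) :
    ‖iteratedFDeriv ℝ 0 f x - iteratedFDeriv ℝ 0 g y‖ₑ = ‖f x - g y‖ₑ := by
  rw [iteratedFDeriv_zero_eq_comp, iteratedFDeriv_zero_eq_comp, Function.comp_apply,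
    Function.comp_apply, ← map_sub, ← ofReal_norm, LinearIsometryEquiv.norm_map, ofReal_norm]

/-- The eigenfunctions are Malliavin differentiable to any order. -/
theorem hasMalliavinDerivs [Nonempty (Fin M)] (hS : SpectralData ν lam ζ N) {n : ℕ →₀ ℕ}
    (hN : N ≤ M) (hn : n.support ⊆ Finset.range M) (k : ℕ) :
    HasMalliavinDerivs ν e k (eigenfunction ν lam e ζ N n) (eigenDeriv ν lam e ζ N n M) := by
  refine ⟨fun l α => measurable_eigenDeriv n l α, ?_⟩
  set σ : ℕ → ℝ := fun j => 1 / ((j : ℝ) + 1) with hσ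
  have hσ0 : ∀ j, 0 < σ j := fun j => by positivity
  have hσ1 : ∀ j, σ j ≤ 1 := fun j => by
    rw [hσ]; exact div_le_one_of_le₀ (by have : (0 : ℝ) ≤ j := Nat.cast_nonneg j
                                         linarith) (by positivity)
  have hσlim : Tendsto (fun j => ENNReal.ofReal (σ j)) atTop (𝓝 0) := by
    have := ENNReal.tendsto_ofReal (tendsto_one_div_add_atTop_nhds_zero_nat (𝕜 := ℝ))
    rwa [ENNReal.ofReal_zero] at this
  choose f φ hf hfb hφ happ using fun j => exists_cylinder_approx (M := M) one_pos
    (hS.varianceBound e) (hS.map_coordVec e) ζ N n k (hσ0 j)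
  have happ' : ∀ j, ∀ l ≤ k, ∫⁻ η,
      ‖iteratedFDeriv ℝ l (f j) (cylMap (fun i => Real.sqrt lam • φ j i) η) -
          iteratedFDeriv ℝ l (profile ζ N n M) (coordVec ν lam e M η)‖ₑ ^ 2 ∂ν
          ≤ ENNReal.ofReal (σ j) := by
    intro j l hl
    refine (lintegral_mono fun η => ?_).trans (happ j l hl)
    refine le_mul_of_one_le_left zero_le ?_
    rw [ENNReal.one_le_ofReal]
    exact Real.one_le_exp (mul_nonneg two_pos.le
      (Finset.sum_nonneg fun i _ => mul_nonneg (rate_nonneg _ _ _) (sq_nonneg _)))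
  refine ⟨fun j η => f j (cylMap (fun i => Real.sqrt lam • φ j i) η),
    fun j => isSmoothCylinder_cylinder _ (hf j) (hfb j), ?_, fun l hl => ?_⟩
  · have h0 : ∀ j, eLpNorm (fun η => f j (cylMap (fun i => Real.sqrt lam • φ j i) η) -
        eigenfunction ν lam e ζ N n η) 2 ν ^ 2 ≤ ENNReal.ofReal (σ j) := by
      intro j
      rw [eLpNorm_two_sq]
      refine le_trans (le_of_eq (lintegral_congr fun η => ?_)) (happ' j 0 (Nat.zero_le k))
      rw [enorm_iteratedFDeriv_zero_sub, hS.eigenfunction_eq_profile hN hn]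
    have h1 : Tendsto (fun j => eLpNorm (fun η => f j (cylMap (fun i => Real.sqrt lam • φ j i) η) -
        eigenfunction ν lam e ζ N n η) 2 ν ^ 2) atTop (𝓝 0) :=
      tendsto_of_tendsto_of_tendsto_of_le_of_le tendsto_const_nhds hσlim (fun _ => zero_le) h0
    have h2 := h1.ennrpow_const (1 / 2 : ℝ)
    simp only [← ENNReal.rpow_natCast, ← ENNReal.rpow_mul] at h2
    norm_num at h2
    exact h2
  · set D : ℝ≥0∞ := 2 * ENNReal.ofReal (lam * (4 * M)) ^ l +
      2 * ((l : ℝ≥0∞) ^ 2 * ENNReal.ofReal (lam * M) * ENNReal.ofReal (lam * (5 * M)) ^ (l - 1)) *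
        ∫⁻ η, ‖iteratedFDeriv ℝ l (profile ζ N n M) (coordVec ν lam e M η)‖ₑ ^ 2 ∂ν with hD
    have hDtop : D ≠ ⊤ := by
      have h3 := (hS.lintegral_profile_sq_lt_top (M := M) e n l).ne
      rw [hD]
      finiteness
    have hle : ∀ j, ∫⁻ η, ∑' α : Fin l → ℕ,
        ‖hDerivCoord e (fun η => f j (cylMap (fun i => Real.sqrt lam • φ j i) η)) l α η -
          eigenDeriv ν lam e ζ N n M l α η‖ₑ ^ 2 ∂ν ≤ D * ENNReal.ofReal (σ j) := by
      intro j
      refine (lintegral_mono fun η => tsum_hDerivCoord_sub_le hS.lam_pos.le e (hf j) (hσ0 j).le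
        (hσ1 j) (hφ j) n l η).trans ?_
      have hm : Measurable fun η =>
          ‖iteratedFDeriv ℝ l (profile ζ N n M) (coordVec ν lam e M η)‖ₑ ^ 2 :=
        ((continuous_iteratedFDeriv_profile ζ N n M l).enorm.measurable.comp
          measurable_coordVec).pow_const 2
      rw [lintegral_add_right _ (hm.const_mul _), lintegral_const_mul' _ _ (by finiteness),
        lintegral_const_mul' _ _ (by finiteness), hD, add_mul]
      refine add_le_add ?_ (le_of_eq (by ring))
      gcongr
      exact happ' j l hl
    have hlim := ENNReal.Tendsto.const_mul (a := D) hσlim (Or.inr hDtop)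
    rw [mul_zero] at hlim
    exact tendsto_of_tendsto_of_tendsto_of_le_of_le tendsto_const_nhds hlim (fun _ => zero_le) hle

end SpectralData

/-- The `Lᵖ` estimates for the eigenfunctions and their Malliavin derivatives. -/
theorem exists_eLpNorm_eigenfunction_le (ζ : ℕ → ℝ) (N : ℕ) (n : ℕ →₀ ℕ) (k : ℕ) {p : ℝ}
    (hp : 2 ≤ p) : ∃ C : ℝ, ∀ (d m : ℕ) (v : Fin m → StrongDual ℝ (PathSpace d))
        (ν : Measure (W0 v)) (lam : ℝ) (e : HilbertBasis ℕ ℝ (H0 v)), SpectralData ν lam ζ N →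
      eLpNorm (eigenfunction ν lam e ζ N n) (ENNReal.ofReal p) (tilt ν lam e ζ) ≤
        ENNReal.ofReal C ∧
      ∃ G : (l : ℕ) → (Fin l → ℕ) → W0 v → ℝ,
        HasMalliavinDerivs ν e k (eigenfunction ν lam e ζ N n) G ∧
        eLpNorm (fun η => hsNorm fun α => G k α η) (ENNReal.ofReal p) (tilt ν lam e ζ)
          ≤ ENNReal.ofReal (lam ^ ((k : ℝ) / 2) * C) := by
  obtain ⟨M₀, hM₀⟩ := n.support.exists_nat_subset_range
  set M := N + M₀ + 1 with hM
  have hN : N ≤ M := by omega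
  have hn : n.support ⊆ Finset.range M := hM₀.trans (Finset.range_subset_range.2 (by omega))
  have hne : Nonempty (Fin M) := ⟨⟨0, by omega⟩⟩
  obtain ⟨C₀, hC₀, hb₀⟩ := exists_eLpNorm_profile_le ζ N n hN 0 hp
  obtain ⟨C₁, hC₁, hb₁⟩ := exists_eLpNorm_profile_le ζ N n hN k hp
  have hMk : (0 : ℝ) ≤ (M : ℝ) ^ ((k : ℝ) / 2) := by positivity
  refine ⟨C₀ + (M : ℝ) ^ ((k : ℝ) / 2) * C₁, fun d m v ν lam e hS => ⟨?_, ?_⟩⟩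
  · refine le_trans (le_of_eq ?_) ((hb₀ d m v ν lam e hS).trans
      (ENNReal.ofReal_le_ofReal (le_add_of_nonneg_right (by positivity))))
    refine eLpNorm_congr_norm_ae (Eventually.of_forall fun η => ?_)
    rw [hS.eigenfunction_eq_profile hN hn, norm_iteratedFDeriv_zero]
  · refine ⟨eigenDeriv ν lam e ζ N n M, hS.hasMalliavinDerivs hN hn k, ?_⟩
    have hlam := hS.lam_pos.le
    set c : ℝ := lam ^ ((k : ℝ) / 2) * (M : ℝ) ^ ((k : ℝ) / 2) with hc
    have hc0 : 0 ≤ c := by positivity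
    have h1 : eLpNorm (fun η => hsNorm fun α => eigenDeriv ν lam e ζ N n M k α η)
        (ENNReal.ofReal p) (tilt ν lam e ζ) ≤
        eLpNorm (c • fun η => ‖iteratedFDeriv ℝ k (profile ζ N n M) (coordVec ν lam e M η)‖)
          (ENNReal.ofReal p) (tilt ν lam e ζ) := by
      refine eLpNorm_mono_enorm fun η => ?_
      rw [Pi.smul_apply, enorm_smul, Real.enorm_of_nonneg hc0, enorm_norm, enorm_eq_self]
      exact hsNorm_eigenDeriv_le hlam n k η
    refine h1.trans ?_
    rw [eLpNorm_const_smul, eLpNorm_norm, Real.enorm_of_nonneg hc0]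
    refine (mul_le_mul_right (hb₁ d m v ν lam e hS) _).trans ?_
    rw [← ENNReal.ofReal_mul hc0]
    refine ENNReal.ofReal_le_ofReal ?_
    rw [hc, mul_assoc]
    gcongr
    exact le_add_of_nonneg_left hC₀

end

section

/-! ### The gradients of the eigenfunctions -/

/-- The multi-index of the partial derivative `∂ᵢ𝐞ₙ`: differentiation lowers the Hermite degree
in a positive direction, and raises it in a negative direction. -/
def stepIdx (N : ℕ) (n : ℕ →₀ ℕ) (i : ℕ) : ℕ →₀ ℕ :=
  n.update i (if i < N then n i + 1 else n i - 1)

/-- The coefficient of the partial derivative `∂ᵢ𝐞ₙ`, for `λ = 1`. -/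
def stepCoef (ζ : ℕ → ℝ) (N : ℕ) (n : ℕ →₀ ℕ) (i : ℕ) : ℝ :=
  if i < N then -(Real.sqrt |1 + ζ i| * Real.sqrt (n i + 1 : ℕ))
    else Real.sqrt |1 + ζ i| * Real.sqrt (n i)

/-- The `i`-th factor of the function `profile`. -/
def profileFactor (ζ : ℕ → ℝ) (N i k : ℕ) (t : ℝ) : ℝ :=
  Real.exp (rate ζ N i) * normHermite k (Real.sqrt |1 + ζ i| * t) *
    Real.exp (-(rate ζ N i * t ^ 2))

lemma profile_eq (ζ : ℕ → ℝ) (N : ℕ) (n : ℕ →₀ ℕ) (M : ℕ) (z : Fin M → ℝ) :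
    profile ζ N n M z = |det2 fun i => |1 + ζ i| - 1| ^ (1 / 4 : ℝ) *
      ∏ i : Fin M, profileFactor ζ N i (n i) (z i) := by
  rw [profile]
  congr 1
  refine Finset.prod_congr rfl fun i _ => ?_
  rw [profileFactor, profilePoly, normHermite_eq]
  simp only [Polynomial.eval_mul, Polynomial.eval_C, Polynomial.eval_comp, Polynomial.eval_X]
  ring

lemma stepIdx_self (N : ℕ) (n : ℕ →₀ ℕ) (i : ℕ) :
    stepIdx N n i i = if i < N then n i + 1 else n i - 1 := by simp [stepIdx]

lemma stepIdx_of_ne (N : ℕ) (n : ℕ →₀ ℕ) {i j : ℕ} (h : j ≠ i) : stepIdx N n i j = n j := by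
  simp [stepIdx, h]

lemma hasDerivAt_profileFactor (ζ : ℕ → ℝ) (N : ℕ) (n : ℕ →₀ ℕ) (i : ℕ) (t : ℝ) :
    HasDerivAt (profileFactor ζ N i (n i))
      (stepCoef ζ N n i * profileFactor ζ N i (stepIdx N n i i) t) t := by
  set s := Real.sqrt |1 + ζ i| with hs
  have hss : s * s = |1 + ζ i| := Real.mul_self_sqrt (abs_nonneg _)
  have h1 : HasDerivAt (fun t => normHermite (n i) (s * t))
      (Real.sqrt (n i) * normHermite (n i - 1) (s * t) * s) t := by
    have := (hasDerivAt_normHermite (n i) (s * t)).comp t ((hasDerivAt_id t).const_mul s)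
    exact this.congr_deriv (by simp)
  have h2 : HasDerivAt (fun t => Real.exp (-(rate ζ N i * t ^ 2)))
      (Real.exp (-(rate ζ N i * t ^ 2)) * -(rate ζ N i * (2 * t))) t := by
    refine (((hasDerivAt_pow 2 t).const_mul (rate ζ N i)).neg).exp.congr_deriv ?_
    simp
  refine ((h1.const_mul (Real.exp (rate ζ N i))).mul h2).congr_deriv ?_
  rw [stepIdx_self, stepCoef, profileFactor, ← hs]
  by_cases hi : i < N
  · simp only [if_pos hi]
    have h3 := mul_normHermite (n i) (s * t)
    have hr : rate ζ N i * 2 = s * s := by rw [rate, if_pos hi, hss]; ring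
    linear_combination (-(Real.exp (rate ζ N i)) * Real.exp (-(rate ζ N i * t ^ 2)) * s) * h3 -
      (t * Real.exp (rate ζ N i) * normHermite (n i) (s * t) *
        Real.exp (-(rate ζ N i * t ^ 2))) * hr
  · simp only [if_neg hi]
    have hr : rate ζ N i = 0 := by rw [rate, if_neg hi]
    simp only [hr]; ring

lemma fderiv_profile_single (ζ : ℕ → ℝ) (N : ℕ) (n : ℕ →₀ ℕ) {M : ℕ} (z : Fin M → ℝ) (i : Fin M) :
    fderiv ℝ (profile ζ N n M) z (Pi.single i 1) =
      stepCoef ζ N n i * profile ζ N (stepIdx N n i) M z := by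
  have hd : DifferentiableAt ℝ (profile ζ N n M) (Function.update z i (z i)) :=
    ((isGaussBounded_profile ζ N n M).1.differentiable (by simp)).differentiableAt
  have h1 := hd.hasFDerivAt.comp_hasDerivAt (z i) (hasDerivAt_update z i (z i))
  rw [Function.update_eq_self] at h1
  refine h1.unique ?_
  have h2 : (profile ζ N n M ∘ Function.update z i) = fun t =>
      |det2 fun i => |1 + ζ i| - 1| ^ (1 / 4 : ℝ) * (profileFactor ζ N i (n i) t *
        ∏ j ∈ Finset.univ.erase i, profileFactor ζ N j (n j) (z j)) := by
    funext t
    rw [Function.comp_apply, profile_eq, ← Finset.mul_prod_erase _ _ (Finset.mem_univ i),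
      Function.update_self]
    congr 2
    refine Finset.prod_congr rfl fun j hj => ?_
    rw [Function.update_of_ne (Finset.ne_of_mem_erase hj)]
  rw [h2]
  refine (((hasDerivAt_profileFactor ζ N n i (z i)).mul_const _).const_mul _).congr_deriv ?_
  rw [profile_eq, ← Finset.mul_prod_erase _ _ (Finset.mem_univ i)]
  have h3 : ∏ j ∈ Finset.univ.erase i, profileFactor ζ N j (stepIdx N n i j) (z j) =
      ∏ j ∈ Finset.univ.erase i, profileFactor ζ N j (n j) (z j) :=
    Finset.prod_congr rfl fun j hj => by
      rw [stepIdx_of_ne _ _ fun h => Finset.ne_of_mem_erase hj (Fin.ext h)]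
  rw [h3]; ring

variable {d m : ℕ} {v : Fin m → StrongDual ℝ (PathSpace d)} {ν : Measure (W0 v)} {lam : ℝ}
  {e : HilbertBasis ℕ ℝ (H0 v)} {ζ : ℕ → ℝ} {N M : ℕ}

lemma norm_hGrad_sub_le (e : HilbertBasis ℕ ℝ (H0 v))
    {f : (Fin M → ℝ) → ℝ} (hf : ContDiff ℝ ∞ f) {φ : Fin M → StrongDual ℝ (W0 v)} {σ : ℝ}
    (hσ1 : σ ≤ 1) (hφ : ∀ i : Fin M, ‖dualRep0 (φ i) - e i‖ ≤ σ)
    {q : (Fin M → ℝ) → ℝ} (η : W0 v) (z : Fin M → ℝ) :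
    ‖hGrad (fun η => f (cylMap (fun i => Real.sqrt lam • φ i) η)) η -
        ∑ i : Fin M, (Real.sqrt lam * fderiv ℝ q z (Pi.single i 1)) • e i‖ ≤
      M * Real.sqrt lam * 2 * ‖iteratedFDeriv ℝ 1 f (cylMap (fun i => Real.sqrt lam • φ i) η) -
          iteratedFDeriv ℝ 1 q z‖ + M * Real.sqrt lam * σ * ‖iteratedFDeriv ℝ 1 q z‖ := by
  set A := iteratedFDeriv ℝ 1 f (cylMap (fun i => Real.sqrt lam • φ i) η) with hA
  set B := iteratedFDeriv ℝ 1 q z with hB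
  have hsq := Real.sqrt_nonneg lam
  have hop : ∀ (L : ContinuousMultilinearMap ℝ (fun _ : Fin 1 => Fin M → ℝ) ℝ) (i : Fin M),
      ‖L fun _ => Pi.single i 1‖ ≤ ‖L‖ := fun L i => by
    refine (L.le_opNorm _).trans (mul_le_of_le_one_right (norm_nonneg _) ?_)
    rw [Finset.prod_const]
    refine pow_le_one₀ (norm_nonneg _) ((pi_norm_le_iff_of_nonneg zero_le_one).2 fun j => ?_)
    rw [Pi.single_apply]
    split_ifs <;> simp
  have hterm : ∀ i : Fin M,
      fderiv ℝ f (cylMap (fun i => Real.sqrt lam • φ i) η) (Pi.single i 1) •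
        dualRep0 (Real.sqrt lam • φ i) - (Real.sqrt lam * fderiv ℝ q z (Pi.single i 1)) • e i =
      (Real.sqrt lam * (A - B) fun _ => Pi.single i 1) • dualRep0 (φ i) +
        (Real.sqrt lam * B fun _ => Pi.single i 1) • (dualRep0 (φ i) - e i) := fun i => by
    rw [sub_apply, hA, hB, iteratedFDeriv_one_apply,
      iteratedFDeriv_one_apply, dualRep0_smul]
    module
  rw [hGrad_cylinder _ hf, ← Finset.sum_sub_distrib]
  refine (norm_sum_le_of_le (f := _) Finset.univ (n := fun _ =>
    Real.sqrt lam * 2 * ‖A - B‖ + Real.sqrt lam * σ * ‖B‖) fun i _ => ?_).trans (le_of_eq ?_)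
  · rw [hterm]
    have hg : ‖dualRep0 (φ i)‖ ≤ 2 := by
      have h1 := norm_le_norm_sub_add (dualRep0 (φ i)) (e i)
      rw [e.orthonormal.1 i] at h1
      linarith [hφ i]
    refine (norm_add_le _ _).trans (add_le_add ?_ ?_)
    · rw [norm_smul, norm_mul, Real.norm_of_nonneg hsq]
      calc _ ≤ Real.sqrt lam * ‖A - B‖ * 2 := by gcongr; exact hop _ i
        _ = _ := by ring
    · rw [norm_smul, norm_mul, Real.norm_of_nonneg hsq]
      calc _ ≤ Real.sqrt lam * ‖B‖ * σ := by gcongr; exacts [hop _ i, hφ i]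
        _ = _ := by ring
  · simp only [Finset.sum_const, Finset.card_univ, Fintype.card_fin, nsmul_eq_mul]; ring

lemma memLp_sum_smul {Ω ι E : Type*} [MeasurableSpace Ω] {P : Measure Ω} [NormedAddCommGroup E]
    [NormedSpace ℝ E] {g : ι → Ω → E} (s : Finset ι) (c : ι → ℝ) (hg : ∀ i, MemLp (g i) 2 P) :
    MemLp (fun η => ∑ i ∈ s, c i • g i η) 2 P :=
  memLp_finsetSum s fun i _ => (hg i).const_smul (c i)

lemma toLp_sum_smul {Ω ι E : Type*} [MeasurableSpace Ω] {P : Measure Ω} [NormedAddCommGroup E]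
    [NormedSpace ℝ E] {g : ι → Ω → E} (s : Finset ι) (c : ι → ℝ) (hg : ∀ i, MemLp (g i) 2 P)
    (hU : MemLp (fun η => ∑ i ∈ s, c i • g i η) 2 P) :
    hU.toLp _ = ∑ i ∈ s, c i • (hg i).toLp (g i) := by
  classical
  induction s using Finset.induction_on with
  | empty =>
    refine Lp.ext (hU.coeFn_toLp.trans ?_)
    filter_upwards [Lp.coeFn_zero E 2 P] with η h
    simp only [Finset.sum_empty]; exact h.symm
  | insert a s ha ih =>
    have h1 : MemLp (fun η => ∑ i ∈ s, c i • g i η) 2 P :=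
      memLp_sum_smul s c hg
    rw [Finset.sum_insert ha, ← ih h1, ← MemLp.toLp_const_smul,
      ← MemLp.toLp_add ((hg a).const_smul (c a)) h1]
    refine MemLp.toLp_congr _ _ (Eventually.of_forall fun η => ?_)
    simp [Finset.sum_insert ha]

namespace SpectralData

lemma memLp_eigenfunction_smul (hS : SpectralData ν lam ζ N) (n : ℕ →₀ ℕ) (h : H0 v) :
    MemLp (fun η => eigenfunction ν lam e ζ N n η • h) 2 (tilt ν lam e ζ) :=
  (ContinuousLinearMap.toSpanSingleton ℝ h).comp_memLp' (hS.memLp_eigenfunction n)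

/-- The vector field `𝐞ₙ eᵢ` as an element of `L²(μ_{λ,T}; H₀)`. -/
def eigenVecLp (hS : SpectralData ν lam ζ N) (e : HilbertBasis ℕ ℝ (H0 v)) (n : ℕ →₀ ℕ) (i : ℕ) :
    Lp (H0 v) 2 (tilt ν lam e ζ) := (hS.memLp_eigenfunction_smul n (e i)).toLp _

/-- The gradient of `𝐞ₙ`, as an element of `L²(μ_{λ,T}; H₀)`. -/
def gradLp (hS : SpectralData ν lam ζ N) (e : HilbertBasis ℕ ℝ (H0 v)) (n : ℕ →₀ ℕ) (M : ℕ) :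
    Lp (H0 v) 2 (tilt ν lam e ζ) :=
  ∑ i ∈ Finset.range M, (Real.sqrt lam * stepCoef ζ N n i) • hS.eigenVecLp e (stepIdx N n i) i

lemma memLp_grad (hS : SpectralData ν lam ζ N) (e : HilbertBasis ℕ ℝ (H0 v)) (n : ℕ →₀ ℕ) (M : ℕ) :
    MemLp (fun η => ∑ i ∈ Finset.range M, (Real.sqrt lam * stepCoef ζ N n i) •
      (eigenfunction ν lam e ζ N (stepIdx N n i) η • e i)) 2 (tilt ν lam e ζ) :=
  memLp_sum_smul (Finset.range M) (fun i => Real.sqrt lam * stepCoef ζ N n i)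
    fun i => hS.memLp_eigenfunction_smul (stepIdx N n i) (e i)

lemma gradLp_eq (hS : SpectralData ν lam ζ N) (e : HilbertBasis ℕ ℝ (H0 v)) (n : ℕ →₀ ℕ) (M : ℕ) :
    hS.gradLp e n M = (hS.memLp_grad e n M).toLp _ :=
  (toLp_sum_smul (Finset.range M) (fun i => Real.sqrt lam * stepCoef ζ N n i)
    (fun i => hS.memLp_eigenfunction_smul (stepIdx N n i) (e i)) (hS.memLp_grad e n M)).symm

lemma eLpNorm_le_of_lintegral (hS : SpectralData ν lam ζ N) (hN : N ≤ M) {E : Type*}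
    [NormedAddCommGroup E] {u : W0 v → E} {σ : ℝ} (hσ : 0 ≤ σ)
    (h : ∫⁻ η, ENNReal.ofReal
          (Real.exp (2 * ∑ i : Fin M, rate ζ N i * coordVec ν lam e M η i ^ 2)) *
        ‖u η‖ₑ ^ 2 ∂(groundMeasure ν lam e ζ N) ≤ ENNReal.ofReal σ) :
    eLpNorm u 2 (tilt ν lam e ζ) ≤ ENNReal.ofReal (Real.sqrt (tiltConst ζ N * σ)) := by
  have h0 := tiltConst_nonneg ζ N
  have h1 : eLpNorm u 2 (tilt ν lam e ζ) ^ 2 ≤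
      ENNReal.ofReal (Real.sqrt (tiltConst ζ N * σ)) ^ 2 := by
    rw [eLpNorm_two_sq, hS.lintegral_tilt hN, ← ENNReal.ofReal_pow (Real.sqrt_nonneg _),
      Real.sq_sqrt (by positivity), ENNReal.ofReal_mul h0]
    gcongr
  exact (ENNReal.pow_le_pow_left_iff two_ne_zero).1 h1

/-- The eigenfunctions belong to the domain of the closed form. -/
theorem eigenLp_mem_closedGradGraph (hS : SpectralData ν lam ζ N) {n : ℕ →₀ ℕ} (hM : 0 < M)
    (hN : N ≤ M) (hn : n.support ⊆ Finset.range M) :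
    (hS.eigenLp e n, hS.gradLp e n M) ∈ closedGradGraph (tilt ν lam e ζ) := by
  have hne : Nonempty (Fin M) := ⟨⟨0, hM⟩⟩
  obtain ⟨U, hUdef⟩ : ∃ U : W0 v → H0 v, U = fun η => ∑ i : Fin M, (Real.sqrt lam *
    fderiv ℝ (profile ζ N n M) (coordVec ν lam e M η) (Pi.single i 1)) • e i := ⟨_, rfl⟩
  have hUeq : U = fun η => ∑ i ∈ Finset.range M, (Real.sqrt lam * stepCoef ζ N n i) •
      (eigenfunction ν lam e ζ N (stepIdx N n i) η • e i) := by
    rw [hUdef]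
    funext η
    rw [Finset.sum_range]
    refine Finset.sum_congr rfl fun i _ => ?_
    have hs : (stepIdx N n i).support ⊆ Finset.range M := by
      intro j hj
      by_cases hji : j = i
      · rw [hji]; exact Finset.mem_range.2 i.2
      · rw [Finsupp.mem_support_iff, stepIdx_of_ne _ _ hji] at hj
        exact hn (Finsupp.mem_support_iff.2 hj)
    rw [fderiv_profile_single, hS.eigenfunction_eq_profile hN hs, smul_smul, mul_assoc]
  have hU : MemLp U 2 (tilt ν lam e ζ) := by
    rw [hUeq]; exact hS.memLp_grad e n M
  have hUlp : hU.toLp U = hS.gradLp e n M := by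
    rw [hS.gradLp_eq e n M]
    exact MemLp.toLp_congr _ _ (Eventually.of_forall fun η => congrFun hUeq η)
  rw [← hUlp]
  obtain ⟨K, hK0, hK⟩ := hS.varianceBound_ground e
  obtain ⟨C, hC0, hC⟩ := exists_eLpNorm_profile_le ζ N n hN 1 (p := 2) le_rfl
  have hC' := hC d m v ν lam e hS
  rw [ENNReal.ofReal_ofNat] at hC'
  have htc := tiltConst_nonneg ζ N
  refine mem_closedGradGraph_of_approx (hS.memLp_eigenfunction n) hU fun ε hε => ?_
  -- The two bounds are the `L²` errors below of the function and of its gradient.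
  obtain ⟨σ, hσ0, hσ1, hσ2, hσ3⟩ : ∃ σ : ℝ, 0 < σ ∧ σ ≤ 1 ∧ Real.sqrt (tiltConst ζ N * σ) ≤ ε ∧
      M * Real.sqrt lam * 2 * Real.sqrt (tiltConst ζ N * σ) + M * Real.sqrt lam * σ * C ≤ ε := by
    have c1 : ContinuousAt (fun σ : ℝ => Real.sqrt (tiltConst ζ N * σ)) 0 := by fun_prop
    have c2 : ContinuousAt (fun σ : ℝ => M * Real.sqrt lam * 2 * Real.sqrt (tiltConst ζ N * σ) +
      M * Real.sqrt lam * σ * C) 0 := by fun_prop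
    have t1 := c1.tendsto.mono_left (nhdsWithin_le_nhds (s := Set.Ioi 0))
    have t2 := c2.tendsto.mono_left (nhdsWithin_le_nhds (s := Set.Ioi 0))
    simp only [mul_zero, Real.sqrt_zero, zero_mul, add_zero] at t1 t2
    obtain ⟨σ, ⟨⟨h1, h2⟩, h3⟩, h4⟩ := (((t1.eventually_le_const hε).and
      (t2.eventually_le_const hε)).and (Ioo_mem_nhdsGT one_pos)).and self_mem_nhdsWithin |>.exists
    exact ⟨σ, h4, h3.2.le, h1, h2⟩
  obtain ⟨f, φ, hf, hfb, hφ, happ⟩ := exists_cylinder_approx hK0 hK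
    (hS.map_coordVec_ground (M := M) e) ζ N n 1 hσ0
  have hd0 := hS.eLpNorm_le_of_lintegral hN hσ0.le (happ 0 zero_le_one)
  have hd1 := hS.eLpNorm_le_of_lintegral hN hσ0.le (happ 1 le_rfl)
  refine ⟨fun η => f (cylMap (fun i => Real.sqrt lam • φ i) η),
    isSmoothCylinder_cylinder _ hf hfb, ?_, ?_⟩
  · refine (le_of_eq ?_).trans (hd0.trans (ENNReal.ofReal_le_ofReal hσ2))
    refine eLpNorm_congr_enorm_ae (Eventually.of_forall fun η => ?_)
    rw [enorm_iteratedFDeriv_zero_sub, hS.eigenfunction_eq_profile hN hn]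
  · set Δ : W0 v → ℝ := fun η =>
      ‖iteratedFDeriv ℝ 1 f (cylMap (fun i => Real.sqrt lam • φ i) η) -
        iteratedFDeriv ℝ 1 (profile ζ N n M) (coordVec ν lam e M η)‖ with hΔ
    set B : W0 v → ℝ := fun η =>
      ‖iteratedFDeriv ℝ 1 (profile ζ N n M) (coordVec ν lam e M η)‖ with hB
    have hcB : StronglyMeasurable fun η =>
        iteratedFDeriv ℝ 1 (profile ζ N n M) (coordVec ν lam e M η) :=
      (continuous_iteratedFDeriv_profile ζ N n M 1).comp_stronglyMeasurable
        measurable_coordVec.stronglyMeasurable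
    have hcA : StronglyMeasurable fun η : W0 v =>
        iteratedFDeriv ℝ 1 f (cylMap (fun i => Real.sqrt lam • φ i) η) :=
      (hf.continuous_iteratedFDeriv (by exact_mod_cast le_top)).comp_stronglyMeasurable
        (cylMap (fun i => Real.sqrt lam • φ i)).continuous.measurable.stronglyMeasurable
    set c₁ : ℝ := M * Real.sqrt lam * 2 with hc₁
    set c₂ : ℝ := M * Real.sqrt lam * σ with hc₂
    have hc₁0 : 0 ≤ c₁ := by positivity
    have hc₂0 : 0 ≤ c₂ := by positivity
    calc eLpNorm (fun η => hGrad (fun η => f (cylMap (fun i => Real.sqrt lam • φ i) η)) η - U η)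
          2 (tilt ν lam e ζ)
        ≤ eLpNorm (c₁ • Δ + c₂ • B) 2 (tilt ν lam e ζ) := by
          refine eLpNorm_mono_real fun η => ?_
          rw [hUdef]
          exact norm_hGrad_sub_le e hf hσ1 hφ η (coordVec ν lam e M η)
      _ ≤ eLpNorm (c₁ • Δ) 2 (tilt ν lam e ζ) + eLpNorm (c₂ • B) 2 (tilt ν lam e ζ) :=
          eLpNorm_add_le ((hcA.sub hcB).norm.const_smul c₁).aestronglyMeasurable
            (hcB.norm.const_smul c₂).aestronglyMeasurable (by norm_num)
      _ ≤ ENNReal.ofReal c₁ * ENNReal.ofReal (Real.sqrt (tiltConst ζ N * σ)) +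
            ENNReal.ofReal c₂ * ENNReal.ofReal C := by
          rw [eLpNorm_const_smul, eLpNorm_const_smul, Real.enorm_of_nonneg hc₁0,
            Real.enorm_of_nonneg hc₂0, hΔ, hB, eLpNorm_norm, eLpNorm_norm]
          gcongr
      _ ≤ ENNReal.ofReal ε := by
          rw [← ENNReal.ofReal_mul hc₁0, ← ENNReal.ofReal_mul hc₂0,
            ← ENNReal.ofReal_add (by positivity) (by positivity)]
          exact ENNReal.ofReal_le_ofReal hσ3

end SpectralData

end

section

/-! ### Integration by parts -/

/-- Integration by parts in a standard Gaussian variable, with a parameter. -/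
lemma integral_by_parts_prod {S : Type*} [MeasurableSpace S] {Q : Measure S} [SFinite Q]
    {U U' K K' : S → ℝ → ℝ} (hU : ∀ y x, HasDerivAt (U y) (U' y x) x)
    (hK : ∀ y x, HasDerivAt (K y) (K' y x) x)
    (h1 : Integrable (fun p : S × ℝ => U' p.1 p.2 * K p.1 p.2) (Q.prod (gaussianReal 0 1)))
    (h2 : Integrable (fun p : S × ℝ => U p.1 p.2 * (p.2 * K p.1 p.2 - K' p.1 p.2))
      (Q.prod (gaussianReal 0 1)))
    (h3 : Integrable (fun p : S × ℝ => U p.1 p.2 * K p.1 p.2) (Q.prod (gaussianReal 0 1))) :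
    ∫ p, U' p.1 p.2 * K p.1 p.2 ∂(Q.prod (gaussianReal 0 1)) =
      ∫ p, U p.1 p.2 * (p.2 * K p.1 p.2 - K' p.1 p.2) ∂(Q.prod (gaussianReal 0 1)) := by
  rw [integral_prod _ h1, integral_prod _ h2]
  refine integral_congr_ae ?_
  filter_upwards [h1.prod_right_ae, h2.prod_right_ae, h3.prod_right_ae] with y g1 g2 g3
  exact gaussian_integral_by_parts (hU y) (hK y) g1 g2 g3

lemma measurable_update_zero {Ω : Type*} {mΩ : MeasurableSpace Ω} {X : ℕ → Ω → ℝ} {i : ℕ}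
    (h : ∀ j, j ≠ i → Measurable (X j)) : Measurable fun w' => Function.update (fun j => X j w') i 0 := by
  refine measurable_pi_iff.2 fun j => ?_
  by_cases hj : j = i
  · subst hj; simp
  · simpa [Function.update_of_ne hj] using h j hj

namespace IsIndepGaussian

variable {Ω : Type*} [MeasurableSpace Ω] {P : Measure Ω} {X : ℕ → Ω → ℝ}

lemma measurable_update {w : ℕ → ℝ≥0} (hX : IsIndepGaussian P X w) (i : ℕ) :
    Measurable fun w' => Function.update (fun j => X j w') i 0 :=
  measurable_update_zero fun j _ => hX.measurable j

/-- The joint law of one variable and all the others is a product. -/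
lemma map_update_prod {w : ℕ → ℝ≥0} (hX : IsIndepGaussian P X w) (i : ℕ) :
    P.map (fun w' => (Function.update (fun j => X j w') i 0, X i w')) =
      (P.map fun w' => Function.update (fun j => X j w') i 0).prod (gaussianReal 0 (w i)) := by
  have hprob := hX.isProbabilityMeasure
  have h1 := indep_iSup_of_disjoint (fun j => (hX.measurable j).comap_le) hX.iIndep.iIndep
    (S := {i}ᶜ) (T := {i}) (Set.disjoint_compl_left_iff_subset.2 subset_rfl)
  have h2 : IndepFun (fun w' => Function.update (fun j => X j w') i 0) (X i) P := by
    refine indep_of_indep_of_le_left (indep_of_indep_of_le_right h1 ?_) ?_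
    · exact le_iSup₂_of_le i rfl le_rfl
    · refine Measurable.comap_le (measurable_update_zero fun j hj => ?_)
      refine Measurable.mono (comap_measurable (X j)) ?_ le_rfl
      exact le_iSup₂_of_le (f := fun j (_ : j ∈ ({i}ᶜ : Set ℕ)) =>
        MeasurableSpace.comap (X j) inferInstance) j hj le_rfl
  rw [(indepFun_iff_map_prod_eq_prod_map_map (hX.measurable_update i).aemeasurable
    (hX.measurable i).aemeasurable).1 h2, hX.law]

end IsIndepGaussian

variable {d m : ℕ} {v : Fin m → StrongDual ℝ (PathSpace d)} {ν : Measure (W0 v)} {lam : ℝ}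
  {e : HilbertBasis ℕ ℝ (H0 v)} {ζ : ℕ → ℝ} {N M : ℕ}

/-- The coordinates of `η` other than the `i`-th one. -/
def otherCoords (ν : Measure (W0 v)) (lam : ℝ) (e : HilbertBasis ℕ ℝ (H0 v)) (ζ : ℕ → ℝ) (i : ℕ)
    (η : W0 v) : ℕ → ℝ := Function.update (fun j => groundCoord ν lam e ζ j η) i 0

/-- The coefficient of the `i`-th variable in `φ`. -/
def dualCoef (lam : ℝ) (e : HilbertBasis ℕ ℝ (H0 v)) (ζ : ℕ → ℝ) (i : ℕ)
    (φ : StrongDual ℝ (W0 v)) : ℝ :=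
  inner ℝ (e i) (dualRep0 φ) / Real.sqrt (lam * |1 + ζ i|)

namespace SpectralData

/-- Every functional splits into a multiple of the `i`-th variable and a function of the other
variables. -/
lemma exists_dual_eq (hS : SpectralData ν lam ζ N) (e : HilbertBasis ℕ ℝ (H0 v)) (i : ℕ)
    (φ : StrongDual ℝ (W0 v)) : ∃ Ψ : (ℕ → ℝ) → ℝ, Measurable Ψ ∧
      ∀ᵐ η ∂ν, φ η = groundCoord ν lam e ζ i η * dualCoef lam e ζ i φ +
        Ψ (otherCoords ν lam e ζ i η) := by
  obtain ⟨ns, hns, hae⟩ := hS.exists_seq_groundCoord e (dualRep0 φ)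
  set S : ℕ → (ℕ → ℝ) → ℝ := fun k y => ∑ j ∈ Finset.range (ns k), dualCoef lam e ζ j φ * y j with hSdef
  -- The upper limit is a measurable function of the coordinates, defined everywhere.
  refine ⟨fun y => limsup (fun k => S k y) atTop, ?_, ?_⟩
  · refine Measurable.limsup fun k => ?_
    exact Finset.measurable_fun_sum _ fun j _ => (measurable_pi_apply j).const_mul _
  · filter_upwards [hae, hS.isonormal.wienerIntegral_dual φ] with η h1 h2
    have h3 : Tendsto (fun k => S k (otherCoords ν lam e ζ i η)) atTop
        (𝓝 (φ η - groundCoord ν lam e ζ i η * dualCoef lam e ζ i φ)) := by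
      rw [h2] at h1
      refine (h1.sub_const (groundCoord ν lam e ζ i η * dualCoef lam e ζ i φ)).congr' ?_
      -- The partial sum contains the `i`-th term as soon as `ns k > i`.
      filter_upwards [hns.tendsto_atTop.eventually_gt_atTop i] with k hk
      rw [hSdef]
      simp only []
      rw [← Finset.add_sum_erase _ _ (Finset.mem_range.2 hk),
        ← Finset.add_sum_erase (f := fun j => dualCoef lam e ζ j φ * otherCoords ν lam e ζ i η j) _
          (Finset.mem_range.2 hk)]
      have h4 : ∑ j ∈ (Finset.range (ns k)).erase i,
          dualCoef lam e ζ j φ * otherCoords ν lam e ζ i η j =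
          ∑ j ∈ (Finset.range (ns k)).erase i,
            inner ℝ (e j) (dualRep0 φ) / Real.sqrt (lam * |1 + ζ j|) * groundCoord ν lam e ζ j η :=
        Finset.sum_congr rfl fun j hj => by
          rw [otherCoords, Function.update_of_ne (Finset.ne_of_mem_erase hj)]; rfl
      rw [h4, otherCoords, Function.update_self, dualCoef]
      ring
    rw [h3.limsup_eq]; ring

/-- Integration by parts along `eᵢ` for the ground state measure. -/
lemma integral_cylinder_by_parts (hS : SpectralData ν lam ζ N) (e : HilbertBasis ℕ ℝ (H0 v))
    (i : ℕ) {f : (Fin M → ℝ) → ℝ} (hf : ContDiff ℝ ∞ f) (ψ : Fin M → StrongDual ℝ (W0 v))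
    {k k' : ℝ → ℝ} (hk : ∀ x, HasDerivAt k (k' x) x) (hk' : Measurable k') {r : (ℕ → ℝ) → ℝ}
    (hr : Measurable r)
    (h1 : Integrable (fun η => fderiv ℝ f (cylMap ψ η) (fun l => dualCoef lam e ζ i (ψ l)) *
      (k (groundCoord ν lam e ζ i η) * r (otherCoords ν lam e ζ i η))) (groundMeasure ν lam e ζ N))
    (h2 : Integrable (fun η => f (cylMap ψ η) * (groundCoord ν lam e ζ i η *
      (k (groundCoord ν lam e ζ i η) * r (otherCoords ν lam e ζ i η)) -
      k' (groundCoord ν lam e ζ i η) * r (otherCoords ν lam e ζ i η))) (groundMeasure ν lam e ζ N))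
    (h3 : Integrable (fun η => f (cylMap ψ η) *
      (k (groundCoord ν lam e ζ i η) * r (otherCoords ν lam e ζ i η)))
      (groundMeasure ν lam e ζ N)) :
    ∫ η, fderiv ℝ f (cylMap ψ η) (fun l => dualCoef lam e ζ i (ψ l)) *
      (k (groundCoord ν lam e ζ i η) * r (otherCoords ν lam e ζ i η)) ∂(groundMeasure ν lam e ζ N) =
    ∫ η, f (cylMap ψ η) * (groundCoord ν lam e ζ i η *
      (k (groundCoord ν lam e ζ i η) * r (otherCoords ν lam e ζ i η)) -
      k' (groundCoord ν lam e ζ i η) * r (otherCoords ν lam e ζ i η))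
        ∂(groundMeasure ν lam e ζ N) := by
  set γ := groundMeasure ν lam e ζ N with hγ
  have hprob : IsProbabilityMeasure γ := hS.isProbabilityMeasure_ground e
  choose Ψ hΨ hψ using fun l => hS.exists_dual_eq e i (ψ l)
  set b : Fin M → ℝ := fun l => dualCoef lam e ζ i (ψ l) with hb
  set Y := otherCoords ν lam e ζ i with hY
  set X := groundCoord ν lam e ζ i with hX
  set τ : W0 v → (ℕ → ℝ) × ℝ := fun η => (Y η, X η) with hτ
  set Q := γ.map Y with hQ
  have hYm : Measurable Y := (hS.indep_groundCoord e).measurable_update i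
  have hτm : Measurable τ := hYm.prodMk (measurable_groundCoord i)
  have hmap : γ.map τ = Q.prod (gaussianReal 0 1) := (hS.indep_groundCoord e).map_update_prod i
  have hcyl : ∀ᵐ η ∂γ, cylMap ψ η = X η • b + fun l => Ψ l (Y η) := by
    have := (ae_all_iff.2 hψ)
    filter_upwards [ground_absolutelyContinuous.ae_le this] with η h
    funext l
    rw [cylMap_apply, h l]; rfl
  set U : (ℕ → ℝ) → ℝ → ℝ := fun y x => f (x • b + fun l => Ψ l y) with hU
  set U' : (ℕ → ℝ) → ℝ → ℝ := fun y x => fderiv ℝ f (x • b + fun l => Ψ l y) b with hU'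
  have hUd : ∀ y x, HasDerivAt (U y) (U' y x) x := fun y x => by
    have g1 : HasDerivAt (fun x : ℝ => x • b + fun l => Ψ l y) b x := by
      simpa using ((hasDerivAt_id x).smul_const b).add_const (fun l => Ψ l y)
    exact ((hf.differentiable (by simp)).differentiableAt.hasFDerivAt).comp_hasDerivAt x g1
  have hvec : Measurable fun p : (ℕ → ℝ) × ℝ => p.2 • b + fun l => Ψ l p.1 := by
    refine measurable_pi_iff.2 fun l => ?_
    exact (measurable_snd.mul_const _).add ((hΨ l).comp measurable_fst)
  have hUm : Measurable fun p : (ℕ → ℝ) × ℝ => U p.1 p.2 := hf.continuous.measurable.comp hvec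
  have hUm' : Measurable fun p : (ℕ → ℝ) × ℝ => U' p.1 p.2 := by
    have hc : Continuous fun z => fderiv ℝ f z b :=
      (hf.continuous_fderiv (by simp)).clm_apply continuous_const
    exact hc.measurable.comp hvec
  have hkm : Measurable k :=
    (continuous_iff_continuousAt.2 fun x => (hk x).continuousAt).measurable
  have hKm : Measurable fun p : (ℕ → ℝ) × ℝ => k p.2 * r p.1 :=
    (hkm.comp measurable_snd).mul (hr.comp measurable_fst)
  have hKm' : Measurable fun p : (ℕ → ℝ) × ℝ => k' p.2 * r p.1 :=
    (hk'.comp measurable_snd).mul (hr.comp measurable_fst)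
  have m1 : Measurable fun p : (ℕ → ℝ) × ℝ => U' p.1 p.2 * (k p.2 * r p.1) := hUm'.mul hKm
  have m2 : Measurable fun p : (ℕ → ℝ) × ℝ =>
      U p.1 p.2 * (p.2 * (k p.2 * r p.1) - k' p.2 * r p.1) :=
    hUm.mul ((measurable_snd.mul hKm).sub hKm')
  have m3 : Measurable fun p : (ℕ → ℝ) × ℝ => U p.1 p.2 * (k p.2 * r p.1) := hUm.mul hKm
  have a1 : (fun η => fderiv ℝ f (cylMap ψ η) b * (k (X η) * r (Y η))) =ᵐ[γ]
      (fun p : (ℕ → ℝ) × ℝ => U' p.1 p.2 * (k p.2 * r p.1)) ∘ τ := by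
    filter_upwards [hcyl] with η h
    rw [h]; rfl
  have a2 : (fun η => f (cylMap ψ η) * (X η * (k (X η) * r (Y η)) - k' (X η) * r (Y η))) =ᵐ[γ]
      (fun p : (ℕ → ℝ) × ℝ => U p.1 p.2 * (p.2 * (k p.2 * r p.1) - k' p.2 * r p.1)) ∘ τ := by
    filter_upwards [hcyl] with η h
    rw [h]; rfl
  have a3 : (fun η => f (cylMap ψ η) * (k (X η) * r (Y η))) =ᵐ[γ]
      (fun p : (ℕ → ℝ) × ℝ => U p.1 p.2 * (k p.2 * r p.1)) ∘ τ := by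
    filter_upwards [hcyl] with η h
    rw [h]; rfl
  have key := integral_by_parts_prod (Q := Q) (K := fun y x => k x * r y)
    (K' := fun y x => k' x * r y) hUd (fun y x => (hk x).mul_const (r y))
    (by rw [← hmap]
        exact (integrable_map_measure m1.aestronglyMeasurable hτm.aemeasurable).2
          ((integrable_congr a1).1 h1))
    (by rw [← hmap]
        exact (integrable_map_measure m2.aestronglyMeasurable hτm.aemeasurable).2
          ((integrable_congr a2).1 h2))
    (by rw [← hmap]
        exact (integrable_map_measure m3.aestronglyMeasurable hτm.aemeasurable).2
          ((integrable_congr a3).1 h3))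
  rw [← hmap, integral_map hτm.aemeasurable m1.aestronglyMeasurable,
    integral_map hτm.aemeasurable m2.aestronglyMeasurable] at key
  rw [integral_congr_ae a1, integral_congr_ae a2]
  exact key

end SpectralData

end

section

/-! ### The Dirichlet form against the eigenfunctions -/

/-- The multi-index of the adjoint `∂ᵢ*𝐞ₙ` of the partial derivative. -/
def costepIdx (N : ℕ) (n : ℕ →₀ ℕ) (i : ℕ) : ℕ →₀ ℕ :=
  n.update i (if i < N then n i - 1 else n i + 1)

/-- The coefficient of the adjoint `∂ᵢ*𝐞ₙ` of the partial derivative, for `λ = 1`. -/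
def costepCoef (ζ : ℕ → ℝ) (N : ℕ) (n : ℕ →₀ ℕ) (i : ℕ) : ℝ :=
  if i < N then -(Real.sqrt |1 + ζ i| * Real.sqrt (n i))
    else Real.sqrt |1 + ζ i| * Real.sqrt (n i + 1 : ℕ)

/-- The `i`-th factor of `𝐞ₙ / 𝐞₀²`, as a function of the `i`-th ground state coordinate. -/
def dualFactor (N i k : ℕ) (x : ℝ) : ℝ :=
  normHermite k x * if i < N then Real.exp (x ^ 2 / 2) else 1

/-- The derivative of `dualFactor`. -/
def dualFactorDeriv (N i k : ℕ) (x : ℝ) : ℝ :=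
  if i < N then (Real.sqrt k * normHermite (k - 1) x + x * normHermite k x) * Real.exp (x ^ 2 / 2)
    else Real.sqrt k * normHermite (k - 1) x

lemma hasDerivAt_dualFactor (N i k : ℕ) (x : ℝ) :
    HasDerivAt (dualFactor N i k) (dualFactorDeriv N i k x) x := by
  unfold dualFactor dualFactorDeriv
  split_ifs
  · have h1 : HasDerivAt (fun x : ℝ => Real.exp (x ^ 2 / 2)) (Real.exp (x ^ 2 / 2) * x) x := by
      refine ((hasDerivAt_pow 2 x).div_const 2).exp.congr_deriv ?_
      simp
    exact ((hasDerivAt_normHermite k x).mul h1).congr_deriv (by ring)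
  · exact ((hasDerivAt_normHermite k x).mul_const 1).congr_deriv (by ring)

lemma measurable_dualFactorDeriv (N i k : ℕ) : Measurable (dualFactorDeriv N i k) := by
  unfold dualFactorDeriv
  have h1 := (continuous_normHermite k).measurable
  have h2 := (continuous_normHermite (k - 1)).measurable
  split_ifs <;> fun_prop

/-- The Gaussian adjoint `x ↦ x g(x) - g'(x)` acts on the factors by shifting the degree. -/
lemma mul_dualFactor_sub (ζ : ℕ → ℝ) (N : ℕ) (n : ℕ →₀ ℕ) (i : ℕ) (x : ℝ) :
    Real.sqrt |1 + ζ i| * (x * dualFactor N i (n i) x - dualFactorDeriv N i (n i) x) =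
      costepCoef ζ N n i * dualFactor N i (costepIdx N n i i) x := by
  have h := mul_normHermite (n i) x
  have hc : costepIdx N n i i = if i < N then n i - 1 else n i + 1 := by simp [costepIdx]
  rw [hc]
  unfold dualFactor dualFactorDeriv costepCoef
  split_ifs
  · ring
  · linear_combination Real.sqrt |1 + ζ i| * h

variable {d m : ℕ} {v : Fin m → StrongDual ℝ (PathSpace d)} {ν : Measure (W0 v)} {lam : ℝ}
  {e : HilbertBasis ℕ ℝ (H0 v)} {ζ : ℕ → ℝ} {N M : ℕ}

/-- The value of the ground state `𝐞₀` at the origin of the coordinates. -/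
def groundConst (ζ : ℕ → ℝ) (N : ℕ) : ℝ :=
  |det2 fun i => |1 + ζ i| - 1| ^ (1 / 4 : ℝ) * Real.exp (∑ i ∈ Finset.range N, |1 + ζ i| / 2)

/-- The factor of `𝐞ₙ / 𝐞₀²` depending on the coordinates other than the `i`-th one. -/
def otherFactor (ζ : ℕ → ℝ) (N : ℕ) (n : ℕ →₀ ℕ) (i : ℕ) (y : ℕ → ℝ) : ℝ :=
  (groundConst ζ N)⁻¹ * multiHermite (n.erase i) y *
    ∏ j ∈ (Finset.range N).erase i, Real.exp (y j ^ 2 / 2)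

lemma measurable_otherFactor (ζ : ℕ → ℝ) (N : ℕ) (n : ℕ →₀ ℕ) (i : ℕ) :
    Measurable (otherFactor ζ N n i) := by
  have h : Measurable (multiHermite (n.erase i)) := by
    unfold multiHermite
    exact Finset.measurable_fun_prod _ fun j _ =>
      (continuous_normHermite _).measurable.comp (measurable_pi_apply j)
  unfold otherFactor
  exact (h.const_mul _).mul (Finset.measurable_fun_prod _ fun j _ => by fun_prop)

namespace SpectralData

lemma eigenfunction_zero_eq (hS : SpectralData ν lam ζ N) (η : W0 v) :
    eigenfunction ν lam e ζ N 0 η =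
      groundConst ζ N * (∏ j ∈ Finset.range N, Real.exp (groundCoord ν lam e ζ j η ^ 2 / 2))⁻¹ := by
  rw [eigenfunction, hermiteProd_zero, mul_one, groundConst, ← Real.exp_sum, ← Real.exp_sum,
    ← Real.exp_neg, mul_assoc, ← Real.exp_add, ← Finset.sum_neg_distrib, ← Finset.sum_add_distrib]
  congr 2
  refine Finset.sum_congr rfl fun i _ => ?_
  have := hS.lam_pos
  rw [groundCoord, mul_pow, Real.sq_sqrt (by positivity)]
  field_simp; ring

lemma hermiteProd_div_eq (hS : SpectralData ν lam ζ N) (n : ℕ →₀ ℕ) (i : ℕ) (η : W0 v) :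
    hermiteProd ν lam e ζ n η * (eigenfunction ν lam e ζ N 0 η)⁻¹ =
      dualFactor N i (n i) (groundCoord ν lam e ζ i η) *
        otherFactor ζ N n i (otherCoords ν lam e ζ i η) := by
  have h1 : hermiteProd ν lam e ζ n η = multiHermite (n.erase i) (otherCoords ν lam e ζ i η) *
      normHermite (n i) (groundCoord ν lam e ζ i η) := by
    refine (multiHermite_erase n i fun j => groundCoord ν lam e ζ j η).trans ?_
    congr 1
    refine Finset.prod_congr rfl fun j hj => ?_
    rw [Finsupp.support_erase] at hj
    simp only [otherCoords, Function.update_of_ne (Finset.ne_of_mem_erase hj)]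
  have h2 : ∏ j ∈ (Finset.range N).erase i, Real.exp (otherCoords ν lam e ζ i η j ^ 2 / 2) =
      ∏ j ∈ (Finset.range N).erase i, Real.exp (groundCoord ν lam e ζ j η ^ 2 / 2) :=
    Finset.prod_congr rfl fun j hj => by
      rw [otherCoords, Function.update_of_ne (Finset.ne_of_mem_erase hj)]
  rw [h1, hS.eigenfunction_zero_eq, mul_inv, inv_inv, otherFactor, h2, dualFactor]
  by_cases hi : i < N
  · rw [← Finset.mul_prod_erase _ _ (Finset.mem_range.2 hi), if_pos hi]; ring
  · rw [Finset.erase_eq_of_notMem (by simpa using hi), if_neg hi]; ring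

lemma hermiteProd_costep_div_eq (hS : SpectralData ν lam ζ N) (n : ℕ →₀ ℕ) (i : ℕ) (η : W0 v) :
    costepCoef ζ N n i * (hermiteProd ν lam e ζ (costepIdx N n i) η *
      (eigenfunction ν lam e ζ N 0 η)⁻¹) =
    Real.sqrt |1 + ζ i| * (groundCoord ν lam e ζ i η *
      (dualFactor N i (n i) (groundCoord ν lam e ζ i η) *
        otherFactor ζ N n i (otherCoords ν lam e ζ i η)) -
      dualFactorDeriv N i (n i) (groundCoord ν lam e ζ i η) *
        otherFactor ζ N n i (otherCoords ν lam e ζ i η)) := by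
  rw [hS.hermiteProd_div_eq _ i]
  have h : otherFactor ζ N (costepIdx N n i) i = otherFactor ζ N n i := by
    unfold otherFactor
    rw [costepIdx, Finsupp.erase_update_eq_erase]
  rw [h, ← mul_assoc, ← mul_dualFactor_sub]
  ring

lemma integral_mul_eigenfunction (hS : SpectralData ν lam ζ N) (g : W0 v → ℝ) (n : ℕ →₀ ℕ) :
    ∫ η, g η * eigenfunction ν lam e ζ N n η ∂(tilt ν lam e ζ) =
      ∫ η, g η * (hermiteProd ν lam e ζ n η * (eigenfunction ν lam e ζ N 0 η)⁻¹)
        ∂(groundMeasure ν lam e ζ N) := by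
  rw [integral_ground]
  refine integral_congr_ae (Eventually.of_forall fun η => ?_)
  have := (hS.eigenfunction_zero_pos (e := e) η).ne'
  simp only []
  rw [eigenfunction_eq n]
  field_simp

lemma integrable_mul_hermiteProd_div (hS : SpectralData ν lam ζ N) {g : W0 v → ℝ}
    (hg : MemLp g 2 (tilt ν lam e ζ)) (n : ℕ →₀ ℕ) :
    Integrable (fun η => g η * (hermiteProd ν lam e ζ n η * (eigenfunction ν lam e ζ N 0 η)⁻¹))
      (groundMeasure ν lam e ζ N) := by
  rw [integrable_ground]
  refine (hg.integrable_mul (hS.memLp_eigenfunction n)).congr (Eventually.of_forall fun η => ?_)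
  have := (hS.eigenfunction_zero_pos (e := e) η).ne'
  simp only [Pi.mul_apply]
  rw [eigenfunction_eq n]
  field_simp

/-- Integration by parts: the adjoint of the derivative along `eᵢ` maps `𝐞ₙ` to a multiple of a
neighbouring eigenfunction. -/
theorem integral_hGrad_mul_eigenfunction (hS : SpectralData ν lam ζ N) {F : W0 v → ℝ}
    (hF : IsSmoothCylinder F) (hFL : MemLp F 2 (tilt ν lam e ζ))
    (hGL : MemLp (hGrad F) 2 (tilt ν lam e ζ)) (n : ℕ →₀ ℕ) (i : ℕ) :
    ∫ η, inner ℝ (e i) (hGrad F η) * eigenfunction ν lam e ζ N n η ∂(tilt ν lam e ζ) =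
      Real.sqrt lam * costepCoef ζ N n i *
        ∫ η, F η * eigenfunction ν lam e ζ N (costepIdx N n i) η ∂(tilt ν lam e ζ) := by
  obtain ⟨r, ψ, f, hf, rfl⟩ := hF.exists_eq
  set s := Real.sqrt (lam * |1 + ζ i|) with hs
  have hs0 : 0 < s := hS.sqrt_pos i
  have hssplit : s = Real.sqrt lam * Real.sqrt |1 + ζ i| := Real.sqrt_mul hS.lam_pos.le _
  have ha0 : Real.sqrt |1 + ζ i| ≠ 0 := fun h => hs0.ne' (by rw [hssplit, h, mul_zero])
  have hgrad : ∀ η, fderiv ℝ f (cylMap ψ η) (fun l => dualCoef lam e ζ i (ψ l)) =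
      s⁻¹ * inner ℝ (e i) (hGrad (fun η => f (cylMap ψ η)) η) := by
    intro η
    have h5 : (fun l => dualCoef lam e ζ i (ψ l)) =
        ∑ l, dualCoef lam e ζ i (ψ l) • (Pi.single l 1 : Fin r → ℝ) := pi_eq_sum_univ' _
    rw [hGrad_cylinder ψ hf, inner_sum, h5, map_sum, Finset.mul_sum]
    refine Finset.sum_congr rfl fun l _ => ?_
    rw [map_smul, smul_eq_mul, inner_smul_right, dualCoef, ← hs]
    ring
  have hGi : MemLp (fun η => inner ℝ (e i) (hGrad (fun η => f (cylMap ψ η)) η)) 2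
      (tilt ν lam e ζ) := (innerSL ℝ (e i)).comp_memLp' hGL
  have i1 := hS.integrable_mul_hermiteProd_div hGi n
  have i2 := hS.integrable_mul_hermiteProd_div hFL (costepIdx N n i)
  have i3 := hS.integrable_mul_hermiteProd_div hFL n
  have e2 : ∀ η, f (cylMap ψ η) * (groundCoord ν lam e ζ i η *
      (dualFactor N i (n i) (groundCoord ν lam e ζ i η) *
        otherFactor ζ N n i (otherCoords ν lam e ζ i η)) -
      dualFactorDeriv N i (n i) (groundCoord ν lam e ζ i η) *
        otherFactor ζ N n i (otherCoords ν lam e ζ i η)) =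
      (Real.sqrt |1 + ζ i|)⁻¹ * costepCoef ζ N n i * (f (cylMap ψ η) *
        (hermiteProd ν lam e ζ (costepIdx N n i) η * (eigenfunction ν lam e ζ N 0 η)⁻¹)) := by
    intro η
    have h := hS.hermiteProd_costep_div_eq (e := e) n i η
    have h' := inv_mul_cancel₀ ha0
    linear_combination (-(Real.sqrt |1 + ζ i|)⁻¹ * f (cylMap ψ η)) * h -
      f (cylMap ψ η) * (groundCoord ν lam e ζ i η *
      (dualFactor N i (n i) (groundCoord ν lam e ζ i η) *
        otherFactor ζ N n i (otherCoords ν lam e ζ i η)) -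
      dualFactorDeriv N i (n i) (groundCoord ν lam e ζ i η) *
        otherFactor ζ N n i (otherCoords ν lam e ζ i η)) * h'
  have key := hS.integral_cylinder_by_parts e i hf ψ (hasDerivAt_dualFactor N i (n i))
    (measurable_dualFactorDeriv N i (n i)) (measurable_otherFactor ζ N n i)
    (by
      refine (i1.const_mul s⁻¹).congr (Eventually.of_forall fun η => ?_)
      simp only []
      rw [hgrad, hS.hermiteProd_div_eq n i, mul_assoc])
    (by
      refine (i2.const_mul ((Real.sqrt |1 + ζ i|)⁻¹ * costepCoef ζ N n i)).congr
        (Eventually.of_forall fun η => ?_)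
      simp only []
      rw [e2])
    (by
      refine i3.congr (Eventually.of_forall fun η => ?_)
      simp only []
      rw [hS.hermiteProd_div_eq n i])
  simp_rw [e2, hgrad, ← hS.hermiteProd_div_eq n i, mul_assoc s⁻¹] at key
  rw [integral_const_mul, integral_const_mul] at key
  rw [hS.integral_mul_eigenfunction, hS.integral_mul_eigenfunction]
  have h6 : ∀ {a b : ℝ}, s⁻¹ * a = b → a = s * b := fun {a b} h => by
    rw [← h, mul_inv_cancel_left₀ hs0.ne']
  rw [h6 key, hssplit]
  field_simp

/-! ### The Dirichlet form on `L²` -/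

lemma inner_eigenVecLp (hS : SpectralData ν lam ζ N) (n : ℕ →₀ ℕ) (i : ℕ)
    (G : Lp (H0 v) 2 (tilt ν lam e ζ)) : inner ℝ (hS.eigenVecLp e n i) G =
      ∫ η, inner ℝ (e i) (G η) * eigenfunction ν lam e ζ N n η ∂(tilt ν lam e ζ) := by
  rw [L2.inner_def]
  refine integral_congr_ae ?_
  filter_upwards [(hS.memLp_eigenfunction_smul n (e i)).coeFn_toLp] with η hη
  rw [eigenVecLp, hη, real_inner_smul_left, mul_comm]

lemma inner_eigenVecLp_of_mem (hS : SpectralData ν lam ζ N) (n : ℕ →₀ ℕ) (i : ℕ)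
    {q : Lp ℝ 2 (tilt ν lam e ζ) × Lp (H0 v) 2 (tilt ν lam e ζ)}
    (hq : q ∈ closedGradGraph (tilt ν lam e ζ)) :
    inner ℝ (hS.eigenVecLp e n i) q.2 =
      Real.sqrt lam * costepCoef ζ N n i * inner ℝ (hS.eigenLp e (costepIdx N n i)) q.1 := by
  have hcl : IsClosed {q : Lp ℝ 2 (tilt ν lam e ζ) × Lp (H0 v) 2 (tilt ν lam e ζ) |
      inner ℝ (hS.eigenVecLp e n i) q.2 =
        Real.sqrt lam * costepCoef ζ N n i * inner ℝ (hS.eigenLp e (costepIdx N n i)) q.1} :=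
    isClosed_eq (continuous_const.inner continuous_snd)
      (continuous_const.mul (continuous_const.inner continuous_fst))
  refine closure_minimal ?_ hcl hq
  rintro q ⟨F, hF, h1, h2⟩
  have hFL : MemLp F 2 (tilt ν lam e ζ) := (memLp_congr_ae h1).1 (Lp.memLp q.1)
  have hGL : MemLp (hGrad F) 2 (tilt ν lam e ζ) := (memLp_congr_ae h2).1 (Lp.memLp q.2)
  have key := hS.integral_hGrad_mul_eigenfunction hF hFL hGL n i
  change _ = _
  rw [inner_eigenVecLp, inner_eigenLp]
  refine Eq.trans (integral_congr_ae ?_) (key.trans ?_)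
  · filter_upwards [h2] with η h
    rw [h]
  · congr 1
    refine integral_congr_ae ?_
    filter_upwards [h1] with η h
    rw [h, mul_comm]

/-- The gradient is closable: a vector field orthogonal to all `𝐞ₙ eᵢ` vanishes. -/
theorem closable (hS : SpectralData ν lam ζ N) [CompleteSpace (W0 v)]
    {G : Lp (H0 v) 2 (tilt ν lam e ζ)}
    (hG : (0, G) ∈ closedGradGraph (tilt ν lam e ζ)) : G = 0 := by
  have h0 : ∀ i, (fun η => inner ℝ (e i) (G η)) =ᵐ[tilt ν lam e ζ] 0 := by
    intro i
    have hGi : MemLp (fun η => inner ℝ (e i) (G η)) 2 (tilt ν lam e ζ) :=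
      (innerSL ℝ (e i)).comp_memLp' (Lp.memLp G)
    have h1 : hGi.toLp _ = 0 := by
      refine hS.eq_zero_of_inner_eigenLp fun n => ?_
      have h2 := hS.inner_eigenVecLp_of_mem n i hG
      rw [inner_zero_right, mul_zero, inner_eigenVecLp] at h2
      rw [inner_eigenLp]
      refine (integral_congr_ae ?_).trans h2
      filter_upwards [hGi.coeFn_toLp] with η h
      rw [h, mul_comm]
    exact hGi.coeFn_toLp.symm.trans (h1 ▸ Lp.coeFn_zero ℝ 2 (tilt ν lam e ζ))
  refine Lp.ext ?_
  filter_upwards [ae_all_iff.2 h0, Lp.coeFn_zero (H0 v) 2 (tilt ν lam e ζ)] with η h hz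
  rw [hz]
  have h1 := hilbertBasis_hasSum_sq e (G η)
  simp only [h, Pi.zero_apply, ne_eq, two_ne_zero, not_false_eq_true, zero_pow] at h1
  simpa using h1.unique hasSum_zero

lemma stepCoef_mul_costepCoef (ζ : ℕ → ℝ) (N : ℕ) (n : ℕ →₀ ℕ) (i : ℕ) :
    stepCoef ζ N n i * costepCoef ζ N (stepIdx N n i) i =
      (if i < N then |1 + ζ i| else 0) + n i * |1 + ζ i| := by
  have h := Real.mul_self_sqrt (abs_nonneg (1 + ζ i))
  rw [stepCoef, costepCoef, stepIdx_self]
  by_cases hi : i < N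
  · simp only [if_pos hi]
    have h2 := Real.mul_self_sqrt (Nat.cast_nonneg (α := ℝ) (n i + 1))
    push_cast at h2 ⊢
    linear_combination (Real.sqrt (n i + 1) * Real.sqrt (n i + 1)) * h + |1 + ζ i| * h2
  · simp only [if_neg hi]
    rcases Nat.eq_zero_or_pos (n i) with h0 | h0
    · simp [h0]
    · rw [Nat.sub_add_cancel h0]
      have h2 := Real.mul_self_sqrt (Nat.cast_nonneg (α := ℝ) (n i))
      linear_combination (Real.sqrt (n i) * Real.sqrt (n i)) * h + |1 + ζ i| * h2

lemma costepIdx_stepIdx (ζ : ℕ → ℝ) (N : ℕ) (n : ℕ →₀ ℕ) (i : ℕ) (h : stepCoef ζ N n i ≠ 0) :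
    costepIdx N (stepIdx N n i) i = n := by
  ext j
  rw [costepIdx, stepIdx_self]
  by_cases hj : j = i
  · subst hj
    rw [Finsupp.coe_update, Function.update_self]
    by_cases hi : j < N
    · simp [hi]
    · simp only [if_neg hi]
      have : n j ≠ 0 := fun h0 => h (by rw [stepCoef, if_neg hi, h0]; simp)
      omega
  · rw [Finsupp.coe_update, Function.update_of_ne hj, stepIdx_of_ne _ _ hj]

/-- The eigenfunctions are eigenvectors of the generator. -/
theorem eigenLp_mem_generatorGraph (hS : SpectralData ν lam ζ N) (n : ℕ →₀ ℕ) :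
    (hS.eigenLp e n, eigenvalueOf lam ζ N n • hS.eigenLp e n) ∈
      generatorGraph (tilt ν lam e ζ) := by
  obtain ⟨M₀, hM₀⟩ := n.support.exists_nat_subset_range
  set M := N + M₀ + 1 with hM
  have hN : N ≤ M := by omega
  have hn : n.support ⊆ Finset.range M := hM₀.trans (Finset.range_subset_range.2 (by omega))
  refine ⟨hS.gradLp e n M, hS.eigenLp_mem_closedGradGraph (by omega) hN hn, fun q hq => ?_⟩
  have hev : eigenvalueOf lam ζ N n = ∑ i ∈ Finset.range M,
      lam * (stepCoef ζ N n i * costepCoef ζ N (stepIdx N n i) i) := by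
    rw [← Finset.mul_sum, eigenvalueOf]
    congr 1
    simp_rw [stepCoef_mul_costepCoef, Finset.sum_add_distrib]
    congr 1
    · rw [← Finset.sum_filter]
      refine Finset.sum_congr ?_ fun _ _ => rfl
      ext i
      simp only [Finset.mem_filter, Finset.mem_range]
      omega
    · exact Finsupp.sum_of_support_subset _ hn _ fun _ _ => by simp
  rw [gradLp, sum_inner, real_inner_smul_left, hev, Finset.sum_mul]
  refine Finset.sum_congr rfl fun i _ => ?_
  rw [real_inner_smul_left, hS.inner_eigenVecLp_of_mem _ i hq]
  by_cases h0 : stepCoef ζ N n i = 0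
  · simp [h0]
  · rw [costepIdx_stepIdx ζ N n i h0]
    have := Real.mul_self_sqrt hS.lam_pos.le
    linear_combination (stepCoef ζ N n i * costepCoef ζ N (stepIdx N n i) i *
      inner ℝ (hS.eigenLp e n) q.1) * this

end SpectralData

end

section

/-! ### The domain of the Dirichlet form -/

section

variable {d m : ℕ} {v : Fin m → StrongDual ℝ (PathSpace d)}

lemma exists_bound_iteratedFDeriv_comp {E E' : Type*} [NormedAddCommGroup E] [NormedSpace ℝ E]
    [NormedAddCommGroup E'] [NormedSpace ℝ E'] {f : E' → ℝ} (hf : ContDiff ℝ ∞ f) (L : E →L[ℝ] E')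
    (hb : ∀ k : ℕ, ∃ C : ℝ, ∀ x, ‖iteratedFDeriv ℝ k f x‖ ≤ C) (k : ℕ) :
    ∃ C : ℝ, ∀ x, ‖iteratedFDeriv ℝ k (f ∘ L) x‖ ≤ C := by
  obtain ⟨C, hC⟩ := hb k
  refine ⟨C * ‖L‖ ^ k, fun x => ?_⟩
  rw [ContinuousLinearMap.iteratedFDeriv_comp_right L hf x (i := k) (by exact_mod_cast le_top)]
  refine (ContinuousMultilinearMap.norm_compContinuousLinearMap_le _ _).trans ?_
  rw [Finset.prod_const, Finset.card_univ, Fintype.card_fin]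
  gcongr
  exact hC _

lemma IsSmoothCylinder.add {F G : W0 v → ℝ} (hF : IsSmoothCylinder F) (hG : IsSmoothCylinder G) :
    IsSmoothCylinder fun η => F η + G η := by
  obtain ⟨r, φ, f, hf, hfb, hFf⟩ := hF
  obtain ⟨s, ψ, g, hg, hgb, hGg⟩ := hG
  set L : (Fin (r + s) → ℝ) →L[ℝ] (Fin r → ℝ) :=
    ContinuousLinearMap.pi fun i => ContinuousLinearMap.proj (Fin.castAdd s i) with hL
  set L' : (Fin (r + s) → ℝ) →L[ℝ] (Fin s → ℝ) :=
    ContinuousLinearMap.pi fun i => ContinuousLinearMap.proj (Fin.natAdd r i) with hL'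
  have h1 : ContDiff ℝ ∞ (f ∘ L) := hf.comp L.contDiff
  have h2 : ContDiff ℝ ∞ (g ∘ L') := hg.comp L'.contDiff
  refine ⟨r + s, Fin.append φ ψ, fun x => (f ∘ L) x + (g ∘ L') x, h1.add h2, fun k => ?_,
    fun η => ?_⟩
  · obtain ⟨C, hC⟩ := exists_bound_iteratedFDeriv_comp hf L hfb k
    obtain ⟨C', hC'⟩ := exists_bound_iteratedFDeriv_comp hg L' hgb k
    refine ⟨C + C', fun x => ?_⟩
    have hk : ((k : ℕ∞) : WithTop ℕ∞) ≤ ((⊤ : ℕ∞) : WithTop ℕ∞) := by exact_mod_cast le_top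
    have := iteratedFDeriv_add_apply (x := x) (h1.of_le hk).contDiffAt (h2.of_le hk).contDiffAt
    have h3 : (fun x => (f ∘ L) x + (g ∘ L') x) = f ∘ L + g ∘ L' := rfl
    rw [h3]
    refine (le_of_eq (congrArg norm this)).trans ((norm_add_le _ _).trans (add_le_add (hC x) (hC' x)))
  · simp only [hFf, hGg, Function.comp_apply]
    congr 2 <;> funext i <;> simp [hL, hL']

lemma IsSmoothCylinder.const_mul {F : W0 v → ℝ} (hF : IsSmoothCylinder F) (c : ℝ) :
    IsSmoothCylinder fun η => c * F η := by
  obtain ⟨r, φ, f, hf, hfb, hFf⟩ := hF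
  refine ⟨r, φ, fun x => c • f x, hf.const_smul c, fun k => ?_, fun η => by simp [hFf]⟩
  obtain ⟨C, hC⟩ := hfb k
  have hk : ((k : ℕ∞) : WithTop ℕ∞) ≤ ((⊤ : ℕ∞) : WithTop ℕ∞) := by exact_mod_cast le_top
  refine ⟨‖c‖ * C, fun x => ?_⟩
  have := iteratedFDeriv_const_smul_apply (a := c) (x := x) (hf.of_le hk).contDiffAt
  refine (le_of_eq (congrArg norm this)).trans ?_
  rw [norm_smul]
  gcongr
  exact hC x

lemma IsSmoothCylinder.differentiableAt {F : W0 v → ℝ} (hF : IsSmoothCylinder F) (η : W0 v) :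
    DifferentiableAt ℝ (fun h : H0 v => F (η + incl0 v h)) 0 := by
  obtain ⟨r, ψ, f, hf, rfl⟩ := hF.exists_eq
  have h1 : Differentiable ℝ f := hf.differentiable (by simp)
  have h2 : Differentiable ℝ fun h : H0 v => cylMap ψ (η + incl0 v h) :=
    (cylMap ψ).differentiable.comp ((incl0 v).differentiable.const_add η)
  exact (h1.comp h2).differentiableAt

lemma hGrad_add {F G : W0 v → ℝ} (hF : IsSmoothCylinder F) (hG : IsSmoothCylinder G) (η : W0 v) :
    hGrad (fun η => F η + G η) η = hGrad F η + hGrad G η := by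
  simp only [hGrad, gradient]
  rw [fderiv_fun_add (hF.differentiableAt η) (hG.differentiableAt η), map_add]

lemma hGrad_const_mul {F : W0 v → ℝ} (hF : IsSmoothCylinder F) (c : ℝ) (η : W0 v) :
    hGrad (fun η => c * F η) η = c • hGrad F η := by
  simp only [hGrad, gradient]
  rw [fderiv_const_mul (hF.differentiableAt η), map_smulₛₗ]
  rfl

/-- The domain of the pre-Dirichlet form as a subspace of `L²`. -/
def formDomain (P : Measure (W0 v)) : Submodule ℝ (Lp ℝ 2 P) where
  carrier := Prod.fst '' gradGraph P
  add_mem' := by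
    rintro _ _ ⟨q, ⟨F, hF, h1, h2⟩, rfl⟩ ⟨q', ⟨F', hF', h1', h2'⟩, rfl⟩
    refine ⟨q + q', ⟨_, hF.add hF', ?_, ?_⟩, rfl⟩
    · filter_upwards [Lp.coeFn_add q.1 q'.1, h1, h1'] with η g g1 g2
      rw [Prod.fst_add, g, Pi.add_apply, g1, g2]
    · filter_upwards [Lp.coeFn_add q.2 q'.2, h2, h2'] with η g g1 g2
      rw [Prod.snd_add, g, Pi.add_apply, g1, g2, hGrad_add hF hF']
  zero_mem' := by
    have h0 : IsSmoothCylinder (v := v) fun _ => 0 :=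
      ⟨0, Fin.elim0, fun _ => 0, contDiff_const, fun k => ⟨0, fun x => by simp⟩, fun _ => rfl⟩
    refine ⟨0, ⟨_, h0, Lp.coeFn_zero _ _ _, ?_⟩, rfl⟩
    filter_upwards [Lp.coeFn_zero (H0 v) 2 P] with η h
    rw [Prod.snd_zero, h]
    simp [hGrad, gradient]
  smul_mem' := by
    rintro c _ ⟨q, ⟨F, hF, h1, h2⟩, rfl⟩
    refine ⟨c • q, ⟨_, hF.const_mul c, ?_, ?_⟩, rfl⟩
    · filter_upwards [Lp.coeFn_smul c q.1, h1] with η g g1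
      rw [Prod.smul_fst, g, Pi.smul_apply, g1, smul_eq_mul]
    · filter_upwards [Lp.coeFn_smul c q.2, h2] with η g g1
      rw [Prod.smul_snd, g, Pi.smul_apply, g1, hGrad_const_mul hF]

variable {ν : Measure (W0 v)} {lam : ℝ} {e : HilbertBasis ℕ ℝ (H0 v)} {ζ : ℕ → ℝ} {N : ℕ}

lemma SpectralData.dense_formDomain (hS : SpectralData ν lam ζ N) [CompleteSpace (W0 v)] :
    Dense (Prod.fst '' gradGraph (tilt ν lam e ζ)) := by
  have h1 : Dense (formDomain (tilt ν lam e ζ) : Set (Lp ℝ 2 (tilt ν lam e ζ))) := by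
    rw [Submodule.dense_iff_topologicalClosure_eq_top, eq_top_iff,
      ← (hS.eigenBasis e).dense_span]
    refine Submodule.topologicalClosure_minimal _ ?_ (Submodule.isClosed_topologicalClosure _)
    rw [Submodule.span_le]
    rintro _ ⟨n, rfl⟩
    obtain ⟨M₀, hM₀⟩ := n.support.exists_nat_subset_range
    have h2 := hS.eigenLp_mem_closedGradGraph (e := e) (n := n) (M := N + M₀ + 1) (by omega)
      (by omega) (hM₀.trans (Finset.range_subset_range.2 (by omega)))
    rw [eigenBasis_apply]
    exact map_mem_closure (f := Prod.fst) (t := Prod.fst '' gradGraph (tilt ν lam e ζ))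
      continuous_fst h2 fun q hq => ⟨q, hq, rfl⟩
  exact h1

end

end

end WienerOU

end

theorem theorem2p22 {d m : ℕ} (μ : Measure (WienerOU.PathSpace d))
    (hμ : WienerOU.IsWienerMeasure μ)
    (v : Fin m → StrongDual ℝ (WienerOU.PathSpace d))
    (hv : Orthonormal ℝ fun i => WienerOU.dualRep (v i))
    (T : WienerOU.H0 v →L[ℝ] WienerOU.H0 v) (hTsa : IsSelfAdjoint T)
    (hTHS : WienerOU.IsHilbertSchmidt T)
    (e : HilbertBasis ℕ ℝ (WienerOU.H0 v)) (ζ : ℕ → ℝ) (hTe : ∀ i, T (e i) = ζ i • e i)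
    (N : ℕ) (hneg : ∀ i < N, 1 + ζ i < 0) (hpos : ∀ i, N ≤ i → 0 < 1 + ζ i) :
    -- the eigenvalues and eigenvectors of `|I + T| - I`
    (∀ i, (WienerOU.opAbs (1 + T) - 1 : WienerOU.H0 v →L[ℝ] WienerOU.H0 v) (e i) = (|1 + ζ i| - 1) • e i) ∧
    (∀ lam : ℝ, 0 < lam →
      -- the series defining the quadratic functional converges
      Tendsto (fun k => eLpNorm (fun η =>
          WienerOU.wickPartial (WienerOU.baseMeasure μ v lam) lam e ζ k η
            - WienerOU.wickSquare (WienerOU.baseMeasure μ v lam) lam e ζ η) 2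
          (WienerOU.baseMeasure μ v lam)) atTop (𝓝 0) ∧
      -- the pre-Dirichlet form is densely defined and closable
      Dense (Prod.fst '' WienerOU.gradGraph (WienerOU.weightedMeasure μ v lam e ζ)) ∧
      (∀ G, (0, G) ∈ WienerOU.closedGradGraph (WienerOU.weightedMeasure μ v lam e ζ) → G = 0) ∧
      -- (1) complete orthonormal system of eigenfunctions
      (∃ b : HilbertBasis (ℕ →₀ ℕ) ℝ (Lp ℝ 2 (WienerOU.weightedMeasure μ v lam e ζ)),
        ∀ n : ℕ →₀ ℕ,
          b n =ᵐ[WienerOU.weightedMeasure μ v lam e ζ]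
            WienerOU.eigenfunction (WienerOU.baseMeasure μ v lam) lam e ζ N n ∧
          (b n, WienerOU.eigenvalueOf lam ζ N n • b n) ∈
            WienerOU.generatorGraph (WienerOU.weightedMeasure μ v lam e ζ)) ∧
      -- (2) identity of signed measures
      (∀ n n' : ℕ →₀ ℕ,
        Integrable (fun η =>
            WienerOU.eigenfunction (WienerOU.baseMeasure μ v lam) lam e ζ N n η *
            WienerOU.eigenfunction (WienerOU.baseMeasure μ v lam) lam e ζ N n' η)
          (WienerOU.weightedMeasure μ v lam e ζ) ∧
        Integrable (fun η =>
            WienerOU.eigenfunction (WienerOU.baseMeasure μ v lam) lam e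
              (fun i => |1 + ζ i| - 1) 0 n η *
            WienerOU.eigenfunction (WienerOU.baseMeasure μ v lam) lam e
              (fun i => |1 + ζ i| - 1) 0 n' η)
          (WienerOU.weightedMeasure μ v lam e (fun i => |1 + ζ i| - 1)) ∧
        (WienerOU.weightedMeasure μ v lam e ζ).withDensityᵥ (fun η =>
            WienerOU.eigenfunction (WienerOU.baseMeasure μ v lam) lam e ζ N n η *
            WienerOU.eigenfunction (WienerOU.baseMeasure μ v lam) lam e ζ N n' η) =
          (WienerOU.weightedMeasure μ v lam e (fun i => |1 + ζ i| - 1)).withDensityᵥ (fun η =>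
            WienerOU.eigenfunction (WienerOU.baseMeasure μ v lam) lam e
              (fun i => |1 + ζ i| - 1) 0 n η *
            WienerOU.eigenfunction (WienerOU.baseMeasure μ v lam) lam e
              (fun i => |1 + ζ i| - 1) 0 n' η)) ∧
      -- the ground state measure is Gaussian with covariance operator `(λ|I + T|)⁻¹` ...
      IsUnit (lam • WienerOU.opAbs (1 + T)) ∧
      WienerOU.IsCenteredGaussianWithCov
        ((WienerOU.weightedMeasure μ v lam e ζ).withDensity fun η => ENNReal.ofReal
          (WienerOU.eigenfunction (WienerOU.baseMeasure μ v lam) lam e ζ N 0 η ^ 2))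
        (Ring.inverse (lam • WienerOU.opAbs (1 + T))) ∧
      -- ... and the other eigenfunctions carry Hermite densities with respect to it
      (∀ n : ℕ →₀ ℕ,
        (WienerOU.weightedMeasure μ v lam e ζ).withDensity (fun η => ENNReal.ofReal
          (WienerOU.eigenfunction (WienerOU.baseMeasure μ v lam) lam e ζ N n η ^ 2)) =
        ((WienerOU.weightedMeasure μ v lam e ζ).withDensity fun η => ENNReal.ofReal
          (WienerOU.eigenfunction (WienerOU.baseMeasure μ v lam) lam e ζ N 0 η ^ 2)).withDensity
          (fun η => ENNReal.ofReal
            (WienerOU.hermiteProd (WienerOU.baseMeasure μ v lam) lam e ζ n η ^ 2)))) ∧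
    -- (3) `Lᵖ` bounds, with constants independent of `λ`
    (∀ (n : ℕ →₀ ℕ) (k : ℕ) (p : ℝ), 2 ≤ p → ∃ C : ℝ, ∀ lam : ℝ, 0 < lam →
      eLpNorm (WienerOU.eigenfunction (WienerOU.baseMeasure μ v lam) lam e ζ N n)
        (ENNReal.ofReal p) (WienerOU.weightedMeasure μ v lam e ζ) ≤ ENNReal.ofReal C ∧
      ∃ G : (l : ℕ) → (Fin l → ℕ) → WienerOU.W0 v → ℝ,
        WienerOU.HasMalliavinDerivs (WienerOU.baseMeasure μ v lam) e k
          (WienerOU.eigenfunction (WienerOU.baseMeasure μ v lam) lam e ζ N n) G ∧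
        eLpNorm (fun η => WienerOU.hsNorm fun α => G k α η)
          (ENNReal.ofReal p) (WienerOU.weightedMeasure μ v lam e ζ)
          ≤ ENNReal.ofReal (lam ^ ((k : ℝ) / 2) * C)) := by
  have hsum := WienerOU.summable_eigenvalue_sq hTsa hTHS e hTe
  have hS : ∀ lam : ℝ, 0 < lam →
      WienerOU.SpectralData (WienerOU.baseMeasure μ v lam) lam ζ N := fun lam hlam =>
    ⟨hμ.baseMeasure_map_dual hv hlam, hlam, hneg, hpos, hsum⟩
  have hcomplete := WienerOU.completeSpace_W0 hv
  refine ⟨fun i => ?_, fun lam hlam => ?_, fun n k p hp => ?_⟩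
  · rw [sub_apply, WienerOU.opAbs_apply hTsa hTe hneg hpos, sub_smul, one_smul]
    rfl
  · have h := hS lam hlam
    refine ⟨h.tendsto_wickPartial e, h.dense_formDomain, fun G hG => h.closable hG,
      ⟨h.eigenBasis e, fun n => ?_⟩,
      fun n n' => ⟨h.integrable_eigenfunction_mul n n', h.flip.integrable_eigenfunction_mul n n',
        h.withDensityᵥ_eq n n'⟩,
      WienerOU.isUnit_smul_opAbs hTsa hTe hneg hpos hsum hlam,
      fun φ => h.map_dual_ground e φ
        (WienerOU.hasSum_inner_inverse hTsa hTe hneg hpos hsum hlam _),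
      fun n => WienerOU.SpectralData.withDensity_eigenfunction_sq n⟩
    have hb : h.eigenBasis e n = h.eigenLp e n := h.eigenBasis_apply n
    exact ⟨hb ▸ h.coeFn_eigenLp n, hb ▸ h.eigenLp_mem_generatorGraph n⟩
  · obtain ⟨C, hC⟩ := WienerOU.exists_eLpNorm_eigenfunction_le ζ N n k hp
    exact ⟨C, fun lam hlam => hC d m v _ lam e (hS lam hlam)⟩
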